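/- **Setting.** Write $\langle a\rangle=1+a$, $Y=\sqrt\varepsilon\,y$, $\|\cdot\|$ and $(\cdot,\cdot)$ for the norm and inner product of $L^2(\mathbb R_+)$, and $w_0=\langle y\rangle\langle Y\rangle^m$. Profiles are smooth up to the boundary of the strips on which they are considered. *Leading Prandtl layer.* Let $E>0$ and let $[u_p,v_p]$ be smooth on $[0,\ell]\times[0,\infty)$, $\ell>0$, exponentially decaying in $y$ with all derivatives, such that $\bar u=E+u_p$, $\bar v=v_p-v_p|_{y=0}$ solve the Prandtl equations $\bar u\,\partial_xu_p+\bar v\,\partial_yu_p-\partial_{yy}u_p=0$, $\partial_xu_p+\partial_yv_p=0$, $\bar u|_{y=0}=0$, with $\bar u(0,y)>0$ for $y>0$ and $\partial_y\bar u(0,0)>0$. For $\lambda,\sigma>0$ put $u^0_p(x,y)=\frac{\lambda^2}{\sigma}u_p(\sigma x,\lambda y)$ and $v^0_p(x,y)=\lambda v_p(\sigma x,\lambda y)$. *Outer flow.* $u^0_e(Y)$ is smooth on $[0,\infty)$, bounded below by a positive constant, $u^0_e(0)=\frac{\lambda^2}{\sigma}E$, and its derivatives of order $\ge1$ decay faster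 than any power of $Y$. *Correctors.* For $1\le i\le4$ let $[u^i_e,v^i_e](x,Y)$ and $[u^i_p,v^i_p](x,y)$ be smooth and divergence free on $[0,L]\times[0,\infty)$, with $u^i_p|_{y=0}=-u^i_e|_{Y=0}$, $v^i_e|_{Y=0}=-v^{i-1}_p|_{y=0}$, $v^4_p|_{y=0}=0$. Given $\kappa>0$ and a sequence $A=(A_k)_{k\ge0}$, assume that $\langle Y\rangle^{m+4}|\nabla^k\{u^i_e,v^i_e\}|\le A_k$ ($k\ge0$), $|u^i_p|\le A_0$, $e^{\kappa y}|\nabla^ku^i_p|\le A_k$ ($k\ge1$), and $e^{\kappa y}|\nabla^kv^i_p|\le A_k$ ($k\ge0$, $i\le3$), for every partial derivative of order $k$. (The correctors may depend on $\varepsilon$ and $L$.) With a smooth cutoff $\chi$, $\chi=1$ on $[0,1]$, $\chi=0$ on $[2,\infty)$, $\chi'\le0$, let $$\tilde u^4_p=\chi(\sqrt\varepsilon y)u^4_p+\sqrt\varepsilon\chi'(\sqrt\varepsilon y)\int_0^yu^4_p\,dy',\qquad \tilde v^4_p=\chi(\sqrt\varepsilon y)v^4_p,$$ and, with the Euler layers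 evaluated at $Y=\sqrt\varepsilon y$, $$u_s=u^0_e+u^0_p+\sum_{i=1}^{3}\varepsilon^{i/2}(u^i_e+u^i_p)+\varepsilon^2(u^4_e+\tilde u^4_p),\qquad v_s=v^0_p+v^1_e+\sum_{i=1}^{3}\varepsilon^{i/2}(v^i_p+v^{i+1}_e)+\varepsilon^2\tilde v^4_p .$$ *The problem.* With $u_s,v_s$ and their derivatives evaluated at $x=0$, consider on $\mathbb R_+$ $$\mathcal Lv^0:=v^0_{yyyy}-\{u_sv^0_{yy}-u_{syy}v^0\}-\{v_sv^0_{yyy}-v^0_yv_{syy}\}+\varepsilon u_{sxx}v^0+\varepsilon v_{sxx}v^0_y=F\in L^2(w_0),$$ $$v^0(0)=v^0_y(0)=0,\qquad\partial_y^kv^0(\infty)=0\quad(k=1,2,3),$$ where $L^2(w_0)=\{F:\|Fw_0\|<\infty\}$ and a solution is a function $v^0\in C^3([0,\infty))$ with $v^0_{yyy}$ locally absolutely continuous which satisfies the equation almost everywhere. Let $h\in C^\infty([0,\infty))$ with $h(0)=0$ and $\sup_y|\partial_y^kh|e^y<\infty$ for all $k\ge0$, and put $u^0=h-v^0_y$,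 $q^0=v^0/u_s$, $$[u^0,v^0]_B=\|u^0\|+\|u^0_y\|+\|u^0_{yy}w_0\|+\|u^0_{yyy}w_0\|+\|q^0_y\|+\Big\|\frac{q^0}{y}\Big\|+\|\sqrt{u_s}\,q^0_{yy}w_0\|+|q^0_y(0)|+\|v^0_{yyy}w_0\|+\|v^0_{yyyy}w_0\|,$$ $$[[q^0]]=\|\sqrt{u_s}\,q^0_{yy}\|+\|u_sq^0_y\|+\sqrt{u_{sy}(0)}\,|q^0_y(0)|.$$ Let $B$ be the set of $[u^0,v^0]\in L^2\times L^2(1/\langle y\rangle)$ with $u^0+v^0_y=h$ and $[u^0,v^0]_B<\infty$. **Proposition 2.1.** There is a universal $m_0$, and for every leading Prandtl layer $(E,u_p,v_p)$ there is $\sigma_0>0$, such that the following holds for all $0<\sigma<\sigma_0$, all $\lambda>0$, all outer flows $u^0_e$, all cutoffs $\chi$, all integers $m\ge m_0$, all $\kappa>0$ and all sequences $A$ as above. There are $\varepsilon_0,C,c>0$, depending only on these data, such that for all $L>0$, all $0<\varepsilon<\varepsilon_0$, all correctors as above, all $F\in L^2(w_0)$ and all $h$ as above, the problem has exactly one solution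 $v^0$ with $[u^0,v^0]\in B$. For this solution $(F,q^0)$ is an absolutely convergent integral and $$[u^0,v^0]_B^2\le C\Big(|(F,q^0)|+\|Fw_0\|^2+\big(\|h\|+\|h_y\|+\|h_{yy}w_0\|+\|h_{yyy}w_0\|\big)^2\Big);$$ moreover $[[q^0]]<\infty$, the inner product below is an absolutely convergent integral, and $$\big(\partial_y^4v^0-\partial_y\{u_s^2q^0_y\},\,q^0\big)\ge c\,[[q^0]]^2 .$$ -/

import Mathlib

open Set Filter Topology MeasureTheory
open scoped ContDiff ENNReal

noncomputable section

namespace BoundaryLayer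

/-- The mixed partial derivative `∂_x^j ∂_y^k f` at `(x, y)`. -/
def pd (j k : ℕ) (f : ℝ → ℝ → ℝ) (x y : ℝ) : ℝ :=
  iteratedDeriv j (fun x' => iteratedDeriv k (f x') y) x

/-- The `k`-th derivative on the closed half line `[0, ∞)` (one-sided at `0`). -/
def D (k : ℕ) (f : ℝ → ℝ) : ℝ → ℝ := iteratedDerivWithin k f (Ici 0)

/-- The `L²(ℝ₊)` norm, with value `∞` if the function is not square integrable. -/
def L2 (f : ℝ → ℝ) : ℝ≥0∞ := eLpNorm f 2 (volume.restrict (Ioi 0))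

/-- The weight `w₀ = ⟨y⟩ ⟨Y⟩ ^ m` with `⟨a⟩ = 1 + a` and `Y = √ε y`. -/
def w0 (m : ℕ) (ε y : ℝ) : ℝ := (1 + y) * (1 + √ε * y) ^ m

/-! ### The approximate Navier-Stokes profile

A function which is smooth up to the boundary of a strip `[0, L] × [0, ∞)` is represented by a
smooth function on the plane; only its restriction to the strip is ever constrained or used. -/

/-- A leading order Prandtl boundary layer `[u, v] = [u⁰_p, v⁰_p]` on `[0, len] × [0, ∞)`, matching
the constant velocity `E = u⁰_e(0)` of the outer flow at the wall.  The full layer is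
`[ū, v̄] = [E + u, v - v(·, 0)]`; it solves the Prandtl equations with zero pressure gradient, does
not slip at the wall, and its initial velocity at `x = 0` is positive away from the wall and has
positive slope at the wall. -/
structure PrandtlLayer where
  len : ℝ
  len_pos : 0 < len
  E : ℝ
  E_pos : 0 < E
  u : ℝ → ℝ → ℝ
  v : ℝ → ℝ → ℝ
  smooth_u : ContDiff ℝ ∞ (Function.uncurry u)
  smooth_v : ContDiff ℝ ∞ (Function.uncurry v)
  momentum : ∀ x ∈ Icc 0 len, ∀ y, 0 ≤ y →
    (E + u x y) * pd 1 0 u x y + (v x y - v x 0) * pd 0 1 u x y - pd 0 2 u x y = 0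
  divFree : ∀ x ∈ Icc 0 len, ∀ y, 0 ≤ y → pd 1 0 u x y + pd 0 1 v x y = 0
  noSlip : ∀ x ∈ Icc 0 len, u x 0 = -E
  initial_pos : ∀ y, 0 < y → 0 < E + u 0 y
  initial_slope : 0 < pd 0 1 u 0 0
  /-- `u` and `v`, with all their derivatives, decay exponentially in `y`. -/
  decay : ∃ κ : ℝ, 0 < κ ∧ ∀ j k : ℕ, ∃ B : ℝ, ∀ x ∈ Icc 0 len, ∀ y, 0 ≤ y →
    |pd j k u x y| ≤ B * Real.exp (-κ * y) ∧ |pd j k v x y| ≤ B * Real.exp (-κ * y)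

/-- The rescaled leading order layer `(λ² / σ) u(σ x, λ y)`. -/
def PrandtlLayer.su (P : PrandtlLayer) (lam sig x y : ℝ) : ℝ :=
  lam ^ 2 / sig * P.u (sig * x) (lam * y)

/-- The rescaled leading order layer `λ v(σ x, λ y)`. -/
def PrandtlLayer.sv (P : PrandtlLayer) (lam sig x y : ℝ) : ℝ :=
  lam * P.v (sig * x) (lam * y)

/-- A smooth outer Euler shear flow `u⁰_e(Y)` with velocity `a` at the wall, bounded below by a
positive constant, whose derivatives decay rapidly. -/
structure IsOuterShear (a : ℝ) (ue0 : ℝ → ℝ) : Prop where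
  smooth : ContDiff ℝ ∞ ue0
  wall : ue0 0 = a
  lower : ∃ b : ℝ, 0 < b ∧ ∀ Y, 0 ≤ Y → b ≤ ue0 Y
  decay : ∀ k N : ℕ, 1 ≤ k → ∃ B : ℝ, ∀ Y, 0 ≤ Y → |iteratedDeriv k ue0 Y| * (1 + Y) ^ N ≤ B

/-- A smooth non-increasing cutoff, `1` on `[0, 1]` and `0` on `[2, ∞)`. -/
structure IsCutoff (χ : ℝ → ℝ) : Prop where
  smooth : ContDiff ℝ ∞ χ
  one : ∀ y ∈ Icc (0 : ℝ) 1, χ y = 1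
  zero : ∀ y, 2 ≤ y → χ y = 0
  deriv_nonpos : ∀ y, 0 < y → deriv χ y ≤ 0

/-- The higher order layers: Euler correctors `[ue i, ve i]`, functions of `(x, Y)`, and Prandtl
correctors `[up i, vp i]`, functions of `(x, y)`.  Only the indices `1 ≤ i ≤ 4` are used; the last
Prandtl corrector `[up 4, vp 4]` is the one before it is cut off. -/
structure Correctors where
  ue : ℕ → ℝ → ℝ → ℝ
  ve : ℕ → ℝ → ℝ → ℝ
  up : ℕ → ℝ → ℝ → ℝ
  vp : ℕ → ℝ → ℝ → ℝ

/-- The correctors are smooth and divergence free, satisfy the matching conditions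
at the wall which make the profile vanish there, and obey the regularity and decay bounds of the
layers on the strip `[0, L] × [0, ∞)`, with bounds `A 0, A 1, …` for the derivatives of
order `0, 1, …`: algebraic decay of order `m + 4` in `Y` for the Euler correctors, exponential decay
of rate `κ` in `y` for the Prandtl correctors (`up i` itself only has to be bounded). -/
structure Correctors.IsAdmissible (K : Correctors) (P : PrandtlLayer) (lam sig : ℝ) (m : ℕ)
    (κ : ℝ) (A : ℕ → ℝ) (L : ℝ) : Prop where
  smooth : ∀ i ∈ Finset.Icc 1 4,
    ContDiff ℝ ∞ (Function.uncurry (K.ue i)) ∧ ContDiff ℝ ∞ (Function.uncurry (K.ve i)) ∧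
    ContDiff ℝ ∞ (Function.uncurry (K.up i)) ∧ ContDiff ℝ ∞ (Function.uncurry (K.vp i))
  divFree : ∀ i ∈ Finset.Icc 1 4, ∀ x ∈ Icc 0 L, ∀ y, 0 ≤ y →
    pd 1 0 (K.ue i) x y + pd 0 1 (K.ve i) x y = 0 ∧
    pd 1 0 (K.up i) x y + pd 0 1 (K.vp i) x y = 0
  wall_u : ∀ i ∈ Finset.Icc 1 4, ∀ x ∈ Icc 0 L, K.up i x 0 = -K.ue i x 0
  wall_v_first : ∀ x ∈ Icc 0 L, K.ve 1 x 0 = -P.sv lam sig x 0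
  wall_v : ∀ i ∈ Finset.Icc 1 3, ∀ x ∈ Icc 0 L, K.ve (i + 1) x 0 = -K.vp i x 0
  wall_v_last : ∀ x ∈ Icc 0 L, K.vp 4 x 0 = 0
  decay_euler : ∀ i ∈ Finset.Icc 1 4, ∀ j k : ℕ, ∀ x ∈ Icc 0 L, ∀ Y, 0 ≤ Y →
    |pd j k (K.ue i) x Y| * (1 + Y) ^ (m + 4) ≤ A (j + k) ∧
    |pd j k (K.ve i) x Y| * (1 + Y) ^ (m + 4) ≤ A (j + k)
  bound_up : ∀ i ∈ Finset.Icc 1 4, ∀ x ∈ Icc 0 L, ∀ y, 0 ≤ y → |K.up i x y| ≤ A 0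
  decay_up : ∀ i ∈ Finset.Icc 1 4, ∀ j k : ℕ, 1 ≤ j + k → ∀ x ∈ Icc 0 L, ∀ y, 0 ≤ y →
    |pd j k (K.up i) x y| * Real.exp (κ * y) ≤ A (j + k)
  decay_vp : ∀ i ∈ Finset.Icc 1 3, ∀ j k : ℕ, ∀ x ∈ Icc 0 L, ∀ y, 0 ≤ y →
    |pd j k (K.vp i) x y| * Real.exp (κ * y) ≤ A (j + k)

/-- The cut off last Prandtl corrector, tangential component. -/
def Correctors.cutU (K : Correctors) (χ : ℝ → ℝ) (ε x y : ℝ) : ℝ :=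
  χ (√ε * y) * K.up 4 x y + √ε * deriv χ (√ε * y) * ∫ z in (0 : ℝ)..y, K.up 4 x z

/-- The cut off last Prandtl corrector, normal component. -/
def Correctors.cutV (K : Correctors) (χ : ℝ → ℝ) (ε x y : ℝ) : ℝ :=
  χ (√ε * y) * K.vp 4 x y

/-- The approximate tangential velocity
`u_s = u⁰_e + u⁰_p + ∑_{i=1}^4 √ε^i (u^i_e + u^i_p)`. -/
def uS (P : PrandtlLayer) (lam sig : ℝ) (ue0 χ : ℝ → ℝ) (K : Correctors) (ε x y : ℝ) : ℝ :=
  ue0 (√ε * y) + P.su lam sig x y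
    + (∑ i ∈ Finset.Icc 1 3, √ε ^ i * (K.ue i x (√ε * y) + K.up i x y))
    + √ε ^ 4 * (K.ue 4 x (√ε * y) + K.cutU χ ε x y)

/-- The approximate normal velocity
`v_s = v⁰_p + v¹_e + ∑_{i=1}^3 √ε^i (v^i_p + v^{i+1}_e) + √ε^4 v^4_p`. -/
def vS (P : PrandtlLayer) (lam sig : ℝ) (χ : ℝ → ℝ) (K : Correctors) (ε x y : ℝ) : ℝ :=
  P.sv lam sig x y + K.ve 1 x (√ε * y)
    + (∑ i ∈ Finset.Icc 1 3, √ε ^ i * (K.vp i x y + K.ve (i + 1) x (√ε * y)))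
    + √ε ^ 4 * K.cutV χ ε x y

/-! ### The boundary value problem and its norms

Below `us` and `vs` are the functions `u_s`, `v_s` of `(x, y)`; everything is evaluated at
`x = 0`. -/

/-- `𝓛 v = v_yyyy - {u_s v_yy - u_syy v} - {v_s v_yyy - v_y v_syy} + ε u_sxx v + ε v_sxx v_y`. -/
def Lop (us vs : ℝ → ℝ → ℝ) (ε : ℝ) (v : ℝ → ℝ) (y : ℝ) : ℝ :=
  D 4 v y - (us 0 y * D 2 v y - pd 0 2 us 0 y * v y)
    - (vs 0 y * D 3 v y - D 1 v y * pd 0 2 vs 0 y)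
    + ε * pd 2 0 us 0 y * v y + ε * pd 2 0 vs 0 y * D 1 v y

/-- The quotient `q⁰ = v⁰ / u_s`; at the wall this is `0 / 0 = 0`, the boundary value of `q⁰`. -/
def quot (us : ℝ → ℝ → ℝ) (v : ℝ → ℝ) (y : ℝ) : ℝ := v y / us 0 y

/-- The component `u⁰ = h - v⁰_y`. -/
def uZero (h v : ℝ → ℝ) (y : ℝ) : ℝ := h y - D 1 v y

/-- The norm `[u⁰, v⁰]_B`. -/
def normB (us : ℝ → ℝ → ℝ) (m : ℕ) (ε : ℝ) (u v : ℝ → ℝ) : ℝ≥0∞ :=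
  L2 u + L2 (D 1 u) + L2 (fun y => D 2 u y * w0 m ε y) + L2 (fun y => D 3 u y * w0 m ε y)
    + L2 (D 1 (quot us v)) + L2 (fun y => quot us v y / y)
    + L2 (fun y => √(us 0 y) * D 2 (quot us v) y * w0 m ε y)
    + ‖D 1 (quot us v) 0‖ₑ
    + L2 (fun y => D 3 v y * w0 m ε y) + L2 (fun y => D 4 v y * w0 m ε y)

/-- The norm `[[q]] = ‖√u_s q_yy‖ + ‖u_s q_y‖ + ‖√u_sy q_y‖_{y=0}`. -/
def normQ (us : ℝ → ℝ → ℝ) (q : ℝ → ℝ) : ℝ≥0∞ :=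
  L2 (fun y => √(us 0 y) * D 2 q y) + L2 (fun y => us 0 y * D 1 q y)
    + ‖√(pd 0 1 us 0 0) * D 1 q 0‖ₑ

/-- The part of the norm `[u⁰, v⁰]_B` that sees `u⁰`, applied to the datum `h`. -/
def normH (m : ℕ) (ε : ℝ) (h : ℝ → ℝ) : ℝ≥0∞ :=
  L2 h + L2 (D 1 h) + L2 (fun y => D 2 h y * w0 m ε y) + L2 (fun y => D 3 h y * w0 m ε y)

/-- The datum `h ∈ C^∞(e^y)` with `h(0) = 0`. -/
structure IsDatum (h : ℝ → ℝ) : Prop where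
  smooth : ContDiffOn ℝ ∞ h (Ici 0)
  decay : ∀ k : ℕ, ∃ B : ℝ, ∀ y, 0 ≤ y → |D k h y| * Real.exp y ≤ B
  wall : h 0 = 0

/-- `v` is a (strong) solution of `𝓛 v = F` on `ℝ₊` with `v(0) = v_y(0) = 0` and `∂_y^k v(∞) = 0`
for the derivatives of order `k = 1, 2, 3` (the fourth one is only a square integrable function),
such that `[h - v_y, v]` belongs to the space `B`. -/
structure IsSolution (us vs : ℝ → ℝ → ℝ) (m : ℕ) (ε : ℝ) (h F v : ℝ → ℝ) : Prop where
  contDiff : ContDiffOn ℝ 3 v (Ici 0)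
  absCont : ∀ b, 0 < b → AbsolutelyContinuousOnInterval (D 3 v) 0 b
  equation : ∀ᵐ y ∂(volume.restrict (Ioi 0)), Lop us vs ε v y = F y
  wall : v 0 = 0
  wall_deriv : D 1 v 0 = 0
  infinity : ∀ k ∈ Finset.Icc 1 3, Tendsto (D k v) atTop (𝓝 0)
  memLp_u : MemLp (uZero h v) 2 (volume.restrict (Ioi 0))
  memLp_v : MemLp (fun y => v y / (1 + y)) 2 (volume.restrict (Ioi 0))
  finite : normB us m ε (uZero h v) v < ⊤

end BoundaryLayer

end

open Set Filter Topology MeasureTheory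
open scoped ContDiff ENNReal

noncomputable section

namespace BoundaryLayer


/-- Lebesgue measure on the half line. -/
abbrev halfLine : Measure ℝ := volume.restrict (Ioi (0 : ℝ))

theorem ae_of_pos {p : ℝ → Prop} (h : ∀ y, 0 < y → p y) : ∀ᵐ y ∂halfLine, p y :=
  (ae_restrict_mem measurableSet_Ioi).mono h

theorem mul_le_left {a b c : ℝ} (h : b ≤ c) (ha : 0 ≤ a) : a * b ≤ a * c :=
  mul_le_mul_of_nonneg_left h ha

theorem mul_le_right {a b c : ℝ} (h : b ≤ c) (ha : 0 ≤ a) : b * a ≤ c * a :=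
  mul_le_mul_of_nonneg_right h ha

theorem continuous_of_hasDerivAt {f f' : ℝ → ℝ} (h : ∀ y, HasDerivAt f (f' y) y) : Continuous f :=
  continuous_iff_continuousAt.2 fun y => (h y).continuousAt

theorem abs_add_le_add {x y X Y : ℝ} (hx : |x| ≤ X) (hy : |y| ≤ Y) : |x + y| ≤ X + Y :=
  (abs_add_le _ _).trans (add_le_add hx hy)

theorem abs_sub_le_add {x y X Y : ℝ} (hx : |x| ≤ X) (hy : |y| ≤ Y) : |x - y| ≤ X + Y :=
  (abs_sub _ _).trans (add_le_add hx hy)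

theorem abs_mul_le_mul {a b A B : ℝ} (ha : |a| ≤ A) (hb : |b| ≤ B) : |a * b| ≤ A * B := by
  rw [abs_mul]
  exact mul_le_mul ha hb (abs_nonneg _) ((abs_nonneg _).trans ha)

theorem le_mul_weight {x X z : ℝ} (hx : 0 ≤ x) (hz : 1 ≤ z) (h : x * z ≤ X) : x ≤ X :=
  (le_mul_of_one_le_right hx hz).trans h

theorem le_add_five {a b c d e : ℝ} (ha : 0 ≤ a) (hb : 0 ≤ b) (hc : 0 ≤ c) (hd : 0 ≤ d)
    (he : 0 ≤ e) : a ≤ a + b + c + d + e ∧ b ≤ a + b + c + d + e ∧ c ≤ a + b + c + d + e ∧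
      d ≤ a + b + c + d + e ∧ e ≤ a + b + c + d + e := by
  refine ⟨?_, ?_, ?_, ?_, ?_⟩ <;> linarith

theorem _root_.ContinuousOn.aesm {f : ℝ → ℝ} (h : ContinuousOn f (Ioi 0)) :
    AEStronglyMeasurable f halfLine := h.aestronglyMeasurable measurableSet_Ioi

/-- `f` is measurable on the half line and bounded by a multiple of `g`. -/
def Dom (f g : ℝ → ℝ) : Prop :=
  AEStronglyMeasurable f halfLine ∧ ∃ C, 0 ≤ C ∧ ∀ y, 0 < y → |f y| ≤ C * g y

namespace Dom

variable {f f' g g' w : ℝ → ℝ}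

theorem mul (h : Dom f g) (h' : Dom f' g') : Dom (fun y => f y * f' y) fun y => g y * g' y := by
  obtain ⟨m, C, hC, h⟩ := h
  obtain ⟨m', C', hC', h'⟩ := h'
  exact ⟨m.mul m', C * C', mul_nonneg hC hC', fun y hy =>
    (abs_mul_le_mul (h y hy) (h' y hy)).trans_eq (by ring)⟩

theorem mono (h : Dom f g) (hg : ∀ y, 0 < y → g y ≤ g' y) : Dom f g' := by
  obtain ⟨m, C, hC, h⟩ := h
  exact ⟨m, C, hC, fun y hy => (h y hy).trans (mul_le_left (hg y hy) hC)⟩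

theorem smul (h : Dom f fun _ => 1) (h' : Dom f' g) : Dom (fun y => f y * f' y) g :=
  (h.mul h').mono fun _ _ => (one_mul _).le

theorem add (h : Dom f g) (h' : Dom f' g) : Dom (fun y => f y + f' y) g := by
  obtain ⟨m, C, hC, h⟩ := h
  obtain ⟨m', C', hC', h'⟩ := h'
  exact ⟨m.add m', C + C', add_nonneg hC hC', fun y hy =>
    (abs_add_le_add (h y hy) (h' y hy)).trans_eq (by ring)⟩

theorem const_mul (c : ℝ) (h : Dom f g) : Dom (fun y => c * f y) g := by
  obtain ⟨m, C, hC, h⟩ := h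
  exact ⟨m.const_mul c, |c| * C, by positivity, fun y hy => by
    rw [abs_mul, mul_assoc]; exact mul_le_left (h y hy) (abs_nonneg c)⟩

theorem sub (h : Dom f g) (h' : Dom f' g) : Dom (fun y => f y - f' y) g := by
  simpa only [neg_one_mul, sub_eq_add_neg] using h.add (h'.const_mul (-1))

theorem of_weight (hm : AEStronglyMeasurable f halfLine) {C : ℝ} (hC : 0 ≤ C)
    (h : ∀ y, 0 < y → |f y * w y| ≤ C * g y) (hw : ∀ y, 0 < y → 0 < w y) :
    Dom f fun y => g y / w y :=
  ⟨hm, C, hC, fun y hy => by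
    have h := h y hy
    rw [abs_mul, abs_of_pos (hw y hy)] at h
    rwa [← mul_div_assoc, le_div_iff₀ (hw y hy)]⟩

theorem div_weight (h : Dom (fun y => f y * w y) g) (hw : ∀ y, 0 < y → 0 < w y)
    (hm : AEStronglyMeasurable f halfLine) : Dom f fun y => g y / w y := by
  obtain ⟨-, C, hC, h⟩ := h
  exact of_weight hm hC h hw

end Dom

/-- `f` is locally absolutely continuous on `(0, ∞)` with derivative `f'` almost everywhere. -/
def LocAC (f f' : ℝ → ℝ) : Prop :=
  (∀ x y, 0 < x → x ≤ y → AbsolutelyContinuousOnInterval f x y) ∧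
    ∀ᵐ y ∂halfLine, HasDerivAt f (f' y) y

theorem LocAC.of_hasDerivAt {f f' : ℝ → ℝ} (h : ∀ y, 0 < y → HasDerivAt f (f' y) y)
    (hc : ContinuousOn f' (Ioi 0)) : LocAC f f' := by
  refine ⟨fun x y hx hxy => ?_, ?_⟩
  · apply ContDiffOn.absolutelyContinuousOnInterval
    rw [uIcc_of_le hxy]
    have hC : ContDiffOn ℝ 1 f (Ioi 0) := by
      rw [show (1 : WithTop ℕ∞) = 0 + 1 from (zero_add 1).symm,
        contDiffOn_succ_iff_deriv_of_isOpen isOpen_Ioi]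
      refine ⟨fun y hy => (h y hy).differentiableAt.differentiableWithinAt, by simp, ?_⟩
      rw [contDiffOn_zero]
      exact hc.congr fun y hy => (h y hy).deriv
    exact hC.mono fun z hz => lt_of_lt_of_le hx hz.1
  · exact ae_of_pos fun y hy => h y hy

theorem LocAC.add {f f' g g' : ℝ → ℝ} (hf : LocAC f f') (hg : LocAC g g') :
    LocAC (fun y => f y + g y) (fun y => f' y + g' y) := by
  refine ⟨fun x y hx hxy => (hf.1 x y hx hxy).add (hg.1 x y hx hxy), ?_⟩
  filter_upwards [hf.2, hg.2] with y h1 h2 using h1.add h2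

theorem LocAC.sub {f f' g g' : ℝ → ℝ} (hf : LocAC f f') (hg : LocAC g g') :
    LocAC (fun y => f y - g y) (fun y => f' y - g' y) := by
  refine ⟨fun x y hx hxy => (hf.1 x y hx hxy).sub (hg.1 x y hx hxy), ?_⟩
  filter_upwards [hf.2, hg.2] with y h1 h2 using h1.sub h2

theorem LocAC.const_mul {f f' : ℝ → ℝ} (c : ℝ) (hf : LocAC f f') :
    LocAC (fun y => c * f y) (fun y => c * f' y) := by
  refine ⟨fun x y hx hxy => (hf.1 x y hx hxy).const_mul c, ?_⟩
  filter_upwards [hf.2] with y h1 using h1.const_mul c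

theorem LocAC.mul {f f' g g' : ℝ → ℝ} (hf : LocAC f f') (hg : LocAC g g') :
    LocAC (fun y => f y * g y) (fun y => f' y * g y + f y * g' y) := by
  refine ⟨fun x y hx hxy => (hf.1 x y hx hxy).mul (hg.1 x y hx hxy), ?_⟩
  filter_upwards [hf.2, hg.2] with y h1 h2 using h1.mul h2

theorem LocAC.congr_deriv {f f' g' : ℝ → ℝ} (hf : LocAC f f')
    (h : ∀ᵐ y ∂halfLine, f' y = g' y) : LocAC f g' := by
  refine ⟨hf.1, ?_⟩
  filter_upwards [hf.2, h] with y h1 h2 using h2 ▸ h1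

theorem LocAC.integral_eq {f f' : ℝ → ℝ} (hf : LocAC f f') {x y : ℝ} (hx : 0 < x) (hxy : x ≤ y) :
    ∫ z in x..y, f' z = f y - f x := by
  rw [← (hf.1 x y hx hxy).integral_deriv_eq_sub]
  apply intervalIntegral.integral_congr_ae
  have := hf.2
  rw [ae_restrict_iff' measurableSet_Ioi] at this
  filter_upwards [this] with z hz hz'
  rw [uIoc_of_le hxy] at hz'
  exact (hz (lt_trans hx hz'.1)).deriv.symm

theorem eq_zero_of_tendsto_of_integrableOn_div {f : ℝ → ℝ} {l : ℝ} (hl : Tendsto f atTop (𝓝 l))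
    (hi : IntegrableOn (fun y => f y / (1 + y)) (Ioi 0)) : l = 0 := by
  by_contra hne
  have hpos : 0 < |l| := abs_pos.2 hne
  have h1 : ∀ᶠ y in atTop, |l| / 2 < |f y| :=
    (hl.abs).eventually (lt_mem_nhds (by linarith))
  obtain ⟨R, hR⟩ := eventually_atTop.1 h1
  set S := max R 1
  have hS1 : 1 ≤ S := le_max_right _ _
  apply not_integrableOn_Ioi_inv (a := S)
  have h2 : IntegrableOn (fun y => (4 / |l|) * ‖f y / (1 + y)‖) (Ioi S) :=
    ((hi.mono_set (Ioi_subset_Ioi (by linarith))).norm).const_mul _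
  refine Integrable.mono' h2 (measurable_inv.aestronglyMeasurable) ?_
  refine (ae_restrict_mem measurableSet_Ioi).mono fun y (hy' : S < y) => ?_
  have hyR := hR y (le_trans (le_max_left _ _) hy'.le)
  have hy0 : 0 < y := by linarith
  rw [Real.norm_eq_abs, abs_of_pos (inv_pos.2 hy0), Real.norm_eq_abs, abs_div,
    abs_of_pos (show 0 < 1 + y by linarith), inv_eq_one_div, div_mul_div_comm,
    div_le_div_iff₀ hy0 (by positivity)]
  nlinarith

/-- If the derivative is integrable and the function is integrable against `1 / (1 + y)` then there
is no boundary term at infinity. -/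
theorem LocAC.integral_Ioi_eq {f f' : ℝ → ℝ} {l : ℝ} (hf : LocAC f f')
    (h0 : Tendsto f (𝓝[>] 0) (𝓝 l)) (hi' : IntegrableOn f' (Ioi 0))
    (hi : IntegrableOn (fun y => f y / (1 + y)) (Ioi 0)) :
    ∫ y in Ioi 0, f' y = -l := by
  have hII : ∀ a b : ℝ, 0 ≤ a → 0 ≤ b → IntervalIntegrable f' volume a b := fun a b ha hb =>
    ⟨hi'.mono_set fun z hz => lt_of_le_of_lt ha hz.1,
      hi'.mono_set fun z hz => lt_of_le_of_lt hb hz.1⟩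
  have h1 : ∀ y : ℝ, 0 < y → ∫ z in (0 : ℝ)..y, f' z = f y - l := by
    intro y hy
    have hc : ContinuousOn (fun x => ∫ z in y..x, f' z) (uIcc 0 y) := by
      apply intervalIntegral.continuousOn_primitive_interval'
      · exact hII _ _ le_rfl hy.le
      · exact right_mem_uIcc
    have hc0 : Tendsto (fun x => ∫ z in y..x, f' z) (𝓝[>] 0) (𝓝 (∫ z in y..(0 : ℝ), f' z)) := by
      have := hc 0 left_mem_uIcc
      refine this.tendsto.mono_left ?_
      rw [uIcc_of_le hy.le]
      rw [← nhdsWithin_Ioo_eq_nhdsGT hy]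
      exact nhdsWithin_mono _ Ioo_subset_Icc_self
    have hc1 : Tendsto (fun x => f x - f y) (𝓝[>] 0) (𝓝 (l - f y)) := h0.sub_const _
    have heq : (fun x => ∫ z in y..x, f' z) =ᶠ[𝓝[>] 0] fun x => f x - f y := by
      filter_upwards [Ioo_mem_nhdsGT hy] with x hx
      rw [intervalIntegral.integral_symm, hf.integral_eq hx.1 hx.2.le]; ring
    have := tendsto_nhds_unique (hc0.congr' heq) hc1
    rw [intervalIntegral.integral_symm, this]; ring
  have h2 := intervalIntegral_tendsto_integral_Ioi 0 hi' tendsto_id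
  have h3 : Tendsto f atTop (𝓝 (l + ∫ y in Ioi 0, f' y)) := by
    refine (h2.const_add l).congr' ?_
    filter_upwards [eventually_gt_atTop 0] with y hy
    rw [id, h1 y hy]; ring
  have := eq_zero_of_tendsto_of_integrableOn_div h3 hi
  linarith

/-- Integration of a pointwise lower bound up to an exact derivative. -/
theorem LocAC.le_integral {f f' g k : ℝ → ℝ} {l : ℝ} (hf : LocAC f f')
    (h0 : Tendsto f (𝓝[>] 0) (𝓝 l)) (hi' : IntegrableOn f' (Ioi 0))
    (hi : IntegrableOn (fun y => f y / (1 + y)) (Ioi 0)) (hg : IntegrableOn g (Ioi 0))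
    (hk : IntegrableOn k (Ioi 0)) (hle : ∀ᵐ y ∂halfLine, g y + f' y ≤ k y) :
    ∫ y in Ioi 0, g y ≤ (∫ y in Ioi 0, k y) + l := by
  have := integral_mono_ae (hg.add hi') hk hle
  rw [integral_add' hg hi', hf.integral_Ioi_eq h0 hi' hi] at this
  linarith

theorem abs_sub_le_of_hasDerivAt {f f' : ℝ → ℝ} {C y : ℝ} (hy : 0 < y)
    (hc : ContinuousOn f (Icc 0 y)) (hd : ∀ z ∈ Ioo 0 y, HasDerivAt f (f' z) z)
    (hb : ∀ z ∈ Ioo 0 y, |f' z| ≤ C) : |f y - f 0| ≤ C * y := by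
  obtain ⟨z, hz, h⟩ := exists_hasDerivAt_eq_slope f f' hy hc hd
  have h2 : f y - f 0 = f' z * y := by rw [h, sub_zero, div_mul_cancel₀ _ hy.ne']
  rw [h2, abs_mul, abs_of_pos hy]
  exact mul_le_right (hb z hz) hy.le

/-- The coefficients of the operator
`v ↦ v_yyyy - (a v_yy - a_yy v) - (b v_yyy - b_yy v_y) + e v + f v_y`, with the derivatives of `a`
and `b` that it contains. -/
structure Coefficients where
  a : ℝ → ℝ
  a1 : ℝ → ℝ
  a2 : ℝ → ℝ
  b : ℝ → ℝ
  b1 : ℝ → ℝ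
  b2 : ℝ → ℝ
  e : ℝ → ℝ
  f : ℝ → ℝ
  da : ∀ y, HasDerivAt a (a1 y) y
  da1 : ∀ y, HasDerivAt a1 (a2 y) y
  ca2 : Continuous a2
  db : ∀ y, HasDerivAt b (b1 y) y
  db1 : ∀ y, HasDerivAt b1 (b2 y) y
  cb2 : Continuous b2
  ce : Continuous e
  cf : Continuous f
  a_zero : a 0 = 0
  b_zero : b 0 = 0
  c : ℝ
  c_pos : 0 < c
  low : ∀ y, 0 ≤ y → c * y ≤ a y * (1 + y)

/-- A function on the half line vanishing with its derivative at the wall, together with its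
derivatives up to the fourth. -/
structure Trial where
  v : ℝ → ℝ
  v1 : ℝ → ℝ
  v2 : ℝ → ℝ
  v3 : ℝ → ℝ
  v4 : ℝ → ℝ
  d0 : ∀ y, 0 < y → HasDerivAt v (v1 y) y
  d1 : ∀ y, 0 < y → HasDerivAt v1 (v2 y) y
  d2 : ∀ y, 0 < y → HasDerivAt v2 (v3 y) y
  c0 : ContinuousOn v (Ici 0)
  c1 : ContinuousOn v1 (Ici 0)
  c2 : ContinuousOn v2 (Ici 0)
  c3 : ContinuousOn v3 (Ici 0)
  ac : LocAC v3 v4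
  z0 : v 0 = 0
  z1 : v1 0 = 0

theorem Trial.o0 (T : Trial) : ContinuousOn T.v (Ioi 0) := T.c0.mono Ioi_subset_Ici_self
theorem Trial.o1 (T : Trial) : ContinuousOn T.v1 (Ioi 0) := T.c1.mono Ioi_subset_Ici_self
theorem Trial.o2 (T : Trial) : ContinuousOn T.v2 (Ioi 0) := T.c2.mono Ioi_subset_Ici_self
theorem Trial.o3 (T : Trial) : ContinuousOn T.v3 (Ioi 0) := T.c3.mono Ioi_subset_Ici_self

theorem tendsto_wall {g : ℝ → ℝ} (hg : ContinuousOn g (Ici 0)) :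
    Tendsto g (𝓝[>] 0) (𝓝 (g 0)) :=
  (hg 0 self_mem_Ici).tendsto.mono_left (nhdsWithin_mono _ Ioi_subset_Ici_self)

namespace Coefficients

variable (S : Coefficients)

theorem ca : Continuous S.a := continuous_of_hasDerivAt S.da
theorem ca1 : Continuous S.a1 := continuous_of_hasDerivAt S.da1
theorem cb : Continuous S.b := continuous_of_hasDerivAt S.db
theorem cb1 : Continuous S.b1 := continuous_of_hasDerivAt S.db1

theorem a_pos {y : ℝ} (hy : 0 < y) : 0 < S.a y := by
  have h := S.low y hy.le
  have h2 : 0 < S.a y * (1 + y) := lt_of_lt_of_le (mul_pos S.c_pos hy) h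
  exact pos_of_mul_pos_left h2 (by linarith)

theorem slope_ge : S.c ≤ S.a1 0 := by
  have h1 : Tendsto (fun y => slope S.a 0 y) (𝓝[>] 0) (𝓝 (S.a1 0)) :=
    (hasDerivAt_iff_tendsto_slope.1 (S.da 0)).mono_left
      (nhdsWithin_mono _ fun y (hy : 0 < y) => hy.ne')
  have h2 : Tendsto (fun y : ℝ => S.c / (1 + y)) (𝓝[>] 0) (𝓝 (S.c / (1 + 0))) := by
    apply Tendsto.mono_left _ nhdsWithin_le_nhds
    exact ContinuousAt.tendsto (by fun_prop (disch := norm_num))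
  have h3 := le_of_tendsto_of_tendsto h2 h1 (by
    filter_upwards [self_mem_nhdsWithin] with y hy
    have hy : 0 < y := hy
    rw [slope_def_field, S.a_zero, sub_zero, sub_zero, div_le_div_iff₀ (by linarith) hy]
    exact S.low y hy.le)
  simpa using h3

/-- The quotient `q = v / a`. -/
def q (T : Trial) (y : ℝ) : ℝ := T.v y / S.a y
/-- The derivative of `q`. -/
def q1 (T : Trial) (y : ℝ) : ℝ := (T.v1 y * S.a y - T.v y * S.a1 y) / S.a y ^ 2
/-- The second derivative of `q`. -/
def q2 (T : Trial) (y : ℝ) : ℝ := (T.v2 y - 2 * S.a1 y * S.q1 T y - S.a2 y * S.q T y) / S.a y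
/-- The derivative of `q` at the wall. -/
def l (T : Trial) : ℝ := T.v2 0 / (2 * S.a1 0)

variable (T : Trial)

theorem v_eq {y : ℝ} (hy : 0 < y) : T.v y = S.a y * S.q T y := by
  have := (S.a_pos hy).ne'
  unfold q; field_simp

theorem v1_eq {y : ℝ} (hy : 0 < y) : T.v1 y = S.a1 y * S.q T y + S.a y * S.q1 T y := by
  have := (S.a_pos hy).ne'
  unfold q1 q; field_simp; ring

theorem v2_eq {y : ℝ} (hy : 0 < y) :
    T.v2 y = S.a y * S.q2 T y + 2 * S.a1 y * S.q1 T y + S.a2 y * S.q T y := by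
  have := (S.a_pos hy).ne'
  unfold q2; field_simp; ring

theorem dq {y : ℝ} (hy : 0 < y) : HasDerivAt (S.q T) (S.q1 T y) y :=
  (T.d0 y hy).div (S.da y) (S.a_pos hy).ne'

theorem dq1 {y : ℝ} (hy : 0 < y) : HasDerivAt (S.q1 T) (S.q2 T y) y := by
  have ha := (S.a_pos hy).ne'
  have h := (((T.d1 y hy).mul (S.da y)).sub ((T.d0 y hy).mul (S.da1 y))).div
    ((S.da y).pow 2) (pow_ne_zero 2 ha)
  refine h.congr_deriv ?_
  simp only [q2, q1, q, Pi.mul_apply, Pi.sub_apply, Pi.pow_apply]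
  field_simp
  ring

theorem cq : ContinuousOn (S.q T) (Ioi 0) := fun _ hy =>
  (S.dq T hy).continuousAt.continuousWithinAt
theorem cq1 : ContinuousOn (S.q1 T) (Ioi 0) := fun _ hy =>
  (S.dq1 T hy).continuousAt.continuousWithinAt
theorem cq2 : ContinuousOn (S.q2 T) (Ioi 0) := by
  have h := S.ca; have h1 := S.ca1; have h2 := S.ca2; have h3 := S.cq T; have h4 := S.cq1 T
  have h5 := T.o2
  unfold q2
  apply ContinuousOn.div _ h.continuousOn fun y hy => (S.a_pos hy).ne'
  fun_prop

theorem cq_div : ContinuousOn (fun y => S.q T y / y) (Ioi 0) :=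
  (S.cq T).div continuousOn_id fun _ hy => ne_of_gt hy

/-- Near the wall the quotient is twice differentiable with bounded second derivative. -/
theorem near_wall : ∃ C : ℝ, ∀ y, 0 < y → y ≤ 1 →
    |S.q T y - S.l T * y| ≤ C * y ^ 2 ∧ |S.q1 T y - S.l T| ≤ C * y ∧ |S.q2 T y| ≤ C := by
  obtain ⟨A0, hA0⟩ := isCompact_Icc.exists_bound_of_continuousOn (S.ca1.continuousOn (s := Icc 0 1))
  obtain ⟨A2, hA2⟩ := isCompact_Icc.exists_bound_of_continuousOn (S.ca2.continuousOn (s := Icc 0 1))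
  obtain ⟨V3, hV3⟩ := isCompact_Icc.exists_bound_of_continuousOn
    (T.c3.mono (Icc_subset_Ici_self : Icc (0 : ℝ) 1 ⊆ Ici 0))
  simp only [Real.norm_eq_abs] at hA0 hA2 hV3
  have z : (0 : ℝ) ∈ Icc (0 : ℝ) 1 := by simp
  have hA0' : 0 ≤ A0 := (abs_nonneg _).trans (hA0 0 z)
  have hA2' : 0 ≤ A2 := (abs_nonneg _).trans (hA2 0 z)
  have hV3' : 0 ≤ V3 := (abs_nonneg _).trans (hV3 0 z)
  have hc := S.c_pos
  have hs := S.slope_ge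
  set l := S.l T with hl
  set C2 := V3 + |l| * (3 * A2) with hC2
  have hC2' : 0 ≤ C2 := by positivity
  have hlv : T.v2 0 = 2 * S.a1 0 * l := by
    have : S.a1 0 ≠ 0 := by linarith
    rw [hl, Coefficients.l]; field_simp
  have hr2 : ∀ y, 0 < y → y ≤ 1 → |T.v2 y - l * (2 * S.a1 y + y * S.a2 y)| ≤ C2 * y := by
    intro y hy hy1
    have h1 : |T.v2 y - T.v2 0| ≤ V3 * y :=
      abs_sub_le_of_hasDerivAt hy (T.c2.mono Icc_subset_Ici_self) (fun z hz => T.d2 z hz.1)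
        fun z hz => hV3 z ⟨hz.1.le, hz.2.le.trans hy1⟩
    have h2 : |S.a1 y - S.a1 0| ≤ A2 * y :=
      abs_sub_le_of_hasDerivAt hy S.ca1.continuousOn (fun z hz => S.da1 z)
        fun z hz => hA2 z ⟨hz.1.le, hz.2.le.trans hy1⟩
    have h3 : |y * S.a2 y| ≤ A2 * y := by
      rw [abs_mul, abs_of_pos hy, mul_comm]
      exact mul_le_right (hA2 y ⟨hy.le, hy1⟩) hy.le
    have h4 : T.v2 y - l * (2 * S.a1 y + y * S.a2 y) =
        (T.v2 y - T.v2 0) - l * (2 * (S.a1 y - S.a1 0) + y * S.a2 y) := by rw [hlv]; ring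
    have h5 : |2 * (S.a1 y - S.a1 0) + y * S.a2 y| ≤ 3 * A2 * y := by
      rw [abs_le] at h2 h3 ⊢; constructor <;> linarith [h2.1, h2.2, h3.1, h3.2]
    rw [h4]
    refine (abs_sub _ _).trans ?_
    rw [abs_mul]
    have := mul_le_left h5 (abs_nonneg l)
    rw [hC2]; linarith
  have hr1 : ∀ y, 0 < y → y ≤ 1 → |T.v1 y - l * (S.a y + y * S.a1 y)| ≤ C2 * y ^ 2 := by
    intro y hy hy1
    have := abs_sub_le_of_hasDerivAt (f := fun y => T.v1 y - l * (S.a y + y * S.a1 y))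
      (f' := fun y => T.v2 y - l * (2 * S.a1 y + y * S.a2 y)) (C := C2 * y) hy ?_ ?_ ?_
    · simpa [T.z1, S.a_zero, mul_assoc, pow_two] using this
    · have h0 := S.ca; have h1 := S.ca1; have h2 := T.c1.mono (Icc_subset_Ici_self : Icc 0 y ⊆ _)
      fun_prop
    · intro z hz
      refine ((T.d1 z hz.1).sub (((S.da z).add ((hasDerivAt_id z).mul (S.da1 z))).const_mul
        l)).congr_deriv ?_
      simp only [id]; ring
    · intro z hz
      exact (hr2 z hz.1 (hz.2.le.trans hy1)).trans (mul_le_left hz.2.le hC2')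
  have hr0 : ∀ y, 0 < y → y ≤ 1 → |T.v y - l * (y * S.a y)| ≤ C2 * y ^ 3 := by
    intro y hy hy1
    have := abs_sub_le_of_hasDerivAt (f := fun y => T.v y - l * (y * S.a y))
      (f' := fun y => T.v1 y - l * (S.a y + y * S.a1 y)) (C := C2 * y ^ 2) hy ?_ ?_ ?_
    · simpa [T.z0, mul_assoc, pow_succ] using this
    · have h0 := S.ca; have h2 := T.c0.mono (Icc_subset_Ici_self : Icc 0 y ⊆ _)
      fun_prop
    · intro z hz
      refine ((T.d0 z hz.1).sub (((hasDerivAt_id z).mul (S.da z)).const_mul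
        l)).congr_deriv ?_
      simp
    · intro z hz
      refine (hr1 z hz.1 (hz.2.le.trans hy1)).trans (mul_le_left ?_ hC2')
      exact pow_le_pow_left₀ hz.1.le hz.2.le 2
  set c := S.c / 2
  have hc' : 0 < c := by positivity
  have hlow : ∀ y, 0 < y → y ≤ 1 → c * y ≤ S.a y := by
    intro y hy hy1
    have h1 := S.low y hy.le
    have h2 := (S.a_pos hy).le
    have : c = S.c / 2 := rfl
    nlinarith
  have hq0 : ∀ y, 0 < y → y ≤ 1 → |S.q T y - l * y| ≤ C2 / c * y ^ 2 := by
    intro y hy hy1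
    have ha := S.a_pos hy
    have h1 : S.q T y - l * y = (T.v y - l * (y * S.a y)) / S.a y := by
      unfold q; field_simp
    rw [h1, abs_div, abs_of_pos ha, div_le_iff₀ ha]
    refine (hr0 y hy hy1).trans ?_
    have := mul_le_left (hlow y hy hy1) (show 0 ≤ C2 / c * y ^ 2 by positivity)
    refine le_trans (le_of_eq ?_) this
    field_simp
  have hq1 : ∀ y, 0 < y → y ≤ 1 → |S.q1 T y - l| ≤ (C2 / c + A0 * (C2 / c) / c) * y := by
    intro y hy hy1
    have ha := S.a_pos hy
    have h1 : S.q1 T y - l = ((T.v1 y - l * (S.a y + y * S.a1 y)) -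
        S.a1 y * (S.q T y - l * y)) / S.a y := by
      have := S.v1_eq T hy
      rw [eq_div_iff ha.ne']; linarith
    rw [h1, abs_div, abs_of_pos ha, div_le_iff₀ ha]
    refine (abs_sub _ _).trans ?_
    rw [abs_mul]
    have h2 := mul_le_mul (hA0 y ⟨hy.le, hy1⟩) (hq0 y hy hy1) (abs_nonneg _) hA0'
    have h3 := hr1 y hy hy1
    have := mul_le_left (hlow y hy hy1)
      (show 0 ≤ (C2 / c + A0 * (C2 / c) / c) * y by positivity)
    refine le_trans ?_ this
    refine (add_le_add h3 h2).trans (le_of_eq ?_)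
    field_simp
  set D1 := C2 / c + A0 * (C2 / c) / c
  have hD1 : 0 ≤ D1 := by positivity
  have hq2 : ∀ y, 0 < y → y ≤ 1 → |S.q2 T y| ≤ (C2 + 2 * A0 * D1 + A2 * (C2 / c)) / c := by
    intro y hy hy1
    have ha := S.a_pos hy
    have h1 : S.q2 T y = ((T.v2 y - l * (2 * S.a1 y + y * S.a2 y)) - 2 * S.a1 y * (S.q1 T y - l)
        - S.a2 y * (S.q T y - l * y)) / S.a y := by
      unfold q2; congr 1; ring
    rw [h1, abs_div, abs_of_pos ha, div_le_iff₀ ha]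
    have e1 := hr2 y hy hy1
    have e2 : |2 * S.a1 y * (S.q1 T y - l)| ≤ 2 * A0 * (D1 * y) := by
      rw [abs_mul, abs_mul, abs_two]
      have := mul_le_mul (hA0 y ⟨hy.le, hy1⟩) (hq1 y hy hy1) (abs_nonneg _) hA0'
      linarith
    have e3 : |S.a2 y * (S.q T y - l * y)| ≤ A2 * (C2 / c * y) := by
      rw [abs_mul]
      refine mul_le_mul (hA2 y ⟨hy.le, hy1⟩) ((hq0 y hy hy1).trans ?_) (abs_nonneg _) hA2'
      apply mul_le_left _ (by positivity)
      nlinarith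
    have e4 := mul_le_left (hlow y hy hy1)
      (show 0 ≤ (C2 + 2 * A0 * D1 + A2 * (C2 / c)) / c by positivity)
    refine le_trans ?_ e4
    refine (abs_sub _ _).trans ?_
    refine (add_le_add (abs_sub _ _) le_rfl).trans ?_
    refine (add_le_add (add_le_add e1 e2) e3).trans (le_of_eq ?_)
    field_simp
  refine ⟨max (C2 / c) (max D1 ((C2 + 2 * A0 * D1 + A2 * (C2 / c)) / c)), fun y hy hy1 =>
    ⟨(hq0 y hy hy1).trans ?_, (hq1 y hy hy1).trans ?_, (hq2 y hy hy1).trans ?_⟩⟩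
  · exact mul_le_right (le_max_left _ _) (by positivity)
  · exact mul_le_right ((le_max_left _ _).trans (le_max_right _ _)) hy.le
  · exact (le_max_right _ _).trans (le_max_right _ _)

theorem tendsto_q1 : Tendsto (S.q1 T) (𝓝[>] 0) (𝓝 (S.l T)) := by
  obtain ⟨C, hC⟩ := S.near_wall T
  rw [tendsto_iff_norm_sub_tendsto_zero]
  have h : Tendsto (fun y : ℝ => C * y) (𝓝[>] 0) (𝓝 (C * 0)) :=
    (continuous_const.mul continuous_id).continuousAt.tendsto.mono_left nhdsWithin_le_nhds
  rw [mul_zero] at h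
  refine squeeze_zero' (Eventually.of_forall fun _ => norm_nonneg _) ?_ h
  filter_upwards [Ioo_mem_nhdsGT (zero_lt_one' ℝ)] with y hy
  exact (hC y hy.1 hy.2.le).2.1

theorem tendsto_q_div : Tendsto (fun y => S.q T y / y) (𝓝[>] 0) (𝓝 (S.l T)) := by
  obtain ⟨C, hC⟩ := S.near_wall T
  rw [tendsto_iff_norm_sub_tendsto_zero]
  have h : Tendsto (fun y : ℝ => C * y) (𝓝[>] 0) (𝓝 (C * 0)) :=
    (continuous_const.mul continuous_id).continuousAt.tendsto.mono_left nhdsWithin_le_nhds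
  rw [mul_zero] at h
  refine squeeze_zero' (Eventually.of_forall fun _ => norm_nonneg _) ?_ h
  filter_upwards [Ioo_mem_nhdsGT (zero_lt_one' ℝ)] with y hy
  have := (hC y hy.1 hy.2.le).1
  have hy0 := hy.1
  rw [Real.norm_eq_abs, show S.q T y / y - S.l T = (S.q T y - S.l T * y) / y by field_simp,
    abs_div, abs_of_pos hy0, div_le_iff₀ hy0]
  linarith

theorem tendsto_q : Tendsto (S.q T) (𝓝[>] 0) (𝓝 0) := by
  have h : Tendsto (fun y : ℝ => y) (𝓝[>] 0) (𝓝 0) := tendsto_id.mono_left nhdsWithin_le_nhds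
  have := (S.tendsto_q_div T).mul h
  rw [mul_zero] at this
  refine this.congr' ?_
  filter_upwards [self_mem_nhdsWithin] with y hy
  have hy : 0 < y := hy
  field_simp

end Coefficients

theorem energy_terms_ge {a y R A2 α β γ η X p p2 : ℝ} (ha : 0 < a) (hy : 0 < y)
    (h1 : |A2| ≤ R) (h2 : y ^ 2 * A2 ^ 2 ≤ R * a) (h3 : |α| ≤ R) (h4 : y * |β| ≤ R)
    (h5 : y ^ 2 * |γ| ≤ R) (h6 : y * |η| ≤ R) :
    3 / 4 * (a * p2 ^ 2) + a ^ 2 * p ^ 2 - R * (3 * X ^ 2 + 7 / 2 * p ^ 2) ≤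
      a * p2 ^ 2 + A2 * (y * X) * p2 - A2 * p ^ 2 + a ^ 2 * p ^ 2 + 3 / 2 * α * p ^ 2
        + β * (y * X) * p + γ * (y * X) ^ 2 + η * (y * X) * p := by
  have hR : 0 ≤ R := (abs_nonneg _).trans h1
  have e1 : -(1 / 4 * (a * p2 ^ 2) + R * X ^ 2) ≤ A2 * (y * X) * p2 := by
    have k1 : 0 ≤ (a * p2 / 2 + A2 * y * X) ^ 2 := sq_nonneg _
    have k2 : y ^ 2 * A2 ^ 2 * X ^ 2 ≤ R * a * X ^ 2 :=
      mul_le_right h2 (sq_nonneg _)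
    have k3 : 0 ≤ a * (1 / 4 * (a * p2 ^ 2) + R * X ^ 2 + A2 * (y * X) * p2) := by nlinarith
    have := nonneg_of_mul_nonneg_right k3 ha
    linarith
  have e2 : A2 * p ^ 2 ≤ R * p ^ 2 :=
    mul_le_right ((le_abs_self _).trans h1) (sq_nonneg _)
  have e3 : -(R * p ^ 2) ≤ α * p ^ 2 := by
    have := mul_le_right ((neg_le_of_abs_le h3)) (sq_nonneg p)
    linarith
  have key : ∀ β : ℝ, y * |β| ≤ R → -(R * (X ^ 2 + p ^ 2) / 2) ≤ β * (y * X) * p := by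
    intro β h
    have k1 : |β * (y * X) * p| ≤ R * (|X| * |p|) := by
      rw [abs_mul, abs_mul, abs_mul, abs_of_pos hy]
      have := mul_le_right h (mul_nonneg (abs_nonneg X) (abs_nonneg p))
      linarith
    have k2 : |X| * |p| ≤ (X ^ 2 + p ^ 2) / 2 := by
      nlinarith [sq_nonneg (|X| - |p|), sq_abs X, sq_abs p]
    have k3 := mul_le_left k2 hR
    linarith [neg_le_of_abs_le k1]
  have e4 := key β h4
  have e5 := key η h6
  have e6 : -(R * X ^ 2) ≤ γ * (y * X) ^ 2 := by
    have k1 : -(y ^ 2 * |γ|) ≤ y ^ 2 * γ := by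
      have := mul_le_left (neg_abs_le γ) (sq_nonneg y)
      linarith
    have k2 := mul_le_right (show -R ≤ y ^ 2 * γ by linarith) (sq_nonneg X)
    linarith
  linarith

theorem hardy_term_le {R R1 y X p : ℝ} (hR : 0 ≤ R) (hR1 : R1 ≤ 0) (hy : 0 < y) :
    8 * (R1 * (y * X ^ 2) + 2 * R * X * p - R * X ^ 2) ≤ 16 * (R * p ^ 2) - 4 * (R * X ^ 2) := by
  have h1 : R1 * (y * X ^ 2) ≤ 0 :=
    mul_nonpos_of_nonpos_of_nonneg hR1 (by positivity)
  have h2 : 0 ≤ R * (2 * p - X) ^ 2 := by positivity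
  nlinarith

theorem interpolation_term_ge {R R1 y k p p2 r : ℝ} (hR : 0 ≤ R) (hy : 0 < y) (hk : 0 < k)
    (hr : r = 1 / (1 + k * y)) (hR1 : -R1 * (y * r ^ 2) ≤ R / 8) :
    R * p ^ 2 - 36 * ((k * y * r) ^ 2 * R * p ^ 2) - 32 * ((y * r) ^ 2 * R * p2 ^ 2) ≤
      8 * (R1 * (y * r ^ 2) * p ^ 2 + R * (r ^ 2 * (1 - 2 * (k * y * r))) * p ^ 2
        + 2 * R * (y * r ^ 2) * p * p2) := by
  have hky : 0 < 1 + k * y := by positivity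
  have hr0 : 0 < r := by rw [hr]; positivity
  set s := k * y * r with hs
  have hs1 : s = 1 - r := by rw [hs, hr]; field_simp; ring
  have hs0 : 0 ≤ s := by positivity
  have hr1 : r ≤ 1 := by linarith
  have e1 := mul_le_right hR1 (sq_nonneg p)
  have e2 : 16 * (s * r ^ 2) ≤ 2 * r ^ 2 + 32 * s ^ 2 := by
    have k1 : 0 ≤ 2 * r ^ 2 * (1 - 4 * s) ^ 2 := by positivity
    have k2 : s ^ 2 * r ^ 2 ≤ s ^ 2 * 1 :=
      mul_le_left (pow_le_one₀ hr0.le hr1) (sq_nonneg s)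
    nlinarith
  have e3 := mul_le_right e2 (show 0 ≤ R * p ^ 2 by positivity)
  have e4 : 0 ≤ 2 * R * r ^ 2 * (p + 4 * (y * p2)) ^ 2 := by positivity
  have e5 : 2 - 4 * s ^ 2 ≤ 4 * r ^ 2 := by rw [hs1]; nlinarith [sq_nonneg (2 * r - 1)]
  have e6 := mul_le_right e5 (show 0 ≤ R * p ^ 2 by positivity)
  have e7 : (y * r) ^ 2 * R * p2 ^ 2 = R * r ^ 2 * (y * p2) ^ 2 := by ring
  nlinarith

namespace Coefficients

/-- Bounds on the coefficients, weighted by `w`. -/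
structure Bounds (S : Coefficients) (w : ℝ → ℝ) (M : ℝ) : Prop where
  cw : Continuous w
  w_ge : ∀ y, 0 < y → 1 + y ≤ w y
  a_le : ∀ y, 0 < y → S.a y * (1 + y) ≤ M * y
  a1_le : ∀ y, 0 < y → |S.a1 y| * w y ≤ M
  a2_le : ∀ y, 0 < y → |S.a2 y| * (w y * (1 + y)) ≤ M
  b_le : ∀ y, 0 < y → |S.b y| * (1 + y) ≤ M * y
  b1_le : ∀ y, 0 < y → |S.b1 y| * w y ≤ M
  b2_le : ∀ y, 0 < y → |S.b2 y| * w y ≤ M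
  e_le : ∀ y, 0 < y → |S.e y| * (w y * (1 + y)) ≤ M
  f_le : ∀ y, 0 < y → |S.f y| * w y ≤ M

/-- The energy density attached to the weight `w`. -/
def density (S : Coefficients) (T : Trial) (y : ℝ) : ℝ :=
  S.a y * S.q2 T y ^ 2 + S.q1 T y ^ 2 + (S.q T y / y) ^ 2

/-- Finiteness of the weighted norms of a trial function. -/
structure Finite (S : Coefficients) (w : ℝ → ℝ) (T : Trial) : Prop where
  q_div : MemLp (fun y => S.q T y / y) 2 halfLine
  q1 : MemLp (S.q1 T) 2 halfLine
  q2 : MemLp (fun y => √(S.a y) * S.q2 T y * w y) 2 halfLine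
  v3 : MemLp (fun y => T.v3 y * w y) 2 halfLine
  v4 : MemLp (fun y => T.v4 y * w y) 2 halfLine

/-- The total density controlling all the terms. -/
def total (S : Coefficients) (w : ℝ → ℝ) (T : Trial) (y : ℝ) : ℝ :=
  (S.q T y / y) ^ 2 + S.q1 T y ^ 2 + (√(S.a y) * S.q2 T y * w y) ^ 2 + (T.v3 y * w y) ^ 2
    + (T.v4 y * w y) ^ 2

theorem Finite.integrable_total {S : Coefficients} {w : ℝ → ℝ} {T : Trial} (h : S.Finite w T) :
    Integrable (S.total w T) halfLine :=
  (((h.q_div.integrable_sq.add h.q1.integrable_sq).add h.q2.integrable_sq).add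
    h.v3.integrable_sq).add h.v4.integrable_sq

theorem Finite.integrable_of_le {S : Coefficients} {w : ℝ → ℝ} {T : Trial} (h : S.Finite w T)
    {g : ℝ → ℝ} (hg : AEStronglyMeasurable g halfLine) (C : ℝ)
    (hle : ∀ y, 0 < y → |g y| ≤ C * S.total w T y) : IntegrableOn g (Ioi 0) :=
  Integrable.mono' (h.integrable_total.const_mul C) hg
    (ae_of_pos hle)

/-- The operator applied to a trial function. -/
def op (S : Coefficients) (T : Trial) (y : ℝ) : ℝ :=
  T.v4 y - (S.a y * T.v2 y - S.a2 y * T.v y) - (S.b y * T.v3 y - T.v1 y * S.b2 y)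
    + S.e y * T.v y + S.f y * T.v1 y

/-- The sum of the moduli of the quantities whose squares make up the total density. -/
def moduli (S : Coefficients) (w : ℝ → ℝ) (T : Trial) (y : ℝ) : ℝ :=
  |S.q T y / y| + |S.q1 T y| + |√(S.a y) * S.q2 T y * w y| + |T.v3 y * w y| + |T.v4 y * w y|

theorem moduli_nonneg (S : Coefficients) (w : ℝ → ℝ) (T : Trial) (y : ℝ) :
    0 ≤ S.moduli w T y := by
  unfold moduli; positivity

theorem moduli_sq_le (S : Coefficients) (w : ℝ → ℝ) (T : Trial) (y : ℝ) :
    S.moduli w T y ^ 2 ≤ 5 * S.total w T y := by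
  unfold moduli total
  rw [← sq_abs (S.q T y / y), ← sq_abs (S.q1 T y), ← sq_abs (√(S.a y) * S.q2 T y * w y),
    ← sq_abs (T.v3 y * w y), ← sq_abs (T.v4 y * w y)]
  generalize |S.q T y / y| = x1
  generalize |S.q1 T y| = x2
  generalize |√(S.a y) * S.q2 T y * w y| = x3
  generalize |T.v3 y * w y| = x4
  generalize |T.v4 y * w y| = x5
  nlinarith [sq_nonneg (x1 - x2), sq_nonneg (x1 - x3), sq_nonneg (x1 - x4), sq_nonneg (x1 - x5),
    sq_nonneg (x2 - x3), sq_nonneg (x2 - x4), sq_nonneg (x2 - x5), sq_nonneg (x3 - x4),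
    sq_nonneg (x3 - x5), sq_nonneg (x4 - x5)]

theorem Finite.integrable_of_dom {S : Coefficients} {w : ℝ → ℝ} {T : Trial} (hF : S.Finite w T)
    {f g : ℝ → ℝ} (h : Dom f g) (hg : ∀ y, 0 < y → g y ≤ S.moduli w T y ^ 2) :
    IntegrableOn f (Ioi 0) := by
  obtain ⟨hm, C, hC, h⟩ := h
  refine hF.integrable_of_le hm (C * 5) fun y hy => (h y hy).trans ?_
  rw [mul_assoc]
  exact mul_le_left ((hg y hy).trans (S.moduli_sq_le w T y)) hC

theorem Finite.memLp_of_dom {S : Coefficients} {w : ℝ → ℝ} {T : Trial} (hF : S.Finite w T)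
    {f g : ℝ → ℝ} (h : Dom f g) (hg : ∀ y, 0 < y → g y ≤ S.moduli w T y) :
    MemLp f 2 halfLine := by
  rw [memLp_two_iff_integrable_sq h.1]
  have h := h.mono hg
  simp only [pow_two]
  exact hF.integrable_of_dom (h.mul h) fun y _ => (pow_two _).ge

theorem _root_.BoundaryLayer.Trial.aesm_v4 (T : Trial) : AEStronglyMeasurable T.v4 halfLine := by
  refine (measurable_deriv T.v3).aestronglyMeasurable.congr ?_
  filter_upwards [T.ac.2] with y hy using hy.deriv

theorem aesm_op (S : Coefficients) (T : Trial) : AEStronglyMeasurable (S.op T) halfLine := by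
  have h0 := T.o0.aesm
  have h1 := T.o1.aesm
  have h2 := T.o2.aesm
  have h3 := T.o3.aesm
  have h4 := T.aesm_v4
  have ha := S.ca.aestronglyMeasurable (μ := halfLine)
  have ha2 := S.ca2.aestronglyMeasurable (μ := halfLine)
  have hb := S.cb.aestronglyMeasurable (μ := halfLine)
  have hb2 := S.cb2.aestronglyMeasurable (μ := halfLine)
  have he := S.ce.aestronglyMeasurable (μ := halfLine)
  have hf := S.cf.aestronglyMeasurable (μ := halfLine)
  exact (((h4.sub ((ha.mul h2).sub (ha2.mul h0))).sub ((hb.mul h3).sub (h1.mul hb2))).add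
    (he.mul h0)).add (hf.mul h1)

section moduli

variable (S : Coefficients) (w : ℝ → ℝ) (T : Trial) (y : ℝ)

theorem le_moduli : |S.q T y / y| ≤ S.moduli w T y ∧ |S.q1 T y| ≤ S.moduli w T y ∧
    |√(S.a y) * S.q2 T y * w y| ≤ S.moduli w T y ∧ |T.v3 y * w y| ≤ S.moduli w T y ∧
    |T.v4 y * w y| ≤ S.moduli w T y :=
  le_add_five (abs_nonneg _) (abs_nonneg _) (abs_nonneg _) (abs_nonneg _) (abs_nonneg _)

theorem sq_le_total : (S.q T y / y) ^ 2 ≤ S.total w T y ∧ S.q1 T y ^ 2 ≤ S.total w T y ∧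
    (√(S.a y) * S.q2 T y * w y) ^ 2 ≤ S.total w T y ∧ (T.v3 y * w y) ^ 2 ≤ S.total w T y ∧
    (T.v4 y * w y) ^ 2 ≤ S.total w T y :=
  le_add_five (sq_nonneg _) (sq_nonneg _) (sq_nonneg _) (sq_nonneg _) (sq_nonneg _)

theorem dom_q1 : Dom (S.q1 T) (S.moduli w T) :=
  ⟨(S.cq1 T).aesm, 1, zero_le_one, fun y _ => (S.le_moduli w T y).2.1.trans (one_mul _).ge⟩

theorem dom_q_div : Dom (fun y => S.q T y / y) (S.moduli w T) :=
  ⟨(S.cq_div T).aesm, 1, zero_le_one, fun y _ => (S.le_moduli w T y).1.trans (one_mul _).ge⟩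

theorem dom_q : Dom (S.q T) fun y => y * S.moduli w T y :=
  ⟨(S.cq T).aesm, 1, zero_le_one, fun y hy => by
    have h := (S.le_moduli w T y).1
    rw [abs_div, abs_of_pos hy, div_le_iff₀ hy] at h
    linarith⟩

variable {y}

theorem le_density (hy : 0 < y) : S.a y * S.q2 T y ^ 2 ≤ S.density T y ∧
    S.q1 T y ^ 2 ≤ S.density T y ∧ (S.q T y / y) ^ 2 ≤ S.density T y ∧
    (S.q T y / y) ^ 2 + S.q1 T y ^ 2 ≤ S.density T y := by
  have h1 := mul_nonneg (S.a_pos hy).le (sq_nonneg (S.q2 T y))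
  have h2 := sq_nonneg (S.q1 T y)
  have h3 := sq_nonneg (S.q T y / y)
  unfold density
  refine ⟨?_, ?_, ?_, ?_⟩ <;> linarith

theorem density_nonneg (hy : 0 < y) : 0 ≤ S.density T y :=
  (sq_nonneg _).trans (S.le_density T hy).2.1

variable {S w} in
theorem density_le_total (hy : 0 < y) (hw : 1 ≤ w y) : S.density T y ≤ S.total w T y := by
  have h1 : (√(S.a y) * S.q2 T y * w y) ^ 2 = S.a y * S.q2 T y ^ 2 * w y ^ 2 := by
    rw [mul_pow, mul_pow, Real.sq_sqrt (S.a_pos hy).le]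
  have h3 : S.a y * S.q2 T y ^ 2 ≤ S.a y * S.q2 T y ^ 2 * w y ^ 2 :=
    le_mul_of_one_le_right (mul_nonneg (S.a_pos hy).le (sq_nonneg _)) (one_le_pow₀ hw)
  have h7 := sq_nonneg (T.v3 y * w y)
  have h8 := sq_nonneg (T.v4 y * w y)
  unfold total density
  rw [h1]
  linarith

theorem continuousOn_density : ContinuousOn (S.density T) (Ioi 0) := by
  have h := S.cq T; have h1 := S.cq1 T; have h2 := S.cq2 T
  have h3 := S.ca.continuousOn (s := Ioi 0)
  have h4 := S.cq_div T
  unfold density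
  fun_prop

end moduli

namespace Bounds

variable {S : Coefficients} {w : ℝ → ℝ} {M : ℝ} (hB : S.Bounds w M)
include hB

theorem M_nonneg : 0 ≤ M := by
  have := hB.a1_le 1 one_pos
  have h := hB.w_ge 1 one_pos
  exact (mul_nonneg (abs_nonneg _) (by linarith)).trans this

theorem w_pos {y : ℝ} (hy : 0 < y) : 0 < w y := by linarith [hB.w_ge y hy]

theorem a_le_const {y : ℝ} (hy : 0 < y) : S.a y ≤ M := by
  have h := hB.a_le y hy
  have := S.a_pos hy
  have := hB.M_nonneg
  nlinarith

theorem b_le_const {y : ℝ} (hy : 0 < y) : |S.b y| ≤ M := by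
  have h := hB.b_le y hy
  have := abs_nonneg (S.b y)
  have := hB.M_nonneg
  by_contra hlt
  push Not at hlt
  nlinarith

theorem one_le {y : ℝ} (hy : 0 < y) : 1 ≤ w y := by linarith [hB.w_ge y hy]

theorem a1_le_const {y : ℝ} (hy : 0 < y) : |S.a1 y| ≤ M :=
  le_mul_weight (abs_nonneg _) (hB.one_le hy) (hB.a1_le y hy)

theorem b1_le_const {y : ℝ} (hy : 0 < y) : |S.b1 y| ≤ M :=
  le_mul_weight (abs_nonneg _) (hB.one_le hy) (hB.b1_le y hy)

theorem integrable_density {T : Trial} (hF : S.Finite w T) :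
    Integrable (S.density T) halfLine := by
  refine hF.integrable_of_le (S.continuousOn_density T).aesm 1 fun y hy => ?_
  rw [one_mul, abs_of_nonneg (S.density_nonneg T hy)]
  exact density_le_total T hy (hB.one_le hy)

theorem v2_le (T : Trial) {y : ℝ} (hy : 0 < y) :
    |T.v2 y * w y| ≤ (1 + M) * |√(S.a y) * S.q2 T y * w y| + 2 * M * |S.q1 T y|
      + M * |S.q T y / y| := by
  have hw := hB.w_pos hy
  have ha := S.a_pos hy
  have hM := hB.M_nonneg
  have h1 : T.v2 y * w y = √(S.a y) * (√(S.a y) * S.q2 T y * w y) + 2 * (S.a1 y * w y) * S.q1 T y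
      + (S.a2 y * (w y * y)) * (S.q T y / y) := by
    rw [S.v2_eq T hy]
    have := Real.mul_self_sqrt ha.le
    have h2 : S.a2 y * (w y * y) * (S.q T y / y) = S.a2 y * w y * S.q T y := by field_simp
    rw [h2]
    linear_combination (-(S.q2 T y * w y)) * this
  rw [h1]
  refine (abs_add_three _ _ _).trans ?_
  have e1 : √(S.a y) ≤ 1 + M := by
    rw [Real.sqrt_le_left (by linarith)]
    nlinarith [hB.a_le_const hy]
  have e2 : |2 * (S.a1 y * w y)| ≤ 2 * M := by
    rw [abs_mul, abs_mul, abs_of_pos hw, abs_two]; linarith [hB.a1_le y hy]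
  have e3 : |S.a2 y * (w y * y)| ≤ M := by
    rw [abs_mul, abs_of_pos (mul_pos hw hy)]
    refine le_trans ?_ (hB.a2_le y hy)
    gcongr; linarith
  rw [abs_mul (√(S.a y)), abs_mul (2 * (S.a1 y * w y)), abs_mul (S.a2 y * (w y * y)),
    abs_of_nonneg (Real.sqrt_nonneg _)]
  gcongr

theorem v1_le (T : Trial) {y : ℝ} (hy : 0 < y) :
    |T.v1 y| ≤ M * |S.q T y / y| + M * |S.q1 T y| := by
  have hw := hB.w_pos hy
  have h1 : T.v1 y = (S.a1 y * y) * (S.q T y / y) + S.a y * S.q1 T y := by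
    rw [S.v1_eq T hy]; field_simp
  rw [h1]
  refine (abs_add_le _ _).trans ?_
  rw [abs_mul (S.a1 y * y), abs_mul (S.a y), abs_of_pos (S.a_pos hy)]
  have e1 : |S.a1 y * y| ≤ M := by
    rw [abs_mul, abs_of_pos hy]
    refine le_trans ?_ (hB.a1_le y hy)
    gcongr; linarith [hB.w_ge y hy]
  have e2 := hB.a_le_const hy
  gcongr

theorem v_le (T : Trial) {y : ℝ} (hy : 0 < y) :
    |T.v y| ≤ M * y * |S.q T y / y| := by
  have h1 : T.v y = S.a y * y * (S.q T y / y) := by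
    rw [S.v_eq T hy]; field_simp
  rw [h1, abs_mul, abs_mul, abs_of_pos (S.a_pos hy), abs_of_pos hy]
  have e2 := hB.a_le_const hy
  gcongr

/-- The lower order part of the operator is controlled by the energy. -/
theorem lower_le (T : Trial) {y : ℝ} (hy : 0 < y) :
    |(S.a2 y * T.v y + T.v1 y * S.b2 y + S.e y * T.v y + S.f y * T.v1 y) * w y| ≤
      4 * M ^ 2 * |S.q T y / y| + 2 * M ^ 2 * |S.q1 T y| := by
  have hw := hB.w_pos hy
  have hM := hB.M_nonneg
  have h0 := hB.v_le T hy
  have h1 := hB.v1_le T hy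
  have key : ∀ g : ℝ, |g| * (w y * (1 + y)) ≤ M → |g * T.v y * w y| ≤ M ^ 2 * |S.q T y / y| := by
    intro g hg
    rw [abs_mul, abs_mul, abs_of_pos hw]
    calc |g| * |T.v y| * w y ≤ |g| * (M * y * |S.q T y / y|) * w y := by gcongr
      _ = M * (|g| * (w y * y)) * |S.q T y / y| := by ring
      _ ≤ M * (|g| * (w y * (1 + y))) * |S.q T y / y| := by gcongr; linarith
      _ ≤ M * M * |S.q T y / y| := by gcongr
      _ = _ := by ring
  have key1 : ∀ g : ℝ, |g| * w y ≤ M →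
      |g * T.v1 y * w y| ≤ M ^ 2 * |S.q T y / y| + M ^ 2 * |S.q1 T y| := by
    intro g hg
    rw [abs_mul, abs_mul, abs_of_pos hw]
    calc |g| * |T.v1 y| * w y = (|g| * w y) * |T.v1 y| := by ring
      _ ≤ M * (M * |S.q T y / y| + M * |S.q1 T y|) := by gcongr
      _ = _ := by ring
  have e1 := key _ (hB.a2_le y hy)
  have e2 := key _ (hB.e_le y hy)
  have e3 := key1 _ (hB.b2_le y hy)
  have e4 := key1 _ (hB.f_le y hy)
  have h : (S.a2 y * T.v y + T.v1 y * S.b2 y + S.e y * T.v y + S.f y * T.v1 y) * w y =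
    S.a2 y * T.v y * w y + S.b2 y * T.v1 y * w y + S.e y * T.v y * w y + S.f y * T.v1 y * w y := by
    ring
  rw [h]
  refine (abs_add_le _ _).trans ?_
  have := abs_add_three (S.a2 y * T.v y * w y) (S.b2 y * T.v1 y * w y) (S.e y * T.v y * w y)
  linarith

section dom

variable (T : Trial)

theorem dom_v3 : Dom T.v3 fun y => S.moduli w T y / w y :=
  .of_weight T.o3.aesm zero_le_one (fun y _ => (S.le_moduli w T y).2.2.2.1.trans (one_mul _).ge)
    fun _ => hB.w_pos

theorem dom_v4 : Dom T.v4 fun y => S.moduli w T y / w y :=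
  .of_weight T.aesm_v4 zero_le_one (fun y _ => (S.le_moduli w T y).2.2.2.2.trans (one_mul _).ge)
    fun _ => hB.w_pos

theorem dom_v2 : Dom T.v2 fun y => S.moduli w T y / w y := by
  have hM := hB.M_nonneg
  refine .of_weight T.o2.aesm (C := 1 + 4 * M) (by positivity) (fun y hy => ?_) fun _ => hB.w_pos
  have h := hB.v2_le T hy
  obtain ⟨h1, h2, h3, -⟩ := S.le_moduli w T y
  have h1 := mul_le_left h1 hM
  have h2 := mul_le_left h2 (show 0 ≤ 2 * M by linarith)
  have h3 := mul_le_left h3 (show 0 ≤ 1 + M by linarith)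
  linarith

theorem dom_v1 : Dom T.v1 (S.moduli w T) := by
  have hM := hB.M_nonneg
  refine ⟨T.o1.aesm, 2 * M, by positivity, fun y hy => (hB.v1_le T hy).trans ?_⟩
  have h1 := mul_le_left (S.le_moduli w T y).1 hM
  have h2 := mul_le_left (S.le_moduli w T y).2.1 hM
  linarith

theorem dom_a : Dom S.a fun _ => 1 :=
  ⟨S.ca.aestronglyMeasurable, M, hB.M_nonneg, fun y hy => by
    rw [mul_one, abs_of_pos (S.a_pos hy)]; exact hB.a_le_const hy⟩

theorem dom_b : Dom S.b fun _ => 1 :=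
  ⟨S.cb.aestronglyMeasurable, M, hB.M_nonneg, fun y hy => by rw [mul_one]; exact hB.b_le_const hy⟩

theorem dom_b1 : Dom S.b1 fun _ => 1 :=
  ⟨S.cb1.aestronglyMeasurable, M, hB.M_nonneg, fun y hy => by
    rw [mul_one]; exact hB.b1_le_const hy⟩

theorem dom_op : Dom (fun y => S.op T y * w y) (S.moduli w T) := by
  have hM := hB.M_nonneg
  have hw := hB.cw.aestronglyMeasurable (μ := halfLine)
  have k : ∀ {f : ℝ → ℝ}, (Dom f fun y => S.moduli w T y / w y) →
      Dom (fun y => w y * f y) (S.moduli w T) := fun h =>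
    (Dom.mul ⟨hw, 1, zero_le_one, fun y hy => by
      rw [one_mul, abs_of_pos (hB.w_pos hy)]⟩ h).mono fun y hy => by
        have := hB.w_pos hy
        field_simp; exact le_rfl
  have h0 : Dom (fun y => (S.a2 y * T.v y + T.v1 y * S.b2 y + S.e y * T.v y + S.f y * T.v1 y) * w y)
      (S.moduli w T) := by
    refine ⟨?_, 6 * M ^ 2, by positivity, fun y hy => (hB.lower_le T hy).trans ?_⟩
    · have := S.ca2; have := S.cb2; have := S.ce; have := S.cf; have := T.o0; have := T.o1
      have := hB.cw
      apply ContinuousOn.aesm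
      fun_prop
    · have h1 := mul_le_left (S.le_moduli w T y).1 (show 0 ≤ 4 * M ^ 2 by positivity)
      have h2 := mul_le_left (S.le_moduli w T y).2.1 (show 0 ≤ 2 * M ^ 2 by positivity)
      linarith
  convert (((k (hB.dom_v4 T)).sub (hB.dom_a.smul (k (hB.dom_v2 T)))).sub
    (hB.dom_b.smul (k (hB.dom_v3 T)))).add h0 using 2
  unfold op; ring

end dom

end Bounds

end Coefficients

namespace Coefficients

/-- The structural condition for the coercivity of the operator: the coefficients of the lower
order terms of the quadratic form are bounded by a decreasing weight `R`, which is small compared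
to the leading terms. -/
structure Coercive (S : Coefficients) (R R1 : ℝ → ℝ) (k δ B : ℝ) : Prop where
  k_pos : 0 < k
  δ_pos : 0 < δ
  dR : ∀ y, 0 ≤ y → HasDerivAt R (R1 y) y
  cR1 : ContinuousOn R1 (Ioi 0)
  R_ge : ∀ y, 0 < y → δ ≤ R y
  R_le : ∀ y, 0 < y → R y ≤ B
  R1_nonpos : ∀ y, 0 < y → R1 y ≤ 0
  R1_le : ∀ y, 0 < y → -R1 y * y ≤ B
  R1_slow : ∀ y, 0 < y → -R1 y * (y * (1 / (1 + k * y)) ^ 2) ≤ R y / 8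
  a2_le : ∀ y, 0 < y → |S.a2 y| ≤ R y
  a2_sq_le : ∀ y, 0 < y → y ^ 2 * S.a2 y ^ 2 ≤ R y * S.a y
  ab_le : ∀ y, 0 < y → |S.a1 y * S.b y - S.a y * S.b1 y| ≤ R y
  ab1_le : ∀ y, 0 < y → y * |S.b y * S.a2 y - S.a1 y * S.b1 y| ≤ R y
  e_le : ∀ y, 0 < y → y ^ 2 * |S.e y * S.a y + S.f y * S.a1 y| ≤ R y
  f_le : ∀ y, 0 < y → y * |S.f y * S.a y| ≤ R y
  large : ∀ y, 0 < y → 3000 * ((k * y * (1 / (1 + k * y))) ^ 2 * R y) ≤ S.a y ^ 2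
  large' : ∀ y, 0 < y → 3000 * ((y * (1 / (1 + k * y))) ^ 2 * R y) ≤ S.a y

/-- The density bounded from below by the quadratic form. -/
def good (S : Coefficients) (T : Trial) (δ y : ℝ) : ℝ :=
  1 / 2 * (S.a y * S.q2 T y ^ 2) + 1 / 2 * (S.a y ^ 2 * S.q1 T y ^ 2)
    + δ * ((S.q T y / y) ^ 2 + S.q1 T y ^ 2)

theorem coercive_pointwise {a y R R1 A2 α β γ η X p p2 k δ r : ℝ} (ha : 0 < a) (hy : 0 < y)
    (hk : 0 < k) (hδ : 0 < δ) (hr : r = 1 / (1 + k * y)) (hR : δ ≤ R) (hR1 : R1 ≤ 0)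
    (hslow : -R1 * (y * r ^ 2) ≤ R / 8)
    (h1 : |A2| ≤ R) (h2 : y ^ 2 * A2 ^ 2 ≤ R * a) (h3 : |α| ≤ R) (h4 : y * |β| ≤ R)
    (h5 : y ^ 2 * |γ| ≤ R) (h6 : y * |η| ≤ R) (h7 : 3000 * ((k * y * r) ^ 2 * R) ≤ a ^ 2)
    (h8 : 3000 * ((y * r) ^ 2 * R) ≤ a) :
    1 / 2 * (a * p2 ^ 2) + 1 / 2 * (a ^ 2 * p ^ 2) + δ * (X ^ 2 + p ^ 2)
      + 8 * (R1 * (y * X ^ 2) + 2 * R * X * p - R * X ^ 2)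
      - 164 * (R1 * (y * r ^ 2) * p ^ 2 + R * (r ^ 2 * (1 - 2 * (k * y * r))) * p ^ 2
        + 2 * R * (y * r ^ 2) * p * p2) ≤
      a * p2 ^ 2 + A2 * (y * X) * p2 - A2 * p ^ 2 + a ^ 2 * p ^ 2 + 3 / 2 * α * p ^ 2
        + β * (y * X) * p + γ * (y * X) ^ 2 + η * (y * X) * p := by
  have e1 := energy_terms_ge (X := X) (p := p) (p2 := p2) ha hy h1 h2 h3 h4 h5 h6
  have hR0 : 0 ≤ R := hδ.le.trans hR
  have e2 := hardy_term_le (X := X) (p := p) hR0 hR1 hy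
  have e3 := interpolation_term_ge (p := p) (p2 := p2) hR0 hy hk hr hslow
  have e4 := mul_le_right hR (show 0 ≤ X ^ 2 + p ^ 2 by positivity)
  have e5 := mul_le_right h7 (sq_nonneg p)
  have e6 := mul_le_right h8 (sq_nonneg p2)
  have e7 : 0 ≤ a * p2 ^ 2 := by positivity
  have e8 : 0 ≤ a ^ 2 * p ^ 2 := by positivity
  have e9 : 0 ≤ R * p ^ 2 := by positivity
  linarith

theorem abs_le_of_sq_le {x B A m : ℝ} (hB : 0 ≤ B) (hm : 0 ≤ m) (hx : x ^ 2 ≤ B * A)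
    (hA : A ≤ m ^ 2) : |x| ≤ (1 + B) * m := by
  refine abs_le_of_sq_le_sq ?_ (by positivity)
  have := mul_le_left hA hB
  have : 0 ≤ (1 + B + B ^ 2) * m ^ 2 := by positivity
  linarith

set_option maxHeartbeats 1000000 in
/-- Coercivity of the operator tested with the quotient `q = v / a`. -/
theorem Coercive.energy {S : Coefficients} {w R R1 : ℝ → ℝ} {k δ B M : ℝ}
    (hC : S.Coercive R R1 k δ B) (hB : S.Bounds w M) {T : Trial} (hF : S.Finite w T) :
    IntegrableOn (fun y => S.op T y * S.q T y) (Ioi 0) ∧ IntegrableOn (S.good T δ) (Ioi 0) ∧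
    (∫ y in Ioi 0, S.good T δ y) + S.a1 0 * S.l T ^ 2 ≤ ∫ y in Ioi 0, S.op T y * S.q T y := by
  have hM := hB.M_nonneg
  have hk := hC.k_pos
  have hδ := hC.δ_pos
  have hB0 : 0 ≤ B := hδ.le.trans ((hC.R_ge 1 one_pos).trans (hC.R_le 1 one_pos))
  have cR : ContinuousOn R (Ioi 0) := fun y hy =>
    (hC.dR y (le_of_lt hy)).continuousAt.continuousWithinAt
  have hqe : ∀ y, 0 < y → S.q T y = y * (S.q T y / y) := fun y hy => by field_simp
  have dq := S.dom_q w T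
  have dX := S.dom_q_div w T
  have dp := S.dom_q1 w T
  have hm0 := S.moduli_nonneg w T
  set μ := S.moduli w T with hμ
  have hdiv : ∀ y, 0 < y → μ y / w y ≤ μ y / y := fun y hy => by
    have := hB.w_ge y hy; have := hm0 y
    gcongr; linarith
  have iop : IntegrableOn (fun y => S.op T y * S.q T y) (Ioi 0) := by
    refine hF.integrable_of_dom (((hB.dom_op T).div_weight (fun _ => hB.w_pos)
      (S.aesm_op T)).mul dq) fun y hy => ?_
    have := mul_le_right (hdiv y hy) (mul_nonneg hy.le (hm0 y))
    exact this.trans_eq (by field_simp; rfl)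
  have igood : IntegrableOn (S.good T δ) (Ioi 0) := by
    refine hF.integrable_of_le (ContinuousOn.aesm ?_) (1 + M ^ 2 + 2 * δ) fun y hy => ?_
    · have h := S.cq T; have h1 := S.cq1 T; have h2 := S.cq2 T; have h3 := S.ca.continuousOn (s := Ioi 0)
      have h4 := S.cq_div T
      unfold good
      fun_prop
    · obtain ⟨h1, h2, -, h3⟩ := S.le_density T hy
      have ha := S.a_pos hy
      have h4 : 0 ≤ S.good T δ y := by unfold good; positivity
      rw [abs_of_nonneg h4]
      refine le_trans ?_ (mul_le_left (density_le_total T hy (hB.one_le hy)) (by positivity))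
      unfold good
      have h5 : S.a y ^ 2 * S.q1 T y ^ 2 ≤ M ^ 2 * S.density T y :=
        mul_le_mul (pow_le_pow_left₀ ha.le (hB.a_le_const hy) 2) h2 (sq_nonneg _) (sq_nonneg _)
      have h6 := mul_le_left h3 hδ.le
      have h8 := S.density_nonneg T hy
      have h9 : 0 ≤ M ^ 2 * S.density T y := by positivity
      have h10 : 0 ≤ δ * S.density T y := by positivity
      linarith
  refine ⟨iop, igood, ?_⟩
  set r : ℝ → ℝ := fun y => 1 / (1 + k * y) with hr
  have hrpos : ∀ y, 0 ≤ y → 0 < 1 + k * y := fun y hy => by positivity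
  have cr : ContinuousOn r (Ioi 0) := by
    refine ContinuousOn.div continuousOn_const (by fun_prop) fun y hy => ?_
    exact (hrpos y (le_of_lt hy)).ne'
  have Lq : LocAC (S.q T) (S.q1 T) := LocAC.of_hasDerivAt (fun y hy => S.dq T hy) (S.cq1 T)
  have Lq1 : LocAC (S.q1 T) (S.q2 T) := LocAC.of_hasDerivAt (fun y hy => S.dq1 T hy) (S.cq2 T)
  have Lv1 : LocAC T.v1 T.v2 := LocAC.of_hasDerivAt T.d1 T.o2
  have Lv2 : LocAC T.v2 T.v3 := LocAC.of_hasDerivAt T.d2 T.o3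
  have La : LocAC S.a S.a1 := LocAC.of_hasDerivAt (fun y _ => S.da y) S.ca1.continuousOn
  have La1 : LocAC S.a1 S.a2 := LocAC.of_hasDerivAt (fun y _ => S.da1 y) S.ca2.continuousOn
  have Lb : LocAC S.b S.b1 := LocAC.of_hasDerivAt (fun y _ => S.db y) S.cb1.continuousOn
  have Lb1 : LocAC S.b1 S.b2 := LocAC.of_hasDerivAt (fun y _ => S.db1 y) S.cb2.continuousOn
  have LR : LocAC R R1 := LocAC.of_hasDerivAt (fun y hy => hC.dR y hy.le) hC.cR1
  have LX : LocAC (fun y => S.q T y / y) (fun y => S.q1 T y / y - S.q T y / y / y) := by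
    refine LocAC.of_hasDerivAt (fun y hy => ?_) ?_
    · refine ((S.dq T hy).div (hasDerivAt_id y) hy.ne').congr_deriv ?_
      simp only [id]; field_simp
    · have h0 : ∀ y ∈ Ioi (0 : ℝ), id y ≠ 0 := fun y hy => ne_of_gt hy
      exact ((S.cq1 T).div continuousOn_id h0).sub ((S.cq_div T).div continuousOn_id h0)
  have Lg : LocAC (fun y => y * r y ^ 2) (fun y => r y ^ 2 * (1 - 2 * (k * y * r y))) := by
    refine LocAC.of_hasDerivAt (fun y hy => ?_) (by fun_prop)
    have h0 := hrpos y hy.le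
    have h1 : HasDerivAt (fun y => 1 + k * y) k y := by
      simpa using ((hasDerivAt_id y).const_mul k).const_add 1
    have h2 : HasDerivAt r (-k / (1 + k * y) ^ 2) y := by
      have h2 := h1.inv h0.ne'
      refine h2.congr_of_eventuallyEq (Eventually.of_forall fun z => ?_)
      simp [hr]
    refine ((hasDerivAt_id y).mul (h2.pow 2)).congr_deriv ?_
    have h3 : k * y * r y = 1 - r y := by simp only [hr]; field_simp; ring
    have h4 : y * (-k / (1 + k * y) ^ 2) = -(k * y * r y) * r y := by
      simp only [hr]; field_simp
    simp only [id, Pi.pow_apply]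
    linear_combination (2 * r y) * h4
  set Φ : ℝ → ℝ := fun y => T.v3 y * S.q T y - T.v2 y * S.q1 T y + S.a1 y * (S.q1 T y * S.q1 T y)
    - S.a y * (S.a y * (S.q1 T y * S.q T y)) - (S.b y * T.v2 y - S.b1 y * T.v1 y) * S.q T y
    + 1 / 2 * (S.a y * (S.b y * (S.q1 T y * S.q1 T y)))
    + 8 * (R y * (S.q T y * (S.q T y / y)))
    - 164 * (R y * ((y * r y ^ 2) * (S.q1 T y * S.q1 T y))) with hΦ
  have LΦ := (((((((T.ac.mul Lq).sub (Lv2.mul Lq1)).add (La1.mul (Lq1.mul Lq1))).sub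
    (La.mul (La.mul (Lq1.mul Lq)))).sub (((Lb.mul Lv2).sub (Lb1.mul Lv1)).mul Lq)).add
    ((La.mul (Lb.mul (Lq1.mul Lq1))).const_mul (1 / 2))).add
    ((LR.mul (Lq.mul LX)).const_mul 8)).sub ((LR.mul (Lg.mul (Lq1.mul Lq1))).const_mul 164)
  set I0 : ℝ → ℝ := fun y => S.a y * S.q2 T y ^ 2 + S.q T y * (S.a2 y * S.q2 T y)
    - S.a2 y * (S.q1 T y * S.q1 T y) + S.a y * (S.a y * (S.q1 T y * S.q1 T y))
    + 3 / 2 * ((S.b y * S.a1 y - S.a y * S.b1 y) * (S.q1 T y * S.q1 T y))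
    + (S.b y * S.a2 y - S.a1 y * S.b1 y + S.a y * S.f y) * (S.q T y * S.q1 T y)
    + (S.a y * S.e y + S.f y * S.a1 y) * (S.q T y * S.q T y) with hI0
  set J : ℝ → ℝ := fun y => 8 * (y * R1 y * (S.q T y / y * (S.q T y / y))
      + 2 * (R y * (S.q T y / y * S.q1 T y)) - R y * (S.q T y / y * (S.q T y / y)))
    - 164 * (y * R1 y * (r y * (r y * (S.q1 T y * S.q1 T y)))
      + R y * (r y * (r y * (S.q1 T y * S.q1 T y))) - 2 * (R y * (r y * (r y * ((1 - r y) *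
        (S.q1 T y * S.q1 T y)))))
      + 2 * (r y * S.q1 T y * (R y * (y * r y) * S.q2 T y))) with hJ
  have LΦ' : LocAC Φ (fun y => S.op T y * S.q T y - I0 y + J y) := by
    refine LΦ.congr_deriv (ae_of_pos fun y hy => ?_)
    simp only [hI0, hJ, op]
    rw [S.v2_eq T hy, S.v1_eq T hy, S.v_eq T hy]
    rw [hqe y hy]
    generalize S.q T y / y = X
    have : y * X / y = X := by field_simp
    rw [this]
    simp only [hr]
    field_simp
    ring
  clear LΦ
  have hq2 : ∀ y, 0 < y → S.a y * S.q2 T y ^ 2 ≤ μ y ^ 2 := fun y hy => by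
    have h := pow_le_pow_left₀ (abs_nonneg _) (S.le_moduli w T y).2.2.1 2
    rw [sq_abs, mul_pow, mul_pow, Real.sq_sqrt (S.a_pos hy).le] at h
    exact (le_mul_of_one_le_right (mul_nonneg (S.a_pos hy).le (sq_nonneg _))
      (one_le_pow₀ (hB.one_le hy))).trans h
  have mq2 := (S.cq2 T).aesm
  have ma2 := S.ca2.aestronglyMeasurable (μ := halfLine)
  have inv : ∀ {f : ℝ → ℝ}, Continuous f → (∀ y, 0 < y → |f y| * w y ≤ M) →
      Dom f fun y => y⁻¹ := fun hf h => ⟨hf.aestronglyMeasurable, M, hM, fun y hy => by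
    rw [← div_eq_mul_inv, le_div_iff₀ hy]
    refine le_trans ?_ (h y hy)
    gcongr; linarith [hB.w_ge y hy]⟩
  have one : ∀ {f : ℝ → ℝ}, AEStronglyMeasurable f halfLine → ∀ C, (∀ y, 0 < y → |f y| ≤ C) →
      Dom f fun _ => 1 := fun hf C h =>
    ⟨hf, C, (abs_nonneg _).trans (h 1 one_pos), fun y hy => (h y hy).trans (mul_one C).ge⟩
  have da := hB.dom_a
  have db := hB.dom_b
  have db1 := hB.dom_b1
  have da1 := one S.ca1.aestronglyMeasurable M fun y hy => hB.a1_le_const hy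
  have hw2 : ∀ {c : ℝ} {y : ℝ}, 0 < y → |c| * (w y * (1 + y)) ≤ M → |c| * w y ≤ M := fun hy h =>
    le_mul_weight (by have := hB.w_pos hy; positivity) (by linarith) ((mul_assoc _ _ _).trans_le h)
  have da2 := one ma2 M fun y hy =>
    le_mul_weight (abs_nonneg _) (hB.one_le hy) (hw2 hy (hB.a2_le y hy))
  have ia1 := inv S.ca1 hB.a1_le
  have ia2 := inv S.ca2 fun y hy => hw2 hy (hB.a2_le y hy)
  have ib1 := inv S.cb1 hB.b1_le
  have jf := inv S.cf hB.f_le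
  have je : Dom S.e fun y => y⁻¹ * y⁻¹ := ⟨S.ce.aestronglyMeasurable, M, hM, fun y hy => by
    simp only []
    rw [← mul_inv, ← div_eq_mul_inv, le_div_iff₀ (by positivity)]
    refine le_trans ?_ (hB.e_le y hy)
    have := hB.w_ge y hy
    gcongr <;> linarith⟩
  have dR : Dom R fun _ => 1 := one cR.aesm B fun y hy => by
    rw [abs_of_nonneg (hδ.le.trans (hC.R_ge y hy))]; exact hC.R_le y hy
  have dR1 : Dom (fun y => y * R1 y) fun _ => 1 :=
    one (continuousOn_id.mul hC.cR1).aesm B fun y hy => by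
      rw [abs_mul, abs_of_pos hy, abs_of_nonpos (hC.R1_nonpos y hy)]
      linarith [hC.R1_le y hy]
  have r1 : ∀ y, 0 < y → 0 < r y ∧ r y ≤ 1 := fun y hy => by
    have h0 := mul_pos hk hy
    exact ⟨by simp only [hr]; positivity, by
      simp only [hr]; rw [div_le_one (by linarith)]; linarith⟩
  have dr := one cr.aesm 1 fun y hy => by rw [abs_of_pos (r1 y hy).1]; exact (r1 y hy).2
  have dr' := one (f := fun y => 1 - r y) (continuousOn_const.sub cr).aesm 1 fun y hy => by
    obtain ⟨h1, h2⟩ := r1 y hy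
    rw [abs_le]; constructor <;> linarith
  have dyr := one (f := fun y => y * r y ^ 2) (continuousOn_id.mul (cr.pow 2)).aesm (1 / k)
    fun y hy => by
      have h0 := mul_pos hk hy
      have h1 := (r1 y hy).1
      rw [abs_of_nonneg (by positivity)]
      simp only [hr]
      rw [one_div, inv_pow, ← div_eq_mul_inv, div_le_div_iff₀ (by positivity) hk]
      nlinarith
  have dp2 : Dom (fun y => R y * (y * r y) * S.q2 T y) μ :=
    ⟨(cR.mul (continuousOn_id.mul cr)).aesm.mul mq2, 1 + B, by positivity, fun y hy => by
      refine abs_le_of_sq_le hB0 (hm0 y) ?_ (hq2 y hy)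
      have h0 : 0 ≤ R y := hδ.le.trans (hC.R_ge y hy)
      have h1 := mul_le_right (hC.large' y hy) (sq_nonneg (S.q2 T y))
      have h2 := mul_le_mul (hC.R_le y hy) h1 (by positivity) hB0
      have h3 : 0 ≤ (R y * (y * r y) * S.q2 T y) ^ 2 := sq_nonneg _
      simp only [hr] at h2 h3 ⊢
      linarith⟩
  have dap2 : Dom (fun y => S.a2 y * S.q2 T y) fun y => μ y / y :=
    .of_weight (w := fun y => y) (ma2.mul mq2) (by positivity : 0 ≤ 1 + B) (fun y hy => by
      refine abs_le_of_sq_le hB0 (hm0 y) ?_ (hq2 y hy)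
      have h1 := mul_le_right (hC.a2_sq_le y hy) (sq_nonneg (S.q2 T y))
      have h2 := mul_le_right (hC.R_le y hy)
        (mul_nonneg (S.a_pos hy).le (sq_nonneg (S.q2 T y)))
      linarith) fun _ => id
  have dap : Dom (fun y => S.a y * S.q2 T y ^ 2) fun y => μ y * μ y :=
    ⟨(S.ca.continuousOn.mul ((S.cq2 T).pow 2)).aesm, 1, zero_le_one, fun y hy => by
      have := S.a_pos hy
      rw [abs_of_nonneg (by positivity), one_mul]; exact (hq2 y hy).trans_eq (pow_two _)⟩
  have iI0 : IntegrableOn I0 (Ioi 0) := hF.integrable_of_dom ((((((dap.add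
    ((dq.mul dap2).mono fun y hy => le_of_eq (by field_simp))).sub (da2.smul (dp.mul dp))).add
    (da.smul (da.smul (dp.mul dp)))).add
    (((db.smul da1).sub (da.smul db1)).smul (dp.mul dp) |>.const_mul (3 / 2))).add
    (((((db.smul ia2).sub (da1.smul ib1)).add (da.smul jf)).mul (dq.mul dp)).mono
      fun y hy => le_of_eq (by field_simp))).add
    (((da.smul je).add (jf.mul ia1)).mul (dq.mul dq) |>.mono
      fun y hy => le_of_eq (by field_simp))) fun y _ => (pow_two _).ge
  have iJ : IntegrableOn J (Ioi 0) := hF.integrable_of_dom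
    (((((dR1.smul (dX.mul dX)).add ((dR.smul (dX.mul dp)).const_mul 2)).sub
      (dR.smul (dX.mul dX))).const_mul 8).sub
    ((((dR1.smul (dr.smul (dr.smul (dp.mul dp)))).add (dR.smul (dr.smul (dr.smul (dp.mul dp))))).sub
      ((dR.smul (dr.smul (dr.smul (dr'.smul (dp.mul dp))))).const_mul 2)).add
      (((dr.smul dp).mul dp2).const_mul 2) |>.const_mul 164)) fun y _ => (pow_two _).ge
  have iΦ' : IntegrableOn (fun y => S.op T y * S.q T y - I0 y + J y) (Ioi 0) := (iop.sub iI0).add iJ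
  have iΦ : IntegrableOn (fun y => Φ y / (1 + y)) (Ioi 0) := by
    have w1 : ∀ y, 0 < y → μ y / w y ≤ μ y := fun y hy => div_le_self (hm0 y) (hB.one_le hy)
    have dv2 := (hB.dom_v2 T).mono w1
    have k1 : ∀ y, 0 < y → μ y * μ y ≤ (1 + y) * μ y ^ 2 := fun y hy => by
      have := mul_nonneg hy.le (sq_nonneg (μ y)); linarith
    have k2 : ∀ y, 0 < y → μ y * (y * μ y) ≤ (1 + y) * μ y ^ 2 := fun y hy => by
      have := sq_nonneg (μ y); linarith
    have dpp := (dp.mul dp).mono k1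
    have dΦ : Dom Φ fun y => (1 + y) * μ y ^ 2 :=
      ((((((((((hB.dom_v3 T).mono w1).mul dq).mono k2).sub ((dv2.mul dp).mono k1)).add
      (da1.smul dpp)).sub (da.smul (da.smul ((dp.mul dq).mono k2)))).sub
      ((((db.smul dv2).sub (db1.smul (hB.dom_v1 T))).mul dq).mono k2)).add
      ((da.smul (db.smul dpp)).const_mul (1 / 2))).add
      ((dR.smul ((dq.mul dX).mono fun y hy =>
        (mul_comm _ _).trans_le (k2 y hy))).const_mul 8)).sub
      ((dR.smul (dyr.smul dpp)).const_mul 164)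
    have di : Dom (fun y : ℝ => (1 + y)⁻¹) fun y => (1 + y)⁻¹ :=
      ⟨by fun_prop, 1, zero_le_one, fun y hy => by rw [abs_of_nonneg (by positivity), one_mul]⟩
    exact hF.integrable_of_dom (dΦ.mul di) fun y hy => le_of_eq (by field_simp; rfl)
  have tΦ : Tendsto Φ (𝓝[>] 0) (𝓝 (-(S.a1 0 * S.l T ^ 2))) := by
    have h1 := tendsto_wall T.c1; have h2 := tendsto_wall T.c2; have h3 := tendsto_wall T.c3
    have ha := tendsto_wall S.ca.continuousOn; have ha1 := tendsto_wall S.ca1.continuousOn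
    have hb := tendsto_wall S.cb.continuousOn; have hb1 := tendsto_wall S.cb1.continuousOn
    have hR := tendsto_wall (g := R) fun y hy => (hC.dR y hy).continuousAt.continuousWithinAt
    have hrr := tendsto_wall (g := fun y => y * r y ^ 2) (by
      refine continuousOn_id.mul (ContinuousOn.pow (ContinuousOn.div continuousOn_const
        (by fun_prop) fun y hy => (hrpos y hy).ne') 2))
    have hq := S.tendsto_q T; have hq1 := S.tendsto_q1 T; have hX := S.tendsto_q_div T
    have hs : S.a1 0 ≠ 0 := (S.c_pos.trans_le S.slope_ge).ne'
    have hlv : T.v2 0 = 2 * S.a1 0 * S.l T := by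
      rw [Coefficients.l]; field_simp
    convert! (((((((h3.mul hq).sub (h2.mul hq1)).add (ha1.mul (hq1.mul hq1))).sub
      (ha.mul (ha.mul (hq1.mul hq)))).sub (((hb.mul h2).sub (hb1.mul h1)).mul hq)).add
      ((ha.mul (hb.mul (hq1.mul hq1))).const_mul (1 / 2))).add
      ((hR.mul (hq.mul hX)).const_mul 8)).sub ((hR.mul (hrr.mul (hq1.mul hq1))).const_mul 164)
      using 2
    rw [hlv, S.a_zero]; ring
  have := LΦ'.le_integral tΦ iΦ' iΦ igood iop
    (ae_of_pos fun y hy => ?_)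
  · linarith
  · have hy : 0 < y := hy
    have := coercive_pointwise (X := S.q T y / y) (p := S.q1 T y) (p2 := S.q2 T y) (S.a_pos hy) hy
      hk hδ rfl (hC.R_ge y hy) (hC.R1_nonpos y hy) (hC.R1_slow y hy) (hC.a2_le y hy)
      (hC.a2_sq_le y hy) (hC.ab_le y hy) (hC.ab1_le y hy) (hC.e_le y hy) (hC.f_le y hy)
      (hC.large y hy) (hC.large' y hy)
    rw [← hqe y hy, show k * y * (1 / (1 + k * y)) = 1 - 1 / (1 + k * y) by field_simp; ring] at this
    simp only [good, hI0, hJ, hr]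
    linarith

end Coefficients

section weight

variable (m : ℕ) (θ : ℝ)

/-- The square of the weight used to test the equation: `w₀²` times `(y / (1 + y))²`. -/
def om (y : ℝ) : ℝ := y ^ 2 * (1 + θ * y) ^ (2 * m)

/-- The derivative of `om`. -/
def om1 (y : ℝ) : ℝ :=
  2 * y * (1 + θ * y) ^ (2 * m) + y ^ 2 * ((2 * m : ℕ) * (1 + θ * y) ^ (2 * m - 1) * θ)

theorem hasDerivAt_om (y : ℝ) : HasDerivAt (om m θ) (om1 m θ y) y := by
  have h1 : HasDerivAt (fun y => 1 + θ * y) θ y := by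
    simpa using ((hasDerivAt_id y).const_mul θ).const_add 1
  have h2 : HasDerivAt (fun y : ℝ => y ^ 2) (2 * y) y := by simpa using hasDerivAt_pow 2 y
  exact h2.mul (h1.pow (2 * m))

variable {m θ}

theorem continuous_om1 : Continuous (om1 m θ) := by unfold om1; fun_prop

theorem om_nonneg (y : ℝ) : 0 ≤ om m θ y := by
  unfold om; rw [pow_mul]; positivity

theorem abs_om1_le (hθ : 0 ≤ θ) {y : ℝ} (hy : 0 < y) : y * |om1 m θ y| ≤ (2 * m + 2) * om m θ y := by
  have h0 : 0 < 1 + θ * y := by positivity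
  have h1 : 0 ≤ om1 m θ y := by unfold om1; positivity
  rw [abs_of_nonneg h1]
  unfold om1 om
  rcases Nat.eq_zero_or_pos m with hm | hm
  · subst hm; simp; nlinarith
  · obtain ⟨j, hj⟩ : ∃ j, 2 * m = j + 1 := ⟨2 * m - 1, by omega⟩
    have hp : (1 + θ * y) ^ (2 * m) = (1 + θ * y) ^ j * (1 + θ * y) := by rw [hj, pow_succ]
    have hjm : 2 * m - 1 = j := by omega
    rw [hjm, hp]
    push_cast
    have : 0 ≤ (1 + θ * y) ^ j := by positivity
    have h2 : θ * y ≤ 1 + θ * y := by linarith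
    have h3 : y ^ 2 * (2 * m * (1 + θ * y) ^ j) * (θ * y) ≤
        y ^ 2 * (2 * m * (1 + θ * y) ^ j) * (1 + θ * y) := by gcongr
    linarith

end weight

theorem w0_sq (m : ℕ) (ε y : ℝ) : w0 m ε y ^ 2 = (1 + y) ^ 2 * (1 + √ε * y) ^ (2 * m) := by
  unfold w0; rw [mul_pow, ← pow_mul, mul_comm m 2]

theorem om_le_w0_sq (m : ℕ) (ε : ℝ) {y : ℝ} (hy : 0 < y) : om m (√ε) y ≤ w0 m ε y ^ 2 := by
  rw [w0_sq]; unfold om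
  have : 0 ≤ √ε := Real.sqrt_nonneg _
  gcongr; linarith

theorem w0_sq_le_om (m : ℕ) (ε : ℝ) {y : ℝ} (hy : 1 ≤ y) :
    w0 m ε y ^ 2 ≤ 4 * om m (√ε) y := by
  rw [w0_sq]; unfold om
  have h : 0 ≤ √ε := Real.sqrt_nonneg _
  rw [← mul_assoc]
  gcongr
  nlinarith

theorem w0_sq_le_of_le_one (m : ℕ) {ε : ℝ} (hε : ε ≤ 1) {y : ℝ} (hy : 0 < y) (hy1 : y ≤ 1) :
    w0 m ε y ^ 2 ≤ 4 * 2 ^ (2 * m) := by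
  rw [w0_sq]
  have h : 0 ≤ √ε := Real.sqrt_nonneg _
  have h1 : √ε ≤ 1 := Real.sqrt_le_one.2 hε
  have h2 : √ε * y ≤ 1 := mul_le_one₀ h1 hy.le hy1
  have h3 : (1 + √ε * y) ^ (2 * m) ≤ 2 ^ (2 * m) := pow_le_pow_left₀ (by positivity) (by linarith) _
  have h4 : (1 + y) ^ 2 ≤ 4 := by nlinarith
  gcongr

/-- The commutator terms are absorbed, up to a bounded term. -/
theorem exists_commutator_bound (m : ℕ) {c M : ℝ} (hc : 0 < c) (hM : 0 ≤ M) :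
    ∃ C : ℝ, 0 ≤ C ∧ ∀ θ : ℝ, 0 ≤ θ → θ ≤ 1 → ∀ y a : ℝ, 0 < y → c * y ≤ a * (1 + y) →
      1 / 2 * (2 * m + 2) ^ 2 * (om m θ y / y ^ 2) + (m + 2) * M * (om m θ y / y) ≤
        1 / 4 * (a * om m θ y) + C := by
  set K : ℝ := 1 / 2 * (2 * m + 2) ^ 2 + (m + 2) * M with hK
  have hK0 : 0 ≤ K := by positivity
  set R : ℝ := max 1 (8 * K / c) with hR
  have hR1 : 1 ≤ R := le_max_left _ _
  refine ⟨K * (R * (1 + R) ^ (2 * m)), by positivity, fun θ hθ hθ1 y a hy ha => ?_⟩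
  have ha0 : 0 ≤ a := by
    have : 0 < a * (1 + y) := lt_of_lt_of_le (mul_pos hc hy) ha
    exact (pos_of_mul_pos_left this (by linarith)).le
  have hom := om_nonneg (m := m) (θ := θ) y
  rcases le_total R y with h | h
  · have hy1 : 1 ≤ y := hR1.trans h
    have h1 : om m θ y / y ^ 2 ≤ om m θ y / y := by
      apply div_le_div_of_nonneg_left hom hy; nlinarith
    have h2 : K / y ≤ c / 8 := by
      rw [div_le_div_iff₀ hy (by norm_num)]
      have : 8 * K / c ≤ y := (le_max_right _ _).trans h
      rw [div_le_iff₀ hc] at this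
      linarith
    have h3 : c / 2 ≤ a := by nlinarith
    have h4 : K * (om m θ y / y) ≤ 1 / 4 * (a * om m θ y) := by
      rw [show K * (om m θ y / y) = K / y * om m θ y by ring]
      nlinarith
    have h5 : 1 / 2 * (2 * m + 2) ^ 2 * (om m θ y / y ^ 2) ≤
        1 / 2 * (2 * m + 2) ^ 2 * (om m θ y / y) := by gcongr
    have h6 : 0 ≤ K * (R * (1 + R) ^ (2 * m)) := by positivity
    have h7 : K * (om m θ y / y) = 1 / 2 * (2 * m + 2) ^ 2 * (om m θ y / y) +
      (m + 2) * M * (om m θ y / y) := by rw [hK]; ring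
    linarith
  · have h0 : (1 + θ * y) ^ (2 * m) ≤ (1 + R) ^ (2 * m) := by
      apply pow_le_pow_left₀ (by positivity)
      nlinarith
    have h1 : om m θ y / y ^ 2 ≤ R * (1 + R) ^ (2 * m) := by
      unfold om
      rw [mul_div_cancel_left₀ _ (by positivity)]
      refine h0.trans (le_mul_of_one_le_left (by positivity) hR1)
    have h2 : om m θ y / y ≤ R * (1 + R) ^ (2 * m) := by
      unfold om
      rw [show y ^ 2 * (1 + θ * y) ^ (2 * m) / y = y * (1 + θ * y) ^ (2 * m) by field_simp]
      gcongr
    have h3 : 0 ≤ 1 / 4 * (a * om m θ y) := by positivity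
    have h4 : 1 / 2 * (2 * m + 2) ^ 2 * (om m θ y / y ^ 2) ≤
        1 / 2 * (2 * m + 2) ^ 2 * (R * (1 + R) ^ (2 * m)) := by gcongr
    have h5 : (m + 2) * M * (om m θ y / y) ≤ (m + 2) * M * (R * (1 + R) ^ (2 * m)) := by gcongr
    rw [hK]; linarith

theorem three_sq_le (x y z : ℝ) : (x + y + z) ^ 2 ≤ 3 * (x ^ 2 + y ^ 2 + z ^ 2) := by
  nlinarith [sq_nonneg (x - y), sq_nonneg (x - z), sq_nonneg (y - z)]

/-- Pointwise form of the weighted estimate. -/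
theorem weighted_pointwise {a b b1 g g1 g2 G W W1 w y c M C n : ℝ} (hy : 0 < y) (ha : 0 < a)
    (hc : 0 < c) (hM : 0 ≤ M) (hG : G = g2 - b * g1 - a * g) (hW : 0 < W)
    (hW1 : y * |W1| ≤ n * W) (hWw : c * W ≤ a * w ^ 2) (hb : |b| ≤ M) (hb1 : |b1| * y ≤ M)
    (hC : 1 / 2 * n ^ 2 * (W / y ^ 2) + (n + 2) / 2 * M * (W / y) ≤ 1 / 4 * (a * W) + C) :
    1 / 2 * (g1 ^ 2 * W) + 1 / 2 * (a * W * g ^ 2)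
      - (g1 * g1 * W + g * g2 * W + g * g1 * W1 - 1 / 2 * (b1 * W + b * W1) * g ^ 2
        - b * W * g * g1) ≤ (G * w) ^ 2 / c + C * g ^ 2 := by
  have e1 : -(G * g * W) ≤ 1 / 4 * (a * W * g ^ 2) + (G * w) ^ 2 / c := by
    have k1 : (G ^ 2 * W) / a ≤ (G * w) ^ 2 / c := by
      rw [div_le_div_iff₀ ha hc]
      have := mul_le_left hWw (sq_nonneg G)
      nlinarith
    have k2 : -(G * g * W) ≤ 1 / 4 * (a * W * g ^ 2) + G ^ 2 * W / a := by
      rw [← sub_nonneg]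
      have : 1 / 4 * (a * W * g ^ 2) + G ^ 2 * W / a - -(G * g * W) = W / a * (a * g / 2 + G) ^ 2 := by
        field_simp; ring
      rw [this]; positivity
    linarith
  have hW1' : |W1| ≤ n * W / y := by rw [le_div_iff₀ hy]; linarith
  have e2 : -(g * g1 * W1) ≤ 1 / 2 * (g1 ^ 2 * W) + 1 / 2 * n ^ 2 * (W / y ^ 2) * g ^ 2 := by
    have k1 : -(g * g1 * W1) ≤ |g| * |g1| * |W1| := by
      rw [← abs_mul, ← abs_mul]; exact neg_le_abs _
    have k2 : |g| * |g1| * |W1| ≤ |g| * |g1| * (n * W / y) := by gcongr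
    have k3 : |g| * |g1| * (n * W / y) ≤
        1 / 2 * (|g1| ^ 2 * W) + 1 / 2 * n ^ 2 * (W / y ^ 2) * |g| ^ 2 := by
      rw [← sub_nonneg]
      have : 1 / 2 * (|g1| ^ 2 * W) + 1 / 2 * n ^ 2 * (W / y ^ 2) * |g| ^ 2 -
          |g| * |g1| * (n * W / y) = 1 / 2 * W * (|g1| - n / y * |g|) ^ 2 := by
        field_simp; ring
      rw [this]; positivity
    rw [sq_abs, sq_abs] at k3
    linarith
  have e3 : 1 / 2 * (b1 * W + b * W1) ≤ (n + 2) / 2 * M * (W / y) := by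
    have k1 : b1 * W ≤ M * (W / y) := by
      have : b1 ≤ M / y := by
        rw [le_div_iff₀ hy]
        exact (mul_le_right (le_abs_self b1) hy.le).trans hb1
      have := mul_le_right this hW.le
      calc b1 * W ≤ M / y * W := this
        _ = _ := by ring
    have k2 : b * W1 ≤ M * (n * W / y) :=
      (le_abs_self _).trans (by rw [abs_mul]; exact mul_le_mul hb hW1' (abs_nonneg _) hM)
    have k3 : 0 ≤ M * (W / y) := by positivity
    have k4 : M * (n * W / y) = n * (M * (W / y)) := by ring
    nlinarith
  have e4 := mul_le_right e3 (sq_nonneg g)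
  have e5 := mul_le_right hC (sq_nonneg g)
  rw [hG] at e1 ⊢
  linarith

theorem integral_comb {A B D : ℝ → ℝ} (hA : Integrable A halfLine) (hB : Integrable B halfLine)
    (hD : Integrable D halfLine) (α β γ : ℝ) :
    Integrable (fun y => α * A y + β * B y + γ * D y) halfLine ∧
    ∫ y in Ioi 0, (α * A y + β * B y + γ * D y) =
      α * (∫ y in Ioi 0, A y) + β * (∫ y in Ioi 0, B y) + γ * ∫ y in Ioi 0, D y := by
  have h1 := hA.const_mul α
  have h2 := hB.const_mul β
  have h3 := hD.const_mul γ
  refine ⟨(h1.add h2).add h3, ?_⟩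
  have e1 := integral_add (f := fun y => α * A y + β * B y) (h1.add h2) h3
  have e2 := integral_add h1 h2
  rw [e1, e2, integral_const_mul, integral_const_mul, integral_const_mul]

theorem integral_le_comb {f A B D : ℝ → ℝ} (hf : Integrable f halfLine)
    (hA : Integrable A halfLine) (hB : Integrable B halfLine)
    (hD : Integrable D halfLine) (α β γ : ℝ)
    (h : ∀ y, 0 < y → f y ≤ α * A y + β * B y + γ * D y) :
    ∫ y in Ioi 0, f y ≤
      α * (∫ y in Ioi 0, A y) + β * (∫ y in Ioi 0, B y) + γ * ∫ y in Ioi 0, D y := by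
  obtain ⟨h1, h2⟩ := integral_comb hA hB hD α β γ
  rw [← h2]
  exact integral_mono_ae hf h1 (ae_of_pos h)

theorem LocAC.integral_le_comb {Φ Φ' f A B D : ℝ → ℝ} (hΦ : LocAC Φ Φ')
    (h0 : Tendsto Φ (𝓝[>] 0) (𝓝 0)) (hi' : IntegrableOn Φ' (Ioi 0))
    (hi : IntegrableOn (fun y => Φ y / (1 + y)) (Ioi 0)) (hf : Integrable f halfLine)
    (hA : Integrable A halfLine) (hB : Integrable B halfLine)
    (hD : Integrable D halfLine) (α β γ : ℝ)
    (h : ∀ y, 0 < y → f y - Φ' y ≤ α * A y + β * B y + γ * D y) :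
    ∫ y in Ioi 0, f y ≤
      α * (∫ y in Ioi 0, A y) + β * (∫ y in Ioi 0, B y) + γ * ∫ y in Ioi 0, D y := by
  obtain ⟨h1, h2⟩ := integral_comb hA hB hD α β γ
  rw [← h2]
  have hneg := hΦ.const_mul (-1)
  have := hneg.le_integral (by simpa using h0.const_mul (-1)) (hi'.const_mul (-1))
    ((hi.const_mul (-1)).congr (Eventually.of_forall fun y => by simp only []; ring)) hf h1
    (ae_of_pos fun y hy => by linarith [h y hy])
  linarith

namespace Coefficients

namespace Bounds

variable {S : Coefficients} {w : ℝ → ℝ} {M : ℝ} (hB : S.Bounds w M)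
include hB

theorem v2_sq_le (T : Trial) {y : ℝ} (hy : 0 < y) :
    T.v2 y ^ 2 ≤ 12 * (1 + M) ^ 2 * S.density T y := by
  have hw := hB.w_pos hy
  have hw1 : 1 ≤ w y := by linarith [hB.w_ge y hy]
  have hM := hB.M_nonneg
  have ha := S.a_pos hy
  have h := hB.v2_le T hy
  rw [abs_mul, abs_mul _ (w y), abs_of_pos hw] at h
  have h1 : |T.v2 y| ≤ (1 + M) * (|√(S.a y) * S.q2 T y| + 2 * |S.q1 T y| + |S.q T y / y|) := by
    have e1 : |S.q1 T y| ≤ |S.q1 T y| * w y := le_mul_of_one_le_right (abs_nonneg _) hw1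
    have e2 : |S.q T y / y| ≤ |S.q T y / y| * w y := le_mul_of_one_le_right (abs_nonneg _) hw1
    have e3 : |T.v2 y| * w y ≤
        (1 + M) * (|√(S.a y) * S.q2 T y| + 2 * |S.q1 T y| + |S.q T y / y|) * w y := by
      have := mul_le_left e1 hM
      have := mul_le_left e2 hM
      have := abs_nonneg (S.q1 T y)
      have := abs_nonneg (S.q T y / y)
      nlinarith
    exact le_of_mul_le_mul_right e3 hw
  have h2 := pow_le_pow_left₀ (abs_nonneg _) h1 2
  rw [sq_abs, mul_pow] at h2
  have h3 := three_sq_le |√(S.a y) * S.q2 T y| (2 * |S.q1 T y|) |S.q T y / y|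
  simp only [mul_pow, sq_abs, Real.sq_sqrt ha.le] at h3
  have h4 : (|√(S.a y) * S.q2 T y| + 2 * |S.q1 T y| + |S.q T y / y|) ^ 2 ≤
      12 * S.density T y := by
    unfold density
    have := sq_nonneg (S.q T y / y)
    have : 0 ≤ S.a y * S.q2 T y ^ 2 := by positivity
    linarith
  have := mul_le_left h4 (sq_nonneg (1 + M))
  linarith

theorem principal_sq_le (T : Trial) {y : ℝ} (hy : 0 < y) :
    ((T.v4 y - S.b y * T.v3 y - S.a y * T.v2 y) * w y) ^ 2 ≤
      48 * (1 + M) ^ 4 * ((S.op T y * w y) ^ 2 + S.density T y) := by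
  have hM := hB.M_nonneg
  have h0 := hB.lower_le T hy
  have h1 : (T.v4 y - S.b y * T.v3 y - S.a y * T.v2 y) * w y = S.op T y * w y -
      (S.a2 y * T.v y + T.v1 y * S.b2 y + S.e y * T.v y + S.f y * T.v1 y) * w y := by
    unfold op; ring
  have h2 : |(T.v4 y - S.b y * T.v3 y - S.a y * T.v2 y) * w y| ≤
      |S.op T y * w y| + 4 * M ^ 2 * |S.q T y / y| + 2 * M ^ 2 * |S.q1 T y| := by
    rw [h1]
    refine (abs_sub_le_add le_rfl h0).trans (by linarith)
  have h3 := pow_le_pow_left₀ (abs_nonneg _) h2 2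
  have h4 := three_sq_le |S.op T y * w y| (4 * M ^ 2 * |S.q T y / y|) (2 * M ^ 2 * |S.q1 T y|)
  rw [sq_abs, mul_pow (4 * M ^ 2), mul_pow (2 * M ^ 2), sq_abs, sq_abs] at h4
  rw [sq_abs] at h3
  have h5 : M ^ 4 ≤ (1 + M) ^ 4 := pow_le_pow_left₀ hM (by linarith) 4
  have h6 : 1 ≤ (1 + M) ^ 4 := one_le_pow₀ (by linarith)
  have h7 := (S.le_density T hy).2.2.2
  have h8 : M ^ 4 * ((S.q T y / y) ^ 2 + S.q1 T y ^ 2) ≤ (1 + M) ^ 4 * S.density T y := by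
    gcongr
  have h9 : (S.op T y * w y) ^ 2 ≤ (1 + M) ^ 4 * (S.op T y * w y) ^ 2 :=
    le_mul_of_one_le_left (sq_nonneg _) h6
  have h10 : 0 ≤ M ^ 4 * S.q1 T y ^ 2 := by positivity
  have h11 : 0 ≤ (S.op T y * w y) ^ 2 := sq_nonneg _
  have e1 : (4 * M ^ 2) ^ 2 = 16 * M ^ 4 := by ring
  have e2 : (2 * M ^ 2) ^ 2 = 4 * M ^ 4 := by ring
  rw [e1, e2] at h4
  linarith

theorem q2_sq_mul_le (T : Trial) {y : ℝ} (hy : 0 < y) :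
    S.a y * (√(S.a y) * S.q2 T y * w y) ^ 2 ≤
      3 * ((T.v2 y * w y) ^ 2 + 4 * M ^ 2 * S.density T y + M ^ 2 * S.density T y) := by
  have hw := hB.w_pos hy
  have ha := S.a_pos hy
  have h1 : S.a y * (√(S.a y) * S.q2 T y * w y) ^ 2 = (T.v2 y * w y + -(2 * (S.a1 y * w y) * S.q1 T y)
      + -((S.a2 y * (w y * y)) * (S.q T y / y))) ^ 2 := by
    rw [mul_pow, mul_pow, Real.sq_sqrt ha.le, S.v2_eq T hy]
    have : S.a2 y * (w y * y) * (S.q T y / y) = S.a2 y * w y * S.q T y := by field_simp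
    rw [this]; ring
  rw [h1]
  refine (three_sq_le _ _ _).trans ?_
  have e1 : (-(2 * (S.a1 y * w y) * S.q1 T y)) ^ 2 ≤ 4 * M ^ 2 * S.density T y := by
    have k1 : (S.a1 y * w y) ^ 2 ≤ M ^ 2 := by
      rw [← sq_abs, abs_mul, abs_of_pos hw]
      exact pow_le_pow_left₀ (by positivity) (hB.a1_le y hy) 2
    have := mul_le_mul k1 (S.le_density T hy).2.1 (sq_nonneg _) (sq_nonneg _)
    calc _ = 4 * ((S.a1 y * w y) ^ 2 * S.q1 T y ^ 2) := by ring
      _ ≤ _ := by linarith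
  have e2 : (-((S.a2 y * (w y * y)) * (S.q T y / y))) ^ 2 ≤ M ^ 2 * S.density T y := by
    have k1 : (S.a2 y * (w y * y)) ^ 2 ≤ M ^ 2 := by
      rw [← sq_abs, abs_mul, abs_of_pos (mul_pos hw hy)]
      refine pow_le_pow_left₀ (by positivity) (le_trans ?_ (hB.a2_le y hy)) 2
      gcongr; linarith
    rw [neg_sq, mul_pow]
    exact mul_le_mul k1 (S.le_density T hy).2.2.1 (sq_nonneg _) (sq_nonneg _)
  linarith

end Bounds

/-- The interior part of the weighted density. -/
def interior (S : Coefficients) (m : ℕ) (θ : ℝ) (T : Trial) (y : ℝ) : ℝ :=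
  T.v3 y ^ 2 * om m θ y + S.a y * om m θ y * T.v2 y ^ 2

theorem le_interior {S : Coefficients} {m : ℕ} {θ : ℝ} (T : Trial) {y : ℝ} (hy : 0 < y) :
    T.v3 y ^ 2 * om m θ y ≤ S.interior m θ T y ∧
      S.a y * om m θ y * T.v2 y ^ 2 ≤ S.interior m θ T y ∧ 0 ≤ S.interior m θ T y := by
  have h1 := S.a_pos hy
  have h2 := om_nonneg (m := m) (θ := θ) y
  have h3 : 0 ≤ S.a y * om m θ y * T.v2 y ^ 2 := by positivity
  have h4 : 0 ≤ T.v3 y ^ 2 * om m θ y := by positivity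
  unfold interior
  refine ⟨?_, ?_, ?_⟩ <;> linarith

theorem v4_sq_le {m : ℕ} {ε M : ℝ} {S : Coefficients} (hε1 : ε ≤ 1)
    (hB : S.Bounds (w0 m ε) M) (T : Trial) {y : ℝ} (hy : 0 < y) :
    (T.v4 y * w0 m ε y) ^ 2 ≤ 3 * (48 * (1 + M) ^ 4) * (S.op T y * w0 m ε y) ^ 2 +
      (3 * (48 * (1 + M) ^ 4) + 3 * M ^ 2 * (4 * 2 ^ (2 * m) : ℝ) * (12 * (1 + M) ^ 2)) * S.density T y + 3 * (M ^ 2 + 4 * M) * S.interior m (√ε) T y := by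
  have hM := hB.M_nonneg
  have ha := S.a_pos hy
  have h1 := three_sq_le ((T.v4 y - S.b y * T.v3 y - S.a y * T.v2 y) * w0 m ε y)
    (S.b y * T.v3 y * w0 m ε y) (S.a y * T.v2 y * w0 m ε y)
  have h2 : (T.v4 y - S.b y * T.v3 y - S.a y * T.v2 y) * w0 m ε y + S.b y * T.v3 y * w0 m ε y +
    S.a y * T.v2 y * w0 m ε y = T.v4 y * w0 m ε y := by ring
  rw [h2] at h1
  have h3 : (S.b y * T.v3 y * w0 m ε y) ^ 2 ≤ M ^ 2 * S.interior m (√ε) T y := by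
    have k1 : (S.b y * (1 + y)) ^ 2 ≤ (M * y) ^ 2 := by
      rw [← sq_abs, abs_mul, abs_of_pos (show 0 < 1 + y by linarith)]
      exact pow_le_pow_left₀ (by positivity) (hB.b_le y hy) 2
    have k2 : (S.b y * T.v3 y * w0 m ε y) ^ 2 =
        (S.b y * (1 + y)) ^ 2 * ((1 + √ε * y) ^ (2 * m) * T.v3 y ^ 2) := by
      rw [mul_pow _ (w0 m ε y), w0_sq]; ring
    have k3 : 0 ≤ (1 + √ε * y) ^ (2 * m) * T.v3 y ^ 2 := by positivity
    have k4 : (M * y) ^ 2 * ((1 + √ε * y) ^ (2 * m) * T.v3 y ^ 2) =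
        M ^ 2 * (T.v3 y ^ 2 * om m (√ε) y) := by unfold om; ring
    rw [k2]
    refine (mul_le_right k1 k3).trans ?_
    rw [k4]
    exact mul_le_left ((le_interior (S := S) (m := m) (θ := √ε) T hy).1) (sq_nonneg M)
  have h4 : (S.a y * T.v2 y * w0 m ε y) ^ 2 ≤ 4 * M * S.interior m (√ε) T y + M ^ 2 * (4 * 2 ^ (2 * m) : ℝ) * (12 * (1 + M) ^ 2) * S.density T y := by
    have t10 : 0 ≤ S.interior m (√ε) T y := (le_interior (S := S) (m := m) (θ := √ε) T hy).2.2
    rcases le_total 1 y with h | h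
    · have k1 : (S.a y * T.v2 y * w0 m ε y) ^ 2 = S.a y * (S.a y * T.v2 y ^ 2 * w0 m ε y ^ 2) := by ring
      have k2 : S.a y * T.v2 y ^ 2 * w0 m ε y ^ 2 ≤ 4 * S.interior m (√ε) T y := by
        have := mul_le_left (w0_sq_le_om m ε h) (show 0 ≤ S.a y * T.v2 y ^ 2 by positivity)
        have := (le_interior (S := S) (m := m) (θ := √ε) T hy).2.1
        linarith
      have k3 : 0 ≤ M ^ 2 * (4 * 2 ^ (2 * m) : ℝ) * (12 * (1 + M) ^ 2) * S.density T y :=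
        mul_nonneg (by positivity) (S.density_nonneg T hy)
      rw [k1]
      have := mul_le_mul (hB.a_le_const hy) k2 (by positivity) hM
      linarith
    · have k1 : (S.a y * T.v2 y * w0 m ε y) ^ 2 = S.a y ^ 2 * (w0 m ε y ^ 2 * T.v2 y ^ 2) := by ring
      have k2 : S.a y ^ 2 * (w0 m ε y ^ 2 * T.v2 y ^ 2) ≤ M ^ 2 * ((4 * 2 ^ (2 * m) : ℝ) * ((12 * (1 + M) ^ 2) * S.density T y)) := by
        have e1 := hB.a_le_const hy
        have e2 := w0_sq_le_of_le_one m hε1 hy h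
        have e3 := hB.v2_sq_le T hy
        gcongr
      rw [k1]
      have : 0 ≤ 4 * M * S.interior m (√ε) T y := by positivity
      linarith
  have h5 := hB.principal_sq_le T hy
  linarith

theorem v3_sq_le {m : ℕ} {ε M : ℝ} {S : Coefficients} (hε1 : ε ≤ 1)
    (hB : S.Bounds (w0 m ε) M) (T : Trial) {y : ℝ} (hy : 0 < y) :
    (T.v3 y * w0 m ε y) ^ 2 ≤ 4 * S.interior m (√ε) T y +
      8 * (4 * 2 ^ (2 * m) : ℝ) * (T.v3 y ^ 2 / (1 + y) ^ 3) + 0 * S.interior m (√ε) T y := by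
  have hM := hB.M_nonneg
  have t10 : 0 ≤ S.interior m (√ε) T y := (le_interior (S := S) (m := m) (θ := √ε) T hy).2.2
  have hz : 0 < 1 + y := by linarith
  rw [mul_pow]
  rcases le_total 1 y with h | h
  · have k1 := mul_le_left (w0_sq_le_om m ε h) (sq_nonneg (T.v3 y))
    have k2 := (le_interior (S := S) (m := m) (θ := √ε) T hy).1
    have k3 : 0 ≤ 8 * (4 * 2 ^ (2 * m) : ℝ) * (T.v3 y ^ 2 / (1 + y) ^ 3) := by positivity
    linarith
  · have k1 := mul_le_left (w0_sq_le_of_le_one m hε1 hy h) (sq_nonneg (T.v3 y))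
    have k2 : T.v3 y ^ 2 ≤ 8 * (T.v3 y ^ 2 / (1 + y) ^ 3) := by
      rw [mul_div_assoc', le_div_iff₀ (by positivity)]
      have : (1 + y) ^ 3 ≤ 2 ^ 3 := pow_le_pow_left₀ hz.le (by linarith) 3
      have := mul_le_left this (sq_nonneg (T.v3 y))
      linarith
    have k3 := mul_le_left k2 (show 0 ≤ (4 * 2 ^ (2 * m) : ℝ) by positivity)
    linarith

theorem q2_sq_le {m : ℕ} {ε M : ℝ} {S : Coefficients} (hε1 : ε ≤ 1) {c : ℝ} (hc : 0 < c) (hSc : S.c = c)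
    (hB : S.Bounds (w0 m ε) M) (T : Trial) {y : ℝ} (hy : 0 < y) :
    (√(S.a y) * S.q2 T y * w0 m ε y) ^ 2 ≤ (4 * 2 ^ (2 * m) : ℝ) * S.density T y +
      30 * M ^ 2 / c * S.density T y + 48 / c ^ 2 * S.interior m (√ε) T y := by
  have hM := hB.M_nonneg
  have ha := S.a_pos hy
  have t10 : 0 ≤ S.interior m (√ε) T y := (le_interior (S := S) (m := m) (θ := √ε) T hy).2.2
  have hd := S.density_nonneg T hy
  rcases le_total 1 y with h | h
  · have k0 : c / 2 ≤ S.a y := by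
      have := S.low y hy.le
      rw [hSc] at this
      nlinarith
    have k1 := hB.q2_sq_mul_le T hy
    have k2 : (T.v2 y * w0 m ε y) ^ 2 ≤ 8 / c * S.interior m (√ε) T y := by
      have e1 := mul_le_left (w0_sq_le_om m ε h) (sq_nonneg (T.v2 y))
      have e2 := (le_interior (S := S) (m := m) (θ := √ε) T hy).2.1
      have e3 := mul_le_right k0 (mul_nonneg (om_nonneg (m := m) (θ := √ε) y) (sq_nonneg (T.v2 y)))
      rw [div_mul_eq_mul_div, le_div_iff₀ hc, mul_pow]
      nlinarith
    have k3 := mul_le_right k0 (sq_nonneg (√(S.a y) * S.q2 T y * w0 m ε y))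
    have k4 : c / 2 * (√(S.a y) * S.q2 T y * w0 m ε y) ^ 2 ≤
        c / 2 * (30 * M ^ 2 / c * S.density T y + 48 / c ^ 2 * S.interior m (√ε) T y) := by
      have e : c / 2 * (30 * M ^ 2 / c * S.density T y + 48 / c ^ 2 * S.interior m (√ε) T y) =
        3 * (8 / c * S.interior m (√ε) T y + 4 * M ^ 2 * S.density T y + M ^ 2 * S.density T y) := by
        field_simp; ring
      rw [e]; linarith
    have k5 := le_of_mul_le_mul_left k4 (by positivity)
    have : 0 ≤ (4 * 2 ^ (2 * m) : ℝ) * S.density T y := by positivity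
    linarith
  · have k1 : (√(S.a y) * S.q2 T y * w0 m ε y) ^ 2 ≤ (4 * 2 ^ (2 * m) : ℝ) * S.density T y := by
      rw [mul_pow, mul_pow, Real.sq_sqrt ha.le, mul_comm (4 * 2 ^ (2 * m) : ℝ)]
      exact mul_le_mul (S.le_density T hy).1 (w0_sq_le_of_le_one m hε1 hy h) (sq_nonneg _) hd
    have : 0 ≤ 30 * M ^ 2 / c * S.density T y := by positivity
    have : 0 ≤ 48 / c ^ 2 * S.interior m (√ε) T y := by positivity
    linarith

theorem Finite.integrable_prod {S : Coefficients} {w : ℝ → ℝ} {T : Trial} (hF : S.Finite w T)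
    (hw : ∀ y, 0 < y → 0 < w y) {f : ℝ → ℝ}
    (h : Dom f fun y => w y ^ 2 * (S.moduli w T y / w y * (S.moduli w T y / w y))) :
    Integrable f halfLine :=
  hF.integrable_of_dom h fun y hy => by
    have := hw y hy
    field_simp; exact le_rfl

theorem near_wall_third_pointwise {y g1 g2 : ℝ} (hy : 0 < y) :
    1 / 2 * (g1 ^ 2 / (1 + y) ^ 3) - ((1 - y) / (1 + y) ^ 3 * (g1 * g1) +
      y / (1 + y) ^ 2 * (g2 * g1 + g1 * g2)) ≤ y ^ 2 * g1 ^ 2 + 4 * ((1 + y) ^ 2 * g2 ^ 2) := by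
  have k1 : 1 / 2 * (g1 ^ 2 / (1 + y) ^ 3) - ((1 - y) / (1 + y) ^ 3 * (g1 * g1) +
    y / (1 + y) ^ 2 * (g2 * g1 + g1 * g2)) =
    ((y - 1 / 2) * g1 ^ 2 - 2 * (y * (1 + y)) * (g1 * g2)) / (1 + y) ^ 3 := by
    field_simp; ring
  rw [k1, div_le_iff₀ (by positivity)]
  have k2 : (y ^ 2 * g1 ^ 2 + 4 * ((1 + y) ^ 2 * g2 ^ 2)) * 1 ≤
    (y ^ 2 * g1 ^ 2 + 4 * ((1 + y) ^ 2 * g2 ^ 2)) * (1 + y) ^ 3 := by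
    gcongr; exact one_le_pow₀ (by linarith)
  have k3 : (y - 1 / 2) * g1 ^ 2 ≤ y ^ 2 / 2 * g1 ^ 2 := by
    gcongr; nlinarith [sq_nonneg (y - 1)]
  have k4 : 0 ≤ (y * g1 / 2 + 2 * ((1 + y) * g2)) ^ 2 := sq_nonneg _
  have k5 : 0 ≤ (y * g1) ^ 2 := sq_nonneg _
  linarith

theorem integrableOn_div_one_add {f : ℝ → ℝ} (hf : Integrable f halfLine) :
    IntegrableOn (fun y => f y / (1 + y)) (Ioi 0) := by
  refine hf.mono (hf.aestronglyMeasurable.aemeasurable.div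
    (by fun_prop : Continuous fun y : ℝ => 1 + y).measurable.aemeasurable).aestronglyMeasurable
    (ae_of_pos fun y hy => ?_)
  have hy : 0 < y := hy
  rw [norm_div, Real.norm_of_nonneg (show 0 ≤ 1 + y by linarith)]
  exact div_le_self (norm_nonneg _) (by linarith)

theorem Finite.integrable_near_wall {S : Coefficients} {w : ℝ → ℝ} {T : Trial}
    (hF : S.Finite w T) (hw : ∀ y, 0 < y → 1 + y ≤ w y) :
    Integrable (fun y => T.v3 y ^ 2 / (1 + y) ^ 3) halfLine := by
  refine hF.integrable_of_le (ContinuousOn.aesm ?_) 1 fun y hy => ?_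
  · exact (T.o3.pow 2).div (by fun_prop) fun y (hy : 0 < y) => by positivity
  · have hw1' : 1 ≤ w y := by linarith [hw y hy]
    rw [abs_of_nonneg (by positivity), one_mul]
    have k1 : T.v3 y ^ 2 / (1 + y) ^ 3 ≤ T.v3 y ^ 2 :=
      div_le_self (sq_nonneg _) (one_le_pow₀ (by linarith))
    have k2 : T.v3 y ^ 2 ≤ (T.v3 y * w y) ^ 2 := by
      rw [mul_pow]; exact le_mul_of_one_le_right (sq_nonneg _) (one_le_pow₀ hw1')
    linarith [(S.sq_le_total w T y).2.2.2.1]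

theorem Finite.near_wall_third {S : Coefficients} {w : ℝ → ℝ} {T : Trial} {M : ℝ}
    (hF : S.Finite w T) (hB : S.Bounds w M) {t1 : ℝ → ℝ} (i1 : Integrable t1 halfLine)
    (ht1 : ∀ y, 0 < y → y ^ 2 * T.v3 y ^ 2 ≤ t1 y) :
    1 / 2 * (∫ y in Ioi 0, T.v3 y ^ 2 / (1 + y) ^ 3) ≤
      (∫ y in Ioi 0, t1 y) + 4 * ∫ y in Ioi 0, (T.v4 y * w y) ^ 2 := by
  have i3' := hF.integrable_near_wall hB.w_ge
  have d3 := hB.dom_v3 T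
  have Lψ : LocAC (fun y => y / (1 + y) ^ 2) (fun y => (1 - y) / (1 + y) ^ 3) := by
    refine LocAC.of_hasDerivAt (fun y hy => ?_) ?_
    · have h1 : HasDerivAt (fun y : ℝ => 1 + y) 1 y := by
        simpa using (hasDerivAt_id y).const_add 1
      have h2 : (1 + y : ℝ) ^ 2 ≠ 0 := by positivity
      refine ((hasDerivAt_id y).div (h1.pow 2) h2).congr_deriv ?_
      simp only [id, Pi.pow_apply]
      have : (1 + y : ℝ) ≠ 0 := by positivity
      field_simp
      ring
    · exact ContinuousOn.div (by fun_prop) (by fun_prop) fun y (hy : 0 < y) => by positivity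
  have L := Lψ.mul (T.ac.mul T.ac)
  have dψ : Dom (fun y : ℝ => y / (1 + y) ^ 2) fun y => w y ^ 2 :=
    ⟨(ContinuousOn.div (by fun_prop) (by fun_prop) fun y (hy : 0 < y) => by positivity).aesm, 1,
      zero_le_one, fun y hy => by
        rw [abs_of_nonneg (by positivity), one_mul, div_le_iff₀ (by positivity)]
        nlinarith [one_le_pow₀ (n := 2) (hB.one_le hy)]⟩
  have dψ' : Dom (fun y : ℝ => (1 - y) / (1 + y) ^ 3) fun y => w y ^ 2 :=
    ⟨(ContinuousOn.div (by fun_prop) (by fun_prop) fun y (hy : 0 < y) => by positivity).aesm, 1,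
      zero_le_one, fun y hy => by
        have k0 : 0 < (1 + y) ^ 3 := by positivity
        rw [abs_div, abs_of_pos k0, one_mul, div_le_iff₀ k0]
        have k1 : 1 ≤ w y ^ 2 := one_le_pow₀ (hB.one_le hy)
        have k2 : |1 - y| ≤ 1 + y := by rw [abs_le]; constructor <;> linarith
        have k3 : 1 + y ≤ (1 + y) ^ 3 := le_self_pow₀ (by linarith) (by norm_num)
        nlinarith⟩
  have := L.integral_le_comb (f := fun y => 1 / 2 * (T.v3 y ^ 2 / (1 + y) ^ 3)) (A := t1)
      (B := fun y => (T.v4 y * w y) ^ 2) (D := t1) ?_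
      (hF.integrable_prod (fun _ => hB.w_pos) ((dψ'.mul (d3.mul d3)).add
        (dψ.mul (((hB.dom_v4 T).mul d3).add (d3.mul (hB.dom_v4 T))))))
      (integrableOn_div_one_add (hF.integrable_prod (fun _ => hB.w_pos) (dψ.mul (d3.mul d3))))
      (i3'.const_mul _) i1 hF.v4.integrable_sq i1 1 4 0 ?_
  · rw [integral_const_mul] at this
    linarith
  · have h3 := tendsto_wall T.c3
    have h4 := tendsto_wall (g := fun y => y / (1 + y) ^ 2)
      (ContinuousOn.div (by fun_prop) (by fun_prop) fun y (hy : 0 ≤ y) => by positivity)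
    convert! h4.mul (h3.mul h3) using 2
    simp
  · intro y hy
    have e1 := ht1 y hy
    have e2 : (1 + y) ^ 2 * T.v4 y ^ 2 ≤ (T.v4 y * w y) ^ 2 := by
      have := pow_le_pow_left₀ (by linarith) (hB.w_ge y hy) 2
      rw [mul_pow]
      have := mul_le_left this (sq_nonneg (T.v4 y))
      linarith
    have e3 := near_wall_third_pointwise (g1 := T.v3 y) (g2 := T.v4 y) hy
    linarith

set_option maxHeartbeats 1000000 in
theorem Finite.interior_le {m : ℕ} {ε M c C0 : ℝ} (hc : 0 < c) (hε1 : ε ≤ 1)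
    (hC0 : 0 ≤ C0) (hcomm : ∀ θ : ℝ, 0 ≤ θ → θ ≤ 1 → ∀ y a : ℝ, 0 < y → c * y ≤ a * (1 + y) →
      1 / 2 * (2 * m + 2) ^ 2 * (om m θ y / y ^ 2) + (m + 2) * M * (om m θ y / y) ≤
        1 / 4 * (a * om m θ y) + C0)
    {S : Coefficients} (hSc : S.c = c)
    (hB : S.Bounds (w0 m ε) M) {T : Trial} (hF : S.Finite (w0 m ε) T)
    (idens : Integrable (S.density T) halfLine)
    (iop : Integrable (fun y => (S.op T y * w0 m ε y) ^ 2) halfLine) :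
    Integrable (S.interior m (√ε) T) halfLine ∧ 1 / 2 * (∫ y in Ioi 0, S.interior m (√ε) T y) ≤
      48 * (1 + M) ^ 4 / c * ((∫ y in Ioi 0, S.density T y) +
        ∫ y in Ioi 0, (S.op T y * w0 m ε y) ^ 2) +
      C0 * (12 * (1 + M) ^ 2) * ∫ y in Ioi 0, S.density T y := by
  have hθ1 : √ε ≤ 1 := Real.sqrt_le_one.2 hε1
  have hM := hB.M_nonneg
  set θ := √ε with hθ
  have hθ0 : 0 ≤ θ := Real.sqrt_nonneg _
  have com : Continuous (om m θ) := continuous_of_hasDerivAt (hasDerivAt_om m θ)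
  have hom0 : ∀ y, 0 ≤ om m θ y := fun y => om_nonneg y
  have prod : ∀ {f : ℝ → ℝ}, Dom f _ → Integrable f halfLine :=
    fun h => hF.integrable_prod (fun _ => hB.w_pos) h
  have d2 := hB.dom_v2 T
  have d3 := hB.dom_v3 T
  have dom : Dom (om m θ) fun y => w0 m ε y ^ 2 :=
    ⟨com.aestronglyMeasurable, 1, zero_le_one, fun y hy => by
      rw [abs_of_nonneg (hom0 y), one_mul]; exact om_le_w0_sq m ε hy⟩
  have i1 : Integrable (S.interior m θ T) halfLine :=
    (prod ((dom.mul (d3.mul d3)).add ((hB.dom_a.smul dom).mul (d2.mul d2)))).congr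
      (Eventually.of_forall fun y => by simp only [interior]; ring)
  have Lv2 : LocAC T.v2 T.v3 := LocAC.of_hasDerivAt T.d2 T.o3
  have Lom : LocAC (om m θ) (om1 m θ) :=
    LocAC.of_hasDerivAt (fun y _ => hasDerivAt_om m θ y) continuous_om1.continuousOn
  have Lb : LocAC S.b S.b1 := LocAC.of_hasDerivAt (fun y _ => S.db y) S.cb1.continuousOn
  have L := (Lom.mul (Lv2.mul T.ac)).sub (((Lb.mul Lom).mul (Lv2.mul Lv2)).const_mul (1 / 2))
  have dom1 : Dom (om1 m θ) fun y => w0 m ε y ^ 2 := by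
    refine ⟨continuous_om1.aestronglyMeasurable, 2 * m + 2, by positivity, fun y hy => ?_⟩
    have h2 : om m θ y ≤ y * w0 m ε y ^ 2 := by
      rw [w0_sq]; unfold om
      have : 0 ≤ (1 + √ε * y) ^ (2 * m) := by positivity
      rw [← mul_assoc]
      gcongr
      nlinarith
    refine le_of_mul_le_mul_left ((abs_om1_le (m := m) hθ0 hy).trans ?_) hy
    have := mul_le_left h2 (show (0 : ℝ) ≤ 2 * m + 2 by positivity)
    linarith
  have om_zero : om m θ 0 = 0 := by simp [om]
  refine ⟨i1, ?_⟩
  have := L.integral_le_comb (f := fun y => 1 / 2 * S.interior m (√ε) T y) (A := fun y => (S.op T y * w0 m ε y) ^ 2) (B := S.density T)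
      (D := S.density T) ?_
      (prod ((dom1.mul (d2.mul d3)).add (dom.mul ((d3.mul d3).add (d2.mul (hB.dom_v4 T)))) |>.sub
        ((((hB.dom_b1.smul dom).add (hB.dom_b.smul dom1)).mul (d2.mul d2)).add
          ((hB.dom_b.smul dom).mul ((d3.mul d2).add (d2.mul d3))) |>.const_mul (1 / 2))))
      (integrableOn_div_one_add (prod ((dom.mul (d2.mul d3)).sub
        ((hB.dom_b.smul dom).mul (d2.mul d2) |>.const_mul (1 / 2)))))
      (i1.const_mul _) iop idens idens ((48 * (1 + M) ^ 4) / c) ((48 * (1 + M) ^ 4) / c) (C0 * (12 * (1 + M) ^ 2)) ?_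
  · rw [integral_const_mul] at this
    linarith
  · have h2 := tendsto_wall T.c2; have h3 := tendsto_wall T.c3; have h4 := tendsto_wall com.continuousOn
    have h5 := tendsto_wall S.cb.continuousOn
    convert! (h4.mul (h2.mul h3)).sub (((h5.mul h4).mul (h2.mul h2)).const_mul (1 / 2)) using 2
    rw [om_zero]; ring
  · intro y hy
    have ha := S.a_pos hy
    have := weighted_pointwise (g := T.v2 y) (g1 := T.v3 y) (g2 := T.v4 y) (w := w0 m ε y) (b := S.b y)
      (b1 := S.b1 y) (c := c) (M := M) (n := 2 * m + 2) (C := C0) (W := om m θ y)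
      (W1 := om1 m θ y) hy ha hc hM rfl ?_ (abs_om1_le hθ0 hy) ?_
      (hB.b_le_const hy) ?_ ?_
    · have e1 := hB.principal_sq_le T hy
      have e2 := mul_le_left (hB.v2_sq_le T hy) hC0
      have e3 := div_le_div_of_nonneg_right e1 hc.le
      have e4 : (48 * (1 + M) ^ 4) * ((S.op T y * w0 m ε y) ^ 2 + S.density T y) / c =
        (48 * (1 + M) ^ 4) / c * (S.op T y * w0 m ε y) ^ 2 + (48 * (1 + M) ^ 4) / c * S.density T y := by ring
      unfold interior
      linarith
    · unfold om; positivity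
    · rw [w0_sq]; unfold om
      have h1 := S.low y hy.le
      rw [hSc] at h1
      have h2 : c * y * y ≤ S.a y * (1 + y) * (1 + y) := by
        apply mul_le_mul h1 (by linarith) hy.le; positivity
      have h3 := mul_le_right h2
        (show 0 ≤ (1 + √ε * y) ^ (2 * m) by positivity)
      nlinarith
    · refine le_trans ?_ (hB.b1_le y hy)
      gcongr; linarith [hB.w_ge y hy]
    · have := hcomm θ hθ0 hθ1 y (S.a y) hy (hSc ▸ S.low y hy.le)
      rw [show ((2 * m + 2 : ℝ) + 2) / 2 = m + 2 by ring]
      exact this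

/-- Weighted estimate: the weighted norms of the second, third and fourth derivatives are
controlled by the energy and the weighted norm of the image under the operator. -/
theorem exists_weighted_bound (m : ℕ) {c M : ℝ} (hc : 0 < c) (hM : 0 ≤ M) :
    ∃ C : ℝ, 0 < C ∧ ∀ ε : ℝ, 0 < ε → ε ≤ 1 → ∀ S : Coefficients, S.c = c →
      S.Bounds (w0 m ε) M → ∀ T : Trial, S.Finite (w0 m ε) T →
      Integrable (S.density T) halfLine ∧
      Integrable (fun y => (S.op T y * w0 m ε y) ^ 2) halfLine ∧
      ∀ N : ℝ, (∫ y in Ioi 0, S.density T y) + (∫ y in Ioi 0, (S.op T y * w0 m ε y) ^ 2) ≤ N →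
      (∫ y in Ioi 0, (T.v3 y * w0 m ε y) ^ 2) ≤ C * N ∧
      (∫ y in Ioi 0, (T.v4 y * w0 m ε y) ^ 2) ≤ C * N ∧
      (∫ y in Ioi 0, (√(S.a y) * S.q2 T y * w0 m ε y) ^ 2) ≤ C * N := by
  obtain ⟨C0, hC0, hcomm⟩ := exists_commutator_bound m hc hM
  set Cg : ℝ := 12 * (1 + M) ^ 2 with hCg
  set CG : ℝ := 48 * (1 + M) ^ 4 with hCG
  set W1 : ℝ := 4 * 2 ^ (2 * m) with hW1
  have hW1' : 4 ≤ W1 := by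
    have : (1 : ℝ) ≤ 2 ^ (2 * m) := one_le_pow₀ (by norm_num)
    linarith
  set K1 : ℝ := 2 * (CG / c + C0 * Cg) with hK1
  set K4 : ℝ := 3 * CG + 3 * M ^ 2 * W1 * Cg + 3 * (M ^ 2 + 4 * M) * K1 with hK4
  set K3 : ℝ := 2 * (K1 + 4 * K4) with hK3
  set K5 : ℝ := 4 * K1 + 8 * W1 * K3 with hK5
  set K6 : ℝ := W1 + 30 * M ^ 2 / c + 48 / c ^ 2 * K1 with hK6
  have hK1' : 0 ≤ K1 := by positivity
  have hK4' : 0 ≤ K4 := by positivity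
  have hK3' : 0 ≤ K3 := by positivity
  have hK5' : 0 ≤ K5 := by positivity
  have hK6' : 0 < K6 := by positivity
  refine ⟨K4 + K5 + K6, by positivity, fun ε hε hε1 S hSc hB T hF => ?_⟩
  set w := w0 m ε with hw
  set θ := √ε with hθ
  have hθ0 : 0 ≤ θ := Real.sqrt_nonneg _
  have hθ1 : θ ≤ 1 := Real.sqrt_le_one.2 hε1
  have idens := hB.integrable_density hF
  have iop : Integrable (fun y => (S.op T y * w y) ^ 2) halfLine :=
    (hF.memLp_of_dom (hB.dom_op T) fun _ _ => le_rfl).integrable_sq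
  refine ⟨idens, iop, fun N hN => ?_⟩
  have id0 : ∀ y, 0 < y → 0 ≤ S.density T y := fun y hy => S.density_nonneg T hy
  have pos_int : ∀ g : ℝ → ℝ, (∀ y, 0 < y → 0 ≤ g y) → 0 ≤ ∫ y in Ioi 0, g y := fun g hg =>
    setIntegral_nonneg measurableSet_Ioi hg
  have N1 := pos_int _ id0
  have N2 := pos_int (fun y => (S.op T y * w y) ^ 2) fun y _ => sq_nonneg _
  have hN0 : 0 ≤ N := by linarith
  have ND : (∫ y in Ioi 0, S.density T y) ≤ N := by linarith
  have i3 : Integrable (fun y => (T.v3 y * w y) ^ 2) halfLine := hF.v3.integrable_sq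
  have i4 : Integrable (fun y => (T.v4 y * w y) ^ 2) halfLine := hF.v4.integrable_sq
  have i6 : Integrable (fun y => (√(S.a y) * S.q2 T y * w y) ^ 2) halfLine := hF.q2.integrable_sq
  obtain ⟨i1, hi1⟩ := Finite.interior_le hc hε1 hC0 hcomm hSc hB hF idens iop
  have i3' := hF.integrable_near_wall hB.w_ge
  have I1 : (∫ y in Ioi 0, S.interior m θ T y) ≤ K1 * N := by
    have k1 := mul_le_left hN (show 0 ≤ CG / c by positivity)
    have k2 := mul_le_left ND (show 0 ≤ C0 * Cg by positivity)
    rw [hK1]; linarith [hi1]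
  have I4 : (∫ y in Ioi 0, (T.v4 y * w y) ^ 2) ≤ K4 * N := by
    have := integral_le_comb i4 iop idens i1 _ _ _ fun y hy => v4_sq_le hε1 hB T hy
    have k1 := mul_le_left hN (show 0 ≤ 3 * CG by positivity)
    have k2 := mul_le_left ND (show 0 ≤ 3 * M ^ 2 * W1 * Cg by positivity)
    have k3 := mul_le_left I1 (show 0 ≤ 3 * (M ^ 2 + 4 * M) by positivity)
    rw [hK4]; linarith
  have I3 : (∫ y in Ioi 0, T.v3 y ^ 2 / (1 + y) ^ 3) ≤ K3 * N := by
    have := hF.near_wall_third hB i1 fun y hy => ?_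
    · rw [hK3]; linarith
    · refine le_trans ?_ (le_interior T hy).1
      unfold om
      have : (1 : ℝ) ≤ (1 + θ * y) ^ (2 * m) := one_le_pow₀ (by
        have : 0 ≤ θ * y := by positivity
        linarith)
      have := mul_le_left this (show 0 ≤ T.v3 y ^ 2 * y ^ 2 by positivity)
      linarith
  have I5 := integral_le_comb i3 i1 i3' i1 _ _ _ fun y hy => v3_sq_le hε1 hB T hy
  have I6 := integral_le_comb i6 idens idens i1 _ _ _ fun y hy => q2_sq_le hε1 hc hSc hB T hy
  have k4N : 0 ≤ K4 * N := by positivity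
  have k5N : 0 ≤ K5 * N := by positivity
  have k6N : 0 ≤ K6 * N := by positivity
  have J5 : (∫ y in Ioi 0, (T.v3 y * w y) ^ 2) ≤ K5 * N := by
    have := mul_le_left I3 (show 0 ≤ 8 * W1 by positivity)
    rw [hK5]; linarith
  have J6 : (∫ y in Ioi 0, (√(S.a y) * S.q2 T y * w y) ^ 2) ≤ K6 * N := by
    have e1 := mul_le_left ND (show 0 ≤ W1 by positivity)
    have e2 := mul_le_left ND (show 0 ≤ 30 * M ^ 2 / c by positivity)
    have e3 := mul_le_left I1 (show 0 ≤ 48 / c ^ 2 by positivity)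
    rw [hK6]; linarith
  exact ⟨by linarith, by linarith, by linarith⟩

end Coefficients

theorem L2_sq {f : ℝ → ℝ} (hf : MemLp f 2 halfLine) :
    L2 f = ENNReal.ofReal (√(∫ y in Ioi 0, f y ^ 2)) := by
  unfold L2
  rw [hf.eLpNorm_eq_integral_rpow_norm (by norm_num) (by norm_num), Real.sqrt_eq_rpow]
  simp [sq_abs]

theorem L2_le {f : ℝ → ℝ} (hf : MemLp f 2 halfLine) {X : ℝ} (h : ∫ y in Ioi 0, f y ^ 2 ≤ X) :
    L2 f ≤ ENNReal.ofReal (√X) := by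
  rw [L2_sq hf]
  exact ENNReal.ofReal_le_ofReal (Real.sqrt_le_sqrt h)

theorem memLp_of_abs_le {f g : ℝ → ℝ} (hg : MemLp g 2 halfLine)
    (hf : AEStronglyMeasurable f halfLine) (h : ∀ y, 0 < y → |f y| ≤ |g y|) :
    MemLp f 2 halfLine :=
  hg.mono hf (ae_of_pos h)

theorem L2_congr {f g : ℝ → ℝ} (h : ∀ y, 0 < y → f y = g y) : L2 f = L2 g :=
  eLpNorm_congr_ae (ae_of_pos h)

theorem LocAC.tendsto_zero {f f' : ℝ → ℝ} (hf : LocAC f f') (h0 : MemLp f 2 halfLine)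
    (h1 : MemLp f' 2 halfLine) : Tendsto f atTop (𝓝 0) := by
  have hsq := hf.mul hf
  have hi' : IntegrableOn (fun y => f' y * f y + f y * f' y) (Ioi 0) :=
    (h1.integrable_mul h0).add (h0.integrable_mul h1)
  have hi : IntegrableOn (fun y => f y * f y) (Ioi 0) := h0.integrable_mul h0
  have hlim := intervalIntegral_tendsto_integral_Ioi (f := fun y => f' y * f y + f y * f' y) 1
    (hi'.mono_set (Ioi_subset_Ioi zero_le_one)) tendsto_id
  have hlim2 : Tendsto (fun y => f y * f y) atTop
      (𝓝 ((∫ y in Ioi 1, (f' y * f y + f y * f' y)) + f 1 * f 1)) := by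
    refine (hlim.add_const (f 1 * f 1)).congr' ?_
    filter_upwards [eventually_ge_atTop 1] with y hy
    rw [id, hsq.integral_eq one_pos hy]
    ring
  have hz := eq_zero_of_tendsto_of_integrableOn_div hlim2 (Coefficients.integrableOn_div_one_add hi)
  rw [hz] at hlim2
  have := (Real.continuous_sqrt.tendsto 0).comp hlim2
  rw [Real.sqrt_zero] at this
  refine tendsto_zero_iff_abs_tendsto_zero f |>.2 (this.congr fun y => ?_)
  simp [Real.sqrt_mul_self_eq_abs]

namespace Coefficients

section apriori

variable {S : Coefficients} {w : ℝ → ℝ} {M : ℝ} {T : Trial}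

theorem Finite.memLp_v1 (hB : S.Bounds w M) (hF : S.Finite w T) : MemLp T.v1 2 halfLine :=
  hF.memLp_of_dom (hB.dom_v1 T) fun _ _ => le_rfl

theorem Finite.memLp_of_dom_div (hB : S.Bounds w M) (hF : S.Finite w T) {f : ℝ → ℝ}
    (h : Dom f fun y => S.moduli w T y / w y) : MemLp f 2 halfLine :=
  hF.memLp_of_dom h fun y hy => div_le_self (S.moduli_nonneg w T y) (hB.one_le hy)

theorem Finite.memLp_v2 (hB : S.Bounds w M) (hF : S.Finite w T) : MemLp T.v2 2 halfLine :=
  hF.memLp_of_dom_div hB (hB.dom_v2 T)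

theorem Finite.memLp_v3 (hB : S.Bounds w M) (hF : S.Finite w T) : MemLp T.v3 2 halfLine :=
  hF.memLp_of_dom_div hB (hB.dom_v3 T)

theorem Finite.memLp_v4 (hB : S.Bounds w M) (hF : S.Finite w T) : MemLp T.v4 2 halfLine :=
  hF.memLp_of_dom_div hB (hB.dom_v4 T)

theorem Finite.memLp_v_div (hB : S.Bounds w M) (hF : S.Finite w T) :
    MemLp (fun y => T.v y / (1 + y)) 2 halfLine := by
  have hM := hB.M_nonneg
  refine hF.memLp_of_dom (g := S.moduli w T) ⟨ContinuousOn.aesm ?_, M, hM, fun y hy => ?_⟩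
    fun _ _ => le_rfl
  · exact T.o0.div (by fun_prop) fun y (hy : 0 < y) => by positivity
  · have h4 := mul_le_left (S.le_moduli w T y).1 hM
    rw [abs_div, abs_of_pos (show 0 < 1 + y by linarith), div_le_iff₀ (by linarith)]
    have h5 := mul_nonneg hM (S.moduli_nonneg w T y)
    nlinarith [hB.v_le T hy]

theorem Finite.tendsto_zero (hB : S.Bounds w M) (hF : S.Finite w T) :
    Tendsto T.v1 atTop (𝓝 0) ∧ Tendsto T.v2 atTop (𝓝 0) ∧ Tendsto T.v3 atTop (𝓝 0) :=
  ⟨(LocAC.of_hasDerivAt T.d1 T.o2).tendsto_zero (hF.memLp_v1 hB)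
    (hF.memLp_v2 hB),
  (LocAC.of_hasDerivAt T.d2 T.o3).tendsto_zero (hF.memLp_v2 hB)
    (hF.memLp_v3 hB), T.ac.tendsto_zero (hF.memLp_v3 hB) (hF.memLp_v4 hB)⟩

/-- The energy controls the density. -/
theorem Coercive.density_le {R R1 : ℝ → ℝ} {k δ B : ℝ} (hC : S.Coercive R R1 k δ B)
    (hB : S.Bounds w M) (hF : S.Finite w T) :
    (∫ y in Ioi 0, S.density T y) ≤ (2 + 1 / δ) * |∫ y in Ioi 0, S.op T y * S.q T y| ∧
      S.l T ^ 2 ≤ 1 / S.c * |∫ y in Ioi 0, S.op T y * S.q T y| := by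
  obtain ⟨-, h2, h3⟩ := hC.energy hB hF
  have hδ := hC.δ_pos
  have hc := S.c_pos
  have hs := S.slope_ge
  have hle := le_abs_self (∫ y in Ioi 0, S.op T y * S.q T y)
  have hg0 : ∀ y, 0 < y → 0 ≤ S.good T δ y := fun y hy => by
    have := S.a_pos hy
    unfold good; positivity
  have hI0 : 0 ≤ ∫ y in Ioi 0, S.good T δ y := setIntegral_nonneg measurableSet_Ioi hg0
  have hl : 0 ≤ S.a1 0 * S.l T ^ 2 := mul_nonneg (hc.le.trans hs) (sq_nonneg _)
  constructor
  · have : (∫ y in Ioi 0, S.density T y) ≤ ∫ y in Ioi 0, (2 + 1 / δ) * S.good T δ y := by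
      refine integral_mono_of_nonneg (ae_of_pos fun y hy =>
        S.density_nonneg T hy) (h2.const_mul _)
        (ae_of_pos fun y hy => ?_)
      have := S.a_pos hy
      have e1 : (2 + 1 / δ) * S.good T δ y = S.density T y + (S.a y ^ 2 * S.q1 T y ^ 2
          + 2 * δ * ((S.q T y / y) ^ 2 + S.q1 T y ^ 2)
          + 1 / δ * (1 / 2 * (S.a y * S.q2 T y ^ 2) + 1 / 2 * (S.a y ^ 2 * S.q1 T y ^ 2))) := by
        unfold good density; field_simp; ring
      simp only []
      rw [e1]
      exact le_add_of_nonneg_right (by positivity)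
    rw [integral_const_mul] at this
    refine this.trans (mul_le_left ?_ (by positivity))
    linarith
  · rw [one_div_mul_eq_div, le_div_iff₀ hc]
    have := mul_le_right hs (sq_nonneg (S.l T))
    linarith

/-- A trial function in the kernel of the operator vanishes. -/
theorem Coercive.eq_zero {R R1 : ℝ → ℝ} {k δ B : ℝ} (hC : S.Coercive R R1 k δ B)
    (hB : S.Bounds w M) (hF : S.Finite w T) (h0 : ∀ᵐ y ∂halfLine, S.op T y = 0) :
    ∀ y, 0 < y → T.v y = 0 := by
  have hz : ∫ y in Ioi 0, S.op T y * S.q T y = 0 := by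
    rw [integral_congr_ae (g := fun _ => 0) (h0.mono fun y hy => by simp [hy])]
    simp
  have h1 := (hC.density_le hB hF).1
  rw [hz, abs_zero, mul_zero] at h1
  have hd0 : 0 ≤ᵐ[halfLine] S.density T :=
    ae_of_pos fun y hy => S.density_nonneg T hy
  have h2 := (integral_eq_zero_iff_of_nonneg_ae hd0 (hB.integrable_density hF)).1
    (le_antisymm h1 (integral_nonneg_of_ae hd0))
  have h3 : EqOn (S.density T) 0 (Ioi 0) :=
    Measure.eqOn_open_of_ae_eq h2 isOpen_Ioi (S.continuousOn_density T) continuousOn_const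
  intro y hy
  have h5 : (S.q T y / y) ^ 2 ≤ 0 := (S.le_density T hy).2.2.1.trans_eq (h3 hy)
  have h6 : S.q T y / y = 0 := by
    have := sq_nonneg (S.q T y / y)
    exact pow_eq_zero_iff (two_ne_zero) |>.1 (le_antisymm h5 this)
  rw [S.v_eq T hy, (div_eq_zero_iff.1 h6).resolve_right hy.ne', mul_zero]

end apriori

/-- All the terms of the norm are controlled by the image under the operator. -/
structure Apriori (S : Coefficients) (w : ℝ → ℝ) (T : Trial) (X : ℝ) : Prop where
  q_div : ∫ y in Ioi 0, (S.q T y / y) ^ 2 ≤ X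
  q1 : ∫ y in Ioi 0, S.q1 T y ^ 2 ≤ X
  q2 : ∫ y in Ioi 0, (√(S.a y) * S.q2 T y * w y) ^ 2 ≤ X
  l : S.l T ^ 2 ≤ X
  v1 : ∫ y in Ioi 0, T.v1 y ^ 2 ≤ X
  v2 : ∫ y in Ioi 0, T.v2 y ^ 2 ≤ X
  v3 : ∫ y in Ioi 0, (T.v3 y * w y) ^ 2 ≤ X
  v4 : ∫ y in Ioi 0, (T.v4 y * w y) ^ 2 ≤ X

theorem exists_apriori (m : ℕ) {c M δ : ℝ} (hc : 0 < c) (hM : 0 ≤ M) (hδ : 0 < δ) :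
    ∃ C : ℝ, 0 < C ∧ ∀ ε : ℝ, 0 < ε → ε ≤ 1 → ∀ S : Coefficients, S.c = c →
      S.Bounds (w0 m ε) M → ∀ (R R1 : ℝ → ℝ) (k B : ℝ), S.Coercive R R1 k δ B →
      ∀ T : Trial, S.Finite (w0 m ε) T →
      S.Apriori (w0 m ε) T (C * (|∫ y in Ioi 0, S.op T y * S.q T y|
        + ∫ y in Ioi 0, (S.op T y * w0 m ε y) ^ 2)) := by
  obtain ⟨C0, hC0, hw⟩ := exists_weighted_bound m hc hM
  set A : ℝ := 2 + 1 / δ with hA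
  have hA2 : 2 ≤ A := by have : 0 < 1 / δ := by positivity
                         linarith
  set K : ℝ := 1 + 12 * (1 + M) ^ 2 + 2 * M ^ 2 with hK
  refine ⟨C0 * A + K * A + 1 / c, by positivity, fun ε hε hε1 S hSc hB R R1 k B hC T hF => ?_⟩
  obtain ⟨h1, h2⟩ := hC.density_le hB hF
  obtain ⟨idens, iop, h3⟩ := hw ε hε hε1 S hSc hB T hF
  rw [hSc] at h2
  set I : ℝ := |∫ y in Ioi 0, S.op T y * S.q T y| with hI
  set J : ℝ := ∫ y in Ioi 0, (S.op T y * w0 m ε y) ^ 2 with hJ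
  have hI0 : 0 ≤ I := abs_nonneg _
  have hJ0 : 0 ≤ J := integral_nonneg fun _ => sq_nonneg _
  obtain ⟨w3, w4, wq⟩ := h3 (A * (I + J)) (by nlinarith)
  have hsum : 0 ≤ I + J := by linarith
  have t1 : 0 ≤ C0 * A * (I + J) := by positivity
  have t2 : 0 ≤ K * A * (I + J) := by positivity
  have t3 : 0 ≤ 1 / c * (I + J) := by positivity
  have hdens : ∫ y in Ioi 0, S.density T y ≤ A * (I + J) := by nlinarith
  have hcomp : ∀ (g : ℝ → ℝ) (κ : ℝ), 0 ≤ κ → κ ≤ K →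
      (∀ y, 0 < y → g y ^ 2 ≤ κ * S.density T y) →
      ∫ y in Ioi 0, g y ^ 2 ≤ (C0 * A + K * A + 1 / c) * (I + J) := by
    intro g κ hκ hκK hg
    have e1 : ∫ y in Ioi 0, g y ^ 2 ≤ ∫ y in Ioi 0, κ * S.density T y :=
      integral_mono_of_nonneg (Eventually.of_forall fun _ => sq_nonneg _) (idens.const_mul κ)
        (ae_of_pos hg)
    rw [integral_const_mul] at e1
    have e2 := mul_le_left hdens hκ
    have e3 := mul_le_right hκK (show 0 ≤ A * (I + J) by positivity)
    linarith
  have hM2 : 0 ≤ M ^ 2 := sq_nonneg M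
  have h12 : 0 ≤ 12 * (1 + M) ^ 2 := by positivity
  refine ⟨hcomp _ 1 zero_le_one (by linarith) fun y hy =>
      (S.le_density T hy).2.2.1.trans (one_mul _).ge,
    hcomp _ 1 zero_le_one (by linarith) fun y hy =>
      (S.le_density T hy).2.1.trans (one_mul _).ge, by linarith, ?_,
    hcomp _ (2 * M ^ 2) (by positivity) (by linarith) fun y hy => ?_,
    hcomp _ (12 * (1 + M) ^ 2) h12 (by linarith) fun y hy => hB.v2_sq_le T hy,
    by linarith, by linarith⟩
  · have : 1 / c * I ≤ 1 / c * (I + J) := by gcongr; linarith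
    linarith
  · have e1 := pow_le_pow_left₀ (abs_nonneg _) (hB.v1_le T hy) 2
    rw [sq_abs] at e1
    have e2 : (M * |S.q T y / y| + M * |S.q1 T y|) ^ 2 ≤
        2 * M ^ 2 * ((S.q T y / y) ^ 2 + S.q1 T y ^ 2) := by
      rw [← sq_abs (S.q T y / y), ← sq_abs (S.q1 T y)]
      nlinarith [mul_nonneg hM2 (sq_nonneg (|S.q T y / y| - |S.q1 T y|))]
    have := mul_le_left (S.le_density T hy).2.2.2 (show 0 ≤ 2 * M ^ 2 by positivity)
    linarith

end Coefficients

theorem D_succ (k : ℕ) (f : ℝ → ℝ) : D (k + 1) f = derivWithin (D k f) (Ici 0) :=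
  iteratedDerivWithin_succ

theorem D_one (f : ℝ → ℝ) : D 1 f = derivWithin f (Ici 0) := by
  rw [D_succ 0]; rfl

theorem D_succ_eq_deriv (k : ℕ) (f : ℝ → ℝ) {y : ℝ} (hy : 0 < y) :
    D (k + 1) f y = deriv (D k f) y := by
  rw [D_succ, derivWithin_of_mem_nhds (Ici_mem_nhds hy)]

theorem continuousOn_D {n : WithTop ℕ∞} {f : ℝ → ℝ} (hf : ContDiffOn ℝ n f (Ici 0)) {k : ℕ}
    (hk : (k : WithTop ℕ∞) ≤ n) : ContinuousOn (D k f) (Ici 0) :=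
  hf.continuousOn_iteratedDerivWithin hk (uniqueDiffOn_Ici 0)

theorem hasDerivAt_D {n : WithTop ℕ∞} {f : ℝ → ℝ} (hf : ContDiffOn ℝ n f (Ici 0)) {k : ℕ}
    (hk : (k : WithTop ℕ∞) < n) {y : ℝ} (hy : 0 < y) :
    HasDerivAt (D k f) (D (k + 1) f y) y := by
  rw [D_succ_eq_deriv k f hy]
  exact ((hf.differentiableOn_iteratedDerivWithin hk (uniqueDiffOn_Ici 0)
    y hy.le).differentiableAt (Ici_mem_nhds hy)).hasDerivAt

theorem locAC_D {k : ℕ} {f : ℝ → ℝ}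
    (h : ∀ b, 0 < b → AbsolutelyContinuousOnInterval (D k f) 0 b) :
    LocAC (D k f) (D (k + 1) f) := by
  refine ⟨fun x y hx hxy => (h y (hx.trans_le hxy)).mono ?_, ?_⟩
  · rw [uIcc_of_le hxy, uIcc_of_le (hx.le.trans hxy)]
    exact Icc_subset_Icc_left hx.le
  · have h1 : ∀ n : ℕ, ∀ᵐ y : ℝ, y ∈ uIcc (0 : ℝ) (n + 1) → DifferentiableAt ℝ (D k f) y :=
      fun n => (h (n + 1) (by positivity)).ae_differentiableAt
    rw [ae_restrict_iff' measurableSet_Ioi]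
    filter_upwards [ae_all_iff.2 h1] with y hy hpos
    have hpos : 0 < y := hpos
    obtain ⟨n, hn⟩ := exists_nat_gt y
    rw [D_succ_eq_deriv k f hpos]
    refine (hy n ?_).hasDerivAt
    rw [uIcc_of_le (by positivity)]
    exact ⟨hpos.le, by linarith⟩

/-- A trial function is determined by a function which is `C³` up to the wall. -/
def Trial.ofFun (v : ℝ → ℝ) (hv : ContDiffOn ℝ 3 v (Ici 0))
    (hac : ∀ b, 0 < b → AbsolutelyContinuousOnInterval (D 3 v) 0 b) (h0 : v 0 = 0)
    (h1 : D 1 v 0 = 0) : Trial where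
  v := v
  v1 := D 1 v
  v2 := D 2 v
  v3 := D 3 v
  v4 := D 4 v
  d0 y hy := hasDerivAt_D hv (k := 0) (by norm_num) hy
  d1 y hy := hasDerivAt_D hv (k := 1) (by norm_num) hy
  d2 y hy := hasDerivAt_D hv (k := 2) (by norm_num) hy
  c0 := hv.continuousOn
  c1 := continuousOn_D hv (by norm_num)
  c2 := continuousOn_D hv (by norm_num)
  c3 := continuousOn_D hv (by norm_num)
  ac := locAC_D hac
  z0 := h0
  z1 := h1

namespace Trial

variable (T : Trial)

theorem hasDerivWithinAt {f f' : ℝ → ℝ} (hc : ContinuousOn f (Ici 0)) (hc' : ContinuousOn f' (Ici 0))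
    (hd : ∀ y, 0 < y → HasDerivAt f (f' y) y) {y : ℝ} (hy : 0 ≤ y) :
    HasDerivWithinAt f (f' y) (Ici 0) y := by
  rcases hy.eq_or_lt with h | h
  · subst h
    refine hasDerivWithinAt_Ici_of_tendsto_deriv (s := Ioi 0)
      (fun y hy => (hd y hy).differentiableAt.differentiableWithinAt)
      ((hc 0 self_mem_Ici).mono Ioi_subset_Ici_self) self_mem_nhdsWithin ?_
    refine (tendsto_wall hc').congr' ?_
    filter_upwards [self_mem_nhdsWithin] with y hy using (hd y hy).deriv.symm
  · exact (hd y h).hasDerivWithinAt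

theorem derivWithin_eq {f f' : ℝ → ℝ} (hc : ContinuousOn f (Ici 0)) (hc' : ContinuousOn f' (Ici 0))
    (hd : ∀ y, 0 < y → HasDerivAt f (f' y) y) : EqOn (derivWithin f (Ici 0)) f' (Ici 0) :=
  fun y hy => (hasDerivWithinAt hc hc' hd hy).derivWithin (uniqueDiffOn_Ici 0 y hy)

theorem D1_eq : EqOn (D 1 T.v) T.v1 (Ici 0) := by
  rw [D_one]; exact derivWithin_eq T.c0 T.c1 T.d0

theorem D2_eq : EqOn (D 2 T.v) T.v2 (Ici 0) := fun y hy => by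
  rw [D_succ 1, derivWithin_congr T.D1_eq (T.D1_eq hy)]
  exact derivWithin_eq T.c1 T.c2 T.d1 hy

theorem D3_eq : EqOn (D 3 T.v) T.v3 (Ici 0) := fun y hy => by
  rw [D_succ 2, derivWithin_congr T.D2_eq (T.D2_eq hy)]
  exact derivWithin_eq T.c2 T.c3 T.d2 hy

theorem D4_eq : ∀ᵐ y ∂halfLine, D 4 T.v y = T.v4 y := by
  filter_upwards [T.ac.2, ae_restrict_mem measurableSet_Ioi] with y hy (hpos : 0 < y)
  rw [D_succ_eq_deriv 3 _ hpos, ← hy.deriv]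
  refine Filter.EventuallyEq.deriv_eq ?_
  filter_upwards [Ioi_mem_nhds hpos] with z hz using T.D3_eq (Ioi_subset_Ici_self hz)

theorem contDiffOn : ContDiffOn ℝ 3 T.v (Ici 0) := by
  refine contDiffOn_of_continuousOn_differentiableOn_deriv (n := 3) ?_ ?_
  · intro k hk
    have hk : k ≤ 3 := by exact_mod_cast hk
    interval_cases k
    · exact T.c0
    · exact T.c1.congr T.D1_eq
    · exact T.c2.congr T.D2_eq
    · exact T.c3.congr T.D3_eq
  · intro k hk
    have hk : k < 3 := by exact_mod_cast hk
    interval_cases k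
    · exact fun y hy => (hasDerivWithinAt T.c0 T.c1 T.d0 hy).differentiableWithinAt
    · exact fun y hy => ((hasDerivWithinAt T.c1 T.c2 T.d1 hy).congr (fun z hz => T.D1_eq hz)
        (T.D1_eq hy)).differentiableWithinAt
    · exact fun y hy => ((hasDerivWithinAt T.c2 T.c3 T.d2 hy).congr (fun z hz => T.D2_eq hz)
        (T.D2_eq hy)).differentiableWithinAt

theorem absolutelyContinuous (h4 : MemLp T.v4 2 halfLine) {b : ℝ} (hb : 0 < b) :
    AbsolutelyContinuousOnInterval (D 3 T.v) 0 b := by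
  have hii : IntervalIntegrable T.v4 volume 0 b := by
    rw [intervalIntegrable_iff_integrableOn_Ioc_of_le hb.le]
    have h5 : MemLp T.v4 2 (volume.restrict (Ioc 0 b)) :=
      h4.mono_measure (Measure.restrict_mono Ioc_subset_Ioi_self le_rfl)
    exact h5.integrable (by norm_num)
  have hac := hii.absolutelyContinuousOnInterval_intervalIntegral (c := b) (by simp)
  have hcI := hac.continuousOn
  rw [uIcc_of_le hb.le] at hcI
  have h1 : EqOn (fun y => ∫ z in b..y, T.v4 z) (fun y => T.v3 y - T.v3 b) (Ioc 0 b) :=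
    fun y hy => by
      simp only []
      rw [intervalIntegral.integral_symm, T.ac.integral_eq hy.1 hy.2]; ring
  have h2 : EqOn (fun y => ∫ z in b..y, T.v4 z) (fun y => T.v3 y - T.v3 b) (Icc 0 b) := by
    refine h1.of_subset_closure hcI ((T.c3.mono Icc_subset_Ici_self).sub continuousOn_const)
      Ioc_subset_Icc_self ?_
    rw [closure_Ioc hb.ne]
  rw [absolutelyContinuousOnInterval_iff] at hac ⊢
  intro η hη
  obtain ⟨δ, hδ, H⟩ := hac η hη
  refine ⟨δ, hδ, fun E hE hlt => (Finset.sum_congr rfl fun i hi => ?_).trans_lt (H E hE hlt)⟩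
  obtain ⟨m1, m2⟩ := hE.1 i hi
  rw [uIcc_of_le hb.le] at m1 m2
  have e1 := h2 m1
  have e2 := h2 m2
  simp only [] at e1 e2
  rw [e1, e2, T.D3_eq m1.1, T.D3_eq m2.1]
  simp

end Trial

theorem natCast_lt_infty (k : ℕ) : (k : WithTop ℕ∞) < ((⊤ : ℕ∞) : WithTop ℕ∞) := by
  exact_mod_cast WithTop.coe_lt_top k

section datum

variable {h v : ℝ → ℝ} (hh : ContDiffOn ℝ ∞ h (Ici 0)) (hv : ContDiffOn ℝ 3 v (Ici 0))
include hh hv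

theorem D1_uZero : EqOn (D 1 (uZero h v)) (fun y => D 1 h y - D 2 v y) (Ici 0) := by
  have n2 : ((2 : ℕ) : WithTop ℕ∞) ≤ 3 := by norm_num
  rw [D_one]
  exact Trial.derivWithin_eq (hh.continuousOn.sub (continuousOn_D hv (by norm_num)))
    ((continuousOn_D hh (by simp)).sub (continuousOn_D hv n2)) fun y hy =>
      (hasDerivAt_D hh (k := 0) (by simp) hy).sub (hasDerivAt_D hv (k := 1) (by norm_num) hy)

theorem D2_uZero : EqOn (D 2 (uZero h v)) (fun y => D 2 h y - D 3 v y) (Ici 0) := fun y hy => by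
  have n2 : ((2 : ℕ) : WithTop ℕ∞) ≤ 3 := by norm_num
  have n3 : ((3 : ℕ) : WithTop ℕ∞) ≤ 3 := by norm_num
  rw [D_succ 1, derivWithin_congr (D1_uZero hh hv) (D1_uZero hh hv hy)]
  exact Trial.derivWithin_eq ((continuousOn_D hh (by simp)).sub (continuousOn_D hv n2))
    ((continuousOn_D hh (natCast_lt_infty 2).le).sub (continuousOn_D hv n3)) (fun y hy =>
      (hasDerivAt_D hh (k := 1) (natCast_lt_infty _) hy).sub (hasDerivAt_D hv (k := 2) (by norm_num) hy)) hy

theorem D3_uZero (hac : ∀ b, 0 < b → AbsolutelyContinuousOnInterval (D 3 v) 0 b) :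
    ∀ᵐ y ∂halfLine, D 3 (uZero h v) y = D 3 h y - D 4 v y := by
  filter_upwards [(locAC_D hac).2, ae_restrict_mem measurableSet_Ioi] with y hy (hpos : 0 < y)
  rw [D_succ_eq_deriv 2 _ hpos]
  have h1 := ((hasDerivAt_D hh (k := 2) (natCast_lt_infty _) hpos).sub hy).deriv
  rw [← h1]
  refine Filter.EventuallyEq.deriv_eq ?_
  filter_upwards [Ioi_mem_nhds hpos] with z hz using D2_uZero hh hv (Ioi_subset_Ici_self hz)

end datum

namespace Coefficients

variable (S : Coefficients) (T : Trial)

theorem hasDerivWithinAt_q_zero : HasDerivWithinAt (S.q T) (S.l T) (Ici 0) 0 := by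
  rw [hasDerivWithinAt_iff_tendsto_slope]
  have : Ici (0 : ℝ) \ {0} = Ioi 0 := by ext; simp [lt_iff_le_and_ne, eq_comm]
  rw [this]
  refine (S.tendsto_q_div T).congr' ?_
  filter_upwards [self_mem_nhdsWithin] with y hy
  rw [slope_def_field]
  simp [q, T.z0]

/-- The coefficients are those of the profile `[us, vs]` at `x = 0`. -/
structure Represents (us vs : ℝ → ℝ → ℝ) (ε : ℝ) : Prop where
  a : S.a = us 0
  a1 : S.a1 = pd 0 1 us 0
  a2 : S.a2 = pd 0 2 us 0
  b : S.b = vs 0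
  b2 : S.b2 = pd 0 2 vs 0
  e : S.e = fun y => ε * pd 2 0 us 0 y
  f : S.f = fun y => ε * pd 2 0 vs 0 y

variable {S} {us vs : ℝ → ℝ → ℝ} {ε : ℝ} (hS : S.Represents us vs ε)
include hS

theorem Represents.quot_eq : quot us T.v = S.q T := by
  funext y; unfold quot q; rw [hS.a]

theorem Represents.D1_quot {y : ℝ} (hy : 0 < y) : D 1 (quot us T.v) y = S.q1 T y := by
  rw [hS.quot_eq, D_succ_eq_deriv 0 _ hy]
  exact (S.dq T hy).deriv

theorem Represents.D1_quot_zero : D 1 (quot us T.v) 0 = S.l T := by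
  rw [hS.quot_eq, D_one]
  exact (S.hasDerivWithinAt_q_zero T).derivWithin (uniqueDiffOn_Ici 0 0 self_mem_Ici)

theorem Represents.D2_quot {y : ℝ} (hy : 0 < y) : D 2 (quot us T.v) y = S.q2 T y := by
  rw [D_succ_eq_deriv 1 _ hy, ← (S.dq1 T hy).deriv]
  refine Filter.EventuallyEq.deriv_eq ?_
  filter_upwards [Ioi_mem_nhds hy] with z hz using hS.D1_quot T hz

theorem Represents.D1_flux {y : ℝ} (hy : 0 < y) :
    D 1 (fun z => us 0 z ^ 2 * D 1 (quot us T.v) z) y = S.a y * T.v2 y - S.a2 y * T.v y := by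
  have h1 : HasDerivAt (fun z => T.v1 z * S.a z - T.v z * S.a1 z)
      (S.a y * T.v2 y - S.a2 y * T.v y) y :=
    (((T.d1 y hy).mul (S.da y)).sub ((T.d0 y hy).mul (S.da1 y))).congr_deriv (by ring)
  rw [D_succ_eq_deriv 0 _ hy, ← h1.deriv]
  refine Filter.EventuallyEq.deriv_eq ?_
  filter_upwards [Ioi_mem_nhds hy] with z hz
  have ha := (S.a_pos hz).ne'
  show us 0 z ^ 2 * D 1 (quot us T.v) z = _
  rw [hS.D1_quot T hz, ← hS.a, q1]
  field_simp

theorem Represents.lop_eq {v : ℝ → ℝ} (hv : ContDiffOn ℝ 3 v (Ici 0))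
    (hac : ∀ b, 0 < b → AbsolutelyContinuousOnInterval (D 3 v) 0 b) (h0 : v 0 = 0)
    (h1 : D 1 v 0 = 0) (y : ℝ) :
    Lop us vs ε v y = S.op (Trial.ofFun v hv hac h0 h1) y := by
  unfold Lop op
  rw [hS.a, hS.a2, hS.b, hS.b2, hS.e, hS.f]
  rfl

end Coefficients

theorem memLp_two_weight_mono {f w : ℝ → ℝ} (hw : ∀ y, 0 < y → 1 ≤ w y)
    (hf : AEStronglyMeasurable f halfLine) (h : MemLp (fun y => f y * w y) 2 halfLine) :
    MemLp f 2 halfLine :=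
  memLp_of_abs_le h hf fun y hy => by
    rw [abs_mul]
    exact le_mul_of_one_le_right (abs_nonneg _) ((hw y hy).trans (le_abs_self _))

theorem continuous_w0 (m : ℕ) (ε : ℝ) : Continuous (w0 m ε) := by unfold w0; fun_prop

/-- Datum functions belong to all the weighted spaces. -/
theorem IsDatum.memLp {h : ℝ → ℝ} (hh : IsDatum h) (m : ℕ) {ε : ℝ} (hε1 : ε ≤ 1) (k : ℕ) :
    MemLp (fun y => D k h y * w0 m ε y) 2 halfLine := by
  obtain ⟨B, hB⟩ := hh.decay k
  have hB0 : 0 ≤ B := (by positivity : (0 : ℝ) ≤ |D k h 0| * Real.exp 0).trans (hB 0 le_rfl)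
  have hc : ContinuousOn (D k h) (Ici 0) := continuousOn_D hh.smooth (natCast_lt_infty k).le
  have hm : AEStronglyMeasurable (fun y => D k h y * w0 m ε y) halfLine :=
    ((hc.mono Ioi_subset_Ici_self).mul (continuous_w0 m ε).continuousOn).aesm
  have hpoly : Tendsto (fun y : ℝ => (1 + y) ^ (m + 1) * Real.exp (-(1 / 2) * y)) atTop (𝓝 0) := by
    have h1 := Real.tendsto_pow_mul_exp_neg_atTop_nhds_zero (m + 1)
    have h2 : Tendsto (fun y : ℝ => (1 + y) / 2) atTop atTop :=
      (tendsto_atTop_add_const_left _ 1 tendsto_id).atTop_div_const (by norm_num)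
    have h3 := ((h1.comp h2).const_mul (2 ^ (m + 1) * Real.exp (1 / 2)))
    rw [mul_zero] at h3
    refine h3.congr fun y => ?_
    simp only [Function.comp]
    rw [div_pow]
    have : Real.exp (-(1 / 2) * y) = Real.exp (1 / 2) * Real.exp (-((1 + y) / 2)) := by
      rw [← Real.exp_add]; ring_nf
    rw [this]; field_simp
  obtain ⟨A, hA⟩ : ∃ A : ℝ, ∀ y : ℝ, 0 ≤ y → (1 + y) ^ (m + 1) * Real.exp (-(1 / 2) * y) ≤ A := by
    obtain ⟨R, hR⟩ := eventually_atTop.1 (hpoly.eventually (ge_mem_nhds (zero_lt_one' ℝ)))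
    obtain ⟨A, hA⟩ := isCompact_Icc.exists_bound_of_continuousOn (s := Icc 0 (max R 0))
      (f := fun y : ℝ => (1 + y) ^ (m + 1) * Real.exp (-(1 / 2) * y)) (by fun_prop)
    refine ⟨max A 1, fun y hy => ?_⟩
    rcases le_total R y with h | h
    · exact (hR y h).trans (le_max_right _ _)
    · exact ((le_abs_self _).trans (hA y ⟨hy, h.trans (le_max_left _ _)⟩)).trans (le_max_left _ _)
  have hA0 : 0 ≤ A := le_trans (by positivity) (hA 0 le_rfl)
  have hexp : MemLp (fun y => B * A * Real.exp (-(1 / 2) * y)) 2 halfLine := by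
    rw [memLp_two_iff_integrable_sq (by fun_prop)]
    have := (integrableOn_exp_mul_Ioi (a := -1) (by norm_num) 0).const_mul ((B * A) ^ 2)
    refine this.congr (Eventually.of_forall fun y => ?_)
    simp only [mul_pow, ← Real.exp_nat_mul]
    push_cast
    ring_nf
  refine memLp_of_abs_le hexp hm fun y hy => ?_
  have hw : |w0 m ε y| ≤ (1 + y) ^ (m + 1) := by
    have h1 : √ε ≤ 1 := Real.sqrt_le_one.2 hε1
    have h0 : 0 ≤ √ε := Real.sqrt_nonneg _
    unfold w0
    rw [abs_of_nonneg (by positivity), pow_succ, mul_comm]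
    gcongr
    nlinarith
  have h2 := hB y hy.le
  have h3 : |D k h y| ≤ B * Real.exp (-y) := by
    rw [Real.exp_neg, ← div_eq_mul_inv, le_div_iff₀ (Real.exp_pos _)]; exact h2
  have h4 : Real.exp (-y) = Real.exp (-(1 / 2) * y) * Real.exp (-(1 / 2) * y) := by
    rw [← Real.exp_add]; ring_nf
  rw [abs_mul, abs_of_nonneg (by positivity : 0 ≤ B * A * Real.exp (-(1 / 2) * y))]
  calc |D k h y| * |w0 m ε y| ≤ B * Real.exp (-y) * (1 + y) ^ (m + 1) := by gcongr
    _ = B * ((1 + y) ^ (m + 1) * Real.exp (-(1 / 2) * y)) * Real.exp (-(1 / 2) * y) := by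
      rw [h4]; ring
    _ ≤ _ := by gcongr; exact hA y hy.le

theorem one_le_w0 (m : ℕ) (ε : ℝ) {y : ℝ} (hy : 0 < y) : 1 ≤ w0 m ε y := by
  unfold w0
  have h0 : 0 ≤ √ε := Real.sqrt_nonneg _
  exact one_le_mul_of_one_le_of_one_le (by linarith) (one_le_pow₀ (by nlinarith))

theorem IsDatum.memLp' {h : ℝ → ℝ} (hh : IsDatum h) (k : ℕ) : MemLp (D k h) 2 halfLine := by
  refine memLp_two_weight_mono (w := w0 0 0) (fun y hy => one_le_w0 _ _ hy)
    (ContinuousOn.aesm ?_) (hh.memLp 0 zero_le_one k)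
  exact (continuousOn_D hh.smooth (natCast_lt_infty k).le).mono Ioi_subset_Ici_self

theorem L2_sub_le {f g : ℝ → ℝ} (hf : MemLp f 2 halfLine) (hg : MemLp g 2 halfLine) :
    L2 (fun y => f y - g y) ≤ L2 f + L2 g :=
  eLpNorm_sub_le hf.1 hg.1 (by norm_num)

namespace Coefficients

variable {S : Coefficients} {us vs : ℝ → ℝ → ℝ} {ε : ℝ} {m : ℕ}

section finiteness

variable {h v : ℝ → ℝ} (hS : S.Represents us vs ε) (hε1 : ε ≤ 1) (hh : IsDatum h)
  (hv : ContDiffOn ℝ 3 v (Ici 0))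
  (hac : ∀ b, 0 < b → AbsolutelyContinuousOnInterval (D 3 v) 0 b) (h0 : v 0 = 0)
  (h1 : D 1 v 0 = 0)
include hS

theorem Represents.normB_le_top_imp (hfin : normB us m ε (uZero h v) v < ⊤) :
    S.Finite (w0 m ε) (Trial.ofFun v hv hac h0 h1) := by
  set T := Trial.ofFun v hv hac h0 h1 with hT
  have cw := (continuous_w0 m ε).continuousOn (s := Ioi 0)
  unfold normB at hfin
  simp only [ENNReal.add_lt_top] at hfin
  obtain ⟨⟨⟨⟨⟨⟨⟨⟨⟨-, -⟩, -⟩, -⟩, t5⟩, t6⟩, t7⟩, -⟩, t9⟩, t10⟩ := hfin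
  refine ⟨⟨((S.cq T).div continuousOn_id fun y hy => ne_of_gt hy).aesm, ?_⟩,
    ⟨(S.cq1 T).aesm, ?_⟩,
    ⟨((S.ca.sqrt.continuousOn.mul (S.cq2 T)).mul cw).aesm, ?_⟩,
    ⟨(T.o3.mul cw).aesm, t9⟩,
    ⟨T.aesm_v4.mul (continuous_w0 m ε).aestronglyMeasurable, t10⟩⟩
  · rw [← hS.quot_eq T]; exact t6
  · exact (L2_congr fun y hy => (hS.D1_quot T hy)).symm.trans_lt t5
  · refine (L2_congr fun y hy => ?_).symm.trans_lt t7
    rw [← hS.a]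
    exact congrArg (fun z => √(S.a y) * z * w0 m ε y) (hS.D2_quot T hy)

include hε1 hh in
/-- The norm is controlled by the datum and the norms of the trial function. -/
theorem Represents.normB_le {M X : ℝ} (hB : S.Bounds (w0 m ε) M)
    (hF : S.Finite (w0 m ε) (Trial.ofFun v hv hac h0 h1))
    (hA : S.Apriori (w0 m ε) (Trial.ofFun v hv hac h0 h1) X) :
    normB us m ε (uZero h v) v ≤ normH m ε h + 10 * ENNReal.ofReal (√X) := by
  set T := Trial.ofFun v hv hac h0 h1 with hT
  set Z := ENNReal.ofReal (√X) with hZ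
  have m1 := hF.memLp_v1 hB
  have m2 := hF.memLp_v2 hB
  have t1 : L2 (uZero h v) ≤ L2 h + Z :=
    (L2_sub_le (hh.memLp' 0) m1).trans (add_le_add le_rfl (L2_le m1 hA.v1))
  have t2 : L2 (D 1 (uZero h v)) ≤ L2 (D 1 h) + Z := by
    rw [L2_congr fun y hy => D1_uZero hh.smooth hv (le_of_lt hy)]
    exact (L2_sub_le (hh.memLp' 1) m2).trans (add_le_add le_rfl (L2_le m2 hA.v2))
  have t3 : L2 (fun y => D 2 (uZero h v) y * w0 m ε y) ≤
      L2 (fun y => D 2 h y * w0 m ε y) + Z := by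
    rw [L2_congr (g := fun y => D 2 h y * w0 m ε y - T.v3 y * w0 m ε y) fun y hy => by
      rw [D2_uZero hh.smooth hv (le_of_lt hy), sub_mul]; rfl]
    exact (L2_sub_le (hh.memLp m hε1 2) hF.v3).trans (add_le_add le_rfl (L2_le hF.v3 hA.v3))
  have t4 : L2 (fun y => D 3 (uZero h v) y * w0 m ε y) ≤
      L2 (fun y => D 3 h y * w0 m ε y) + Z := by
    have : L2 (fun y => D 3 (uZero h v) y * w0 m ε y) =
        L2 (fun y => D 3 h y * w0 m ε y - T.v4 y * w0 m ε y) := by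
      refine eLpNorm_congr_ae ?_
      filter_upwards [D3_uZero hh.smooth hv hac] with y hy
      rw [hy, sub_mul]; rfl
    rw [this]
    exact (L2_sub_le (hh.memLp m hε1 3) hF.v4).trans (add_le_add le_rfl (L2_le hF.v4 hA.v4))
  have t5 : L2 (D 1 (quot us v)) ≤ Z := by
    rw [show L2 (D 1 (quot us v)) = L2 (S.q1 T) from L2_congr fun y hy => hS.D1_quot T hy]
    exact L2_le hF.q1 hA.q1
  have t6 : L2 (fun y => quot us v y / y) ≤ Z := by
    have : quot us v = S.q T := hS.quot_eq T
    rw [this]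
    exact L2_le hF.q_div hA.q_div
  have t7 : L2 (fun y => √(us 0 y) * D 2 (quot us v) y * w0 m ε y) ≤ Z := by
    rw [L2_congr (g := fun y => √(S.a y) * S.q2 T y * w0 m ε y) fun y hy => by
      rw [hS.a, ← hS.D2_quot T hy]; rfl]
    exact L2_le hF.q2 hA.q2
  have t8 : ‖D 1 (quot us v) 0‖ₑ ≤ Z := by
    have : D 1 (quot us v) 0 = S.l T := hS.D1_quot_zero T
    rw [this, ← ofReal_norm]
    exact ENNReal.ofReal_le_ofReal (Real.abs_le_sqrt hA.l)
  have t9 : L2 (fun y => D 3 v y * w0 m ε y) ≤ Z := L2_le hF.v3 hA.v3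
  have t10 : L2 (fun y => D 4 v y * w0 m ε y) ≤ Z := L2_le hF.v4 hA.v4
  unfold normB normH
  calc _ ≤ (L2 h + Z) + (L2 (D 1 h) + Z) + (L2 (fun y => D 2 h y * w0 m ε y) + Z)
        + (L2 (fun y => D 3 h y * w0 m ε y) + Z) + Z + Z + Z + Z + Z + Z := by gcongr
    _ = _ := by ring

end finiteness

end Coefficients

theorem ennreal_add_sq_le (a b : ℝ≥0∞) : (a + b) ^ 2 ≤ 4 * a ^ 2 + 4 * b ^ 2 := by
  rcases le_total a b with h | h
  · calc (a + b) ^ 2 ≤ (b + b) ^ 2 := by gcongr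
      _ = 4 * b ^ 2 := by ring
      _ ≤ _ := le_add_self
  · calc (a + b) ^ 2 ≤ (a + a) ^ 2 := by gcongr
      _ = 4 * a ^ 2 := by ring
      _ ≤ _ := le_self_add

/-- The difference of two trial functions. -/
def Trial.sub (T T' : Trial) : Trial where
  v y := T.v y - T'.v y
  v1 y := T.v1 y - T'.v1 y
  v2 y := T.v2 y - T'.v2 y
  v3 y := T.v3 y - T'.v3 y
  v4 y := T.v4 y - T'.v4 y
  d0 y hy := (T.d0 y hy).sub (T'.d0 y hy)
  d1 y hy := (T.d1 y hy).sub (T'.d1 y hy)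
  d2 y hy := (T.d2 y hy).sub (T'.d2 y hy)
  c0 := T.c0.sub T'.c0
  c1 := T.c1.sub T'.c1
  c2 := T.c2.sub T'.c2
  c3 := T.c3.sub T'.c3
  ac := T.ac.sub T'.ac
  z0 := by rw [T.z0, T'.z0, sub_zero]
  z1 := by rw [T.z1, T'.z1, sub_zero]

namespace Coefficients

variable {S : Coefficients}

theorem q_sub (T T' : Trial) (y : ℝ) : S.q (T.sub T') y = S.q T y - S.q T' y := by
  simp only [q, Trial.sub]; ring

theorem q1_sub (T T' : Trial) (y : ℝ) : S.q1 (T.sub T') y = S.q1 T y - S.q1 T' y := by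
  simp only [q1, Trial.sub]; ring

theorem q2_sub (T T' : Trial) (y : ℝ) : S.q2 (T.sub T') y = S.q2 T y - S.q2 T' y := by
  simp only [q2, q1_sub, q_sub]; simp only [Trial.sub]; ring

theorem op_sub (T T' : Trial) (y : ℝ) : S.op (T.sub T') y = S.op T y - S.op T' y := by
  simp only [op, Trial.sub]; ring

theorem Finite.sub {w : ℝ → ℝ} {T T' : Trial} (h : S.Finite w T) (h' : S.Finite w T') :
    S.Finite w (T.sub T') where
  q_div := (h.q_div.sub h'.q_div).ae_eq (Eventually.of_forall fun y => by
    simp only [Pi.sub_apply, q_sub]; ring)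
  q1 := (h.q1.sub h'.q1).ae_eq (Eventually.of_forall fun y => by
    simp only [Pi.sub_apply, q1_sub])
  q2 := (h.q2.sub h'.q2).ae_eq (Eventually.of_forall fun y => by
    simp only [Pi.sub_apply, q2_sub]; ring)
  v3 := (h.v3.sub h'.v3).ae_eq (Eventually.of_forall fun y => by
    simp only [Pi.sub_apply, Trial.sub]; ring)
  v4 := (h.v4.sub h'.v4).ae_eq (Eventually.of_forall fun y => by
    simp only [Pi.sub_apply, Trial.sub]; ring)

/-- Trial functions with the same image under a coercive operator coincide. -/
theorem Coercive.unique {w R R1 : ℝ → ℝ} {k δ B M : ℝ} (hC : S.Coercive R R1 k δ B)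
    (hB : S.Bounds w M) {T T' : Trial} (hF : S.Finite w T) (hF' : S.Finite w T')
    (h : ∀ᵐ y ∂halfLine, S.op T y = S.op T' y) : EqOn T.v T'.v (Ici 0) := fun y hy => by
  rcases (show 0 ≤ y from hy).eq_or_lt with h0 | h0
  · rw [← h0, T.z0, T'.z0]
  · have := hC.eq_zero hB (hF.sub hF') (h.mono fun y hy => by rw [op_sub, hy, sub_self]) y h0
    exact sub_eq_zero.1 this

/-- The coefficients of the symmetric part `v ↦ v_yyyy - (a v_yy - a_yy v)` of the operator. -/
def principal (S : Coefficients) : Coefficients where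
  a := S.a
  a1 := S.a1
  a2 := S.a2
  b := fun _ => 0
  b1 := fun _ => 0
  b2 := fun _ => 0
  e := fun _ => 0
  f := fun _ => 0
  da := S.da
  da1 := S.da1
  ca2 := S.ca2
  db y := hasDerivAt_const y 0
  db1 y := hasDerivAt_const y 0
  cb2 := continuous_const
  ce := continuous_const
  cf := continuous_const
  a_zero := S.a_zero
  b_zero := rfl
  c := S.c
  c_pos := S.c_pos
  low := S.low

theorem Bounds.principal {w : ℝ → ℝ} {M : ℝ} (hB : S.Bounds w M) : S.principal.Bounds w M := by
  have hM := hB.M_nonneg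
  exact ⟨hB.cw, hB.w_ge, hB.a_le, hB.a1_le, hB.a2_le,
    fun y hy => by simp only [Coefficients.principal, abs_zero, zero_mul]; positivity,
    fun y _ => by simpa [Coefficients.principal], fun y _ => by simpa [Coefficients.principal],
    fun y _ => by simpa [Coefficients.principal], fun y _ => by simpa [Coefficients.principal]⟩

theorem Coercive.principal {R R1 : ℝ → ℝ} {k δ B : ℝ} (hC : S.Coercive R R1 k δ B) :
    S.principal.Coercive R R1 k δ B where
  k_pos := hC.k_pos
  δ_pos := hC.δ_pos
  dR := hC.dR
  cR1 := hC.cR1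
  R_ge := hC.R_ge
  R_le := hC.R_le
  R1_nonpos := hC.R1_nonpos
  R1_le := hC.R1_le
  R1_slow := hC.R1_slow
  a2_le := hC.a2_le
  a2_sq_le := hC.a2_sq_le
  ab_le y hy := by
    simp only [Coefficients.principal, mul_zero, sub_zero, abs_zero]
    exact hC.δ_pos.le.trans (hC.R_ge y hy)
  ab1_le y hy := by
    simp only [Coefficients.principal, mul_zero, zero_mul, sub_zero, abs_zero]
    exact hC.δ_pos.le.trans (hC.R_ge y hy)
  e_le y hy := by
    simp only [Coefficients.principal, zero_mul, add_zero, abs_zero, mul_zero]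
    exact hC.δ_pos.le.trans (hC.R_ge y hy)
  f_le y hy := by
    simp only [Coefficients.principal, zero_mul, abs_zero, mul_zero]
    exact hC.δ_pos.le.trans (hC.R_ge y hy)
  large := hC.large
  large' := hC.large'

theorem op_principal (T : Trial) (y : ℝ) :
    S.principal.op T y = T.v4 y - (S.a y * T.v2 y - S.a2 y * T.v y) := by
  simp only [op, principal]; ring

/-- Positivity of the symmetric part. -/
theorem Coercive.principal_energy {w R R1 : ℝ → ℝ} {k δ B M : ℝ} (hC : S.Coercive R R1 k δ B)
    (hB : S.Bounds w M) {T : Trial} (hF : S.Finite w T) :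
    IntegrableOn (fun y => (T.v4 y - (S.a y * T.v2 y - S.a2 y * T.v y)) * S.q T y) (Ioi 0) ∧
    MemLp (fun y => √(S.a y) * S.q2 T y) 2 halfLine ∧
    MemLp (fun y => S.a y * S.q1 T y) 2 halfLine ∧
    1 / 2 * (∫ y in Ioi 0, (√(S.a y) * S.q2 T y) ^ 2)
      + 1 / 2 * (∫ y in Ioi 0, (S.a y * S.q1 T y) ^ 2) + S.a1 0 * S.l T ^ 2 ≤
      ∫ y in Ioi 0, (T.v4 y - (S.a y * T.v2 y - S.a2 y * T.v y)) * S.q T y := by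
  have hF' : S.principal.Finite w T := ⟨hF.q_div, hF.q1, hF.q2, hF.v3, hF.v4⟩
  obtain ⟨h1, h2, h3⟩ := hC.principal.energy hB.principal hF'
  have e : ∀ y, S.principal.op T y * S.principal.q T y =
      (T.v4 y - (S.a y * T.v2 y - S.a2 y * T.v y)) * S.q T y := fun y => by
    rw [op_principal]; rfl
  simp only [e] at h1 h3
  have m2 : MemLp (fun y => √(S.a y) * S.q2 T y) 2 halfLine :=
    memLp_two_weight_mono (fun y hy => hB.one_le hy)
      ((S.ca.sqrt.continuousOn.mul (S.cq2 T)).aesm) hF.q2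
  have m1 : MemLp (fun y => S.a y * S.q1 T y) 2 halfLine := by
    refine memLp_of_abs_le (hF.q1.const_mul M)
      ((S.ca.continuousOn.mul (S.cq1 T)).aesm) fun y hy => ?_
    rw [abs_mul, abs_mul, abs_of_pos (S.a_pos hy), abs_of_nonneg hB.M_nonneg]
    exact mul_le_right (hB.a_le_const hy) (abs_nonneg _)
  refine ⟨h1, m2, m1, le_trans (add_le_add ?_ le_rfl) h3⟩
  rw [← integral_const_mul, ← integral_const_mul,
    ← integral_add (m2.integrable_sq.const_mul _) (m1.integrable_sq.const_mul _)]
  refine integral_mono_ae ((m2.integrable_sq.const_mul _).add (m1.integrable_sq.const_mul _)) h2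
    (ae_of_pos fun y hy => ?_)
  have ha := S.a_pos hy
  have hδ := hC.δ_pos
  have e3 : S.principal.good T δ y = 1 / 2 * (S.a y * S.q2 T y ^ 2) +
    1 / 2 * (S.a y ^ 2 * S.q1 T y ^ 2) + δ * ((S.q T y / y) ^ 2 + S.q1 T y ^ 2) := rfl
  beta_reduce
  rw [e3, mul_pow, mul_pow, Real.sq_sqrt ha.le]
  exact le_add_of_nonneg_right (by positivity)

/-- Well-posedness of the boundary value problem for coefficients for which the operator is
coercive and onto. -/
theorem exists_wellPosed (m : ℕ) {c M δ : ℝ} (hc : 0 < c) (hM : 0 ≤ M) (hδ : 0 < δ) :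
    ∃ C : ℝ, 0 < C ∧ ∀ ε : ℝ, 0 < ε → ε ≤ 1 → ∀ S : Coefficients, S.c = c →
      S.Bounds (w0 m ε) M → ∀ (R R1 : ℝ → ℝ) (k B : ℝ), S.Coercive R R1 k δ B →
      (∀ F : ℝ → ℝ, MemLp (fun y => F y * w0 m ε y) 2 halfLine →
        ∃ T : Trial, S.Finite (w0 m ε) T ∧ ∀ᵐ y ∂halfLine, S.op T y = F y) →
      ∀ us vs : ℝ → ℝ → ℝ, S.Represents us vs ε →
      ∀ F h : ℝ → ℝ, MemLp (fun y => F y * w0 m ε y) 2 (volume.restrict (Ioi 0)) → IsDatum h →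
        (∃ v : ℝ → ℝ, IsSolution us vs m ε h F v) ∧
        (∀ v v' : ℝ → ℝ, IsSolution us vs m ε h F v → IsSolution us vs m ε h F v' →
          EqOn v v' (Ici 0)) ∧
        (∀ v : ℝ → ℝ, IsSolution us vs m ε h F v →
          IntegrableOn (fun y => F y * quot us v y) (Ioi 0) ∧
          normB us m ε (uZero h v) v ^ 2 ≤
            ENNReal.ofReal C * (‖∫ y in Ioi 0, F y * quot us v y‖ₑ
              + L2 (fun y => F y * w0 m ε y) ^ 2 + normH m ε h ^ 2) ∧
          IntegrableOn (fun y =>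
            (D 4 v y - D 1 (fun z => us 0 z ^ 2 * D 1 (quot us v) z) y) * quot us v y) (Ioi 0) ∧
          normQ us (quot us v) < ⊤ ∧
          1 / 6 * (normQ us (quot us v)).toReal ^ 2 ≤
            ∫ y in Ioi 0,
              (D 4 v y - D 1 (fun z => us 0 z ^ 2 * D 1 (quot us v) z) y) * quot us v y) := by
  obtain ⟨C, hC, hap⟩ := exists_apriori m hc hM hδ
  refine ⟨400 * C + 4, by positivity, fun ε hε hε1 S hSc hB R R1 k B hcoer hex us vs hS F h hF hh =>
    ⟨?_, ?_, ?_⟩⟩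
  · obtain ⟨T, hT, hop⟩ := hex F hF
    have hac : ∀ b, 0 < b → AbsolutelyContinuousOnInterval (D 3 T.v) 0 b := fun b hb =>
      T.absolutelyContinuous (hT.memLp_v4 hB) hb
    have hz1 : D 1 T.v 0 = 0 := by rw [T.D1_eq self_mem_Ici, T.z1]
    obtain ⟨l1, l2, l3⟩ := hT.tendsto_zero hB
    have hTF : S.Finite (w0 m ε) (Trial.ofFun T.v T.contDiffOn hac T.z0 hz1) := by
      have e1 : ∀ y, 0 < y → S.q1 (Trial.ofFun T.v T.contDiffOn hac T.z0 hz1) y = S.q1 T y :=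
        fun y hy => by
          show (D 1 T.v y * S.a y - T.v y * S.a1 y) / S.a y ^ 2 = _
          rw [T.D1_eq (le_of_lt hy)]; rfl
      have mem := ae_restrict_mem (μ := volume) (measurableSet_Ioi (a := (0 : ℝ)))
      refine ⟨hT.q_div, hT.q1.ae_eq (mem.mono fun y hy => (e1 y hy).symm),
        hT.q2.ae_eq (mem.mono fun y hy => ?_), hT.v3.ae_eq (mem.mono fun y hy => ?_),
        hT.v4.ae_eq (T.D4_eq.mono fun y hy => ?_)⟩
      · simp only []
        congr 2
        show _ = (D 2 T.v y - 2 * S.a1 y * S.q1 _ y - S.a2 y * S.q _ y) / S.a y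
        rw [e1 y hy, T.D2_eq (Ioi_subset_Ici_self hy)]; rfl
      · simp only []
        rw [← T.D3_eq (Ioi_subset_Ici_self hy)]; rfl
      · simp only []
        rw [← hy]; rfl
    have hm1 : MemLp (D 1 T.v) 2 halfLine :=
      (hT.memLp_v1 hB).ae_eq (ae_of_pos fun y hy =>
        (T.D1_eq (Ioi_subset_Ici_self hy)).symm)
    refine ⟨T.v, T.contDiffOn, hac, ?_, T.z0, hz1, ?_, (hh.memLp' 0).sub hm1,
      hT.memLp_v_div hB, ?_⟩
    · filter_upwards [hop, T.D4_eq, ae_restrict_mem measurableSet_Ioi] with y hy h4 (hpos : 0 < y)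
      rw [hS.lop_eq T.contDiffOn hac T.z0 hz1, ← hy]
      show D 4 T.v y - (S.a y * D 2 T.v y - S.a2 y * T.v y) -
        (S.b y * D 3 T.v y - D 1 T.v y * S.b2 y) + S.e y * T.v y + S.f y * D 1 T.v y = _
      rw [h4, T.D1_eq hpos.le, T.D2_eq hpos.le, T.D3_eq hpos.le]
      rfl
    · intro j hj
      rw [Finset.mem_Icc] at hj
      obtain ⟨j1, j2⟩ := hj
      have ev := eventually_ge_atTop (0 : ℝ)
      interval_cases j
      · exact l1.congr' (ev.mono fun y hy => (T.D1_eq hy).symm)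
      · exact l2.congr' (ev.mono fun y hy => (T.D2_eq hy).symm)
      · exact l3.congr' (ev.mono fun y hy => (T.D3_eq hy).symm)
    · refine (hS.normB_le hε1 hh T.contDiffOn hac T.z0 hz1 hB hTF
        (hap ε hε hε1 S hSc hB R R1 k B hcoer _ hTF)).trans_lt ?_
      have n0 : L2 h < ⊤ := (hh.memLp' 0).2
      have n1 : L2 (D 1 h) < ⊤ := (hh.memLp' 1).2
      have n2 : L2 (fun y => D 2 h y * w0 m ε y) < ⊤ := (hh.memLp m hε1 2).2
      have n3 : L2 (fun y => D 3 h y * w0 m ε y) < ⊤ := (hh.memLp m hε1 3).2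
      unfold normH
      refine ENNReal.add_lt_top.2 ⟨by simp [n0, n1, n2, n3], ?_⟩
      exact ENNReal.mul_lt_top (by norm_num) ENNReal.ofReal_lt_top
  · intro v v' H H'
    have f1 := hS.normB_le_top_imp H.contDiff H.absCont H.wall H.wall_deriv H.finite
    have f2 := hS.normB_le_top_imp H'.contDiff H'.absCont H'.wall H'.wall_deriv H'.finite
    refine hcoer.unique hB f1 f2 ?_
    filter_upwards [H.equation, H'.equation] with y h1 h2
    rw [← hS.lop_eq, ← hS.lop_eq, h1, h2]
  · intro v H
    have hTF := hS.normB_le_top_imp H.contDiff H.absCont H.wall H.wall_deriv H.finite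
    have hA := hap ε hε hε1 S hSc hB R R1 k B hcoer _ hTF
    have hNB := hS.normB_le hε1 hh H.contDiff H.absCont H.wall H.wall_deriv hB hTF hA
    have hE := hcoer.energy hB hTF
    have hP := hcoer.principal_energy hB hTF
    set T := Trial.ofFun v H.contDiff H.absCont H.wall H.wall_deriv with hT
    have hop : ∀ᵐ y ∂halfLine, S.op T y = F y := by
      filter_upwards [H.equation] with y hy
      rw [← hy, hS.lop_eq H.contDiff H.absCont H.wall H.wall_deriv]
    have hq : quot us v = S.q T := hS.quot_eq T
    have hint : (∫ y in Ioi 0, S.op T y * S.q T y) = ∫ y in Ioi 0, F y * quot us v y := by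
      rw [hq]; exact integral_congr_ae (hop.mono fun y hy => by simp only [hy])
    have hint2 : (∫ y in Ioi 0, (S.op T y * w0 m ε y) ^ 2) = ∫ y in Ioi 0, (F y * w0 m ε y) ^ 2 :=
      integral_congr_ae (hop.mono fun y hy => by simp only [hy])
    have hflux : ∀ y, 0 < y → (D 4 v y - D 1 (fun z => us 0 z ^ 2 * D 1 (quot us v) z) y) *
        quot us v y = (T.v4 y - (S.a y * T.v2 y - S.a2 y * T.v y)) * S.q T y := fun y hy => by
      rw [hq, ← hS.D1_flux T hy]
      rw [hS.quot_eq T]; rfl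
    have hfluxae := (ae_restrict_mem (μ := volume) (measurableSet_Ioi (a := (0 : ℝ)))).mono hflux
    have hN1 : L2 (fun y => √(us 0 y) * D 2 (quot us v) y) =
        L2 (fun y => √(S.a y) * S.q2 T y) := L2_congr fun y hy => by
      rw [hS.a, ← hS.D2_quot T hy]; rfl
    have hN2 : L2 (fun y => us 0 y * D 1 (quot us v) y) = L2 (fun y => S.a y * S.q1 T y) :=
      L2_congr fun y hy => by rw [hS.a, ← hS.D1_quot T hy]; rfl
    have hN3 : ‖√(pd 0 1 us 0 0) * D 1 (quot us v) 0‖ₑ = ‖√(S.a1 0) * S.l T‖ₑ := by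
      rw [hS.a1, ← hS.D1_quot_zero T]; rfl
    refine ⟨?_, ?_, ?_, ?_, ?_⟩
    · rw [hq]
      exact hE.1.congr (hop.mono fun y hy => by simp only [hy])
    · rw [hint, hint2] at hNB
      have hI0 : 0 ≤ |∫ y in Ioi 0, F y * quot us v y| := abs_nonneg _
      have hJ0 : 0 ≤ ∫ y in Ioi 0, (F y * w0 m ε y) ^ 2 := integral_nonneg fun _ => sq_nonneg _
      have k1 : ENNReal.ofReal (√(C * (|∫ y in Ioi 0, F y * quot us v y| +
          ∫ y in Ioi 0, (F y * w0 m ε y) ^ 2))) ^ 2 = ENNReal.ofReal C *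
          (‖∫ y in Ioi 0, F y * quot us v y‖ₑ + L2 (fun y => F y * w0 m ε y) ^ 2) := by
        rw [← ENNReal.ofReal_pow (Real.sqrt_nonneg _), Real.sq_sqrt (by positivity),
          ENNReal.ofReal_mul hC.le, ENNReal.ofReal_add hI0 hJ0, L2_sq hF,
          ← ENNReal.ofReal_pow (Real.sqrt_nonneg _), Real.sq_sqrt hJ0, ← ofReal_norm]
        rfl
      set Z := ENNReal.ofReal (√(C * (|∫ y in Ioi 0, F y * quot us v y| +
          ∫ y in Ioi 0, (F y * w0 m ε y) ^ 2)))
      have k2 : (normH m ε h + 10 * Z) ^ 2 ≤ 4 * normH m ε h ^ 2 + 400 * Z ^ 2 := by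
        refine (ennreal_add_sq_le _ _).trans_eq (by ring)
      refine (pow_le_pow_left₀ zero_le hNB 2).trans (k2.trans ?_)
      rw [k1, ENNReal.ofReal_add (by positivity) (by norm_num), ENNReal.ofReal_mul (by norm_num)]
      have e1 : ENNReal.ofReal 400 = 400 := by norm_num
      have e2 : ENNReal.ofReal 4 = 4 := by norm_num
      rw [e1, e2]
      set P := ENNReal.ofReal C
      set U := ‖∫ y in Ioi 0, F y * quot us v y‖ₑ + L2 (fun y => F y * w0 m ε y) ^ 2
      calc 4 * normH m ε h ^ 2 + 400 * (P * U) ≤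
          (4 * normH m ε h ^ 2 + 400 * (P * U)) + (4 * U + 400 * P * normH m ε h ^ 2) :=
            le_self_add
        _ = _ := by ring
    · exact hP.1.congr (hfluxae.mono fun y hy => hy.symm)
    · unfold normQ
      rw [hN1, hN2, hN3]
      exact ENNReal.add_lt_top.2 ⟨ENNReal.add_lt_top.2 ⟨hP.2.1.2, hP.2.2.1.2⟩, enorm_lt_top⟩
    · rw [integral_congr_ae hfluxae]
      refine le_trans ?_ hP.2.2.2
      unfold normQ
      rw [hN1, hN2, hN3, L2_sq hP.2.1, L2_sq hP.2.2.1, ← ofReal_norm,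
        ← ENNReal.ofReal_add (Real.sqrt_nonneg _) (Real.sqrt_nonneg _),
        ← ENNReal.ofReal_add (by positivity) (norm_nonneg _), ENNReal.toReal_ofReal (by positivity)]
      set A1 := ∫ y in Ioi 0, (√(S.a y) * S.q2 T y) ^ 2
      set A2 := ∫ y in Ioi 0, (S.a y * S.q1 T y) ^ 2
      have a1 : 0 ≤ A1 := integral_nonneg fun _ => sq_nonneg _
      have a2 : 0 ≤ A2 := integral_nonneg fun _ => sq_nonneg _
      have a3 : ‖√(S.a1 0) * S.l T‖ ^ 2 = S.a1 0 * S.l T ^ 2 := by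
        rw [Real.norm_eq_abs, sq_abs, mul_pow, Real.sq_sqrt (S.c_pos.le.trans S.slope_ge)]
      have a4 := three_sq_le (√A1) (√A2) ‖√(S.a1 0) * S.l T‖
      rw [a3, Real.sq_sqrt a1, Real.sq_sqrt a2] at a4
      have a5 : 0 ≤ S.a1 0 * S.l T ^ 2 := mul_nonneg (S.c_pos.le.trans S.slope_ge) (sq_nonneg _)
      linarith

end Coefficients

/-- Square integrable functions on the line. -/
abbrev Sq := Lp ℝ 2 (volume : Measure ℝ)

theorem abs_integral_mul_le {α : Type*} [MeasurableSpace α] {μ : Measure α} {f g : α → ℝ}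
    (hf : MemLp f 2 μ) (hg : MemLp g 2 μ) :
    |∫ x, f x * g x ∂μ| ≤ √(∫ x, f x ^ 2 ∂μ) * √(∫ x, g x ^ 2 ∂μ) := by
  have key : ∀ {u : α → ℝ} (hu : MemLp u 2 μ), √(∫ x, u x ^ 2 ∂μ) = ‖hu.toLp u‖ := by
    intro u hu
    rw [← Real.sqrt_sq (norm_nonneg (hu.toLp u)), ← real_inner_self_eq_norm_sq, L2.inner_def]
    congr 1
    refine integral_congr_ae ?_
    filter_upwards [hu.coeFn_toLp] with x hx
    simp [hx, pow_two]
  rw [key hf, key hg]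
  refine le_trans (le_of_eq ?_) (abs_real_inner_le_norm (hf.toLp f) (hg.toLp g))
  rw [L2.inner_def]
  congr 1
  refine integral_congr_ae ?_
  filter_upwards [hf.coeFn_toLp, hg.coeFn_toLp] with x hx hy
  simp [hx, hy, mul_comm]

theorem Sq.norm_eq (f : Sq) : ‖f‖ = √(∫ x, f x ^ 2) := by
  rw [← Real.sqrt_sq (norm_nonneg f), ← real_inner_self_eq_norm_sq, L2.inner_def]
  simp [pow_two]

theorem Sq.integral_sq (f : Sq) : ∫ x, f x ^ 2 = ‖f‖ ^ 2 := by
  rw [Sq.norm_eq, Real.sq_sqrt (integral_nonneg fun _ => sq_nonneg _)]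

/-- The map `K` is almost everywhere the action of a compact operator. -/
def CompactRep (K : Sq → ℝ → ℝ) : Prop :=
  ∃ A : Sq →L[ℝ] Sq, IsCompactOperator A ∧ ∀ f, A f =ᵐ[volume] K f

namespace CompactRep

theorem zero : CompactRep fun _ _ => 0 :=
  ⟨0, isCompactOperator_zero, fun f => by
    filter_upwards [Lp.coeFn_zero ℝ 2 (volume : Measure ℝ)] with x hx using hx⟩

theorem add {K K' : Sq → ℝ → ℝ} (h : CompactRep K) (h' : CompactRep K') :
    CompactRep fun f y => K f y + K' f y := by
  obtain ⟨A, hA, hK⟩ := h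
  obtain ⟨A', hA', hK'⟩ := h'
  refine ⟨A + A', hA.add hA', fun f => ?_⟩
  filter_upwards [Lp.coeFn_add (A f) (A' f), hK f, hK' f] with x h1 h2 h3
  rw [add_apply, h1, Pi.add_apply, h2, h3]

theorem sum {ι : Type*} (s : Finset ι) {K : ι → Sq → ℝ → ℝ} (h : ∀ i, CompactRep (K i)) :
    CompactRep fun f y => ∑ i ∈ s, K i f y := by
  classical
  induction s using Finset.induction_on with
  | empty => simpa using zero
  | insert a s ha ih =>
    simp only [Finset.sum_insert ha]
    exact (h a).add ih

theorem rankOne (φ : Sq →L[ℝ] ℝ) {e : ℝ → ℝ} (he : MemLp e 2 volume) :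
    CompactRep fun f y => φ f * e y := by
  have hc := (isCompactOperator_of_locallyCompactSpace_dom φ).clm_comp
    (ContinuousLinearMap.toSpanSingleton ℝ (he.toLp e))
  refine ⟨(ContinuousLinearMap.toSpanSingleton ℝ (he.toLp e)).comp φ, hc, fun f => ?_⟩
  filter_upwards [Lp.coeFn_smul (φ f) (he.toLp e), he.coeFn_toLp] with x h1 h2
  simp [h1, h2]

theorem of_approx {K : Sq → ℝ → ℝ} (hadd : ∀ f g, K (f + g) =ᵐ[volume] fun y => K f y + K g y)
    (hsmul : ∀ (r : ℝ) f, K (r • f) =ᵐ[volume] fun y => r * K f y)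
    (hmem : ∀ f, MemLp (K f) 2 volume)
    (happ : ∀ η : ℝ, 0 < η → ∃ K', CompactRep K' ∧
      ∀ f, eLpNorm (fun y => K f y - K' f y) 2 volume ≤ ENNReal.ofReal (η * ‖f‖)) :
    CompactRep K := by
  have hdiff : ∀ {A : Sq →L[ℝ] Sq} {K' : Sq → ℝ → ℝ} {η : ℝ}, 0 ≤ η →
      (∀ f, A f =ᵐ[volume] K' f) →
      (∀ f, eLpNorm (fun y => K f y - K' f y) 2 volume ≤ ENNReal.ofReal (η * ‖f‖)) →
      ∀ f, ‖(hmem f).toLp (K f) - A f‖ ≤ η * ‖f‖ := by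
    intro A K' η hη hA hle f
    have e : eLpNorm (⇑((hmem f).toLp (K f)) - ⇑(A f)) 2 volume ≤ ENNReal.ofReal (η * ‖f‖) := by
      refine le_trans (le_of_eq (eLpNorm_congr_ae ?_)) (hle f)
      filter_upwards [(hmem f).coeFn_toLp, hA f] with x h1 h2
      simp [h1, h2]
    rw [Lp.norm_def]
    refine ENNReal.toReal_le_of_le_ofReal (by positivity) ?_
    rw [eLpNorm_congr_ae (Lp.coeFn_sub _ _)]
    exact e
  let L : Sq →ₗ[ℝ] Sq :=
    { toFun := fun f => (hmem f).toLp (K f)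
      map_add' := fun f g => by
        rw [← MemLp.toLp_add, MemLp.toLp_eq_toLp_iff]
        exact hadd f g
      map_smul' := fun r f => by
        rw [RingHom.id_apply, ← MemLp.toLp_const_smul, MemLp.toLp_eq_toLp_iff]
        exact hsmul r f }
  obtain ⟨K1, ⟨A1, -, hA1⟩, hK1⟩ := happ 1 one_pos
  let A : Sq →L[ℝ] Sq := L.mkContinuous (1 + ‖A1‖) fun f => by
    have h1 := hdiff zero_le_one hA1 hK1 f
    have h2 := A1.le_opNorm f
    have h3 : ‖L f‖ ≤ ‖L f - A1 f‖ + ‖A1 f‖ := by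
      simpa using norm_add_le (L f - A1 f) (A1 f)
    have h4 : ‖L f - A1 f‖ ≤ 1 * ‖f‖ := h1
    linarith
  refine ⟨A, ?_, fun f => (hmem f).coeFn_toLp⟩
  have hcl : A ∈ closure {T : Sq →L[ℝ] Sq | IsCompactOperator T} := by
    rw [Metric.mem_closure_iff]
    intro η hη
    obtain ⟨K', ⟨A', hc, hA'⟩, hK'⟩ := happ (η / 2) (by positivity)
    refine ⟨A', hc, ?_⟩
    rw [dist_eq_norm]
    refine lt_of_le_of_lt (ContinuousLinearMap.opNorm_le_bound _ (by positivity) fun f => ?_)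
      (half_lt_self hη)
    exact hdiff (by positivity) hA' hK' f
  rwa [IsClosed.closure_eq isClosed_setOfPred_isCompactOperator] at hcl

end CompactRep

/-- A linear family of functions on the half line, uniformly bounded, Hölder continuous and square
integrable. -/
structure RegularFamily (P : Sq → ℝ → ℝ) (C : ℝ) : Prop where
  nonneg : 0 ≤ C
  add : ∀ f g y, 0 ≤ y → P (f + g) y = P f y + P g y
  smul : ∀ (r : ℝ) f y, 0 ≤ y → P (r • f) y = r * P f y
  bound : ∀ f y, 0 ≤ y → |P f y| ≤ C * ‖f‖
  modulus : ∀ f x y, 0 ≤ x → x ≤ y → y ≤ x + 1 → |P f y - P f x| ≤ C * ‖f‖ * √(y - x)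
  memLp : ∀ f, MemLp (P f) 2 halfLine
  sq_le : ∀ f, ∫ y in Ioi 0, P f y ^ 2 ≤ C ^ 2 * ‖f‖ ^ 2

/-- Evaluation of a regular family at a point. -/
def RegularFamily.eval {P : Sq → ℝ → ℝ} {C : ℝ} (h : RegularFamily P C) (y : ℝ) (hy : 0 ≤ y) :
    Sq →L[ℝ] ℝ :=
  LinearMap.mkContinuous
    { toFun := fun f => P f y
      map_add' := fun f g => h.add f g y hy
      map_smul' := fun r f => h.smul r f y hy } C fun f => h.bound f y hy

theorem exists_floor_mul {h y : ℝ} (hh : 0 < h) (hy : 0 ≤ y) :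
    (⌊y / h⌋₊ : ℝ) * h ≤ y ∧ y < (⌊y / h⌋₊ + 1 : ℝ) * h :=
  ⟨by rw [← le_div_iff₀ hh]; exact Nat.floor_le (by positivity),
    by rw [← div_lt_iff₀ hh]; exact Nat.lt_floor_add_one _⟩

theorem sum_indicator_cells {h y : ℝ} (hh : 0 < h) (hy : 0 ≤ y) (J : ℕ) (hJ : y < J * h)
    (u : ℕ → ℝ) : ∑ j ∈ Finset.range J,
      u j * (Ico ((j : ℝ) * h) ((j + 1 : ℝ) * h)).indicator (fun _ => (1 : ℝ)) y =
        u ⌊y / h⌋₊ := by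
  obtain ⟨h1, h2⟩ := exists_floor_mul hh hy
  rw [Finset.sum_eq_single ⌊y / h⌋₊]
  · rw [indicator_of_mem (by exact ⟨h1, h2⟩), mul_one]
  · intro j _ hj
    rw [indicator_of_notMem, mul_zero]
    rintro ⟨h3, h4⟩
    apply hj
    symm
    rw [Nat.floor_eq_iff (by positivity)]
    exact ⟨by rwa [le_div_iff₀ hh], by rwa [div_lt_iff₀ hh]⟩
  · intro hn
    exfalso
    apply hn
    rw [Finset.mem_range, Nat.floor_lt (by positivity), div_lt_iff₀ hh]
    exact hJ

theorem sum_indicator_cells_of_le {h y : ℝ} (hh : 0 < h) (J : ℕ) (hJ : J * h ≤ y)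
    (u : ℕ → ℝ) : ∑ j ∈ Finset.range J,
      u j * (Ico ((j : ℝ) * h) ((j + 1 : ℝ) * h)).indicator (fun _ => (1 : ℝ)) y = 0 := by
  refine Finset.sum_eq_zero fun j hj => ?_
  rw [indicator_of_notMem, mul_zero]
  rintro ⟨-, h4⟩
  have : (j + 1 : ℝ) ≤ J := by exact_mod_cast Finset.mem_range.1 hj
  nlinarith

/-- A regular family multiplied by a function which vanishes at infinity is compact. -/
theorem RegularFamily.compactRep {P : Sq → ℝ → ℝ} {C : ℝ} (hP : RegularFamily P C) {c : ℝ → ℝ}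
    (hc : ContinuousOn c (Ici 0)) (hlim : Tendsto c atTop (𝓝 0)) :
    CompactRep fun f => (Ioi 0).indicator fun y => c y * P f y := by
  have hC := hP.nonneg
  obtain ⟨B, hB0, hB⟩ : ∃ B : ℝ, 0 < B ∧ ∀ y, 0 ≤ y → |c y| ≤ B := by
    obtain ⟨R, hR⟩ := eventually_atTop.1 ((tendsto_zero_iff_abs_tendsto_zero c).1 hlim |>.eventually
      (ge_mem_nhds (zero_lt_one' ℝ)))
    obtain ⟨A, hA⟩ := isCompact_Icc.exists_bound_of_continuousOn (s := Icc 0 (max R 0))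
      (hc.mono Icc_subset_Ici_self)
    refine ⟨max A 1, by positivity, fun y hy => ?_⟩
    rcases le_total R y with h | h
    · exact (hR y h).trans (le_max_right _ _)
    · exact (hA y ⟨hy, h.trans (le_max_left _ _)⟩).trans (le_max_left _ _)
  have hcm : AEStronglyMeasurable c halfLine := (hc.mono Ioi_subset_Ici_self).aesm
  have hmul : ∀ f, MemLp (fun y => c y * P f y) 2 halfLine := fun f =>
    memLp_of_abs_le ((hP.memLp f).const_mul B) (hcm.mul (hP.memLp f).1) fun y hy => by
      rw [abs_mul, abs_mul, abs_of_pos hB0]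
      exact mul_le_right (hB y (le_of_lt hy)) (abs_nonneg _)
  refine CompactRep.of_approx (fun f g => Eventually.of_forall fun y => ?_)
    (fun r f => Eventually.of_forall fun y => ?_)
    (fun f => (memLp_indicator_iff_restrict measurableSet_Ioi).2 (hmul f)) fun η hη => ?_
  · by_cases hy : y ∈ Ioi (0 : ℝ)
    · simp only [indicator_of_mem hy, hP.add f g y (le_of_lt hy)]; ring
    · simp only [indicator_of_notMem hy, add_zero]
  · by_cases hy : y ∈ Ioi (0 : ℝ)
    · simp only [indicator_of_mem hy, hP.smul r f y (le_of_lt hy)]; ring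
    · simp only [indicator_of_notMem hy, mul_zero]
  -- the tail parameter and the mesh size
  set η' : ℝ := η / (C + 1) with hη'
  have hη'0 : 0 < η' := by positivity
  obtain ⟨R, hR⟩ := eventually_atTop.1 ((tendsto_zero_iff_abs_tendsto_zero c).1 hlim |>.eventually
    (ge_mem_nhds (show (0 : ℝ) < η' / 2 by positivity)))
  obtain ⟨n, hn⟩ := exists_nat_gt (max (max R 1) (4 * B ^ 2 / η' ^ 2))
  have hnR : R ≤ n := (le_max_left _ _).trans ((le_max_left _ _).trans hn.le)
  have hn1 : (1 : ℝ) ≤ n := (le_max_right _ _).trans ((le_max_left _ _).trans hn.le)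
  have hn0 : (0 : ℝ) < n := by linarith
  have hnB : 4 * B ^ 2 / η' ^ 2 ≤ n := (le_max_right _ _).trans hn.le
  set h : ℝ := 1 / (n : ℝ) ^ 2 with hh
  have hh0 : 0 < h := by positivity
  have hh1 : h ≤ 1 := by
    rw [hh, div_le_one (by positivity)]; exact one_le_pow₀ hn1
  have hsum : ((n ^ 3 : ℕ) : ℝ) * h = n := by rw [hh]; push_cast; field_simp
  have hcell : ∀ j : ℕ, MemLp ((Ioi 0).indicator fun y => c y *
      (Ico ((j : ℝ) * h) ((j + 1 : ℝ) * h)).indicator (fun _ => (1 : ℝ)) y) 2 volume := by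
    intro j
    rw [memLp_indicator_iff_restrict measurableSet_Ioi]
    have h1 : MemLp ((Ico ((j : ℝ) * h) ((j + 1 : ℝ) * h)).indicator fun _ => (1 : ℝ)) 2 halfLine :=
      memLp_indicator_const 2 measurableSet_Ico 1 (Or.inr (ne_of_lt
        ((Measure.restrict_apply_le _ _).trans_lt (by simp))))
    refine memLp_of_abs_le (h1.const_mul B) (hcm.mul h1.1) fun y hy => ?_
    rw [abs_mul, abs_mul, abs_of_pos hB0]
    exact mul_le_right (hB y (le_of_lt hy)) (abs_nonneg _)
  refine ⟨_, CompactRep.sum (Finset.range (n ^ 3)) fun j =>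
    CompactRep.rankOne (hP.eval (j * h) (by positivity)) (hcell j), fun f => ?_⟩
  set u : ℕ → ℝ := fun j => P f (j * h) with hu
  have hpt : ∀ y, 0 < y → (c y * P f y - c y * ∑ j ∈ Finset.range (n ^ 3),
      u j * (Ico ((j : ℝ) * h) ((j + 1 : ℝ) * h)).indicator (fun _ => (1 : ℝ)) y) ^ 2 ≤
      (Ioc (0 : ℝ) n).indicator (fun _ => B ^ 2 * C ^ 2 * ‖f‖ ^ 2 * h) y
        + (η' / 2) ^ 2 * P f y ^ 2 := by
    intro y hy
    rcases lt_or_ge y n with hyn | hyn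
    · rw [sum_indicator_cells hh0 hy.le _ (by rwa [hsum]), ← mul_sub, mul_pow,
        indicator_of_mem (show y ∈ Ioc (0 : ℝ) n from ⟨hy, hyn.le⟩)]
      obtain ⟨e1, e2⟩ := exists_floor_mul hh0 hy.le
      have e3 := hP.modulus f (⌊y / h⌋₊ * h) y (by positivity) e1 (by linarith)
      have e4 : y - ⌊y / h⌋₊ * h ≤ h := by linarith
      have e5 : |P f y - u ⌊y / h⌋₊| ≤ C * ‖f‖ * √h :=
        e3.trans (by gcongr)
      have e6 := pow_le_pow_left₀ (abs_nonneg _) e5 2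
      rw [sq_abs, mul_pow, Real.sq_sqrt hh0.le] at e6
      have e7 : c y ^ 2 ≤ B ^ 2 := by
        rw [← sq_abs]; exact pow_le_pow_left₀ (abs_nonneg _) (hB y hy.le) 2
      have e8 := mul_le_mul e7 e6 (sq_nonneg _) (sq_nonneg _)
      have e9 : 0 ≤ (η' / 2) ^ 2 * P f y ^ 2 := by positivity
      calc _ ≤ _ := e8
        _ ≤ B ^ 2 * C ^ 2 * ‖f‖ ^ 2 * h + (η' / 2) ^ 2 * P f y ^ 2 := by
          rw [mul_pow]; linarith
    · rw [sum_indicator_cells_of_le hh0 _ (by rwa [hsum]), mul_zero, sub_zero, mul_pow]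
      have e1 := pow_le_pow_left₀ (abs_nonneg _) (hR y (hnR.trans hyn)) 2
      rw [Function.comp_apply, sq_abs] at e1
      have e2 : 0 ≤ (Ioc (0 : ℝ) n).indicator (fun _ => B ^ 2 * C ^ 2 * ‖f‖ ^ 2 * h) y :=
        indicator_nonneg (fun _ _ => by positivity) y
      have e3 := mul_le_right e1 (sq_nonneg (P f y))
      linarith
  have hfun : (fun y => (Ioi 0).indicator (fun y => c y * P f y) y -
      ∑ j ∈ Finset.range (n ^ 3), hP.eval (j * h) (by positivity) f * (Ioi 0).indicator
        (fun y => c y * (Ico ((j : ℝ) * h) ((j + 1 : ℝ) * h)).indicator (fun _ => (1 : ℝ)) y) y) =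
      (Ioi 0).indicator fun y => c y * P f y - c y * ∑ j ∈ Finset.range (n ^ 3),
        u j * (Ico ((j : ℝ) * h) ((j + 1 : ℝ) * h)).indicator (fun _ => (1 : ℝ)) y := by
    funext y
    by_cases hy : y ∈ Ioi (0 : ℝ)
    · simp only [indicator_of_mem hy, Finset.mul_sum]
      congr 1
      refine Finset.sum_congr rfl fun j _ => ?_
      show P f (j * h) * _ = _
      simp only [hu]; ring
    · simp only [indicator_of_notMem hy, mul_zero, Finset.sum_const_zero, sub_zero]
  rw [hfun, eLpNorm_indicator_eq_eLpNorm_restrict measurableSet_Ioi]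
  have hD : MemLp (fun y => c y * P f y - c y * ∑ j ∈ Finset.range (n ^ 3),
        u j * (Ico ((j : ℝ) * h) ((j + 1 : ℝ) * h)).indicator (fun _ => (1 : ℝ)) y) 2 halfLine := by
    refine (hmul f).sub ?_
    have : MemLp (fun y => ∑ j ∈ Finset.range (n ^ 3), u j * (c y *
        (Ico ((j : ℝ) * h) ((j + 1 : ℝ) * h)).indicator (fun _ => (1 : ℝ)) y)) 2 halfLine :=
      memLp_finsetSum _ fun j _ =>
        ((memLp_indicator_iff_restrict measurableSet_Ioi).1 (hcell j)).const_mul _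
    refine this.ae_eq (Eventually.of_forall fun y => ?_)
    simp only [Finset.mul_sum]
    exact Finset.sum_congr rfl fun j _ => by ring
  have hL := L2_sq hD
  unfold L2 at hL
  rw [hL]
  refine ENNReal.ofReal_le_ofReal ?_
  rw [Real.sqrt_le_left (by positivity)]
  have hIoc : Integrable ((Ioc (0 : ℝ) n).indicator fun _ => B ^ 2 * C ^ 2 * ‖f‖ ^ 2 * h)
      halfLine :=
    (integrable_indicator_iff measurableSet_Ioc).2
      (integrableOn_const ((Measure.restrict_apply_le _ _).trans_lt (by simp)).ne)
  have hPi := (hP.memLp f).integrable_sq.const_mul ((η' / 2) ^ 2)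
  have h1 := integral_mono_ae hD.integrable_sq (hIoc.add hPi)
    (ae_of_pos hpt)
  rw [integral_add' hIoc hPi, integral_const_mul, integral_indicator measurableSet_Ioc,
    Measure.restrict_restrict measurableSet_Ioc,
    inter_eq_left.2 (Ioc_subset_Ioi_self : Ioc (0 : ℝ) n ⊆ Ioi 0), setIntegral_const,
    Real.volume_real_Ioc_of_le hn0.le, smul_eq_mul, sub_zero] at h1
  have h2 := mul_le_left (hP.sq_le f) (sq_nonneg (η' / 2))
  have h3 : (n : ℝ) * (B ^ 2 * C ^ 2 * ‖f‖ ^ 2 * h) ≤ (η' / 2) ^ 2 * (C ^ 2 * ‖f‖ ^ 2) := by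
    have e1 : (n : ℝ) * (B ^ 2 * C ^ 2 * ‖f‖ ^ 2 * h) = B ^ 2 / n * (C ^ 2 * ‖f‖ ^ 2) := by
      rw [hh]; field_simp
    rw [e1]
    refine mul_le_right ?_ (by positivity)
    rw [div_le_iff₀ hn0]
    rw [div_le_iff₀ (by positivity)] at hnB
    linarith
  have h4 : (η' / 2) ^ 2 * (C ^ 2 * ‖f‖ ^ 2) + (η' / 2) ^ 2 * (C ^ 2 * ‖f‖ ^ 2) ≤
      (η * ‖f‖) ^ 2 := by
    have e1 : η = η' * (C + 1) := by rw [hη']; field_simp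
    have e2 : C ^ 2 ≤ (C + 1) ^ 2 := by gcongr; linarith
    have e3 := mul_le_left e2 (show 0 ≤ η' ^ 2 * ‖f‖ ^ 2 by positivity)
    rw [e1]
    have e4 : 0 ≤ η' ^ 2 * ‖f‖ ^ 2 * C ^ 2 := by positivity
    nlinarith
  linarith

theorem integrable_of_intervalIntegral_le {f : ℝ → ℝ} {K : ℝ} (hc : ContinuousOn f (Ici 0))
    (h0 : ∀ y, 0 ≤ y → 0 ≤ f y) (h : ∀ x R, 0 < x → x ≤ R → ∫ y in x..R, f y ≤ K) :
    Integrable f halfLine ∧ ∫ y in Ioi 0, f y ≤ K := by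
  have hii : ∀ a b : ℝ, 0 ≤ a → 0 ≤ b → IntervalIntegrable f volume a b := fun a b ha hb =>
    (hc.mono fun y hy => (le_min ha hb).trans hy.1).intervalIntegrable
  have hR : ∀ R : ℝ, 0 < R → ∫ y in (0 : ℝ)..R, f y ≤ K := by
    intro R hR
    have hcont : ContinuousOn (fun x => ∫ y in R..x, f y) (uIcc R 0) :=
      intervalIntegral.continuousOn_primitive_interval' (hii _ _ hR.le le_rfl) left_mem_uIcc
    have h1 : Tendsto (fun x => -∫ y in R..x, f y) (𝓝[>] 0) (𝓝 (-∫ y in R..0, f y)) := by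
      refine Tendsto.neg (((hcont 0 right_mem_uIcc).tendsto).mono_left ?_)
      rw [uIcc_of_ge hR.le]
      exact nhdsWithin_le_of_mem (mem_of_superset (Ioc_mem_nhdsGT hR) Ioc_subset_Icc_self)
    rw [intervalIntegral.integral_symm]
    refine le_of_tendsto h1 ?_
    filter_upwards [Ioc_mem_nhdsGT hR] with x hx
    rw [← intervalIntegral.integral_symm]
    exact h x R hx.1 hx.2
  have hint : IntegrableOn f (Ioi 0) := by
    refine integrableOn_Ioi_of_intervalIntegral_norm_bounded (b := fun R : ℝ => R) (l := atTop) K 0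
      (fun R => ?_) tendsto_id ?_
    · exact ((hc.mono Icc_subset_Ici_self).integrableOn_Icc (b := R)).mono_set Ioc_subset_Icc_self
    · filter_upwards [eventually_gt_atTop 0] with R hpos
      refine le_trans (le_of_eq (intervalIntegral.integral_congr fun y hy => ?_)) (hR R hpos)
      rw [uIcc_of_le hpos.le] at hy
      exact Real.norm_of_nonneg (h0 y hy.1)
  refine ⟨hint, le_of_tendsto (intervalIntegral_tendsto_integral_Ioi 0 hint tendsto_id) ?_⟩
  filter_upwards [eventually_gt_atTop 0] with R hpos using hR R hpos

/-- Bounded solutions of `u' = s u + g` with square integrable `g` are square integrable. -/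
theorem LocAC.memLp_of_ode {u u' g : ℝ → ℝ} {s B : ℝ} (hs : s ≠ 0) (hu : LocAC u u')
    (hcu : ContinuousOn u (Ici 0)) (hode : ∀ᵐ y ∂halfLine, u' y = s * u y + g y)
    (hB : ∀ y, 0 ≤ y → |u y| ≤ B) (hg : MemLp g 2 halfLine) :
    MemLp u 2 halfLine ∧
      ∫ y in Ioi 0, u y ^ 2 ≤ (B ^ 2 + (∫ y in Ioi 0, g y ^ 2) / |s|) / |s| := by
  have hs0 : 0 < |s| := abs_pos.2 hs
  have hmeas := (hcu.mono Ioi_subset_Ici_self).aesm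
  have key : ∀ x R : ℝ, 0 < x → x ≤ R →
      ∫ y in x..R, u y ^ 2 ≤ (B ^ 2 + (∫ y in Ioi 0, g y ^ 2) / |s|) / |s| := by
    intro x R hx hxR
    have hIu : IntervalIntegrable (fun y => u y ^ 2) volume x R :=
      ((hcu.pow 2).mono (by rw [uIcc_of_le hxR]; exact fun y hy => hx.le.trans hy.1)).intervalIntegrable
    have hsub : Ioc x R ⊆ Ioi 0 := fun y hy => hx.trans hy.1
    have hIg : IntervalIntegrable (fun y => g y ^ 2) volume x R :=
      (intervalIntegrable_iff_integrableOn_Ioc_of_le hxR).2 (hg.integrable_sq.mono_measure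
        (Measure.restrict_mono hsub le_rfl))
    have hsq := (hu.mul hu).congr_deriv (g' := fun y => 2 * s * u y ^ 2 + 2 * (u y * g y))
      (hode.mono fun y hy => by rw [hy]; ring)
    have huR : MemLp u 2 (volume.restrict (Ioc x R)) := by
      rw [memLp_two_iff_integrable_sq (hmeas.mono_measure (Measure.restrict_mono hsub le_rfl))]
      exact (intervalIntegrable_iff_integrableOn_Ioc_of_le hxR).1 hIu
    have hgR : MemLp g 2 (volume.restrict (Ioc x R)) :=
      hg.mono_measure (Measure.restrict_mono hsub le_rfl)
    have hIug : IntervalIntegrable (fun y => u y * g y) volume x R :=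
      (intervalIntegrable_iff_integrableOn_Ioc_of_le hxR).2 (huR.integrable_mul hgR)
    have e1 := hsq.integral_eq hx hxR
    rw [intervalIntegral.integral_add (hIu.const_mul _) (hIug.const_mul _),
      intervalIntegral.integral_const_mul, intervalIntegral.integral_const_mul] at e1
    set U := ∫ y in x..R, u y ^ 2
    set W := ∫ y in x..R, u y * g y
    have hU0 : 0 ≤ U := intervalIntegral.integral_nonneg hxR fun _ _ => sq_nonneg _
    have e2 : |2 * W| ≤ |s| * U + (∫ y in x..R, g y ^ 2) / |s| := by
      have a1 : ∀ y, |2 * (u y * g y)| ≤ |s| * u y ^ 2 + g y ^ 2 / |s| := fun y => by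
        rw [abs_mul, abs_two, abs_mul, ← sq_abs (u y), ← sq_abs (g y), ← sub_nonneg]
        have : |s| * |u y| ^ 2 + |g y| ^ 2 / |s| - 2 * (|u y| * |g y|) =
          (|s| * |u y| - |g y|) ^ 2 / |s| := by field_simp; ring
        rw [this]; positivity
      have a2 := intervalIntegral.norm_integral_le_of_norm_le (f := fun y => 2 * (u y * g y))
        (g := fun y => |s| * u y ^ 2 + g y ^ 2 / |s|) hxR (ae_of_all _ fun y _ => a1 y)
        ((hIu.const_mul _).add (hIg.div_const _))
      rwa [intervalIntegral.integral_add (hIu.const_mul _) (hIg.div_const _),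
        intervalIntegral.integral_const_mul, intervalIntegral.integral_const_mul,
        intervalIntegral.integral_div] at a2
    have e3 : ∫ y in x..R, g y ^ 2 ≤ ∫ y in Ioi 0, g y ^ 2 := by
      rw [intervalIntegral.integral_of_le hxR]
      exact setIntegral_mono_set hg.integrable_sq (ae_of_all _ fun _ => sq_nonneg _)
        hsub.eventuallyLE
    have e4 : |u R * u R - u x * u x| ≤ B ^ 2 := by
      have b1 := pow_le_pow_left₀ (abs_nonneg _) (hB R (hx.le.trans hxR)) 2
      have b2 := pow_le_pow_left₀ (abs_nonneg _) (hB x hx.le) 2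
      rw [sq_abs] at b1 b2
      rw [abs_le]; constructor <;> nlinarith [sq_nonneg (u R), sq_nonneg (u x)]
    have e5 : 2 * (|s| * U) ≤ B ^ 2 + |2 * W| := by
      have : 2 * (|s| * U) = |(u R * u R - u x * u x) - 2 * W| := by
        rw [← e1, show 2 * s * U + 2 * W - 2 * W = 2 * (s * U) by ring, abs_mul, abs_mul, abs_two,
          abs_of_nonneg hU0]
      rw [this]
      exact (abs_sub _ _).trans (by linarith)
    have e6 := div_le_div_of_nonneg_right e3 hs0.le
    rw [le_div_iff₀ hs0]
    linarith
  obtain ⟨h1, h2⟩ := integrable_of_intervalIntegral_le (hcu.pow 2) (fun _ _ => sq_nonneg _) key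
  exact ⟨(memLp_two_iff_integrable_sq hmeas).2 h1, h2⟩

theorem locAC_primitive {u : ℝ → ℝ} (hu : ∀ x y, IntervalIntegrable u volume x y) :
    LocAC (fun y => ∫ z in (0 : ℝ)..y, u z) u := by
  refine ⟨fun x y hx hxy => ?_, ?_⟩
  · exact ((hu 0 y).absolutelyContinuousOnInterval_intervalIntegral (c := 0) (by simp)).mono (by
      rw [uIcc_of_le hxy, uIcc_of_le (hx.le.trans hxy)]; exact Icc_subset_Icc_left hx.le)
  · refine ae_restrict_of_ae ?_
    have h1 : ∀ n : ℕ, ∀ᵐ y : ℝ, y ∈ uIcc (-(n : ℝ)) n →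
        HasDerivAt (fun y => ∫ z in (0 : ℝ)..y, u z) (u y) y := fun n => by
      filter_upwards [(hu (-(n : ℝ)) n).ae_hasDerivAt_integral] with y hy hmem
      refine hy hmem 0 ?_
      rw [uIcc_of_le (by linarith [Nat.cast_nonneg (α := ℝ) n])]
      constructor <;> linarith [Nat.cast_nonneg (α := ℝ) n]
    filter_upwards [ae_all_iff.2 h1] with y hy
    obtain ⟨n, hn⟩ := exists_nat_gt |y|
    rw [abs_lt] at hn
    refine hy n ?_
    rw [uIcc_of_le (by linarith)]
    exact ⟨hn.1.le, hn.2.le⟩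

section green

variable (μ : ℝ) (f g : Sq)

/-- The solution of `k' = μ k + f` which is bounded at infinity. -/
def back (y : ℝ) : ℝ := -(Real.exp (μ * y) * ∫ z in Ioi y, Real.exp (-(μ * z)) * f z)

/-- The solution of `G' = -μ G + back μ f` which vanishes at the wall. -/
def fwd (y : ℝ) : ℝ := Real.exp (-(μ * y)) * ∫ z in (0 : ℝ)..y, Real.exp (μ * z) * back μ f z

theorem back_smul (μ : ℝ) (f : Sq) (r : ℝ) (y : ℝ) : back μ (r • f) y = r * back μ f y := by
  have : ∫ z in Ioi y, Real.exp (-(μ * z)) * (r • f : Sq) z =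
      r * ∫ z in Ioi y, Real.exp (-(μ * z)) * f z := by
    rw [← integral_const_mul]
    refine integral_congr_ae (ae_restrict_of_ae ?_)
    filter_upwards [Lp.coeFn_smul r f] with z hz
    rw [hz, Pi.smul_apply, smul_eq_mul]; ring
  unfold back; rw [this]; ring

theorem fwd_smul (μ : ℝ) (f : Sq) (r : ℝ) (y : ℝ) : fwd μ (r • f) y = r * fwd μ f y := by
  unfold fwd
  simp only [back_smul]
  simp only [mul_left_comm _ r]
  rw [intervalIntegral.integral_const_mul]
  ring

variable {μ} (hμ : 0 < μ)
include hμ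

theorem integral_exp_sq (y : ℝ) :
    IntegrableOn (fun z => Real.exp (-(μ * z)) ^ 2) (Ioi y) ∧
    ∫ z in Ioi y, Real.exp (-(μ * z)) ^ 2 = Real.exp (-(μ * y)) ^ 2 / (2 * μ) := by
  have e : ∀ z, Real.exp (-(μ * z)) ^ 2 = Real.exp (-(2 * μ) * z) := fun z => by
    rw [← Real.exp_nat_mul]; congr 1; push_cast; ring
  simp only [e]
  refine ⟨integrableOn_exp_mul_Ioi (by linarith) y, ?_⟩
  rw [integral_exp_mul_Ioi (by linarith)]
  field_simp

theorem memLp_exp (y : ℝ) : MemLp (fun z => Real.exp (-(μ * z))) 2 (volume.restrict (Ioi y)) :=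
  (memLp_two_iff_integrable_sq (by fun_prop)).2 (integral_exp_sq hμ y).1

theorem integrableOn_exp_mul (y : ℝ) :
    IntegrableOn (fun z => Real.exp (-(μ * z)) * f z) (Ioi y) :=
  (memLp_exp hμ y).integrable_mul ((Lp.memLp f).restrict _)

theorem abs_back_le (y : ℝ) : |back μ f y| ≤ 1 / √(2 * μ) * ‖f‖ := by
  have h := abs_integral_mul_le (memLp_exp hμ y) ((Lp.memLp f).restrict (Ioi y))
  rw [(integral_exp_sq hμ y).2, Real.sqrt_div (sq_nonneg _), Real.sqrt_sq (Real.exp_pos _).le] at h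
  have h2 : √(∫ z in Ioi y, f z ^ 2) ≤ ‖f‖ := by
    rw [Sq.norm_eq]
    exact Real.sqrt_le_sqrt (setIntegral_le_integral (Lp.memLp f).integrable_sq
      (ae_of_all _ fun _ => sq_nonneg _))
  unfold back
  rw [abs_neg, abs_mul, abs_of_pos (Real.exp_pos _)]
  calc _ ≤ Real.exp (μ * y) * (Real.exp (-(μ * y)) / √(2 * μ) * ‖f‖) := by gcongr; exact h.trans (by gcongr)
    _ = (Real.exp (μ * y) * Real.exp (-(μ * y))) * (1 / √(2 * μ) * ‖f‖) := by ring
    _ = _ := by rw [← Real.exp_add, add_neg_cancel, Real.exp_zero, one_mul]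

theorem back_add (y : ℝ) : back μ (f + g) y = back μ f y + back μ g y := by
  have : ∫ z in Ioi y, Real.exp (-(μ * z)) * (f + g : Sq) z =
      (∫ z in Ioi y, Real.exp (-(μ * z)) * f z) + ∫ z in Ioi y, Real.exp (-(μ * z)) * g z := by
    rw [← integral_add (integrableOn_exp_mul f hμ y) (integrableOn_exp_mul g hμ y)]
    refine integral_congr_ae (ae_restrict_of_ae ?_)
    filter_upwards [Lp.coeFn_add f g] with z hz
    rw [hz, Pi.add_apply]; ring
  unfold back; rw [this]; ring

theorem back_eq (y : ℝ) : back μ f y = Real.exp (μ * y) *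
    ((∫ z in (0 : ℝ)..y, Real.exp (-(μ * z)) * f z) - ∫ z in Ioi 0, Real.exp (-(μ * z)) * f z) := by
  have := intervalIntegral.integral_Ioi_sub_Ioi' (integrableOn_exp_mul f hμ 0)
    (integrableOn_exp_mul f hμ y)
  rw [← this]; unfold back; ring

theorem intervalIntegrable_exp_mul (x y : ℝ) :
    IntervalIntegrable (fun z => Real.exp (-(μ * z)) * f z) volume x y :=
  ⟨(integrableOn_exp_mul f hμ x).mono_set Ioc_subset_Ioi_self,
    (integrableOn_exp_mul f hμ y).mono_set Ioc_subset_Ioi_self⟩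

theorem continuous_back : Continuous (back μ f) := by
  have h : Continuous fun y => ∫ z in (0 : ℝ)..y, Real.exp (-(μ * z)) * f z :=
    intervalIntegral.continuous_primitive (fun x y => intervalIntegrable_exp_mul f hμ x y) 0
  rw [funext (back_eq f hμ)]
  fun_prop

theorem locAC_back : LocAC (back μ f) fun y => μ * back μ f y + f y := by
  have hP := locAC_primitive fun x y => intervalIntegrable_exp_mul f hμ x y
  have hconst : LocAC (fun _ => ∫ z in Ioi 0, Real.exp (-(μ * z)) * f z) fun _ => 0 :=
    LocAC.of_hasDerivAt (fun y _ => hasDerivAt_const y _) continuousOn_const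
  have hexp : LocAC (fun y => Real.exp (μ * y)) fun y => μ * Real.exp (μ * y) := by
    refine LocAC.of_hasDerivAt (fun y _ => ?_) (by fun_prop)
    simpa [mul_comm] using ((hasDerivAt_id y).const_mul μ).exp
  have := (hexp.mul (hP.sub hconst)).congr_deriv (g' := fun y => μ * back μ f y + f y)
    (ae_of_all _ fun y => by
      rw [back_eq f hμ y]
      have : Real.exp (μ * y) * Real.exp (-(μ * y)) = 1 := by
        rw [← Real.exp_add, add_neg_cancel, Real.exp_zero]
      linear_combination f y * this)
  rw [funext (back_eq f hμ)] at this ⊢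
  exact this

theorem hasDerivAt_fwd (y : ℝ) : HasDerivAt (fwd μ f) (-μ * fwd μ f y + back μ f y) y := by
  have hc := continuous_back f hμ
  have h1 : HasDerivAt (fun y => ∫ z in (0 : ℝ)..y, Real.exp (μ * z) * back μ f z)
      (Real.exp (μ * y) * back μ f y) y :=
    intervalIntegral.integral_hasDerivAt_right ((by fun_prop : Continuous fun z =>
      Real.exp (μ * z) * back μ f z).intervalIntegrable _ _)
      ((by fun_prop : Continuous fun z =>
        Real.exp (μ * z) * back μ f z).stronglyMeasurableAtFilter _ _)
      (by fun_prop)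
  have h2 : HasDerivAt (fun y => Real.exp (-(μ * y))) (-μ * Real.exp (-(μ * y))) y := by
    simpa [mul_comm] using ((hasDerivAt_id y).const_mul μ).neg.exp
  refine (h2.mul h1).congr_deriv ?_
  have : Real.exp (-(μ * y)) * Real.exp (μ * y) = 1 := by
    rw [← Real.exp_add, neg_add_cancel, Real.exp_zero]
  unfold fwd
  linear_combination back μ f y * this

theorem continuous_fwd : Continuous (fwd μ f) :=
  continuous_of_hasDerivAt (hasDerivAt_fwd f hμ)

theorem fwd_add (y : ℝ) : fwd μ (f + g) y = fwd μ f y + fwd μ g y := by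
  have c1 := continuous_back f hμ
  have c2 := continuous_back g hμ
  unfold fwd
  rw [← mul_add, ← intervalIntegral.integral_add ((by fun_prop : Continuous fun z =>
    Real.exp (μ * z) * back μ f z).intervalIntegrable _ _) ((by fun_prop : Continuous fun z =>
    Real.exp (μ * z) * back μ g z).intervalIntegrable _ _)]
  simp only [back_add f g hμ, mul_add]

theorem abs_fwd_le {y : ℝ} (hy : 0 ≤ y) : |fwd μ f y| ≤ 1 / √(2 * μ) * ‖f‖ / μ := by
  have c1 := continuous_back f hμ
  set B := 1 / √(2 * μ) * ‖f‖
  have hB : 0 ≤ B := by positivity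
  have h1 : ‖∫ z in (0 : ℝ)..y, Real.exp (μ * z) * back μ f z‖ ≤
      ∫ z in (0 : ℝ)..y, B * Real.exp (μ * z) := by
    refine intervalIntegral.norm_integral_le_of_norm_le hy (ae_of_all _ fun z _ => ?_)
      ((by fun_prop : Continuous fun z => B * Real.exp (μ * z)).intervalIntegrable _ _)
    rw [norm_mul, Real.norm_of_nonneg (Real.exp_pos _).le, mul_comm]
    exact mul_le_right (abs_back_le f hμ z) (Real.exp_pos _).le
  have h2 : ∫ z in (0 : ℝ)..y, Real.exp (μ * z) = (Real.exp (μ * y) - 1) / μ := by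
    have := intervalIntegral.integral_eq_sub_of_hasDerivAt (a := 0) (b := y)
      (f := fun z => Real.exp (μ * z) / μ) (f' := fun z => Real.exp (μ * z)) (fun z _ => by
        have := (((hasDerivAt_id z).const_mul μ).exp).div_const μ
        simp only [id, mul_one] at this
        refine this.congr_deriv (by field_simp))
      ((by fun_prop : Continuous fun z : ℝ => Real.exp (μ * z)).intervalIntegrable _ _)
    rw [this, mul_zero, Real.exp_zero]; ring
  rw [intervalIntegral.integral_const_mul, h2, Real.norm_eq_abs] at h1
  unfold fwd
  rw [abs_mul, abs_of_pos (Real.exp_pos _)]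
  have h3 : Real.exp (-(μ * y)) * Real.exp (μ * y) = 1 := by
    rw [← Real.exp_add, neg_add_cancel, Real.exp_zero]
  calc _ ≤ Real.exp (-(μ * y)) * (B * ((Real.exp (μ * y) - 1) / μ)) := by gcongr
    _ = B / μ * (1 - Real.exp (-(μ * y))) := by linear_combination B / μ * h3
    _ ≤ B / μ * 1 := by gcongr; linarith [Real.exp_pos (-(μ * y))]
    _ = _ := mul_one _

/-- The square norms of the Green operators. -/
theorem exists_green_bound : ∃ C : ℝ, 0 ≤ C ∧ ∀ f : Sq,
    (∀ y, 0 ≤ y → |back μ f y| ≤ C * ‖f‖) ∧ (∀ y, 0 ≤ y → |fwd μ f y| ≤ C * ‖f‖) ∧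
    MemLp (back μ f) 2 halfLine ∧ ∫ y in Ioi 0, back μ f y ^ 2 ≤ C ^ 2 * ‖f‖ ^ 2 ∧
    MemLp (fwd μ f) 2 halfLine ∧ ∫ y in Ioi 0, fwd μ f y ^ 2 ≤ C ^ 2 * ‖f‖ ^ 2 := by
  set B : ℝ := 1 / √(2 * μ) with hB
  set X : ℝ := (B ^ 2 + 1 / μ) / μ with hX
  set Y : ℝ := ((B / μ) ^ 2 + X / μ) / μ with hY
  have hB0 : 0 ≤ B := by positivity
  have hX0 : 0 ≤ X := by positivity
  have hY0 : 0 ≤ Y := by positivity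
  have hsX := Real.sqrt_nonneg X
  have hsY := Real.sqrt_nonneg Y
  have hBμ : 0 ≤ B / μ := by positivity
  refine ⟨B + B / μ + √X + √Y, by positivity, fun f => ?_⟩
  have hf := norm_nonneg f
  have t1 : ∀ x y : ℝ, 0 ≤ x → x ≤ √y → 0 ≤ y → x ^ 2 ≤ y := fun x y hx hxy hy => by
    have := pow_le_pow_left₀ hx hxy 2
    rwa [Real.sq_sqrt hy] at this
  have sX : X ≤ (B + B / μ + √X + √Y) ^ 2 := by
    calc X = (√X) ^ 2 := (Real.sq_sqrt hX0).symm
      _ ≤ _ := by gcongr; linarith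
  have sY : Y ≤ (B + B / μ + √X + √Y) ^ 2 := by
    calc Y = (√Y) ^ 2 := (Real.sq_sqrt hY0).symm
      _ ≤ _ := by gcongr; linarith
  have b1 := fun y => abs_back_le f hμ y
  have b2 := fun y (hy : 0 ≤ y) => abs_fwd_le f hμ hy
  have hf2 : ∫ y in Ioi 0, f y ^ 2 ≤ ‖f‖ ^ 2 := by
    rw [← Sq.integral_sq]
    exact setIntegral_le_integral (Lp.memLp f).integrable_sq (ae_of_all _ fun _ => sq_nonneg _)
  obtain ⟨m1, i1⟩ := (locAC_back f hμ).memLp_of_ode hμ.ne' (continuous_back f hμ).continuousOn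
    (ae_of_all _ fun _ => rfl) (fun y _ => b1 y) ((Lp.memLp f).restrict _)
  have i1' : ∫ y in Ioi 0, back μ f y ^ 2 ≤ X * ‖f‖ ^ 2 := by
    refine i1.trans ?_
    rw [abs_of_pos hμ]
    calc _ ≤ ((B * ‖f‖) ^ 2 + ‖f‖ ^ 2 / μ) / μ := by gcongr
      _ = _ := by rw [hX]; ring
  have Lf : LocAC (fwd μ f) fun y => -μ * fwd μ f y + back μ f y :=
    LocAC.of_hasDerivAt (fun y _ => hasDerivAt_fwd f hμ y) (by
      have := continuous_fwd f hμ
      have := continuous_back f hμ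
      fun_prop)
  obtain ⟨m2, i2⟩ := Lf.memLp_of_ode (neg_ne_zero.2 hμ.ne') (continuous_fwd f hμ).continuousOn
    (ae_of_all _ fun _ => rfl) b2 m1
  have i2' : ∫ y in Ioi 0, fwd μ f y ^ 2 ≤ Y * ‖f‖ ^ 2 := by
    refine i2.trans ?_
    rw [abs_neg, abs_of_pos hμ]
    calc _ ≤ ((B * ‖f‖ / μ) ^ 2 + X * ‖f‖ ^ 2 / μ) / μ := by gcongr
      _ = _ := by rw [hY]; ring
  refine ⟨fun y _ => (b1 y).trans ?_, fun y hy => (b2 y hy).trans ?_, m1, i1'.trans ?_, m2,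
    i2'.trans ?_⟩
  · gcongr; linarith
  · rw [show B * ‖f‖ / μ = B / μ * ‖f‖ by ring]
    gcongr; linarith
  · gcongr
  · gcongr

end green

/-- A weight `w` with logarithmic derivative `p`. -/
structure LogWeight (w p p1 : ℝ → ℝ) : Prop where
  cw : Continuous w
  w_ge : ∀ y, 0 ≤ y → 1 + y ≤ w y
  dw : ∀ y, 0 < y → HasDerivAt w (p y * w y) y
  dp : ∀ y, 0 < y → HasDerivAt p (p1 y) y
  cp : ContinuousOn p (Ici 0)
  cp1 : ContinuousOn p1 (Ici 0)
  p_lim : Tendsto p atTop (𝓝 0)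
  p1_lim : Tendsto p1 atTop (𝓝 0)

/-- The reciprocal of a weight, extended to the line. -/
def recip (w : ℝ → ℝ) (y : ℝ) : ℝ := (w (max y 0))⁻¹

theorem integral_one_add_inv_sq {y : ℝ} (hy : 0 ≤ y) :
    IntegrableOn (fun z : ℝ => ((1 + z)⁻¹) ^ 2) (Ioi y) ∧
      ∫ z in Ioi y, ((1 + z)⁻¹) ^ 2 = (1 + y)⁻¹ := by
  have hd : ∀ z ∈ Ici y, HasDerivAt (fun z : ℝ => -(1 + z)⁻¹) (((1 + z)⁻¹) ^ 2) z := by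
    intro z hz
    have hz : y ≤ z := hz
    have h1 : HasDerivAt (fun y : ℝ => 1 + y) 1 z := by simpa using (hasDerivAt_id z).const_add 1
    have h2 : 1 + z ≠ 0 := by linarith
    refine (h1.inv h2).neg.congr_deriv ?_
    field_simp
  have hlim : Tendsto (fun z : ℝ => -(1 + z)⁻¹) atTop (𝓝 0) := by
    simpa using (tendsto_inv_atTop_zero.comp (tendsto_atTop_add_const_left _ (1 : ℝ)
      tendsto_id)).neg
  have hint := integrableOn_Ioi_deriv_of_nonneg' hd (fun z _ => sq_nonneg _) hlim
  refine ⟨hint, ?_⟩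
  rw [integral_Ioi_of_hasDerivAt_of_tendsto' hd hint hlim]
  ring

namespace LogWeight

variable {w p p1 : ℝ → ℝ} (hw : LogWeight w p p1)
include hw

theorem pos {y : ℝ} (hy : 0 ≤ y) : 0 < w y := by linarith [hw.w_ge y hy]

theorem recip_pos (y : ℝ) : 0 < recip w y := inv_pos.2 (hw.pos (le_max_right _ _))

theorem continuous_recip : Continuous (recip w) :=
  (hw.cw.comp (continuous_id.max continuous_const)).inv₀ fun _ => (hw.pos (le_max_right _ _)).ne'

theorem recip_le {y : ℝ} (hy : 0 ≤ y) : recip w y ≤ (1 + y)⁻¹ := by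
  unfold recip
  rw [max_eq_left hy]
  exact inv_anti₀ (by linarith) (hw.w_ge y hy)

theorem mul_recip {y : ℝ} (hy : 0 ≤ y) : recip w y * w y = 1 := by
  unfold recip
  rw [max_eq_left hy, inv_mul_cancel₀ (hw.pos hy).ne']

theorem hasDerivAt_recip {y : ℝ} (hy : 0 < y) : HasDerivAt (recip w) (-(p y) * recip w y) y := by
  have h1 := (hw.dw y hy).inv (hw.pos hy.le).ne'
  have h2 : recip w =ᶠ[𝓝 y] fun y => (w y)⁻¹ := by
    filter_upwards [Ioi_mem_nhds hy] with z hz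
    unfold recip
    rw [max_eq_left (le_of_lt hz)]
  refine (h1.congr_of_eventuallyEq h2).congr_deriv ?_
  have := (hw.pos hy.le).ne'
  unfold recip
  rw [max_eq_left hy.le]
  field_simp

theorem memLp_recip {y : ℝ} (hy : 0 ≤ y) : MemLp (recip w) 2 (volume.restrict (Ioi y)) ∧
    ∫ z in Ioi y, recip w z ^ 2 ≤ (1 + y)⁻¹ := by
  have h := integral_one_add_inv_sq hy
  have hle : ∀ z ∈ Ioi y, recip w z ^ 2 ≤ ((1 + z)⁻¹) ^ 2 := fun z hz =>
    pow_le_pow_left₀ (hw.recip_pos z).le (hw.recip_le (hy.trans (le_of_lt hz))) 2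
  have hm := hw.continuous_recip.aestronglyMeasurable (μ := volume.restrict (Ioi y))
  have hi : IntegrableOn (fun z => recip w z ^ 2) (Ioi y) :=
    Integrable.mono' h.1 (hm.pow 2) ((ae_restrict_mem measurableSet_Ioi).mono fun z hz => by
      rw [Real.norm_of_nonneg (sq_nonneg _)]; exact hle z hz)
  refine ⟨(memLp_two_iff_integrable_sq hm).2 hi, ?_⟩
  rw [← h.2]
  exact setIntegral_mono_on hi h.1 measurableSet_Ioi hle

/-- Hardy's inequality for a primitive vanishing at infinity. -/
theorem hardy_tail {G : ℝ → ℝ} (hG : Continuous G) (hG2 : MemLp G 2 halfLine)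
    (h0 : ∫ z in Ioi 0, G z * recip w z = 0) :
    MemLp (fun y => ∫ z in (0 : ℝ)..y, G z * recip w z) 2 halfLine ∧
    ∫ y in Ioi 0, (∫ z in (0 : ℝ)..y, G z * recip w z) ^ 2 ≤ 6 * ∫ y in Ioi 0, G y ^ 2 := by
  have cr := hw.continuous_recip
  have cGr : Continuous fun z => G z * recip w z := hG.mul cr
  set u : ℝ → ℝ := fun y => ∫ z in (0 : ℝ)..y, G z * recip w z with hu
  have du : ∀ y, HasDerivAt u (G y * recip w y) y := fun y =>
    intervalIntegral.integral_hasDerivAt_right (cGr.intervalIntegrable _ _)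
      (cGr.stronglyMeasurableAtFilter _ _) cGr.continuousAt
  have cu : Continuous u := continuous_of_hasDerivAt du
  set N := ∫ y in Ioi 0, G y ^ 2 with hN
  have hN0 : 0 ≤ N := integral_nonneg fun _ => sq_nonneg _
  have hint : ∀ y, 0 ≤ y → IntegrableOn (fun z => G z * recip w z) (Ioi y) := fun y hy =>
    (hG2.mono_measure (Measure.restrict_mono (Ioi_subset_Ioi hy) le_rfl)).integrable_mul
      (hw.memLp_recip hy).1
  have htail : ∀ y, 0 ≤ y → (1 + y) * u y ^ 2 ≤ N := by
    intro y hy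
    have e1 : u y = -∫ z in Ioi y, G z * recip w z := by
      have := intervalIntegral.integral_Ioi_sub_Ioi' (hint 0 le_rfl) (hint y hy)
      rw [h0] at this
      rw [hu]; linarith
    have hGy := hG2.mono_measure (Measure.restrict_mono (Ioi_subset_Ioi hy) le_rfl)
    have e2 := abs_integral_mul_le hGy (hw.memLp_recip hy).1
    have e3 : ∫ z in Ioi y, G z ^ 2 ≤ N := setIntegral_mono_set hG2.integrable_sq
      (ae_of_all _ fun _ => sq_nonneg _) (Ioi_subset_Ioi hy).eventuallyLE
    have e4 : |u y| ≤ √N * √((1 + y)⁻¹) := by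
      rw [e1, abs_neg]
      exact e2.trans (mul_le_mul (Real.sqrt_le_sqrt e3) (Real.sqrt_le_sqrt (hw.memLp_recip hy).2)
        (Real.sqrt_nonneg _) (Real.sqrt_nonneg _))
    have e5 := pow_le_pow_left₀ (abs_nonneg _) e4 2
    have hy1 : 0 < 1 + y := by linarith
    rw [sq_abs, mul_pow, Real.sq_sqrt hN0, Real.sq_sqrt (by positivity)] at e5
    calc (1 + y) * u y ^ 2 ≤ (1 + y) * (N * (1 + y)⁻¹) := by gcongr
      _ = N := by field_simp
  have key : ∀ x R : ℝ, 0 < x → x ≤ R → ∫ y in x..R, u y ^ 2 ≤ 6 * N := by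
    intro x R hx hxR
    have hsub : Ioc x R ⊆ Ioi 0 := fun y hy => hx.trans hy.1
    have cont1 : Continuous fun y => 2 * ((1 + y) * u y * (G y * recip w y)) := by fun_prop
    have cont0 : Continuous fun y => u y ^ 2 := by fun_prop
    have e1 := intervalIntegral.integral_eq_sub_of_hasDerivAt (a := x) (b := R)
      (f := fun y => (1 + y) * u y ^ 2)
      (f' := fun y => u y ^ 2 + 2 * ((1 + y) * u y * (G y * recip w y))) (fun y _ => by
        have h1 : HasDerivAt (fun y : ℝ => 1 + y) 1 y := by
          simpa using (hasDerivAt_id y).const_add 1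
        refine (h1.mul ((du y).pow 2)).congr_deriv ?_
        simp only [Pi.pow_apply]; push_cast; ring)
      ((cont0.add cont1).intervalIntegrable x R)
    have i1 : IntervalIntegrable (fun y => u y ^ 2) volume x R := cont0.intervalIntegrable _ _
    have i2 : IntervalIntegrable (fun y => 2 * ((1 + y) * u y * (G y * recip w y))) volume x R :=
      cont1.intervalIntegrable _ _
    rw [intervalIntegral.integral_add i1 i2] at e1
    have e2 : |∫ y in x..R, 2 * ((1 + y) * u y * (G y * recip w y))| ≤
        ∫ y in x..R, (1 / 2 * u y ^ 2 + 2 * G y ^ 2) := by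
      have i5 : IntervalIntegrable (fun y => 1 / 2 * u y ^ 2 + 2 * G y ^ 2) volume x R :=
        (by fun_prop : Continuous fun y => 1 / 2 * u y ^ 2 + 2 * G y ^ 2).intervalIntegrable _ _
      rw [← Real.norm_eq_abs]
      refine intervalIntegral.norm_integral_le_of_norm_le hxR (ae_of_all _ fun y hy => ?_) i5
      have hy0 : 0 < y := hx.trans hy.1
      have h1 : |(1 + y) * recip w y| ≤ 1 := by
        have := hw.recip_le hy0.le
        have hp := hw.recip_pos y
        rw [abs_of_nonneg (by positivity)]
        calc (1 + y) * recip w y ≤ (1 + y) * (1 + y)⁻¹ := by gcongr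
          _ = 1 := by field_simp
      rw [Real.norm_eq_abs, show 2 * ((1 + y) * u y * (G y * recip w y)) =
        2 * (((1 + y) * recip w y) * (u y * G y)) by ring, abs_mul, abs_two, abs_mul, abs_mul (u y),
        ← sq_abs (u y), ← sq_abs (G y)]
      have h2 : |(1 + y) * recip w y| * (|u y| * |G y|) ≤ 1 * (|u y| * |G y|) := by gcongr
      nlinarith [sq_nonneg (|u y| - 2 * |G y|)]
    have i3 : IntervalIntegrable (fun y => 1 / 2 * u y ^ 2) volume x R :=
      (by fun_prop : Continuous fun y => 1 / 2 * u y ^ 2).intervalIntegrable _ _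
    have i4 : IntervalIntegrable (fun y => 2 * G y ^ 2) volume x R :=
      (by fun_prop : Continuous fun y => 2 * G y ^ 2).intervalIntegrable _ _
    have e2' : ∫ y in x..R, (1 / 2 * u y ^ 2 + 2 * G y ^ 2) =
        1 / 2 * (∫ y in x..R, u y ^ 2) + 2 * ∫ y in x..R, G y ^ 2 := by
      rw [intervalIntegral.integral_add i3 i4, intervalIntegral.integral_const_mul,
        intervalIntegral.integral_const_mul]
    rw [e2'] at e2
    have e3 : ∫ y in x..R, G y ^ 2 ≤ N := by
      rw [intervalIntegral.integral_of_le hxR]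
      exact setIntegral_mono_set hG2.integrable_sq (ae_of_all _ fun _ => sq_nonneg _)
        hsub.eventuallyLE
    have e4 := htail R (hx.le.trans hxR)
    have e5 : 0 ≤ (1 + x) * u x ^ 2 := by positivity
    have e6 := neg_abs_le (∫ y in x..R, 2 * ((1 + y) * u y * (G y * recip w y)))
    linarith
  obtain ⟨h1, h2⟩ := integrable_of_intervalIntegral_le (by fun_prop) (fun _ _ => sq_nonneg _) key
  exact ⟨(memLp_two_iff_integrable_sq cu.aestronglyMeasurable).2 h1, h2⟩

end LogWeight

/-- Hardy's inequality for a primitive vanishing at the wall. -/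
theorem hardy_div {u : ℝ → ℝ} (cu : Continuous u) (hu2 : MemLp u 2 halfLine) :
    MemLp (fun y => (∫ z in (0 : ℝ)..y, u z) / (1 + y)) 2 halfLine ∧
    ∫ y in Ioi 0, ((∫ z in (0 : ℝ)..y, u z) / (1 + y)) ^ 2 ≤ 4 * ∫ y in Ioi 0, u y ^ 2 := by
  set V : ℝ → ℝ := fun y => ∫ z in (0 : ℝ)..y, u z with hV
  have dV : ∀ y, HasDerivAt V (u y) y := fun y =>
    intervalIntegral.integral_hasDerivAt_right (cu.intervalIntegrable _ _)
      (cu.stronglyMeasurableAtFilter _ _) cu.continuousAt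
  have cV : Continuous V := continuous_of_hasDerivAt dV
  set N := ∫ y in Ioi 0, u y ^ 2 with hN
  have hq : ContinuousOn (fun y => V y / (1 + y)) (Ici 0) :=
    cV.continuousOn.div (by fun_prop) fun y (hy : 0 ≤ y) => by positivity
  have key : ∀ x R : ℝ, 0 < x → x ≤ R → ∫ y in x..R, (V y / (1 + y)) ^ 2 ≤ 4 * N := by
    intro x R hx hxR
    have hR := hx.le.trans hxR
    have hII : ∀ {g : ℝ → ℝ}, ContinuousOn g (Ici 0) → IntervalIntegrable g volume 0 R :=
      fun hg => (hg.mono (by rw [uIcc_of_le hR]; exact Icc_subset_Ici_self)).intervalIntegrable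
    have i1 : IntervalIntegrable (fun y => (V y / (1 + y)) ^ 2) volume 0 R := hII (hq.pow 2)
    have i2 : IntervalIntegrable (fun y => 2 * (V y / (1 + y) * u y)) volume 0 R :=
      hII (continuousOn_const.mul (hq.mul cu.continuousOn))
    have i3 : IntervalIntegrable (fun y => u y ^ 2) volume 0 R := (cu.pow 2).intervalIntegrable _ _
    have e0 : ∫ y in x..R, (V y / (1 + y)) ^ 2 ≤ ∫ y in (0 : ℝ)..R, (V y / (1 + y)) ^ 2 :=
      intervalIntegral.integral_mono_interval hx.le hxR le_rfl (ae_of_all _ fun _ => sq_nonneg _) i1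
    have e1 := intervalIntegral.integral_eq_sub_of_hasDerivAt (a := 0) (b := R)
      (f := fun y => V y ^ 2 / (1 + y))
      (f' := fun y => 2 * (V y / (1 + y) * u y) - (V y / (1 + y)) ^ 2) (fun y hy => by
        rw [uIcc_of_le hR] at hy
        have h1 : HasDerivAt (fun y : ℝ => 1 + y) 1 y := by
          simpa using (hasDerivAt_id y).const_add 1
        have h2 : 1 + y ≠ 0 := by linarith [hy.1]
        refine (((dV y).pow 2).div h1 h2).congr_deriv ?_
        simp only [Pi.pow_apply]; push_cast; field_simp)
      (i2.sub i1)
    rw [intervalIntegral.integral_sub i2 i1] at e1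
    have hV0 : V 0 = 0 := by simp [hV]
    rw [hV0] at e1
    have e2 : |∫ y in (0 : ℝ)..R, 2 * (V y / (1 + y) * u y)| ≤
        ∫ y in (0 : ℝ)..R, (1 / 2 * (V y / (1 + y)) ^ 2 + 2 * u y ^ 2) := by
      rw [← Real.norm_eq_abs]
      refine intervalIntegral.norm_integral_le_of_norm_le hR (ae_of_all _ fun y hy => ?_)
        ((i1.const_mul (1 / 2)).add (i3.const_mul 2))
      rw [Real.norm_eq_abs, abs_mul, abs_two, abs_mul, ← sq_abs (V y / (1 + y)), ← sq_abs (u y)]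
      nlinarith [sq_nonneg (|V y / (1 + y)| - 2 * |u y|)]
    have e2' : ∫ y in (0 : ℝ)..R, (1 / 2 * (V y / (1 + y)) ^ 2 + 2 * u y ^ 2) =
        1 / 2 * (∫ y in (0 : ℝ)..R, (V y / (1 + y)) ^ 2) + 2 * ∫ y in (0 : ℝ)..R, u y ^ 2 := by
      rw [intervalIntegral.integral_add (i1.const_mul (1 / 2)) (i3.const_mul 2),
        intervalIntegral.integral_const_mul, intervalIntegral.integral_const_mul]
    rw [e2'] at e2
    have e3 : ∫ y in (0 : ℝ)..R, u y ^ 2 ≤ N := by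
      rw [intervalIntegral.integral_of_le hR]
      exact setIntegral_mono_set hu2.integrable_sq (ae_of_all _ fun _ => sq_nonneg _)
        Ioc_subset_Ioi_self.eventuallyLE
    have e4 : 0 ≤ V R ^ 2 / (1 + R) := by positivity
    have e5 := le_abs_self (∫ y in (0 : ℝ)..R, 2 * (V y / (1 + y) * u y))
    have e6 : (0 : ℝ) ^ 2 / (1 + 0) = 0 := by norm_num
    rw [e6] at e1
    linarith
  obtain ⟨h1, h2⟩ := integrable_of_intervalIntegral_le (hq.pow 2) (fun _ _ => sq_nonneg _) key
  exact ⟨(memLp_two_iff_integrable_sq ((hq.mono Ioi_subset_Ici_self).aesm)).2 h1,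
    h2⟩

/-- A linear family with square integrable derivative is regular. -/
theorem RegularFamily.of_deriv {P P' : Sq → ℝ → ℝ} {C : ℝ} (hC : 0 ≤ C)
    (hadd : ∀ f g y, 0 ≤ y → P (f + g) y = P f y + P g y)
    (hsmul : ∀ (r : ℝ) f y, 0 ≤ y → P (r • f) y = r * P f y)
    (hcont : ∀ f, ContinuousOn (P f) (Ici 0)) (hac : ∀ f, LocAC (P f) (P' f))
    (h0 : ∀ f, MemLp (P f) 2 halfLine) (h0' : ∀ f, ∫ y in Ioi 0, P f y ^ 2 ≤ C ^ 2 * ‖f‖ ^ 2)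
    (h1 : ∀ f, MemLp (P' f) 2 halfLine)
    (h1' : ∀ f, ∫ y in Ioi 0, P' f y ^ 2 ≤ C ^ 2 * ‖f‖ ^ 2) : RegularFamily P (2 * C) := by
  have mod : ∀ f x y, 0 ≤ x → x ≤ y → |P f y - P f x| ≤ C * ‖f‖ * √(y - x) := by
    have pos : ∀ f x y, 0 < x → x ≤ y → |P f y - P f x| ≤ C * ‖f‖ * √(y - x) := by
      intro f x y hx hxy
      have hsub : Ioc x y ⊆ Ioi 0 := fun z hz => hx.trans hz.1
      rw [← (hac f).integral_eq hx hxy, intervalIntegral.integral_of_le hxy]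
      have m1 : MemLp (fun _ : ℝ => (1 : ℝ)) 2 (volume.restrict (Ioc x y)) := memLp_const 1
      have e1 := abs_integral_mul_le ((h1 f).mono_measure (Measure.restrict_mono hsub le_rfl)) m1
      simp only [mul_one, one_pow, integral_const, smul_eq_mul] at e1
      rw [measureReal_restrict_apply MeasurableSet.univ, univ_inter, Real.volume_real_Ioc_of_le hxy]
        at e1
      refine e1.trans (mul_le_right ?_ (Real.sqrt_nonneg _))
      rw [Real.sqrt_le_left (by positivity), mul_pow]
      exact (setIntegral_mono_set (h1 f).integrable_sq (ae_of_all _ fun _ => sq_nonneg _)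
        hsub.eventuallyLE).trans (h1' f)
    intro f x y hx hxy
    rcases hx.eq_or_lt with h | h
    · subst h
      rcases hxy.eq_or_lt with h' | h'
      · subst h'; simp
      · have t1 : Tendsto (fun x => |P f y - P f x|) (𝓝[>] 0) (𝓝 |P f y - P f 0|) :=
          (tendsto_const_nhds.sub
            (tendsto_wall (hcont f))).abs
        have t2 : Tendsto (fun x => C * ‖f‖ * √(y - x)) (𝓝[>] 0) (𝓝 (C * ‖f‖ * √(y - 0))) :=
          ((by fun_prop : Continuous fun x => C * ‖f‖ * √(y - x)).tendsto 0).mono_left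
            nhdsWithin_le_nhds
        refine le_of_tendsto_of_tendsto t1 t2 ?_
        filter_upwards [Ioo_mem_nhdsGT h'] with x hx using pos f x y hx.1 hx.2.le
    · exact pos f x y h hxy
  refine ⟨by positivity, hadd, hsmul, fun f y hy => ?_, fun f x y hx hxy _ =>
    (mod f x y hx hxy).trans ?_, h0, fun f => (h0' f).trans ?_⟩
  · by_contra hlt
    push Not at hlt
    have hlow : ∀ z ∈ Ioc y (y + 1), (C * ‖f‖) ^ 2 < P f z ^ 2 := by
      intro z hz
      have e1 := mod f y z hy hz.1.le
      have e2 : √(z - y) ≤ 1 := Real.sqrt_le_one.2 (by linarith [hz.2])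
      have e3 : C * ‖f‖ * √(z - y) ≤ C * ‖f‖ := mul_le_of_le_one_right (by positivity) e2
      have e4 : |P f y| ≤ |P f z| + |P f z - P f y| := by
        have := abs_sub_abs_le_abs_sub (P f y) (P f z)
        rw [abs_sub_comm (P f y)] at this
        linarith
      rw [← sq_abs (P f z)]
      exact pow_lt_pow_left₀ (by linarith) (by positivity) two_ne_zero
    have hsub : Ioc y (y + 1) ⊆ Ioi 0 := fun z hz => hy.trans_lt hz.1
    have hI := (h0 f).integrable_sq.mono_measure (Measure.restrict_mono hsub le_rfl)
    have e5 : ∫ z in Ioc y (y + 1), P f z ^ 2 ≤ C ^ 2 * ‖f‖ ^ 2 :=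
      (setIntegral_mono_set (h0 f).integrable_sq (ae_of_all _ fun _ => sq_nonneg _)
        hsub.eventuallyLE).trans (h0' f)
    have e6 : ∫ _ in y..(y + 1), (C * ‖f‖) ^ 2 < ∫ z in y..(y + 1), P f z ^ 2 := by
      refine intervalIntegral.integral_lt_integral_of_ae_le_of_measure_setOfPred_lt_ne_zero
        (by linarith) intervalIntegrable_const
        ((intervalIntegrable_iff_integrableOn_Ioc_of_le (by linarith)).2 hI)
        ((ae_restrict_mem measurableSet_Ioc).mono fun z hz => (hlow z hz).le) ?_
      have : volume.restrict (Ioc y (y + 1)) (Ioc y (y + 1)) ≠ 0 := by simp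
      exact fun h => this (measure_mono_null hlow h)
    rw [intervalIntegral.integral_const, intervalIntegral.integral_of_le
      (by linarith : y ≤ y + 1), smul_eq_mul, mul_pow] at e6
    linarith
  · gcongr; linarith
  · gcongr; linarith

/-- Square integrability on the half line with a bound for the norm. -/
def SqLe (g : ℝ → ℝ) (X : ℝ) : Prop :=
  MemLp g 2 halfLine ∧ ∫ y in Ioi 0, g y ^ 2 ≤ X ^ 2

namespace SqLe

variable {f g : ℝ → ℝ} {X Y : ℝ}

theorem add (hf : SqLe f X) (hg : SqLe g Y) (hX : 0 ≤ X) (hY : 0 ≤ Y) :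
    SqLe (fun y => f y + g y) (2 * (X + Y)) := by
  refine ⟨hf.1.add hg.1, ?_⟩
  have h1 := (hf.1.integrable_sq.const_mul 2).add (hg.1.integrable_sq.const_mul 2)
  have h2 : ∫ y in Ioi 0, (f y + g y) ^ 2 ≤ ∫ y in Ioi 0, (2 * f y ^ 2 + 2 * g y ^ 2) :=
    integral_mono (hf.1.add hg.1).integrable_sq h1 fun y => by
      simp only []; nlinarith [sq_nonneg (f y - g y)]
  have h3 : ∫ y in Ioi 0, (2 * f y ^ 2 + 2 * g y ^ 2) =
      2 * (∫ y in Ioi 0, f y ^ 2) + 2 * ∫ y in Ioi 0, g y ^ 2 := by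
    rw [integral_add (hf.1.integrable_sq.const_mul 2) (hg.1.integrable_sq.const_mul 2),
      integral_const_mul, integral_const_mul]
  have := hf.2
  have := hg.2
  nlinarith

theorem of_le (hf : SqLe f X) {K : ℝ} (hK : 0 ≤ K) (hg : AEStronglyMeasurable g halfLine)
    (h : ∀ y, 0 < y → |g y| ≤ K * |f y|) : SqLe g (K * X) := by
  have hm : MemLp g 2 halfLine := memLp_of_abs_le (hf.1.const_mul K) hg fun y hy => by
    rw [abs_mul, abs_of_nonneg hK]; exact h y hy
  refine ⟨hm, ?_⟩
  have h1 : ∫ y in Ioi 0, g y ^ 2 ≤ ∫ y in Ioi 0, K ^ 2 * f y ^ 2 :=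
    setIntegral_mono_on hm.integrable_sq (hf.1.integrable_sq.const_mul _) measurableSet_Ioi
      fun y hy => by
        have := pow_le_pow_left₀ (abs_nonneg _) (h y hy) 2
        rwa [sq_abs, mul_pow, sq_abs] at this
  rw [integral_const_mul] at h1
  rw [mul_pow]
  exact h1.trans (mul_le_left hf.2 (sq_nonneg _))

theorem mono (hf : SqLe f X) (hX : 0 ≤ X) (h : X ≤ Y) : SqLe f Y :=
  ⟨hf.1, hf.2.trans (pow_le_pow_left₀ hX h 2)⟩

end SqLe

theorem memLp_of_near_far {g h : ℝ → ℝ} {C : ℝ} (hg : AEStronglyMeasurable g halfLine)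
    (hh : MemLp h 2 halfLine) (near : ∀ y, 0 < y → y ≤ 1 → |g y| ≤ C)
    (far : ∀ y, 1 < y → |g y| ≤ |h y|) : MemLp g 2 halfLine := by
  have hE : MemLp (fun y => |C| * Real.exp 1 * Real.exp (-(1 * y))) 2 halfLine :=
    (memLp_exp one_pos 0).const_mul _
  refine memLp_of_abs_le (hh.norm.add hE) hg fun y hy => ?_
  simp only [Real.norm_eq_abs, Pi.add_apply]
  have h0 : 0 ≤ |C| * Real.exp 1 * Real.exp (-(1 * y)) := by positivity
  rw [abs_of_nonneg (add_nonneg (abs_nonneg _) h0)]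
  rcases le_or_gt y 1 with h1 | h1
  · have h2 : 1 ≤ Real.exp 1 * Real.exp (-(1 * y)) := by
      rw [← Real.exp_add]; exact Real.one_le_exp (by linarith)
    have := near y hy h1
    nlinarith [abs_nonneg (h y), le_abs_self C, abs_nonneg C]
  · linarith [far y h1]

section kernel

/-- The multiple of `exp (-μ y)` which makes the weighted mean of the Green function vanish. -/
def meanCoeff (μ : ℝ) (w : ℝ → ℝ) (f : Sq) : ℝ :=
  -(∫ z in Ioi 0, fwd μ f z * recip w z) / ∫ z in Ioi 0, Real.exp (-(μ * z)) * recip w z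

/-- The solution `G` of `G'' - μ² G = f` with vanishing weighted mean. -/
def green (μ : ℝ) (w : ℝ → ℝ) (f : Sq) (y : ℝ) : ℝ :=
  fwd μ f y + meanCoeff μ w f * Real.exp (-(μ * y))

/-- The derivative of `green`. -/
def green1 (μ : ℝ) (w : ℝ → ℝ) (f : Sq) (y : ℝ) : ℝ := back μ f y - μ * green μ w f y

/-- The primitive of the weighted `green`. -/
def prim1 (μ : ℝ) (w : ℝ → ℝ) (f : Sq) (y : ℝ) : ℝ := ∫ z in (0 : ℝ)..y, green μ w f z * recip w z

/-- The second primitive of the weighted `green`. -/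
def prim (μ : ℝ) (w : ℝ → ℝ) (f : Sq) (y : ℝ) : ℝ := ∫ z in (0 : ℝ)..y, prim1 μ w f z

variable {μ : ℝ} (hμ : 0 < μ) {w p p1 : ℝ → ℝ} (hw : LogWeight w p p1)

theorem meanCoeff_smul (r : ℝ) (f : Sq) : meanCoeff μ w (r • f) = r * meanCoeff μ w f := by
  unfold meanCoeff
  simp only [fwd_smul, mul_assoc, integral_const_mul]
  ring

theorem green_smul (r : ℝ) (f : Sq) (y : ℝ) : green μ w (r • f) y = r * green μ w f y := by
  unfold green
  rw [fwd_smul, meanCoeff_smul]; ring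

theorem green1_smul (r : ℝ) (f : Sq) (y : ℝ) : green1 μ w (r • f) y = r * green1 μ w f y := by
  unfold green1
  rw [back_smul, green_smul]; ring

theorem prim1_smul (r : ℝ) (f : Sq) (y : ℝ) : prim1 μ w (r • f) y = r * prim1 μ w f y := by
  unfold prim1
  simp only [green_smul, mul_assoc, intervalIntegral.integral_const_mul]

theorem prim_smul (r : ℝ) (f : Sq) (y : ℝ) : prim μ w (r • f) y = r * prim μ w f y := by
  unfold prim
  simp only [prim1_smul, intervalIntegral.integral_const_mul]

include hμ

theorem hasDerivAt_green (f : Sq) (y : ℝ) : HasDerivAt (green μ w f) (green1 μ w f y) y := by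
  have h1 : HasDerivAt (fun y => Real.exp (-(μ * y))) (Real.exp (-(μ * y)) * -(μ * 1)) y :=
    ((hasDerivAt_id y).const_mul μ).neg.exp
  refine ((hasDerivAt_fwd f hμ y).add (h1.const_mul (meanCoeff μ w f))).congr_deriv ?_
  unfold green1 green
  ring

theorem continuous_green (f : Sq) : Continuous (green μ w f) :=
  continuous_of_hasDerivAt (hasDerivAt_green hμ f)

theorem continuous_green1 (f : Sq) : Continuous (green1 μ w f) :=
  (continuous_back f hμ).sub (continuous_const.mul (continuous_green hμ f))

theorem locAC_green (f : Sq) : LocAC (green μ w f) (green1 μ w f) :=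
  LocAC.of_hasDerivAt (fun y _ => hasDerivAt_green hμ f y) (continuous_green1 hμ f).continuousOn

theorem locAC_green1 (f : Sq) :
    LocAC (green1 μ w f) fun y => f y + μ ^ 2 * green μ w f y := by
  refine ((locAC_back f hμ).sub ((locAC_green (w := w) hμ f).const_mul μ)).congr_deriv
    (ae_of_all _ fun y => ?_)
  simp only [green1]
  ring

include hw

theorem continuous_green_recip (f : Sq) : Continuous fun y => green μ w f y * recip w y :=
  (continuous_green hμ f).mul hw.continuous_recip

theorem hasDerivAt_prim1 (f : Sq) (y : ℝ) :
    HasDerivAt (prim1 μ w f) (green μ w f y * recip w y) y :=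
  intervalIntegral.integral_hasDerivAt_right
    ((continuous_green_recip hμ hw f).intervalIntegrable _ _)
    ((continuous_green_recip hμ hw f).stronglyMeasurableAtFilter _ _)
    (continuous_green_recip hμ hw f).continuousAt

theorem continuous_prim1 (f : Sq) : Continuous (prim1 μ w f) :=
  continuous_of_hasDerivAt (hasDerivAt_prim1 hμ hw f)

theorem hasDerivAt_prim (f : Sq) (y : ℝ) : HasDerivAt (prim μ w f) (prim1 μ w f y) y :=
  intervalIntegral.integral_hasDerivAt_right
    ((continuous_prim1 hμ hw f).intervalIntegrable _ _)
    ((continuous_prim1 hμ hw f).stronglyMeasurableAtFilter _ _)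
    (continuous_prim1 hμ hw f).continuousAt

theorem continuous_prim (f : Sq) : Continuous (prim μ w f) :=
  continuous_of_hasDerivAt (hasDerivAt_prim hμ hw f)

theorem integral_exp_recip_pos : 0 < ∫ z in Ioi 0, Real.exp (-(μ * z)) * recip w z := by
  have hI : IntegrableOn (fun z => Real.exp (-(μ * z)) * recip w z) (Ioi 0) :=
    (memLp_exp hμ 0).integrable_mul (hw.memLp_recip le_rfl).1
  rw [setIntegral_pos_iff_support_of_nonneg_ae
    (ae_of_all _ fun z => mul_nonneg (Real.exp_pos _).le (hw.recip_pos z).le) hI]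
  have : Function.support (fun z => Real.exp (-(μ * z)) * recip w z) = univ :=
    eq_univ_of_forall fun z => (mul_pos (Real.exp_pos _) (hw.recip_pos z)).ne'
  rw [this, univ_inter]
  simp

theorem meanCoeff_add (f g : Sq) :
    meanCoeff μ w (f + g) = meanCoeff μ w f + meanCoeff μ w g := by
  obtain ⟨C, -, hC⟩ := exists_green_bound hμ
  have hI : ∀ f : Sq, Integrable (fun z => fwd μ f z * recip w z) halfLine := fun f =>
    (hC f).2.2.2.2.1.integrable_mul (hw.memLp_recip le_rfl).1
  unfold meanCoeff
  simp only [fwd_add f g hμ, add_mul]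
  rw [integral_add (hI f) (hI g)]
  ring

theorem green_add (f g : Sq) (y : ℝ) :
    green μ w (f + g) y = green μ w f y + green μ w g y := by
  unfold green
  rw [fwd_add f g hμ, meanCoeff_add hμ hw]; ring

theorem green1_add (f g : Sq) (y : ℝ) :
    green1 μ w (f + g) y = green1 μ w f y + green1 μ w g y := by
  unfold green1
  rw [back_add f g hμ, green_add hμ hw]; ring

theorem prim1_add (f g : Sq) (y : ℝ) :
    prim1 μ w (f + g) y = prim1 μ w f y + prim1 μ w g y := by
  unfold prim1
  rw [← intervalIntegral.integral_add ((continuous_green_recip hμ hw f).intervalIntegrable _ _)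
    ((continuous_green_recip hμ hw g).intervalIntegrable _ _)]
  simp only [green_add hμ hw, add_mul]

theorem prim_add (f g : Sq) (y : ℝ) : prim μ w (f + g) y = prim μ w f y + prim μ w g y := by
  unfold prim
  rw [← intervalIntegral.integral_add ((continuous_prim1 hμ hw f).intervalIntegrable _ _)
    ((continuous_prim1 hμ hw g).intervalIntegrable _ _)]
  simp only [prim1_add hμ hw]

theorem integral_green_recip (f : Sq) : ∫ z in Ioi 0, green μ w f z * recip w z = 0 := by
  obtain ⟨C, -, hC⟩ := exists_green_bound hμ
  have hI : Integrable (fun z => fwd μ f z * recip w z) halfLine :=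
    (hC f).2.2.2.2.1.integrable_mul (hw.memLp_recip le_rfl).1
  have hE : Integrable (fun z => Real.exp (-(μ * z)) * recip w z) halfLine :=
    (memLp_exp hμ 0).integrable_mul (hw.memLp_recip le_rfl).1
  have hpos := integral_exp_recip_pos hμ hw
  unfold green
  simp only [add_mul, mul_assoc]
  rw [integral_add hI (hE.const_mul _), integral_const_mul]
  unfold meanCoeff
  rw [div_mul_cancel₀ _ hpos.ne']
  ring

theorem exists_kernel_bound : ∃ C : ℝ, 0 ≤ C ∧ ∀ f : Sq, SqLe (green μ w f) (C * ‖f‖) ∧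
    SqLe (green1 μ w f) (C * ‖f‖) ∧ SqLe (prim1 μ w f) (C * ‖f‖) ∧
    SqLe (fun y => prim μ w f y / (1 + y)) (C * ‖f‖) := by
  obtain ⟨C, hC0, hC⟩ := exists_green_bound hμ
  set d := ∫ z in Ioi 0, Real.exp (-(μ * z)) * recip w z with hd
  have hd0 : 0 < d := integral_exp_recip_pos hμ hw
  set Q := √(∫ z in Ioi 0, Real.exp (-(μ * z)) ^ 2) with hQ
  have hQ0 : 0 ≤ Q := Real.sqrt_nonneg _
  set C1 := 2 * (C + C / d * Q) with hC1
  have hC1' : 0 ≤ C1 := by positivity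
  set C2 := 2 * (C + μ * C1) with hC2
  have hC2' : 0 ≤ C2 := by positivity
  refine ⟨C1 + C2 + 3 * C1 + 2 * (3 * C1), by positivity, fun f => ?_⟩
  obtain ⟨-, -, mb, ib, mf, jf⟩ := hC f
  have hf := norm_nonneg f
  have hk : |meanCoeff μ w f| ≤ C / d * ‖f‖ := by
    have h1 := abs_integral_mul_le mf (hw.memLp_recip le_rfl).1
    have h2 := (hw.memLp_recip le_rfl).2
    have h3 : √(∫ z in Ioi 0, fwd μ f z ^ 2) ≤ C * ‖f‖ := by
      rw [Real.sqrt_le_left (by positivity), mul_pow]; exact jf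
    have h4 : √(∫ z in Ioi 0, recip w z ^ 2) ≤ 1 := by
      rw [Real.sqrt_le_one]; simpa using h2
    have h5 := h1.trans (mul_le_mul h3 h4 (Real.sqrt_nonneg _) (by positivity))
    unfold meanCoeff
    rw [abs_div, abs_neg, abs_of_pos hd0, div_mul_eq_mul_div]
    exact div_le_div_of_nonneg_right (by linarith) hd0.le
  have sE : SqLe (fun y => Real.exp (-(μ * y))) Q :=
    ⟨memLp_exp hμ 0, (Real.sq_sqrt (integral_nonneg fun _ => sq_nonneg _)).ge⟩
  have sF : SqLe (fwd μ f) (C * ‖f‖) := ⟨mf, by rw [mul_pow]; exact jf⟩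
  have sB : SqLe (back μ f) (C * ‖f‖) := ⟨mb, by rw [mul_pow]; exact ib⟩
  have sG : SqLe (green μ w f) (C1 * ‖f‖) := by
    have h1 : SqLe (fun y => meanCoeff μ w f * Real.exp (-(μ * y))) (C / d * ‖f‖ * Q) :=
      sE.of_le (by positivity) (by fun_prop) fun y _ => by rw [abs_mul]; gcongr
    refine (sF.add h1 (by positivity) (by positivity)).mono (by positivity) (le_of_eq ?_)
    rw [hC1]; ring
  have sG1 : SqLe (green1 μ w f) (C2 * ‖f‖) := by
    have h1 : SqLe (fun y => -(μ * green μ w f y)) (μ * (C1 * ‖f‖)) :=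
      sG.of_le hμ.le (((continuous_green hμ f).const_mul μ).neg.aestronglyMeasurable) fun y _ => by
        rw [abs_neg, abs_mul, abs_of_pos hμ]
    refine (sB.add h1 (by positivity) (by positivity)).mono (by positivity) (le_of_eq ?_)
    rw [hC2]; ring
  have sP1 : SqLe (prim1 μ w f) (3 * (C1 * ‖f‖)) := by
    obtain ⟨h1, h2⟩ := hw.hardy_tail (continuous_green hμ f) sG.1 (integral_green_recip hμ hw f)
    refine ⟨h1, h2.trans ?_⟩
    have := sG.2
    nlinarith [sq_nonneg (C1 * ‖f‖)]
  have sP : SqLe (fun y => prim μ w f y / (1 + y)) (2 * (3 * (C1 * ‖f‖))) := by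
    obtain ⟨h1, h2⟩ := hardy_div (continuous_prim1 hμ hw f) sP1.1
    refine ⟨h1, h2.trans ?_⟩
    have := sP1.2
    nlinarith
  have n1 : 0 ≤ C1 * ‖f‖ := by positivity
  have n2 : 0 ≤ C2 * ‖f‖ := by positivity
  exact ⟨sG.mono (by positivity) (by linarith), sG1.mono (by positivity) (by linarith),
    sP1.mono (by positivity) (by linarith), sP.mono (by positivity) (by linarith)⟩

theorem exists_regularFamily : ∃ C : ℝ, RegularFamily (green μ w) C ∧
    RegularFamily (green1 μ w) C ∧ RegularFamily (prim1 μ w) C ∧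
    RegularFamily (fun f y => prim μ w f y / (1 + y)) C := by
  obtain ⟨C, hC0, hC⟩ := exists_kernel_bound hμ hw
  have push : ∀ {X : ℝ} {g : ℝ → ℝ} {f : Sq}, SqLe g (X * ‖f‖) →
      ∫ y in Ioi 0, g y ^ 2 ≤ X ^ 2 * ‖f‖ ^ 2 := fun h => by rw [← mul_pow]; exact h.2
  set C' := 2 * (1 + μ ^ 2 * C) + 2 * (C + C) + C with hC'
  have hC'0 : 0 ≤ C' := by positivity
  have hμC : 0 ≤ μ ^ 2 * C := by positivity
  have up : ∀ {X : ℝ} {g : ℝ → ℝ} {f : Sq}, SqLe g (X * ‖f‖) → 0 ≤ X → X ≤ C' →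
      SqLe g (C' * ‖f‖) := fun h h0 h1 => h.mono (by positivity) (by gcongr)
  have cg := fun f => continuous_green (w := w) hμ f
  have cg1 := fun f => continuous_green1 (w := w) hμ f
  have cp1 := fun f => continuous_prim1 hμ hw f
  have cp := fun f => continuous_prim hμ hw f
  have hCC : C ≤ C' := by linarith
  refine ⟨2 * C', ?_, ?_, ?_, ?_⟩
  · exact RegularFamily.of_deriv hC'0 (fun f g y _ => green_add hμ hw f g y)
      (fun r f y _ => green_smul r f y) (fun f => (cg f).continuousOn) (locAC_green hμ)
      (fun f => (hC f).1.1) (fun f => push (up (hC f).1 hC0 hCC)) (fun f => (hC f).2.1.1)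
      (fun f => push (up (hC f).2.1 hC0 hCC))
  · have h1 : ∀ f : Sq, SqLe (fun y => f y + μ ^ 2 * green μ w f y) (C' * ‖f‖) := by
      intro f
      have h2 : SqLe (fun y => μ ^ 2 * green μ w f y) (μ ^ 2 * (C * ‖f‖)) :=
        (hC f).1.of_le (by positivity) ((cg f).const_mul _).aestronglyMeasurable fun y _ => by
          rw [abs_mul, abs_of_pos (by positivity : 0 < μ ^ 2)]
      have h3 : SqLe f (1 * ‖f‖) := by
        refine ⟨(Lp.memLp f).restrict _, ?_⟩
        rw [one_mul, ← Sq.integral_sq]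
        exact setIntegral_le_integral (Lp.memLp f).integrable_sq (ae_of_all _ fun _ => sq_nonneg _)
      refine (h3.add h2 (by positivity) (by positivity)).mono (by positivity) ?_
      rw [show 2 * (1 * ‖f‖ + μ ^ 2 * (C * ‖f‖)) = 2 * (1 + μ ^ 2 * C) * ‖f‖ by ring]
      gcongr
      linarith
    exact RegularFamily.of_deriv hC'0 (fun f g y _ => green1_add hμ hw f g y)
      (fun r f y _ => green1_smul r f y) (fun f => (cg1 f).continuousOn) (locAC_green1 hμ)
      (fun f => (hC f).2.1.1) (fun f => push (up (hC f).2.1 hC0 hCC)) (fun f => (h1 f).1)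
      (fun f => push (h1 f))
  · have h1 : ∀ f : Sq, SqLe (fun y => green μ w f y * recip w y) (C' * ‖f‖) := by
      intro f
      refine ((hC f).1.of_le zero_le_one (continuous_green_recip hμ hw f).aestronglyMeasurable
        fun y hy => ?_).mono (by positivity) (by rw [one_mul]; gcongr)
      have h2 : recip w y ≤ 1 :=
        (hw.recip_le hy.le).trans (inv_le_one_of_one_le₀ (by linarith))
      rw [abs_mul, abs_of_pos (hw.recip_pos y), mul_comm]
      gcongr
    exact RegularFamily.of_deriv hC'0 (fun f g y _ => prim1_add hμ hw f g y)
      (fun r f y _ => prim1_smul r f y) (fun f => (cp1 f).continuousOn)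
      (fun f => LocAC.of_hasDerivAt (fun y _ => hasDerivAt_prim1 hμ hw f y)
        (continuous_green_recip hμ hw f).continuousOn)
      (fun f => (hC f).2.2.1.1) (fun f => push (up (hC f).2.2.1 hC0 hCC)) (fun f => (h1 f).1)
      (fun f => push (h1 f))
  · have dP : ∀ f y, 0 < y → HasDerivAt (fun y => prim μ w f y / (1 + y))
        (prim1 μ w f y * (1 + y)⁻¹ + -(prim μ w f y / (1 + y)) * (1 + y)⁻¹) y := by
      intro f y hy
      have h1 : HasDerivAt (fun y : ℝ => 1 + y) 1 y := by simpa using (hasDerivAt_id y).const_add 1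
      refine ((hasDerivAt_prim hμ hw f y).div h1 (by positivity)).congr_deriv ?_
      field_simp
      ring
    have ci : ContinuousOn (fun y : ℝ => (1 + y)⁻¹) (Ici 0) :=
      ContinuousOn.inv₀ (by fun_prop) fun y (hy : 0 ≤ y) => by positivity
    have cd : ∀ f, ContinuousOn (fun y => prim μ w f y / (1 + y)) (Ici 0) := fun f =>
      (cp f).continuousOn.div (by fun_prop) fun y (hy : 0 ≤ y) => by positivity
    have inv_le : ∀ y : ℝ, 0 < y → |(1 + y)⁻¹| ≤ 1 := fun y hy => by
      rw [abs_of_pos (by positivity)]; exact inv_le_one_of_one_le₀ (by linarith)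
    have h1 : ∀ f : Sq, SqLe (fun y => prim1 μ w f y * (1 + y)⁻¹ +
        -(prim μ w f y / (1 + y)) * (1 + y)⁻¹) (C' * ‖f‖) := by
      intro f
      have h2 : SqLe (fun y => prim1 μ w f y * (1 + y)⁻¹) (1 * (C * ‖f‖)) :=
        (hC f).2.2.1.of_le zero_le_one (ContinuousOn.aesm
          (((cp1 f).continuousOn.mul ci).mono Ioi_subset_Ici_self)) fun y hy => by
            rw [abs_mul, mul_comm]; exact mul_le_right (inv_le y hy) (abs_nonneg _)
      have h3 : SqLe (fun y => -(prim μ w f y / (1 + y)) * (1 + y)⁻¹) (1 * (C * ‖f‖)) :=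
        (hC f).2.2.2.of_le zero_le_one (ContinuousOn.aesm
          (((cd f).neg.mul ci).mono Ioi_subset_Ici_self)) fun y hy => by
            rw [abs_mul, abs_neg, mul_comm]
            exact mul_le_right (inv_le y hy) (abs_nonneg _)
      refine (h2.add h3 (by positivity) (by positivity)).mono (by positivity) ?_
      rw [show 2 * (1 * (C * ‖f‖) + 1 * (C * ‖f‖)) = 2 * (C + C) * ‖f‖ by ring]
      gcongr
      linarith
    exact RegularFamily.of_deriv hC'0
      (fun f g y _ => by rw [prim_add hμ hw, add_div])
      (fun r f y _ => by rw [prim_smul, mul_div_assoc]) cd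
      (fun f => LocAC.of_hasDerivAt (dP f)
        ((((cp1 f).continuousOn.mul ci).add ((cd f).neg.mul ci)).mono Ioi_subset_Ici_self))
      (fun f => (hC f).2.2.2.1) (fun f => push (up (hC f).2.2.2 hC0 hCC)) (fun f => (h1 f).1)
      (fun f => push (h1 f))

end kernel

/-- The coefficients have limits at infinity, fast enough for the weight `w`. -/
structure Coefficients.Asymptotics (S : Coefficients) (w : ℝ → ℝ) (N : ℝ) : Prop where
  N_pos : 0 < N
  a_lim : Tendsto S.a atTop (𝓝 N)
  b_lim : Tendsto S.b atTop (𝓝 0)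
  first : Tendsto (fun y => w y * (S.b2 y + S.f y)) atTop (𝓝 0)
  zeroth : Tendsto (fun y => w y * (1 + y) * (S.a2 y + S.e y)) atTop (𝓝 0)

theorem exists_bound_of_tendsto {f : ℝ → ℝ} {l : ℝ} (hf : ContinuousOn f (Ici 0))
    (hl : Tendsto f atTop (𝓝 l)) : ∃ C, ∀ y, 0 ≤ y → |f y| ≤ C := by
  obtain ⟨R, hR⟩ := eventually_atTop.1 (hl.abs.eventually (ge_mem_nhds (lt_add_one |l|)))
  obtain ⟨C, hC⟩ := isCompact_Icc.exists_bound_of_continuousOn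
    (hf.mono (Icc_subset_Ici_self : Icc 0 R ⊆ Ici 0))
  refine ⟨max (|l| + 1) C, fun y hy => ?_⟩
  rcases le_total y R with h | h
  · exact (hC y ⟨hy, h⟩).trans (le_max_right _ _)
  · exact (hR y h).trans (le_max_left _ _)

section existence

variable {μ : ℝ} (hμ : 0 < μ) {w p p1 : ℝ → ℝ} (hw : LogWeight w p p1)
include hμ hw

theorem LogWeight.hasDerivAt_green_recip (f : Sq) {y : ℝ} (hy : 0 < y) :
    HasDerivAt (fun y => green μ w f y * recip w y)
      ((green1 μ w f y - p y * green μ w f y) * recip w y) y :=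
  ((hasDerivAt_green hμ f y).mul (hw.hasDerivAt_recip hy)).congr_deriv (by ring)

theorem LogWeight.locAC_third (f : Sq) :
    LocAC (fun y => (green1 μ w f y - p y * green μ w f y) * recip w y) fun y =>
      (f y + μ ^ 2 * green μ w f y - 2 * p y * green1 μ w f y
        + (p y ^ 2 - p1 y) * green μ w f y) * recip w y := by
  have hp : LocAC p p1 := LocAC.of_hasDerivAt hw.dp (hw.cp1.mono Ioi_subset_Ici_self)
  have hr : LocAC (recip w) fun y => -(p y) * recip w y :=
    LocAC.of_hasDerivAt (fun y hy => hw.hasDerivAt_recip hy)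
      ((hw.cp.neg.mul hw.continuous_recip.continuousOn).mono Ioi_subset_Ici_self)
  exact (((locAC_green1 hμ f).sub (hp.mul (locAC_green hμ f))).mul hr).congr_deriv
    (ae_of_all _ fun y => by ring)

/-- The trial function with `w v'' = G`, `G'' - μ² G = f`. -/
def LogWeight.trial (f : Sq) : Trial where
  v := prim μ w f
  v1 := prim1 μ w f
  v2 y := green μ w f y * recip w y
  v3 y := (green1 μ w f y - p y * green μ w f y) * recip w y
  v4 y := (f y + μ ^ 2 * green μ w f y - 2 * p y * green1 μ w f y
    + (p y ^ 2 - p1 y) * green μ w f y) * recip w y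
  d0 y _ := hasDerivAt_prim hμ hw f y
  d1 y _ := hasDerivAt_prim1 hμ hw f y
  d2 _ hy := hw.hasDerivAt_green_recip hμ f hy
  c0 := (continuous_prim hμ hw f).continuousOn
  c1 := (continuous_prim1 hμ hw f).continuousOn
  c2 := (continuous_green_recip hμ hw f).continuousOn
  c3 := ((continuous_green1 hμ f).continuousOn.sub
    (hw.cp.mul (continuous_green hμ f).continuousOn)).mul hw.continuous_recip.continuousOn
  ac := hw.locAC_third hμ f
  z0 := by simp [prim]
  z1 := by simp [prim1]

variable {S : Coefficients}

theorem LogWeight.op_trial (f : Sq) {y : ℝ} (hy : 0 < y) :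
    w y * S.op (hw.trial hμ f) y = f y + ((-2 * p y - S.b y) * green1 μ w f y
      + (p y ^ 2 - p1 y + (μ ^ 2 - S.a y) + S.b y * p y) * green μ w f y
      + (w y * (S.b2 y + S.f y)) * prim1 μ w f y
      + (w y * (1 + y) * (S.a2 y + S.e y)) * (prim μ w f y / (1 + y))) := by
  have h1 := hw.mul_recip hy.le
  have h2 : 1 + y ≠ 0 := by positivity
  have h3 : w y ≠ 0 := (hw.pos hy.le).ne'
  have h4 : recip w y = 1 / w y := by field_simp; linarith
  unfold Coefficients.op LogWeight.trial
  simp only [h4]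
  field_simp
  ring

theorem LogWeight.finite_trial {M : ℝ} (hB : S.Bounds w M) (f : Sq) :
    S.Finite w (hw.trial hμ f) := by
  obtain ⟨C, hC0, hC⟩ := exists_kernel_bound hμ hw
  obtain ⟨sG, sG1, sP1, sP⟩ := hC f
  set T := hw.trial hμ f with hT
  have hM := hB.M_nonneg
  obtain ⟨C0, hC0⟩ := S.near_wall T
  have hlow : ∀ y, 1 < y → S.c / 2 ≤ S.a y := fun y hy => by
    have := S.low y (by linarith)
    have := S.c_pos
    nlinarith
  have hc := S.c_pos
  have hv : ∀ y, T.v y = prim μ w f y := fun _ => rfl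
  have hv1 : ∀ y, T.v1 y = prim1 μ w f y := fun _ => rfl
  have hv2 : ∀ y, T.v2 y = green μ w f y * recip w y := fun _ => rfl
  have hv3 : ∀ y, T.v3 y = (green1 μ w f y - p y * green μ w f y) * recip w y := fun _ => rfl
  set H : ℝ → ℝ := fun y => |prim μ w f y / (1 + y)| + |prim1 μ w f y| + |green μ w f y| with hH
  have mH : MemLp H 2 halfLine := (sP.1.norm.add sP1.1.norm).add sG.1.norm
  have fq : ∀ y, 1 < y → |S.q T y| ≤ 2 / S.c * |prim μ w f y| := fun y hy => by
    have := hlow y hy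
    unfold Coefficients.q
    rw [hv, abs_div, abs_of_pos (by linarith : 0 < S.a y), div_le_iff₀ (by linarith)]
    have : 1 ≤ 2 / S.c * S.a y := by rw [div_mul_eq_mul_div, le_div_iff₀ hc]; linarith
    nlinarith [abs_nonneg (prim μ w f y)]
  have fq0 : ∀ y, 1 < y → |S.q T y| ≤ 2 / S.c * ((1 + y) * |prim μ w f y / (1 + y)|) := by
    intro y hy
    have h1 : (1 + y) * |prim μ w f y / (1 + y)| = |prim μ w f y| := by
      rw [abs_div, abs_of_pos (by linarith : (0 : ℝ) < 1 + y)]; field_simp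
    rw [h1]; exact fq y hy
  set K1 := 2 / S.c * (1 + M * (2 / S.c)) with hK1
  have hK1' : 0 ≤ K1 := by positivity
  have fq1 : ∀ y, 1 < y → |S.q1 T y| ≤ K1 * H y := by
    intro y hy
    have ha := hlow y hy
    have ha0 : 0 < S.a y := by linarith
    have h1 : S.q1 T y = (prim1 μ w f y - S.a1 y * S.q T y) / S.a y := by
      unfold Coefficients.q1 Coefficients.q
      rw [hv, hv1]
      field_simp
    have h2 : |S.a1 y| * (1 + y) ≤ M :=
      (mul_le_left (hw.w_ge y (by linarith)) (abs_nonneg _)).trans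
        (hB.a1_le y (by linarith))
    have h3 : |S.a1 y * S.q T y| ≤ M * (2 / S.c) * |prim μ w f y / (1 + y)| := by
      rw [abs_mul]
      calc |S.a1 y| * |S.q T y|
          ≤ |S.a1 y| * (2 / S.c * ((1 + y) * |prim μ w f y / (1 + y)|)) := by
            gcongr; exact fq0 y hy
        _ = |S.a1 y| * (1 + y) * (2 / S.c * |prim μ w f y / (1 + y)|) := by ring
        _ ≤ M * (2 / S.c * |prim μ w f y / (1 + y)|) := by gcongr
        _ = _ := by ring
    have h4 : |prim1 μ w f y - S.a1 y * S.q T y| ≤ (1 + M * (2 / S.c)) * H y := by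
      refine (abs_sub _ _).trans ?_
      have n1 := abs_nonneg (prim μ w f y / (1 + y))
      have n2 := abs_nonneg (prim1 μ w f y)
      have n3 := abs_nonneg (green μ w f y)
      have n4 : 0 ≤ M * (2 / S.c) := by positivity
      simp only [hH]
      nlinarith [mul_nonneg n4 n2, mul_nonneg n4 n3]
    rw [h1, abs_div, abs_of_pos ha0, div_le_iff₀ ha0]
    have h5 : 0 ≤ (1 + M * (2 / S.c)) * H y := (abs_nonneg _).trans h4
    have h6 : 1 ≤ 2 / S.c * S.a y := by rw [div_mul_eq_mul_div, le_div_iff₀ hc]; linarith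
    rw [hK1]
    nlinarith
  have hH0 : ∀ y, 0 ≤ H y := fun y => by positivity
  have near : ∀ {g : ℝ → ℝ} {K : ℝ}, ContinuousOn g (Ioi 0) →
      (∃ C, ∀ y, 0 < y → y ≤ 1 → |g y| ≤ C) → (∀ y, 1 < y → |g y| ≤ K * H y) →
      MemLp g 2 halfLine := by
    intro g K hg ⟨C, hn⟩ hf
    exact memLp_of_near_far hg.aesm (mH.const_mul K) hn
      fun y hy => (hf y hy).trans (le_abs_self _)
  refine ⟨near (K := 4 / S.c) ((S.cq T).div continuousOn_id fun y hy => ne_of_gt hy)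
    ⟨|S.l T| + C0, ?_⟩ ?_, near (S.cq1 T) ⟨|S.l T| + C0, ?_⟩ fq1, ?_, ?_, ?_⟩
  · intro y hy hy1
    have h1 := (hC0 y hy hy1).1
    have h2 : S.q T y / y = S.l T + (S.q T y - S.l T * y) / y := by field_simp; ring
    rw [h2]
    refine (abs_add_le _ _).trans (add_le_add_right ?_ _)
    rw [abs_div, abs_of_pos hy, div_le_iff₀ hy]
    have : 0 ≤ C0 := (abs_nonneg _).trans (hC0 y hy hy1).2.2
    nlinarith [mul_nonneg (mul_nonneg this hy.le) (sub_nonneg.2 hy1)]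
  · intro y hy
    rw [abs_div, abs_of_pos (by linarith : 0 < y), div_le_iff₀ (by linarith)]
    refine (fq0 y hy).trans ?_
    have n2 := abs_nonneg (prim1 μ w f y)
    have n3 := abs_nonneg (green μ w f y)
    have h1 : |prim μ w f y / (1 + y)| ≤ H y := by simp only [hH]; linarith
    calc 2 / S.c * ((1 + y) * |prim μ w f y / (1 + y)|) ≤ 2 / S.c * ((2 * y) * H y) := by
          gcongr; linarith
      _ = _ := by ring
  · intro y hy hy1
    have h1 := (hC0 y hy hy1).2.1
    have h2 : 0 ≤ C0 := (abs_nonneg _).trans (hC0 y hy hy1).2.2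
    have h3 : |S.q1 T y| ≤ |S.l T| + |S.q1 T y - S.l T| := by
      have := abs_sub_abs_le_abs_sub (S.q1 T y) (S.l T); linarith
    nlinarith
  · have cs : ContinuousOn (fun y => √(S.a y) * S.q2 T y * w y) (Ioi 0) :=
      (S.ca.sqrt.continuousOn.mul (S.cq2 T)).mul hw.cw.continuousOn
    set Ks := 1 / √(S.c / 2) with hKs
    refine near (K := Ks * (1 + 2 * M * K1 + M * (2 / S.c))) cs ?_ ?_
    · obtain ⟨A, hA⟩ := isCompact_Icc.exists_bound_of_continuousOn
        ((S.ca.sqrt.mul hw.cw).continuousOn (s := Icc 0 1))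
      refine ⟨A * C0, fun y hy hy1 => ?_⟩
      have h1 := hA y ⟨hy.le, hy1⟩
      rw [show √(S.a y) * S.q2 T y * w y = √(S.a y) * w y * S.q2 T y by ring, abs_mul]
      exact mul_le_mul h1 (hC0 y hy hy1).2.2 (abs_nonneg _) ((norm_nonneg _).trans h1)
    · intro y hy
      have hy0 : 0 < y := by linarith
      have ha := hlow y hy
      have ha0 : 0 < S.a y := by linarith
      have hsa : 0 < √(S.a y) := Real.sqrt_pos.2 ha0
      have h1 : √(S.a y) * S.q2 T y * w y =
          1 / √(S.a y) * (green μ w f y - 2 * (S.a1 y * w y) * S.q1 T y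
            - (S.a2 y * w y) * S.q T y) := by
        have e1 : √(S.a y) * √(S.a y) = S.a y := Real.mul_self_sqrt ha0.le
        have e2 := hw.mul_recip hy0.le
        have e3 : √(S.a y) / S.a y = 1 / √(S.a y) := by
          rw [div_eq_div_iff ha0.ne' hsa.ne']; linarith
        unfold Coefficients.q2
        rw [hv2, show √(S.a y) * ((green μ w f y * recip w y - 2 * S.a1 y * S.q1 T y
          - S.a2 y * S.q T y) / S.a y) * w y = √(S.a y) / S.a y *
          (green μ w f y * (recip w y * w y) - 2 * (S.a1 y * w y) * S.q1 T y
            - (S.a2 y * w y) * S.q T y) by ring, e2, e3, mul_one]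
      have hwp := hw.pos hy0.le
      have n1 := abs_nonneg (prim μ w f y / (1 + y))
      have n2 := abs_nonneg (prim1 μ w f y)
      have n3 := abs_nonneg (green μ w f y)
      have h2 : |2 * (S.a1 y * w y) * S.q1 T y| ≤ 2 * M * K1 * H y := by
        rw [abs_mul, abs_mul, abs_two, abs_mul, abs_of_pos hwp]
        calc 2 * (|S.a1 y| * w y) * |S.q1 T y| ≤ 2 * M * (K1 * H y) := by
              gcongr
              · exact hB.a1_le y hy0
              · exact fq1 y hy
          _ = _ := by ring
      have h3 : |S.a2 y * w y * S.q T y| ≤ M * (2 / S.c) * H y := by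
        rw [abs_mul, abs_mul, abs_of_pos hwp]
        calc |S.a2 y| * w y * |S.q T y|
            ≤ |S.a2 y| * w y * (2 / S.c * ((1 + y) * |prim μ w f y / (1 + y)|)) := by
              gcongr; exact fq0 y hy
          _ = |S.a2 y| * (w y * (1 + y)) * (2 / S.c * |prim μ w f y / (1 + y)|) := by ring
          _ ≤ M * (2 / S.c * H y) := by
              gcongr
              · exact hB.a2_le y hy0
              · simp only [hH]; linarith
          _ = _ := by ring
      rw [h1, abs_mul, abs_of_pos (by positivity : 0 < 1 / √(S.a y)), mul_assoc Ks]
      refine mul_le_mul ?_ ?_ (abs_nonneg _) (by positivity)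
      · exact one_div_le_one_div_of_le (Real.sqrt_pos.2 (by linarith)) (Real.sqrt_le_sqrt ha)
      · have h4 : |green μ w f y - 2 * (S.a1 y * w y) * S.q1 T y - S.a2 y * w y * S.q T y| ≤
            |green μ w f y| + |2 * (S.a1 y * w y) * S.q1 T y| + |S.a2 y * w y * S.q T y| :=
          (abs_sub _ _).trans (add_le_add_left (abs_sub _ _) _)
        have h5 : |green μ w f y| ≤ H y := by simp only [hH]; linarith
        linarith
  all_goals
    obtain ⟨Cp, hCp⟩ : ∃ C, ∀ y, 0 ≤ y → |p y| ≤ C ∧ |p1 y| ≤ C := by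
      obtain ⟨C1, h1⟩ := exists_bound_of_tendsto hw.cp hw.p_lim
      obtain ⟨C2, h2⟩ := exists_bound_of_tendsto hw.cp1 hw.p1_lim
      exact ⟨max C1 C2, fun y hy => ⟨(h1 y hy).trans (le_max_left _ _),
        (h2 y hy).trans (le_max_right _ _)⟩⟩
    have cG := (continuous_green (w := w) hμ f)
    have cG1 := (continuous_green1 (w := w) hμ f)
    have hCp0 : 0 ≤ Cp := (abs_nonneg _).trans (hCp 0 le_rfl).1
    have cp := hw.cp.mono Ioi_subset_Ici_self
    have cp1 := hw.cp1.mono Ioi_subset_Ici_self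
  · have h1 : MemLp (fun y => p y * green μ w f y) 2 halfLine :=
      memLp_of_abs_le (sG.1.const_mul Cp) ((cp.mul cG.continuousOn).aesm)
        fun y hy => by
          rw [abs_mul, abs_mul, abs_of_nonneg hCp0]
          exact mul_le_right (hCp y hy.le).1 (abs_nonneg _)
    refine (memLp_congr_ae (ae_of_pos fun y hy => ?_)).1
      (sG1.1.sub h1)
    have := hw.mul_recip (le_of_lt (show (0:ℝ) < y from hy))
    simp only [hv3, Pi.sub_apply]
    rw [mul_assoc, this, mul_one]
  · have h1 : MemLp (fun y => (2 * p y) * green1 μ w f y) 2 halfLine :=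
      memLp_of_abs_le (sG1.1.const_mul (2 * Cp)) (ContinuousOn.aesm
        ((continuousOn_const.mul cp).mul cG1.continuousOn)) fun y hy => by
          rw [abs_mul, abs_mul, abs_mul _ (green1 μ w f y), abs_mul 2 Cp, abs_of_nonneg hCp0]
          have := (hCp y hy.le).1
          gcongr
    have h2 : MemLp (fun y => (p y ^ 2 - p1 y) * green μ w f y) 2 halfLine :=
      memLp_of_abs_le (sG.1.const_mul (Cp ^ 2 + Cp)) (ContinuousOn.aesm
        (((cp.pow 2).sub cp1).mul cG.continuousOn)) fun y hy => by
          rw [abs_mul, abs_mul, abs_of_nonneg (by positivity : 0 ≤ Cp ^ 2 + Cp)]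
          refine mul_le_right ((abs_sub _ _).trans ?_) (abs_nonneg _)
          rw [abs_pow]
          obtain ⟨e1, e2⟩ := hCp y hy.le
          gcongr
    have h3 : MemLp f 2 halfLine := (Lp.memLp f).restrict _
    refine (memLp_congr_ae (ae_of_pos fun y hy => ?_)).1
      (((h3.add (sG.1.const_mul (μ ^ 2))).sub h1).add h2)
    have := hw.mul_recip (le_of_lt (show (0:ℝ) < y from hy))
    change _ = ((f y + μ ^ 2 * green μ w f y - 2 * p y * green1 μ w f y
      + (p y ^ 2 - p1 y) * green μ w f y) * recip w y) * w y
    rw [mul_assoc, this, mul_one]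
    rfl

theorem LogWeight.eq_zero_of_trial {f : Sq} (h : ∀ y, 0 < y → (hw.trial hμ f).v y = 0) :
    ∀ᵐ y ∂halfLine, f y = 0 := by
  have loc : ∀ {g g' : ℝ → ℝ}, (∀ y, 0 < y → g y = 0) → ∀ y, 0 < y → HasDerivAt g (g' y) y →
      g' y = 0 := by
    intro g g' hg y hy hd
    refine hd.unique ((hasDerivAt_const y (0 : ℝ)).congr_of_eventuallyEq ?_)
    filter_upwards [Ioi_mem_nhds hy] with z hz using hg z hz
  have h1 : ∀ y, 0 < y → prim1 μ w f y = 0 := fun y hy =>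
    loc (g' := prim1 μ w f) h y hy (hasDerivAt_prim hμ hw f y)
  have h2 : ∀ y, 0 < y → green μ w f y = 0 := fun y hy => by
    have := loc (g' := fun y => green μ w f y * recip w y) h1 y hy (hasDerivAt_prim1 hμ hw f y)
    exact (mul_eq_zero.1 this).resolve_right (hw.recip_pos y).ne'
  have h3 : ∀ y, 0 < y → green1 μ w f y = 0 := fun y hy =>
    loc (g' := green1 μ w f) h2 y hy (hasDerivAt_green hμ f y)
  filter_upwards [(locAC_green1 (w := w) hμ f).2, ae_restrict_mem measurableSet_Ioi] with y hd hy
  have := loc (g' := fun y => f y + μ ^ 2 * green μ w f y) h3 y hy hd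
  simp only [h2 y hy, mul_zero, add_zero] at this
  exact this

end existence

/-- Solvability in the weighted space: the operator is a compact perturbation of an invertible one
and is injective. -/
theorem Coefficients.exists_of_coercive {S : Coefficients} {w p p1 R R1 : ℝ → ℝ} {k δ B M N : ℝ}
    (hw : LogWeight w p p1) (hB : S.Bounds w M) (hC : S.Coercive R R1 k δ B)
    (hN : S.Asymptotics w N) {F : ℝ → ℝ} (hF : MemLp (fun y => F y * w y) 2 halfLine) :
    ∃ T, S.Finite w T ∧ ∀ᵐ y ∂halfLine, S.op T y = F y := by
  set μ := √N with hμ'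
  have hμ : 0 < μ := Real.sqrt_pos.2 hN.N_pos
  have hμ2 : μ ^ 2 = N := Real.sq_sqrt hN.N_pos.le
  obtain ⟨C, r1, r2, r3, r4⟩ := exists_regularFamily hμ hw
  have cw := hw.cw
  have ca := S.ca
  have ca2 := S.ca2
  have cb := S.cb
  have cb2 := S.cb2
  have ce := S.ce
  have cf := S.cf
  have k1 := r2.compactRep (c := fun y => -2 * p y - S.b y)
    ((continuousOn_const.mul hw.cp).sub cb.continuousOn)
    (by simpa using (hw.p_lim.const_mul (-2)).sub hN.b_lim)
  have k2 := r1.compactRep (c := fun y => p y ^ 2 - p1 y + (μ ^ 2 - S.a y) + S.b y * p y)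
    ((((hw.cp.pow 2).sub hw.cp1).add (continuousOn_const.sub ca.continuousOn)).add
      (cb.continuousOn.mul hw.cp)) (by
      have := (((hw.p_lim.pow 2).sub hw.p1_lim).add
        ((tendsto_const_nhds (x := N)).sub hN.a_lim)).add (hN.b_lim.mul hw.p_lim)
      rw [hμ2]
      simpa using this)
  have k3 := r3.compactRep (c := fun y => w y * (S.b2 y + S.f y))
    (by fun_prop : Continuous _).continuousOn hN.first
  have k4 := r4.compactRep (c := fun y => w y * (1 + y) * (S.a2 y + S.e y))
    (by fun_prop : Continuous _).continuousOn hN.zeroth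
  obtain ⟨A, hA, hAf⟩ := ((k1.add k2).add k3).add k4
  have hop : ∀ f : Sq, ∀ᵐ y ∂halfLine, w y * S.op (hw.trial hμ f) y = f y + A f y := by
    intro f
    filter_upwards [ae_restrict_of_ae (hAf f), ae_restrict_mem measurableSet_Ioi] with y h1 hy
    rw [hw.op_trial hμ f hy, h1]
    simp only [indicator_of_mem hy]
  have hneg : ∀ f : Sq, ∀ᵐ y, y ∉ Ioi (0 : ℝ) → A f y = 0 := by
    intro f
    filter_upwards [hAf f] with y h1 hy
    rw [h1]
    simp only [indicator_of_notMem hy, add_zero]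
  have hinj : ¬ Module.End.HasEigenvalue (A : Module.End ℝ Sq) (-1) := by
    intro he
    obtain ⟨f, hf⟩ := he.exists_hasEigenvector
    have hAfe : A f = -f := by
      have := hf.apply_eq_smul
      simpa using this
    apply hf.2
    have h0 : ∀ᵐ y ∂halfLine, S.op (hw.trial hμ f) y = 0 := by
      filter_upwards [hop f, ae_restrict_of_ae (Lp.coeFn_neg f), ae_restrict_mem measurableSet_Ioi]
        with y h1 h2 hy
      rw [hAfe, h2, Pi.neg_apply, add_neg_cancel] at h1
      exact (mul_eq_zero.1 h1).resolve_left (hw.pos (le_of_lt (show (0:ℝ) < y from hy))).ne'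
    have h1 := hw.eq_zero_of_trial hμ (hC.eq_zero hB (hw.finite_trial hμ hB f) h0)
    rw [ae_restrict_iff' measurableSet_Ioi] at h1
    rw [Lp.eq_zero_iff_ae_eq_zero]
    filter_upwards [h1, hneg f, Lp.coeFn_neg f] with y h2 h3 h4
    by_cases hy : y ∈ Ioi (0 : ℝ)
    · exact h2 hy
    · have := h3 hy
      rw [hAfe, h4, Pi.neg_apply, neg_eq_zero] at this
      exact this
  have hres := (hA.hasEigenvalue_or_mem_resolventSet (neg_ne_zero.2 one_ne_zero)).resolve_left hinj
  rw [spectrum.mem_resolventSet_iff] at hres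
  obtain ⟨U, hU⟩ := hres
  have hI : MemLp ((Ioi (0 : ℝ)).indicator fun y => F y * w y) 2 volume :=
    (memLp_indicator_iff_restrict measurableSet_Ioi).2 hF
  set g : Sq := hI.toLp _ with hg
  set f : Sq := -((↑U⁻¹ : Sq →L[ℝ] Sq) g) with hf
  have hsolve : f + A f = g := by
    have h1 : (↑U * ↑U⁻¹ : Sq →L[ℝ] Sq) g = g := by rw [Units.mul_inv]; rfl
    have h2 : (↑U : Sq →L[ℝ] Sq) ((↑U⁻¹ : Sq →L[ℝ] Sq) g) = g := h1
    set x := (↑U⁻¹ : Sq →L[ℝ] Sq) g with hx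
    have h3 : (algebraMap ℝ (Sq →L[ℝ] Sq) (-1) - A) x = -x - A x := by
      simp [Algebra.algebraMap_eq_smul_one]
    rw [hU, h3] at h2
    rw [hf, map_neg, ← sub_eq_add_neg, h2]
  refine ⟨hw.trial hμ f, hw.finite_trial hμ hB f, ?_⟩
  filter_upwards [hop f, ae_restrict_of_ae (Lp.coeFn_add f (A f)),
    ae_restrict_of_ae hI.coeFn_toLp, ae_restrict_mem measurableSet_Ioi] with y h1 h2 h3 hy
  rw [hsolve, ← hg, Pi.add_apply] at *
  rw [← h2, h3, indicator_of_mem hy, mul_comm] at h1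
  exact mul_right_cancel₀ (hw.pos (le_of_lt (show (0:ℝ) < y from hy))).ne' h1

theorem logWeight_w0 (m : ℕ) {ε : ℝ} (hε : 0 < ε) :
    LogWeight (w0 m ε) (fun y => (1 + y)⁻¹ + m * √ε * (1 + √ε * y)⁻¹)
      (fun y => -((1 + y)⁻¹ ^ 2) - m * √ε ^ 2 * (1 + √ε * y)⁻¹ ^ 2) := by
  have hθ : 0 < √ε := Real.sqrt_pos.2 hε
  have dlin : ∀ c y : ℝ, HasDerivAt (fun y : ℝ => 1 + c * y) c y := fun c y => by
    simpa using ((hasDerivAt_id y).const_mul c).const_add 1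
  have dlin1 : ∀ y : ℝ, HasDerivAt (fun y : ℝ => 1 + y) 1 y := fun y => by
    simpa using (hasDerivAt_id y).const_add 1
  have ne1 : ∀ y : ℝ, 0 ≤ y → 1 + y ≠ 0 := fun y hy => by positivity
  have ne2 : ∀ y : ℝ, 0 ≤ y → 1 + √ε * y ≠ 0 := fun y hy => by positivity
  have ci1 : ContinuousOn (fun y : ℝ => (1 + y)⁻¹) (Ici 0) :=
    ContinuousOn.inv₀ (by fun_prop) ne1
  have ci2 : ContinuousOn (fun y : ℝ => (1 + √ε * y)⁻¹) (Ici 0) :=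
    ContinuousOn.inv₀ (by fun_prop) ne2
  have l1 : Tendsto (fun y : ℝ => (1 + y)⁻¹) atTop (𝓝 0) :=
    tendsto_inv_atTop_zero.comp (tendsto_atTop_add_const_left _ _ tendsto_id)
  have l2 : Tendsto (fun y : ℝ => (1 + √ε * y)⁻¹) atTop (𝓝 0) :=
    tendsto_inv_atTop_zero.comp (tendsto_atTop_add_const_left _ _ (tendsto_id.const_mul_atTop hθ))
  refine ⟨continuous_w0 m ε, fun y hy => ?_, fun y hy => ?_, fun y hy => ?_, ?_, ?_, ?_, ?_⟩
  · unfold w0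
    exact le_mul_of_one_le_right (by positivity) (one_le_pow₀ (by nlinarith [mul_nonneg hθ.le hy]))
  · have h1 := (dlin1 y).mul ((dlin (√ε) y).pow m)
    refine h1.congr_deriv ?_
    have e1 := ne1 y hy.le
    have e2 := ne2 y hy.le
    unfold w0
    rcases m with _ | m
    · simp [e1]
    · simp only [Pi.pow_apply, Nat.add_sub_cancel]
      push_cast
      field_simp
      ring
  · refine (((dlin1 y).inv (ne1 y hy.le)).add
      (((dlin (√ε) y).inv (ne2 y hy.le)).const_mul (m * √ε))).congr_deriv ?_
    have e1 := ne1 y hy.le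
    have e2 := ne2 y hy.le
    field_simp
    ring
  · exact ci1.add (continuousOn_const.mul ci2)
  · exact (ci1.pow 2).neg.sub (continuousOn_const.mul (ci2.pow 2))
  · simpa using l1.add (l2.const_mul (m * √ε))
  · simpa using (l1.pow 2).neg.sub ((l2.pow 2).const_mul (m * √ε ^ 2))

theorem Coefficients.Bounds.exists_lim {S : Coefficients} {m : ℕ} {ε M : ℝ} (hm : 1 ≤ m)
    (hε : 0 < ε) (hε1 : ε ≤ 1) (hB : S.Bounds (w0 m ε) M) :
    ∃ N, 0 < N ∧ Tendsto S.a atTop (𝓝 N) := by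
  have hθ : 0 < √ε := Real.sqrt_pos.2 hε
  have hθ1 : √ε ≤ 1 := Real.sqrt_le_one.2 hε1
  have hI : IntegrableOn S.a1 (Ioi 0) := by
    refine Integrable.mono' ((integral_one_add_inv_sq le_rfl).1.const_mul (M / √ε))
      S.ca1.aestronglyMeasurable (ae_of_pos fun y hy => ?_)
    have hy : 0 < y := hy
    have h1 := hB.a1_le y hy
    have h2 : √ε * (1 + y) ^ 2 ≤ w0 m ε y := by
      unfold w0
      have : √ε * (1 + y) ≤ 1 + √ε * y := by nlinarith
      calc √ε * (1 + y) ^ 2 = (1 + y) * (√ε * (1 + y)) := by ring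
        _ ≤ (1 + y) * (1 + √ε * y) := by gcongr
        _ ≤ (1 + y) * (1 + √ε * y) ^ m := by
          gcongr
          exact le_self_pow₀ (by nlinarith [mul_pos hθ hy]) (by omega)
    have h3 : |S.a1 y| * (√ε * (1 + y) ^ 2) ≤ M :=
      (mul_le_left h2 (abs_nonneg _)).trans h1
    rw [Real.norm_eq_abs, inv_pow, ← div_eq_mul_inv, div_div, le_div_iff₀ (by positivity)]
    exact h3
  have hl := tendsto_limUnder_of_hasDerivAt_of_integrableOn_Ioi (fun y _ => S.da y) hI
  refine ⟨_, ?_, hl⟩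
  have hc := S.c_pos
  have : S.c / 2 ≤ limUnder atTop S.a := by
    refine ge_of_tendsto hl ?_
    filter_upwards [eventually_ge_atTop 1] with y hy
    have := S.low y (by linarith)
    nlinarith
  linarith

/-- The limits at infinity of the lower order coefficients. -/
structure Coefficients.Decay (S : Coefficients) (w : ℝ → ℝ) : Prop where
  b : Tendsto S.b atTop (𝓝 0)
  first : Tendsto (fun y => w y * (S.b2 y + S.f y)) atTop (𝓝 0)
  zeroth : Tendsto (fun y => w y * (1 + y) * (S.a2 y + S.e y)) atTop (𝓝 0)

theorem Coefficients.exists_of_decay {S : Coefficients} {m : ℕ} {ε M k δ B : ℝ} {R R1 : ℝ → ℝ}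
    (hm : 1 ≤ m) (hε : 0 < ε) (hε1 : ε ≤ 1) (hB : S.Bounds (w0 m ε) M)
    (hC : S.Coercive R R1 k δ B) (hD : S.Decay (w0 m ε)) {F : ℝ → ℝ}
    (hF : MemLp (fun y => F y * w0 m ε y) 2 halfLine) :
    ∃ T, S.Finite (w0 m ε) T ∧ ∀ᵐ y ∂halfLine, S.op T y = F y := by
  obtain ⟨N, hN, hl⟩ := hB.exists_lim hm hε hε1
  exact exists_of_coercive (logWeight_w0 m hε) hB hC ⟨hN, hl, hD.b, hD.first, hD.zeroth⟩ hF

/-- A function of two variables is smooth. -/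
abbrev Smooth₂ (f : ℝ → ℝ → ℝ) : Prop := ContDiff ℝ ((⊤ : ℕ∞) : WithTop ℕ∞) (Function.uncurry f)

namespace Smooth₂

variable {f : ℝ → ℝ → ℝ} (hf : Smooth₂ f)
include hf

theorem right (x : ℝ) : ContDiff ℝ ((⊤ : ℕ∞) : WithTop ℕ∞) (f x) :=
  hf.comp (contDiff_const.prodMk contDiff_id)

theorem left (y : ℝ) : ContDiff ℝ ((⊤ : ℕ∞) : WithTop ℕ∞) fun x => f x y :=
  hf.comp (contDiff_id.prodMk contDiff_const)

theorem hasDerivAt_right (x y : ℝ) :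
    HasDerivAt (f x) (fderiv ℝ (Function.uncurry f) (x, y) (0, 1)) y := by
  have h1 : HasFDerivAt (Function.uncurry f) _ (x, y) :=
    (hf.differentiable (by simp)).differentiableAt.hasFDerivAt
  exact h1.comp_hasDerivAt y ((hasDerivAt_const y x).prodMk (hasDerivAt_id y))

theorem hasDerivAt_left (x y : ℝ) :
    HasDerivAt (fun x => f x y) (fderiv ℝ (Function.uncurry f) (x, y) (1, 0)) x := by
  have h1 : HasFDerivAt (Function.uncurry f) _ (x, y) :=
    (hf.differentiable (by simp)).differentiableAt.hasFDerivAt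
  exact h1.comp_hasDerivAt x ((hasDerivAt_id x).prodMk (hasDerivAt_const x y))

theorem fderiv_apply (v : ℝ × ℝ) : Smooth₂ fun x y => fderiv ℝ (Function.uncurry f) (x, y) v :=
  (hf.fderiv_right (m := ((⊤ : ℕ∞) : WithTop ℕ∞)) (by simp)).clm_apply contDiff_const

theorem deriv_right : Smooth₂ fun x y => deriv (f x) y := by
  have := hf.fderiv_apply (0, 1)
  simpa only [← (hf.hasDerivAt_right _ _).deriv] using this

theorem deriv_left : Smooth₂ fun x y => deriv (fun x => f x y) x := by
  have := hf.fderiv_apply (1, 0)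
  simpa only [← (hf.hasDerivAt_left _ _).deriv] using this

/-- The mixed derivatives commute. -/
theorem deriv_comm (x y : ℝ) : deriv (fun y => deriv (fun x => f x y) x) y =
    deriv (fun x => deriv (f x) y) x := by
  have e1 : (fun y => deriv (fun x => f x y) x) =
      fun y => fderiv ℝ (Function.uncurry f) (x, y) (1, 0) :=
    funext fun y => (hf.hasDerivAt_left x y).deriv
  have e2 : (fun x => deriv (f x) y) =
      fun x => fderiv ℝ (Function.uncurry f) (x, y) (0, 1) :=
    funext fun x => (hf.hasDerivAt_right x y).deriv
  have hd : HasFDerivAt (fderiv ℝ (Function.uncurry f))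
      (fderiv ℝ (fderiv ℝ (Function.uncurry f)) (x, y)) (x, y) :=
    ((hf.fderiv_right (m := ((⊤ : ℕ∞) : WithTop ℕ∞)) (by simp)).differentiable
      (by simp)).differentiableAt.hasFDerivAt
  have d1 : HasDerivAt (fun y => fderiv ℝ (Function.uncurry f) (x, y) (1, 0))
      (fderiv ℝ (fderiv ℝ (Function.uncurry f)) (x, y) (0, 1) (1, 0)) y := by
    have h := hd.comp_hasDerivAt y ((hasDerivAt_const y x).prodMk (hasDerivAt_id y))
    exact (h.clm_apply (hasDerivAt_const y ((1 : ℝ), (0 : ℝ)))).congr_deriv (by simp)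
  have d2 : HasDerivAt (fun x => fderiv ℝ (Function.uncurry f) (x, y) (0, 1))
      (fderiv ℝ (fderiv ℝ (Function.uncurry f)) (x, y) (1, 0) (0, 1)) x := by
    have h := hd.comp_hasDerivAt x ((hasDerivAt_id x).prodMk (hasDerivAt_const x y))
    exact (h.clm_apply (hasDerivAt_const x ((0 : ℝ), (1 : ℝ)))).congr_deriv (by simp)
  rw [e1, e2, d1.deriv, d2.deriv]
  exact second_derivative_symmetric (fun z =>
    (hf.differentiable (by simp)).differentiableAt.hasFDerivAt) hd _ _

theorem iterated_right (k : ℕ) : Smooth₂ fun x y => iteratedDeriv k (f x) y := by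
  induction k with
  | zero => simpa only [iteratedDeriv_zero] using hf
  | succ k ih => simpa only [iteratedDeriv_succ] using ih.deriv_right

theorem iterated_left (j : ℕ) : Smooth₂ fun x y => iteratedDeriv j (fun x => f x y) x := by
  induction j with
  | zero => simpa only [iteratedDeriv_zero] using hf
  | succ j ih => simpa only [iteratedDeriv_succ] using ih.deriv_left

theorem smooth_pd (j k : ℕ) : Smooth₂ (pd j k f) := (hf.iterated_right k).iterated_left j

theorem hasDerivAt_iterated_left (j : ℕ) (x y : ℝ) :
    HasDerivAt (fun y => iteratedDeriv j (fun x => f x y) x)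
      (iteratedDeriv j (fun x => deriv (f x) y) x) y := by
  have key : ∀ j, ∀ {f : ℝ → ℝ → ℝ}, Smooth₂ f → ∀ x y,
      deriv (fun y => iteratedDeriv j (fun x => f x y) x) y =
        iteratedDeriv j (fun x => deriv (f x) y) x := by
    intro j
    induction j with
    | zero => intro f hf x y; simp only [iteratedDeriv_zero]
    | succ j ih =>
      intro f hf x y
      simp only [iteratedDeriv_succ]
      rw [(hf.iterated_left j).deriv_comm]
      congr 1
      funext x'
      exact ih hf x' y
  rw [← key j hf x y]
  exact (((hf.iterated_left j).right x).differentiable (by simp)).differentiableAt.hasDerivAt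

theorem hasDerivAt_pd_right (j k : ℕ) (x y : ℝ) :
    HasDerivAt (pd j k f x) (pd j (k + 1) f x y) y := by
  have := (hf.iterated_right k).hasDerivAt_iterated_left j x y
  simp only [← iteratedDeriv_succ] at this
  exact this

theorem hasDerivAt_pd_left (j k : ℕ) (x y : ℝ) :
    HasDerivAt (fun x => pd j k f x y) (pd (j + 1) k f x y) x := by
  unfold pd
  rw [iteratedDeriv_succ]
  exact ((((hf.iterated_right k).iterated_left j).left y).differentiable
    (by simp)).differentiableAt.hasDerivAt

theorem continuous_pd (j k : ℕ) (x : ℝ) : Continuous (pd j k f x) :=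
  ((hf.smooth_pd j k).right x).continuous

/-- Differentiation under the integral. -/
theorem hasDerivAt_integral (x y : ℝ) :
    HasDerivAt (fun x => ∫ z in (0 : ℝ)..y, f x z)
      (∫ z in (0 : ℝ)..y, deriv (fun x => f x z) x) x := by
  have hc : Continuous fun q : ℝ × ℝ => deriv (fun x => f x q.2) q.1 := hf.deriv_left.continuous
  obtain ⟨C, hC⟩ := (isCompact_Icc.prod isCompact_uIcc).exists_bound_of_continuousOn
    (hc.continuousOn (s := Icc (x - 1) (x + 1) ×ˢ uIcc 0 y))
  refine (intervalIntegral.hasDerivAt_integral_of_dominated_loc_of_deriv_le (𝕜 := ℝ)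
    (F' := fun x z => deriv (fun x => f x z) x) (bound := fun _ => C)
    (Icc_mem_nhds (sub_one_lt x) (lt_add_one x))
    (Eventually.of_forall fun x => (hf.right x).continuous.aestronglyMeasurable)
    ((hf.right x).continuous.intervalIntegrable _ _)
    (hf.deriv_left.right x).continuous.aestronglyMeasurable ?_ intervalIntegrable_const ?_).2
  · exact ae_of_all _ fun z hz x' hx' => hC (x', z) ⟨hx', uIoc_subset_uIcc hz⟩
  · exact ae_of_all _ fun z _ x' _ =>
      ((hf.left z).differentiable (by simp)).differentiableAt.hasDerivAt

theorem iteratedDeriv_integral (j : ℕ) (x y : ℝ) :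
    iteratedDeriv j (fun x => ∫ z in (0 : ℝ)..y, f x z) x =
      ∫ z in (0 : ℝ)..y, pd j 0 f x z := by
  induction j generalizing x with
  | zero => simp [pd]
  | succ j ih =>
    rw [iteratedDeriv_succ]
    have : iteratedDeriv j (fun x => ∫ z in (0 : ℝ)..y, f x z) =
        fun x => ∫ z in (0 : ℝ)..y, pd j 0 f x z := funext fun x => ih x
    rw [this, ((hf.smooth_pd j 0).hasDerivAt_integral x y).deriv]
    congr 1
    funext z
    exact (hf.hasDerivAt_pd_left j 0 x z).deriv

theorem contDiff_integral (y : ℝ) (n : ℕ) :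
    ContDiff ℝ n fun x => ∫ z in (0 : ℝ)..y, f x z := by
  refine contDiff_nat_iff_iteratedDeriv.2 ⟨fun j _ => ?_, fun j _ x => ?_⟩
  · have : iteratedDeriv j (fun x => ∫ z in (0 : ℝ)..y, f x z) =
        fun x => ∫ z in (0 : ℝ)..y, pd j 0 f x z :=
      funext fun x => hf.iteratedDeriv_integral j x y
    rw [this]
    exact continuous_iff_continuousAt.2 fun x =>
      ((hf.smooth_pd j 0).hasDerivAt_integral x y).continuousAt
  · have : iteratedDeriv j (fun x => ∫ z in (0 : ℝ)..y, f x z) =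
        fun x => ∫ z in (0 : ℝ)..y, pd j 0 f x z :=
      funext fun x => hf.iteratedDeriv_integral j x y
    rw [this]
    exact ((hf.smooth_pd j 0).hasDerivAt_integral x y).differentiableAt

theorem comp_mul (s t : ℝ) : Smooth₂ fun x y => f (s * x) (t * y) :=
  hf.comp ((contDiff_const.mul contDiff_fst).prodMk (contDiff_const.mul contDiff_snd))

theorem pd_comp_mul (s t : ℝ) (j k : ℕ) (x y : ℝ) :
    pd j k (fun x y => f (s * x) (t * y)) x y = s ^ j * t ^ k * pd j k f (s * x) (t * y) := by
  unfold pd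
  have h1 : ∀ x', iteratedDeriv k (fun y => f (s * x') (t * y)) y =
      t ^ k * iteratedDeriv k (f (s * x')) (t * y) := fun x' =>
    congrFun (iteratedDeriv_comp_const_mul ((hf.right (s * x')).of_le (mod_cast le_top)) t) y
  have h2 : ContDiff ℝ j fun x' => iteratedDeriv k (f x') (t * y) :=
    ((hf.iterated_right k).left (t * y)).of_le (mod_cast le_top)
  simp only [h1]
  rw [iteratedDeriv_const_mul_field, congrFun (iteratedDeriv_comp_const_mul h2 s) x]
  ring

end Smooth₂

/-- Smooth functions which agree on an interval have the same derivatives at its end point. -/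
theorem iteratedDeriv_eq_of_eqOn {f g : ℝ → ℝ} {L : ℝ} (hL : 0 < L) (n : ℕ)
    (hf : ContDiff ℝ n f) (hg : ContDiff ℝ n g) (h : EqOn f g (Icc 0 L)) :
    iteratedDeriv n f 0 = iteratedDeriv n g 0 := by
  have h0 : (0 : ℝ) ∈ Icc 0 L := ⟨le_rfl, hL.le⟩
  rw [← iteratedDerivWithin_eq_iteratedDeriv (uniqueDiffOn_Icc hL) hf.contDiffAt h0,
    ← iteratedDerivWithin_eq_iteratedDeriv (uniqueDiffOn_Icc hL) hg.contDiffAt h0]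
  exact iteratedDerivWithin_congr h h0

/-- The regularity of a profile near the initial line which is needed to form the operator. -/
structure Regular (G : ℝ → ℝ → ℝ) : Prop where
  d1 : ∀ y, HasDerivAt (G 0) (pd 0 1 G 0 y) y
  d2 : ∀ y, HasDerivAt (pd 0 1 G 0) (pd 0 2 G 0 y) y
  c2 : Continuous (pd 0 2 G 0)
  cx : ∀ y, ContDiff ℝ 2 fun x => G x y
  cxx : Continuous (pd 2 0 G 0)

theorem pd_zero_one (G : ℝ → ℝ → ℝ) (x y : ℝ) : pd 0 1 G x y = deriv (G x) y := by
  simp [pd]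

theorem pd_zero_two (G : ℝ → ℝ → ℝ) (x : ℝ) : pd 0 2 G x = deriv (pd 0 1 G x) := by
  have h : pd 0 1 G x = iteratedDeriv 1 (G x) := by funext y; simp only [pd, iteratedDeriv_zero]
  funext y
  rw [h, ← iteratedDeriv_succ]
  simp only [pd, iteratedDeriv_zero]

theorem pd_eq_of_hasDerivAt {G : ℝ → ℝ → ℝ} {g1 g2 : ℝ → ℝ} {x : ℝ}
    (h1 : ∀ y, HasDerivAt (G x) (g1 y) y) (h2 : ∀ y, HasDerivAt g1 (g2 y) y) :
    pd 0 1 G x = g1 ∧ pd 0 2 G x = g2 := by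
  have e1 : pd 0 1 G x = g1 := funext fun y => by rw [pd_zero_one, (h1 y).deriv]
  refine ⟨e1, ?_⟩
  rw [pd_zero_two, e1]
  exact funext fun y => (h2 y).deriv

theorem Smooth₂.regular {f : ℝ → ℝ → ℝ} (hf : Smooth₂ f) : Regular f where
  d1 y := hf.hasDerivAt_pd_right 0 0 0 y
  d2 y := hf.hasDerivAt_pd_right 0 1 0 y
  c2 := hf.continuous_pd 0 2 0
  cx y := by exact_mod_cast contDiff_infty.1 (hf.left y) 2
  cxx := hf.continuous_pd 2 0 0

namespace Regular

variable {G H : ℝ → ℝ → ℝ}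

theorem add_eq (hG : Regular G) (hH : Regular H) :
    (pd 0 1 (fun x y => G x y + H x y) 0 = fun y => pd 0 1 G 0 y + pd 0 1 H 0 y) ∧
    (pd 0 2 (fun x y => G x y + H x y) 0 = fun y => pd 0 2 G 0 y + pd 0 2 H 0 y) ∧
    (pd 2 0 (fun x y => G x y + H x y) 0 = fun y => pd 2 0 G 0 y + pd 2 0 H 0 y) := by
  obtain ⟨e1, e2⟩ := pd_eq_of_hasDerivAt (G := fun x y => G x y + H x y) (x := 0)
    (fun y => (hG.d1 y).add (hH.d1 y)) (fun y => (hG.d2 y).add (hH.d2 y))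
  refine ⟨e1, e2, funext fun y => ?_⟩
  simp only [pd, iteratedDeriv_zero]
  exact iteratedDeriv_fun_add (hG.cx y).contDiffAt (hH.cx y).contDiffAt

theorem add (hG : Regular G) (hH : Regular H) : Regular fun x y => G x y + H x y := by
  obtain ⟨e1, e2, e3⟩ := hG.add_eq hH
  refine ⟨fun y => ?_, fun y => ?_, ?_, fun y => (hG.cx y).add (hH.cx y), ?_⟩
  · rw [e1]; exact (hG.d1 y).add (hH.d1 y)
  · rw [e1, e2]; exact (hG.d2 y).add (hH.d2 y)
  · rw [e2]; exact hG.c2.add hH.c2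
  · rw [e3]; exact hG.cxx.add hH.cxx

theorem smul_eq (hG : Regular G) (r : ℝ) :
    (pd 0 1 (fun x y => r * G x y) 0 = fun y => r * pd 0 1 G 0 y) ∧
    (pd 0 2 (fun x y => r * G x y) 0 = fun y => r * pd 0 2 G 0 y) ∧
    (pd 2 0 (fun x y => r * G x y) 0 = fun y => r * pd 2 0 G 0 y) := by
  obtain ⟨e1, e2⟩ := pd_eq_of_hasDerivAt (G := fun x y => r * G x y) (x := 0)
    (fun y => (hG.d1 y).const_mul r) (fun y => (hG.d2 y).const_mul r)
  refine ⟨e1, e2, funext fun y => ?_⟩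
  simp only [pd, iteratedDeriv_zero]
  exact iteratedDeriv_const_mul_field r _

theorem smul (hG : Regular G) (r : ℝ) : Regular fun x y => r * G x y := by
  obtain ⟨e1, e2, e3⟩ := hG.smul_eq r
  refine ⟨fun y => ?_, fun y => ?_, ?_, fun y => contDiff_const.mul (hG.cx y), ?_⟩
  · rw [e1]; exact (hG.d1 y).const_mul r
  · rw [e1, e2]; exact (hG.d2 y).const_mul r
  · rw [e2]; exact continuous_const.mul hG.c2
  · rw [e3]; exact continuous_const.mul hG.cxx

end Regular

/-- A profile whose value, first two normal derivatives and second tangential derivative on the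
initial line are bounded by multiples of given functions. -/
structure Piece (β₀ β₁ β₂ βₓ : ℝ → ℝ) (C : ℝ) (G : ℝ → ℝ → ℝ) : Prop where
  reg : Regular G
  b0 : ∀ y, 0 < y → |G 0 y| ≤ C * β₀ y
  b1 : ∀ y, 0 < y → |pd 0 1 G 0 y| ≤ C * β₁ y
  b2 : ∀ y, 0 < y → |pd 0 2 G 0 y| ≤ C * β₂ y
  bx : ∀ y, 0 < y → |pd 2 0 G 0 y| ≤ C * βₓ y

namespace Piece

variable {β₀ β₁ β₂ βₓ γ₀ γ₁ γ₂ γₓ : ℝ → ℝ} {C C' r : ℝ} {G H : ℝ → ℝ → ℝ}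

theorem add (hG : Piece β₀ β₁ β₂ βₓ C G) (hH : Piece β₀ β₁ β₂ βₓ C' H) :
    Piece β₀ β₁ β₂ βₓ (C + C') fun x y => G x y + H x y := by
  obtain ⟨e1, e2, e3⟩ := hG.reg.add_eq hH.reg
  refine ⟨hG.reg.add hH.reg, fun y hy => ?_, fun y hy => ?_, fun y hy => ?_, fun y hy => ?_⟩
  · rw [add_mul]; exact (abs_add_le _ _).trans (add_le_add (hG.b0 y hy) (hH.b0 y hy))
  · rw [add_mul, e1]; exact (abs_add_le _ _).trans (add_le_add (hG.b1 y hy) (hH.b1 y hy))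
  · rw [add_mul, e2]; exact (abs_add_le _ _).trans (add_le_add (hG.b2 y hy) (hH.b2 y hy))
  · rw [add_mul, e3]; exact (abs_add_le _ _).trans (add_le_add (hG.bx y hy) (hH.bx y hy))

theorem smul (hG : Piece β₀ β₁ β₂ βₓ C G) (hC : 0 ≤ C) (hr : 0 ≤ r)
    (h0 : ∀ y, 0 < y → r * β₀ y ≤ γ₀ y) (h1 : ∀ y, 0 < y → r * β₁ y ≤ γ₁ y)
    (h2 : ∀ y, 0 < y → r * β₂ y ≤ γ₂ y) (hx : ∀ y, 0 < y → r * βₓ y ≤ γₓ y) :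
    Piece γ₀ γ₁ γ₂ γₓ C fun x y => r * G x y := by
  obtain ⟨e1, e2, e3⟩ := hG.reg.smul_eq r
  have key : ∀ {g b c : ℝ}, |g| ≤ C * b → r * b ≤ c → |r * g| ≤ C * c := by
    intro g b c h h'
    rw [abs_mul, abs_of_nonneg hr]
    calc r * |g| ≤ r * (C * b) := by gcongr
      _ = C * (r * b) := by ring
      _ ≤ C * c := by gcongr
  refine ⟨hG.reg.smul r, fun y hy => key (hG.b0 y hy) (h0 y hy), fun y hy => ?_,
    fun y hy => ?_, fun y hy => ?_⟩
  · rw [e1]; exact key (hG.b1 y hy) (h1 y hy)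
  · rw [e2]; exact key (hG.b2 y hy) (h2 y hy)
  · rw [e3]; exact key (hG.bx y hy) (hx y hy)

theorem mono (hG : Piece β₀ β₁ β₂ βₓ C G) (hC : 0 ≤ C)
    (h0 : ∀ y, 0 < y → β₀ y ≤ γ₀ y) (h1 : ∀ y, 0 < y → β₁ y ≤ γ₁ y)
    (h2 : ∀ y, 0 < y → β₂ y ≤ γ₂ y) (hx : ∀ y, 0 < y → βₓ y ≤ γₓ y) :
    Piece γ₀ γ₁ γ₂ γₓ C G :=
  ⟨hG.reg, fun y hy => (hG.b0 y hy).trans (mul_le_left (h0 y hy) hC),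
    fun y hy => (hG.b1 y hy).trans (mul_le_left (h1 y hy) hC),
    fun y hy => (hG.b2 y hy).trans (mul_le_left (h2 y hy) hC),
    fun y hy => (hG.bx y hy).trans (mul_le_left (hx y hy) hC)⟩

end Piece

/-- Algebraic decay in the outer variable. -/
def tail (θ : ℝ) (m : ℕ) (y : ℝ) : ℝ := ((1 + θ * y) ^ (m + 4))⁻¹

/-- Exponential decay in the inner variable. -/
def edecay (κ y : ℝ) : ℝ := Real.exp (-(κ * y))

theorem edecay_pos (κ y : ℝ) : 0 < edecay κ y := Real.exp_pos _

theorem tail_pos {θ y : ℝ} (hθ : 0 < θ) (m : ℕ) (hy : 0 < y) : 0 < tail θ m y := by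
  unfold tail; positivity

theorem tail_le_one {θ y : ℝ} (hθ : 0 < θ) (m : ℕ) (hy : 0 < y) : tail θ m y ≤ 1 :=
  inv_le_one_of_one_le₀ (one_le_pow₀ (by nlinarith [mul_pos hθ hy]))

theorem abs_le_mul_edecay {g A κ y : ℝ} (h : |g| * Real.exp (κ * y) ≤ A) :
    |g| ≤ A * edecay κ y := by
  unfold edecay
  rw [Real.exp_neg, ← div_eq_mul_inv, le_div_iff₀ (Real.exp_pos _)]
  exact h

theorem abs_le_mul_tail {g A θ y : ℝ} {m : ℕ} (hθ : 0 < θ) (hy : 0 < y)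
    (h : |g| * (1 + θ * y) ^ (m + 4) ≤ A) : |g| ≤ A * tail θ m y := by
  unfold tail
  rw [← div_eq_mul_inv, le_div_iff₀ (by positivity)]
  exact h

/-- The sum of the bounds of the derivatives up to order three. -/
def bound₃ (A : ℕ → ℝ) : ℝ := |A 0| + |A 1| + |A 2| + |A 3|

theorem le_bound₃ (A : ℕ → ℝ) {j : ℕ} (hj : j ≤ 3) : A j ≤ bound₃ A := by
  unfold bound₃
  have h0 := abs_nonneg (A 0)
  have h1 := abs_nonneg (A 1)
  have h2 := abs_nonneg (A 2)
  have h3 := abs_nonneg (A 3)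
  interval_cases j
  · linarith [le_abs_self (A 0)]
  · linarith [le_abs_self (A 1)]
  · linarith [le_abs_self (A 2)]
  · linarith [le_abs_self (A 3)]

theorem bound₃_nonneg (A : ℕ → ℝ) : 0 ≤ bound₃ A := by unfold bound₃; positivity

/-- An Euler layer. -/
theorem piece_euler {g : ℝ → ℝ → ℝ} (hg : Smooth₂ g) {A : ℕ → ℝ} {θ : ℝ} {m : ℕ} (hθ : 0 < θ)
    (h : ∀ j k : ℕ, ∀ Y, 0 ≤ Y → |pd j k g 0 Y| * (1 + Y) ^ (m + 4) ≤ A (j + k)) :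
    Piece (tail θ m) (fun y => θ * tail θ m y) (fun y => θ ^ 2 * tail θ m y)
      (tail θ m) (bound₃ A) fun x y => g x (θ * y) := by
  have hs : Smooth₂ fun x y => g x (θ * y) := by simpa only [one_mul] using hg.comp_mul 1 θ
  have he : ∀ j k y, pd j k (fun x y => g x (θ * y)) 0 y = θ ^ k * pd j k g 0 (θ * y) := by
    intro j k y
    have := hg.pd_comp_mul 1 θ j k 0 y
    simpa only [one_mul, one_pow] using this
  have hb : ∀ j k y, j + k ≤ 3 → 0 < y → |θ ^ k * pd j k g 0 (θ * y)| ≤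
      bound₃ A * (θ ^ k * tail θ m y) := by
    intro j k y hjk hy
    have h1 := abs_le_mul_tail hθ hy ((h j k (θ * y) (by positivity)).trans (le_bound₃ A hjk))
    rw [abs_mul, abs_of_pos (pow_pos hθ k)]
    calc _ ≤ θ ^ k * (bound₃ A * tail θ m y) := by gcongr
      _ = _ := by ring
  refine ⟨hs.regular, fun y hy => ?_, fun y hy => ?_, fun y hy => ?_, fun y hy => ?_⟩
  · simpa [pd] using hb 0 0 y (by norm_num) hy
  · rw [he]; simpa using hb 0 1 y (by norm_num) hy
  · rw [he]; exact hb 0 2 y (by norm_num) hy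
  · rw [he]; simpa using hb 2 0 y (by norm_num) hy

/-- A Prandtl layer. -/
theorem piece_prandtl {g : ℝ → ℝ → ℝ} (hg : Smooth₂ g) {A : ℕ → ℝ} {κ : ℝ} {β₀ : ℝ → ℝ}
    (h0 : ∀ y, 0 < y → |g 0 y| ≤ bound₃ A * β₀ y)
    (h : ∀ j k : ℕ, 1 ≤ j + k → ∀ y, 0 ≤ y → |pd j k g 0 y| * Real.exp (κ * y) ≤ A (j + k)) :
    Piece β₀ (edecay κ) (edecay κ) (edecay κ) (bound₃ A) g :=
  ⟨hg.regular, h0,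
    fun y hy => abs_le_mul_edecay ((h 0 1 le_rfl y hy.le).trans (le_bound₃ A (by norm_num))),
    fun y hy => abs_le_mul_edecay ((h 0 2 (by norm_num) y hy.le).trans
      (le_bound₃ A (by norm_num))),
    fun y hy => abs_le_mul_edecay ((h 2 0 (by norm_num) y hy.le).trans
      (le_bound₃ A (by norm_num)))⟩

theorem IsCutoff.exists_bound {χ : ℝ → ℝ} (hχ : IsCutoff χ) (m : ℕ) :
    ∃ X : ℝ, 0 ≤ X ∧ ∀ j ≤ 3, ∀ θ y : ℝ, 0 < θ → 0 < y →
      |iteratedDeriv j χ (θ * y)| ≤ X * tail θ m y ∧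
      |iteratedDeriv j χ (θ * y)| * (θ * y) ≤ X * tail θ m y := by
  have hone : ∀ j : ℕ, ∃ X : ℝ, ∀ Y, 0 ≤ Y → |iteratedDeriv j χ Y| * (1 + Y) ^ (m + 5) ≤ X := by
    intro j
    have hc : Continuous fun Y => iteratedDeriv j χ Y * (1 + Y) ^ (m + 5) :=
      (hχ.smooth.continuous_iteratedDeriv j (mod_cast le_top)).mul (by fun_prop)
    obtain ⟨X, hX⟩ := isCompact_Icc.exists_bound_of_continuousOn (hc.continuousOn (s := Icc 0 2))
    refine ⟨X, fun Y hY => ?_⟩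
    rcases le_or_gt Y 2 with h | h
    · have := hX Y ⟨hY, h⟩
      rwa [Real.norm_eq_abs, abs_mul, abs_of_nonneg (by positivity : 0 ≤ (1 + Y) ^ (m + 5))] at this
    · have h1 : χ =ᶠ[𝓝 Y] fun _ => 0 := by
        filter_upwards [Ioi_mem_nhds h] with z hz using hχ.zero z (le_of_lt hz)
      rw [(h1.iteratedDeriv j).eq_of_nhds]
      have h2 : iteratedDeriv j (fun _ : ℝ => (0 : ℝ)) Y = 0 := by simp
      rw [h2, abs_zero, zero_mul]
      exact (norm_nonneg _).trans (hX 0 ⟨le_rfl, by norm_num⟩)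
  choose X hX using hone
  refine ⟨bound₃ X, bound₃_nonneg X, fun j hj θ y hθ hy => ?_⟩
  have h1 := (hX j (θ * y) (by positivity)).trans (le_bound₃ X hj)
  have hθy := mul_pos hθ hy
  have h2 : |iteratedDeriv j χ (θ * y)| * (1 + θ * y) ≤ bound₃ X * tail θ m y := by
    have h3 := abs_le_mul_tail (g := |iteratedDeriv j χ (θ * y)| * (1 + θ * y)) (m := m) hθ hy
      (A := bound₃ X) (by
        rw [abs_of_nonneg (by positivity), mul_assoc, ← pow_succ']; exact h1)
    rwa [abs_of_nonneg (by positivity)] at h3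
  have h4 := abs_nonneg (iteratedDeriv j χ (θ * y))
  constructor <;> nlinarith

theorem IsCutoff.hasDerivAt {χ : ℝ → ℝ} (hχ : IsCutoff χ) (θ : ℝ) (j : ℕ) (y : ℝ) :
    HasDerivAt (fun y => iteratedDeriv j χ (θ * y)) (θ * iteratedDeriv (j + 1) χ (θ * y)) y := by
  have h1 : HasDerivAt (iteratedDeriv j χ) (iteratedDeriv (j + 1) χ (θ * y)) (θ * y) := by
    rw [iteratedDeriv_succ]
    exact ((hχ.smooth.differentiable_iteratedDeriv j (by
      exact_mod_cast WithTop.coe_lt_top _)) _).hasDerivAt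
  have h2 : HasDerivAt (fun y : ℝ => θ * y) θ y := by simpa using (hasDerivAt_id y).const_mul θ
  exact (h1.comp y h2).congr_deriv (by ring)

theorem abs_le_three {a b c A B C : ℝ} (ha : |a| ≤ A) (hb : |b| ≤ B) (hc : |c| ≤ C) :
    |a + b + c| ≤ A + B + C :=
  (abs_add_le _ _).trans (add_le_add ((abs_add_le _ _).trans (add_le_add ha hb)) hc)

section cut

variable {χ : ℝ → ℝ} (hχ : IsCutoff χ) {θ κ X B : ℝ} {m : ℕ}
  (hθ : 0 < θ) (hθ1 : θ ≤ 1) (hX0 : 0 ≤ X)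
  (hX : ∀ j ≤ 3, ∀ y : ℝ, 0 < y → |iteratedDeriv j χ (θ * y)| ≤ X * tail θ m y ∧
      |iteratedDeriv j χ (θ * y)| * (θ * y) ≤ X * tail θ m y) (hB : 0 ≤ B)

theorem abs_smul_le {u Y r : ℝ} (hu : |u| ≤ Y) (hr : 0 ≤ r) : |r * u| ≤ r * Y := by
  rw [abs_mul, abs_of_nonneg hr]; gcongr

section bounds

variable {j : ℕ} (hj : j ≤ 3) {u y : ℝ} (hy : 0 < y)
include hθ hX hj hy

include hX0 in
theorem abs_cut_mul_le (hu : |u| ≤ B) :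
    |iteratedDeriv j χ (θ * y) * u| ≤ X * B * tail θ m y := by
  rw [abs_mul, mul_right_comm]
  exact mul_le_mul (hX j hj y hy).1 hu (abs_nonneg _) (mul_nonneg hX0 (tail_pos hθ m hy).le)

include hX0 in
theorem abs_cut_mul_le_edecay (hu : |u| ≤ B * edecay κ y) :
    |iteratedDeriv j χ (θ * y) * u| ≤ X * B * edecay κ y := by
  rw [abs_mul, mul_assoc]
  exact mul_le_mul ((hX j hj y hy).1.trans (mul_le_of_le_one_right hX0 (tail_le_one hθ m hy))) hu
    (abs_nonneg _) hX0

include hB in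
theorem abs_cut_mul_le_of_le_mul (hu : |u| ≤ B * y) :
    |θ * (iteratedDeriv j χ (θ * y) * u)| ≤ X * B * tail θ m y := by
  rw [abs_mul, abs_mul, abs_of_pos hθ]
  have h1 := mul_le_left hu (mul_nonneg hθ.le (abs_nonneg (iteratedDeriv j χ (θ * y))))
  have h2 := mul_le_left (hX j hj y hy).2 hB
  linarith

end bounds

include hχ hθ hθ1 hX0 hX hB

/-- The normal component of a Prandtl layer which is cut off. -/
theorem piece_cutV {g : ℝ → ℝ → ℝ} (hg : Smooth₂ g)
    (h0 : ∀ y, 0 < y → |g 0 y| ≤ B) (h1 : ∀ y, 0 < y → |pd 0 1 g 0 y| ≤ B * edecay κ y)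
    (h2 : ∀ y, 0 < y → |pd 0 2 g 0 y| ≤ B * edecay κ y)
    (hx : ∀ y, 0 < y → |pd 2 0 g 0 y| ≤ B) :
    Piece (tail θ m) (fun y => edecay κ y + tail θ m y) (fun y => edecay κ y + θ * tail θ m y)
      (tail θ m) (4 * (X * B)) fun x y => χ (θ * y) * g x y := by
  set c : ℕ → ℝ → ℝ := fun j y => iteratedDeriv j χ (θ * y) with hc
  have dc : ∀ j y, HasDerivAt (c j) (θ * c (j + 1) y) y := fun j y => hχ.hasDerivAt θ j y
  have cc : ∀ j, Continuous (c j) := fun j => continuous_of_hasDerivAt (dc j)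
  have ec0 : ∀ y, χ (θ * y) = c 0 y := fun y => by simp [hc]
  have dg0 : ∀ y, HasDerivAt (g 0) (pd 0 1 g 0 y) y := hg.regular.d1
  have dg1 : ∀ y, HasDerivAt (pd 0 1 g 0) (pd 0 2 g 0 y) y := hg.regular.d2
  have cg := (hg.right 0).continuous
  have cg1 := hg.continuous_pd 0 1 0
  have cg2 := hg.continuous_pd 0 2 0
  simp only [ec0]
  set G : ℝ → ℝ → ℝ := fun x y => c 0 y * g x y with hG
  have D1 : ∀ y, HasDerivAt (G 0) (θ * (c 1 y * g 0 y) + c 0 y * pd 0 1 g 0 y) y := fun y =>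
    ((dc 0 y).mul (dg0 y)).congr_deriv (by ring)
  have D2 : ∀ y, HasDerivAt (fun y => θ * (c 1 y * g 0 y) + c 0 y * pd 0 1 g 0 y)
      (θ ^ 2 * (c 2 y * g 0 y) + 2 * (θ * (c 1 y * pd 0 1 g 0 y)) + c 0 y * pd 0 2 g 0 y) y :=
    fun y => ((((dc 1 y).mul (dg0 y)).const_mul θ).add ((dc 0 y).mul (dg1 y))).congr_deriv (by ring)
  obtain ⟨e1, e2⟩ := pd_eq_of_hasDerivAt D1 D2
  have exx : pd 2 0 G 0 = fun y => c 0 y * pd 2 0 g 0 y := by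
    funext y
    simp only [pd, iteratedDeriv_zero, hG]
    exact iteratedDeriv_const_mul_field _ _
  have reg : Regular G := by
    refine ⟨fun y => e1 ▸ D1 y, fun y => e1 ▸ e2 ▸ D2 y, ?_, fun y =>
      contDiff_const.mul (hg.regular.cx y), ?_⟩
    · rw [e2]
      have := cc 0
      have := cc 1
      have := cc 2
      fun_prop
    · rw [exx]
      exact (cc 0).mul (hg.continuous_pd 2 0 0)
  have hXA : 0 ≤ X * B := by positivity
  have J0 := fun y (hy : 0 < y) => tail_pos hθ m hy
  have pc := @abs_cut_mul_le χ θ X B m hθ hX0 hX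
  have pe := @abs_cut_mul_le_edecay χ θ κ X B m hθ hX0 hX
  refine ⟨reg, fun y hy => ?_, fun y hy => ?_, fun y hy => ?_, fun y hy => ?_⟩ <;>
    have n1 := mul_nonneg hXA (J0 y hy).le <;>
    have n2 := mul_nonneg hXA (edecay_pos κ y).le
  · have t1 := pc (j := 0) (by norm_num) hy (h0 y hy)
    refine t1.trans ?_
    nlinarith
  · rw [e1]
    have t1 := abs_smul_le (pc (j := 1) (by norm_num) hy (h0 y hy)) hθ.le
    have t2 := pe (j := 0) (by norm_num) hy (h1 y hy)
    refine (abs_add_le _ _).trans ((add_le_add t1 t2).trans ?_)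
    have := mul_le_right hθ1 n1
    nlinarith
  · rw [e2]
    have t1 := abs_smul_le (pc (j := 2) (by norm_num) hy (h0 y hy)) (sq_nonneg θ)
    have t2 := abs_smul_le (abs_smul_le (pe (j := 1) (by norm_num) hy (h1 y hy)) hθ.le) zero_le_two
    have t3 := pe (j := 0) (by norm_num) hy (h2 y hy)
    refine (abs_le_three t1 t2 t3).trans ?_
    have n3 := mul_le_right hθ1 n2
    have n4 := mul_le_right hθ1 (mul_nonneg hθ.le n1)
    have n5 := mul_nonneg hθ.le n1
    nlinarith
  · rw [exx]
    have t1 := pc (j := 0) (by norm_num) hy (hx y hy)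
    refine t1.trans ?_
    nlinarith

/-- The flux of a Prandtl layer which is cut off. -/
theorem piece_cut_integral {g : ℝ → ℝ → ℝ} (hg : Smooth₂ g) (h0 : ∀ y, 0 ≤ y → |g 0 y| ≤ B)
    (h1 : ∀ y, 0 < y → |pd 0 1 g 0 y| ≤ B * edecay κ y) (hx : ∀ y, 0 ≤ y → |pd 2 0 g 0 y| ≤ B) :
    Piece (tail θ m) (tail θ m) (fun y => edecay κ y + θ * tail θ m y) (tail θ m) (4 * (X * B))
      fun x y => θ * deriv χ (θ * y) * ∫ z in (0 : ℝ)..y, g x z := by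
  set W : ℝ → ℝ := fun y => ∫ z in (0 : ℝ)..y, g 0 z with hW
  set c : ℕ → ℝ → ℝ := fun j y => iteratedDeriv j χ (θ * y) with hc
  have dc : ∀ j y, HasDerivAt (c j) (θ * c (j + 1) y) y := fun j y => hχ.hasDerivAt θ j y
  have cc : ∀ j, Continuous (c j) := fun j => continuous_of_hasDerivAt (dc j)
  have ec1 : ∀ y, deriv χ (θ * y) = c 1 y := fun y => by simp [hc]
  have dW : ∀ y, HasDerivAt W (g 0 y) y := fun y =>
    intervalIntegral.integral_hasDerivAt_right ((hg.right 0).continuous.intervalIntegrable _ _)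
      ((hg.right 0).continuous.stronglyMeasurableAtFilter _ _) (hg.right 0).continuous.continuousAt
  have cW : Continuous W := continuous_of_hasDerivAt dW
  have cg := (hg.right 0).continuous
  have cg1 := hg.continuous_pd 0 1 0
  have c1 := cc 1
  have c2 := cc 2
  have c3 := cc 3
  simp only [ec1]
  set G : ℝ → ℝ → ℝ := fun x y => θ * c 1 y * ∫ z in (0 : ℝ)..y, g x z with hG
  have D1 : ∀ y, HasDerivAt (G 0) (θ * (c 1 y * g 0 y) + θ * (θ * (c 2 y * W y))) y := fun y =>
    (((dc 1 y).const_mul θ).mul (dW y)).congr_deriv (by ring)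
  have D2 : ∀ y, HasDerivAt (fun y => θ * (c 1 y * g 0 y) + θ * (θ * (c 2 y * W y)))
      (2 * (θ ^ 2 * (c 2 y * g 0 y)) + θ * (c 1 y * pd 0 1 g 0 y)
        + θ ^ 2 * (θ * (c 3 y * W y))) y := fun y =>
    ((((dc 1 y).mul (hg.regular.d1 y)).const_mul θ).add
      ((((dc 2 y).mul (dW y)).const_mul θ).const_mul θ)).congr_deriv (by ring)
  obtain ⟨e1, e2⟩ := pd_eq_of_hasDerivAt D1 D2
  have exx : pd 2 0 G 0 = fun y => θ * c 1 y * ∫ z in (0 : ℝ)..y, pd 2 0 g 0 z := by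
    funext y
    simp only [pd, iteratedDeriv_zero, hG]
    rw [iteratedDeriv_const_mul_field, hg.iteratedDeriv_integral]
    simp only [pd, iteratedDeriv_zero]
  have reg : Regular G := by
    refine ⟨fun y => e1 ▸ D1 y, fun y => e1 ▸ e2 ▸ D2 y, ?_, fun y =>
      contDiff_const.mul (by exact_mod_cast hg.contDiff_integral y 2), ?_⟩
    · rw [e2]; fun_prop
    · rw [exx]
      have h1 := hg.continuous_pd 2 0 0
      have h2 : Continuous fun y => ∫ z in (0 : ℝ)..y, pd 2 0 g 0 z :=
        intervalIntegral.continuous_primitive (fun a b => h1.intervalIntegrable a b) 0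
      fun_prop
  have hXA : 0 ≤ X * B := by positivity
  have bW : ∀ {u : ℝ → ℝ} y, 0 < y → (∀ z, 0 ≤ z → |u z| ≤ B) →
      |∫ z in (0 : ℝ)..y, u z| ≤ B * y := fun {u} y hy hu => by
    have := intervalIntegral.norm_integral_le_of_norm_le_const (a := 0) (b := y) (f := u)
      (C := B) fun z hz => by
        rw [uIoc_of_le hy.le] at hz; exact hu z hz.1.le
    rwa [sub_zero, abs_of_pos hy] at this
  have J0 := fun y (hy : 0 < y) => tail_pos hθ m hy
  have pc := @abs_cut_mul_le χ θ X B m hθ hX0 hX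
  have pe := @abs_cut_mul_le_edecay χ θ κ X B m hθ hX0 hX
  have pw := @abs_cut_mul_le_of_le_mul χ θ X B m hθ hX hB
  refine ⟨reg, fun y hy => ?_, fun y hy => ?_, fun y hy => ?_, fun y hy => ?_⟩ <;>
    have n1 := mul_nonneg hXA (J0 y hy).le <;>
    have n2 := mul_nonneg hXA (edecay_pos κ y).le <;>
    have n3 := mul_le_right hθ1 n1
  · have t1 := pw (j := 1) (by norm_num) hy (bW y hy h0)
    rw [← mul_assoc] at t1
    exact t1.trans (by linarith)
  · rw [e1]
    have t1 := abs_smul_le (pc (j := 1) (by norm_num) hy (h0 y hy.le)) hθ.le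
    have t2 := abs_smul_le (pw (j := 2) (by norm_num) hy (bW y hy h0)) hθ.le
    refine (abs_add_le _ _).trans ((add_le_add t1 t2).trans ?_)
    linarith
  · rw [e2]
    have t1 := abs_smul_le (abs_smul_le (pc (j := 2) (by norm_num) hy (h0 y hy.le))
      (sq_nonneg θ)) zero_le_two
    have t2 := abs_smul_le (pe (j := 1) (by norm_num) hy (h1 y hy)) hθ.le
    have t3 := abs_smul_le (pw (j := 3) le_rfl hy (bW y hy h0)) (sq_nonneg θ)
    refine (abs_le_three t1 t2 t3).trans ?_
    have n4 := mul_le_right hθ1 n2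
    have n5 := mul_le_right hθ1 (mul_nonneg hθ.le n1)
    nlinarith
  · rw [exx]
    have t1 := pw (j := 1) (by norm_num) hy (bW y hy hx)
    rw [← mul_assoc] at t1
    exact t1.trans (by linarith)

end cut

/-- The normal component recovered from the tangential one. -/
theorem normal_bounds {u v : ℝ → ℝ → ℝ} (hu : Smooth₂ u) (hv : Smooth₂ v) {κ L : ℝ}
    {A : ℕ → ℝ} (hκ : 0 < κ) (hL : 0 < L)
    (h : ∀ j k : ℕ, 1 ≤ j + k → ∀ y, 0 ≤ y → |pd j k u 0 y| * Real.exp (κ * y) ≤ A (j + k))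
    (hdiv : ∀ x ∈ Icc 0 L, ∀ y, 0 ≤ y → pd 1 0 u x y + pd 0 1 v x y = 0)
    (hwall : ∀ x ∈ Icc 0 L, v x 0 = 0) :
    (∀ y, 0 < y → |v 0 y| ≤ bound₃ A / κ) ∧
    (∀ y, 0 < y → |pd 0 1 v 0 y| ≤ bound₃ A * edecay κ y) ∧
    (∀ y, 0 < y → |pd 0 2 v 0 y| ≤ bound₃ A * edecay κ y) ∧
    ∀ y, 0 < y → |pd 2 0 v 0 y| ≤ bound₃ A / κ := by
  have h0L : (0 : ℝ) ∈ Icc 0 L := ⟨le_rfl, hL.le⟩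
  have hA := bound₃_nonneg A
  have bj : ∀ j k, 1 ≤ j + k → j + k ≤ 3 → ∀ y, 0 ≤ y →
      |pd j k u 0 y| ≤ bound₃ A * edecay κ y := fun j k h1 h2 y hy =>
    abs_le_mul_edecay ((h j k h1 y hy).trans (le_bound₃ A h2))
  have prim_le : ∀ {f g : ℝ → ℝ}, (∀ y, HasDerivAt f (g y) y) → f 0 = 0 →
      (∀ y, 0 ≤ y → |g y| ≤ bound₃ A * edecay κ y) → ∀ y, 0 < y → |f y| ≤ bound₃ A / κ := by
    intro f g hd hf0 hg y hy
    have dB : ∀ z, HasDerivAt (fun z => bound₃ A / κ * (1 - edecay κ z))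
        (bound₃ A * edecay κ z) z := by
      intro z
      have h1 : HasDerivAt (fun z => Real.exp (-(κ * z))) (Real.exp (-(κ * z)) * -(κ * 1)) z :=
        ((hasDerivAt_id z).const_mul κ).neg.exp
      refine ((h1.const_sub 1).const_mul (bound₃ A / κ)).congr_deriv ?_
      unfold edecay
      field_simp
    have h1 := image_norm_le_of_norm_deriv_right_le_deriv_boundary (a := 0) (b := y) (f := f)
      (f' := g) (fun z _ => (hd z).continuousAt.continuousWithinAt)
      (fun z _ => (hd z).hasDerivWithinAt) (B := fun z => bound₃ A / κ * (1 - edecay κ z))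
      (B' := fun z => bound₃ A * edecay κ z) (by simp [hf0, edecay]) dB
      (fun z hz => hg z hz.1) (right_mem_Icc.2 hy.le)
    have h2 := (edecay_pos κ y).le
    have h3 : 0 ≤ bound₃ A / κ := by positivity
    refine h1.trans ?_
    nlinarith
  have e1 : ∀ y, 0 ≤ y → pd 0 1 v 0 y = -pd 1 0 u 0 y := fun y hy => by
    linarith [hdiv 0 h0L y hy]
  have e2 : ∀ y, 0 < y → pd 0 2 v 0 y = -pd 1 1 u 0 y := by
    intro y hy
    refine (hv.hasDerivAt_pd_right 0 1 0 y).unique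
      ((hu.hasDerivAt_pd_right 1 0 0 y).neg.congr_of_eventuallyEq ?_)
    filter_upwards [Ioi_mem_nhds hy] with z hz using e1 z (le_of_lt hz)
  have e3 : ∀ y, 0 ≤ y → pd 2 1 v 0 y = -pd 3 0 u 0 y := by
    intro y hy
    have t1 : ContDiff ℝ (2 : ℕ) fun x => pd 0 1 v x y :=
      contDiff_infty.1 ((hv.smooth_pd 0 1).left y) 2
    have t2 : ContDiff ℝ (2 : ℕ) fun x => -pd 1 0 u x y :=
      contDiff_infty.1 ((hu.smooth_pd 1 0).left y).neg 2
    have := iteratedDeriv_eq_of_eqOn hL 2 t1 t2 fun x hx => by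
      linarith [hdiv x hx y hy]
    rw [iteratedDeriv_fun_neg] at this
    have s1 : iteratedDeriv 2 (fun x => pd 0 1 v x y) 0 = pd 2 1 v 0 y := by
      simp only [pd, iteratedDeriv_zero]
    have s2 : iteratedDeriv 2 (fun x => pd 1 0 u x y) 0 = pd 3 0 u 0 y := by
      have h3 : iteratedDeriv 3 (fun x => u x y) = iteratedDeriv 2 (deriv fun x => u x y) :=
        iteratedDeriv_succ'
      simp only [pd, iteratedDeriv_zero, h3, iteratedDeriv_one]
    rw [← s1, ← s2, this]
  have e4 : pd 2 0 v 0 0 = 0 := by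
    have := iteratedDeriv_eq_of_eqOn hL 2 (contDiff_infty.1 (hv.left 0) 2)
      (contDiff_const (c := (0 : ℝ))) fun x hx => hwall x hx
    simp only [pd, iteratedDeriv_zero]
    rw [this]
    simp
  refine ⟨prim_le (fun y => hv.hasDerivAt_pd_right 0 0 0 y) (hwall 0 h0L) fun y hy => ?_,
    fun y hy => ?_, fun y hy => ?_,
    prim_le (fun y => hv.hasDerivAt_pd_right 2 0 0 y) e4 fun y hy => ?_⟩
  · rw [e1 y hy, abs_neg]; exact bj 1 0 le_rfl (by norm_num) y hy
  · rw [e1 y hy.le, abs_neg]; exact bj 1 0 le_rfl (by norm_num) y hy.le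
  · rw [e2 y hy, abs_neg]; exact bj 1 1 (by norm_num) (by norm_num) y hy.le
  · rw [e3 y hy, abs_neg]; exact bj 3 0 (by norm_num) (by norm_num) y hy

/-- The tangential profile without its leading layers. -/
def restU (χ : ℝ → ℝ) (K : Correctors) (ε x y : ℝ) : ℝ :=
  (∑ i ∈ Finset.Icc 1 3, √ε ^ i * (K.ue i x (√ε * y) + K.up i x y))
    + √ε ^ 4 * (K.ue 4 x (√ε * y) + K.cutU χ ε x y)

/-- The normal profile without its leading layer. -/
def restV (χ : ℝ → ℝ) (K : Correctors) (ε x y : ℝ) : ℝ :=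
  K.ve 1 x (√ε * y)
    + (∑ i ∈ Finset.Icc 1 3, √ε ^ i * (K.vp i x y + K.ve (i + 1) x (√ε * y)))
    + √ε ^ 4 * K.cutV χ ε x y

theorem sum_Icc_one_three (f : ℕ → ℝ) : ∑ i ∈ Finset.Icc 1 3, f i = f 1 + f 2 + f 3 := by
  simp [Finset.sum_Icc_succ_top]

theorem exists_piece_rest {χ : ℝ → ℝ} (hχ : IsCutoff χ) (m : ℕ) {κ : ℝ} (hκ : 0 < κ) (A : ℕ → ℝ) :
    ∃ C : ℝ, 0 ≤ C ∧ ∀ P : PrandtlLayer, ∀ lam sig L ε : ℝ, 0 < L → 0 < ε → ε ≤ 1 →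
      ∀ K : Correctors, K.IsAdmissible P lam sig m κ A L →
      Piece (fun _ => √ε) (fun y => √ε * (edecay κ y + tail (√ε) m y))
        (fun y => √ε * (edecay κ y + √ε * tail (√ε) m y))
        (fun y => edecay κ y + √ε * tail (√ε) m y) C (restU χ K ε) ∧
      Piece (fun y => edecay κ y + tail (√ε) m y)
        (fun y => √ε * (edecay κ y + tail (√ε) m y))
        (fun y => √ε * (edecay κ y + √ε * tail (√ε) m y))
        (fun y => edecay κ y + tail (√ε) m y) C (restV χ K ε) := by
  obtain ⟨X, hX0, hX⟩ := hχ.exists_bound m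
  set b := bound₃ A with hb
  have hb0 : 0 ≤ b := bound₃_nonneg A
  set D := b + b / κ with hD
  have hD0 : 0 ≤ D := by positivity
  set Z := b + b + (b + 8 * (X * b)) + (b + 8 * (X * D)) with hZ
  have hXb : 0 ≤ X * b := by positivity
  have hXD : 0 ≤ X * D := by positivity
  have hZ0 : 0 ≤ Z := by linarith
  refine ⟨Z + Z + Z + Z + Z, by linarith, fun P lam sig L ε hL hε hε1 K hK => ?_⟩
  set θ := √ε with hθd
  have hθ : 0 < θ := Real.sqrt_pos.2 hε
  have hθ1 : θ ≤ 1 := Real.sqrt_le_one.2 hε1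
  have h0L : (0 : ℝ) ∈ Icc 0 L := ⟨le_rfl, hL.le⟩
  set E := edecay κ with hE
  set J := tail θ m with hJ
  have E0 : ∀ y, 0 ≤ E y := fun y => (edecay_pos κ y).le
  have J0 : ∀ y, 0 < y → 0 ≤ J y := fun y hy => (tail_pos hθ m hy).le
  have J1 : ∀ y, 0 < y → J y ≤ 1 := fun y hy => tail_le_one hθ m hy
  have tJ : ∀ y, 0 < y → θ * J y ≤ J y := fun y hy => mul_le_of_le_one_left (J0 y hy) hθ1
  have tE : ∀ y, θ * E y ≤ E y := fun y => mul_le_of_le_one_left (E0 y) hθ1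
  have ttJ : ∀ y, 0 < y → θ ^ 2 * J y ≤ θ * J y := fun y hy => by
    have := mul_le_left (tJ y hy) hθ.le
    calc θ ^ 2 * J y = θ * (θ * J y) := by ring
      _ ≤ _ := this
  have mon : ∀ {β₀ β₁ β₂ βₓ : ℝ → ℝ} {c c' : ℝ} {G : ℝ → ℝ → ℝ}, Piece β₀ β₁ β₂ βₓ c G →
      (∀ y, 0 < y → 0 ≤ β₀ y) → (∀ y, 0 < y → 0 ≤ β₁ y) → (∀ y, 0 < y → 0 ≤ β₂ y) →
      (∀ y, 0 < y → 0 ≤ βₓ y) → c ≤ c' → Piece β₀ β₁ β₂ βₓ c' G :=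
    fun h p0 p1 p2 px hcc => ⟨h.reg,
      fun y hy => (h.b0 y hy).trans (mul_le_right hcc (p0 y hy)),
      fun y hy => (h.b1 y hy).trans (mul_le_right hcc (p1 y hy)),
      fun y hy => (h.b2 y hy).trans (mul_le_right hcc (p2 y hy)),
      fun y hy => (h.bx y hy).trans (mul_le_right hcc (px y hy))⟩
  have nEJ : ∀ y, 0 < y → 0 ≤ E y + J y := fun y hy => add_nonneg (E0 y) (J0 y hy)
  have nEtJ : ∀ y, 0 < y → 0 ≤ E y + θ * J y := fun y hy =>
    add_nonneg (E0 y) (mul_nonneg hθ.le (J0 y hy))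
  have pow_le : ∀ i, 1 ≤ i → θ ^ i ≤ θ := fun i hi => pow_le_of_le_one hθ.le hθ1 (by omega)
  have ueP : ∀ i ∈ Finset.Icc 1 4, Piece (fun _ => 1) (fun y => E y + J y)
      (fun y => E y + θ * J y) (fun y => E y + J y) b fun x y => K.ue i x (θ * y) := fun i hi =>
    (piece_euler (hK.smooth i hi).1 (m := m) hθ fun j k Y hY =>
      (hK.decay_euler i hi j k 0 h0L Y hY).1).mono hb0 J1
      (fun y hy => by linarith [tJ y hy, E0 y]) (fun y hy => by linarith [ttJ y hy, E0 y])
      (fun y hy => by linarith [E0 y])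
  have veP : ∀ i ∈ Finset.Icc 1 4, Piece J (fun y => θ * J y) (fun y => θ ^ 2 * J y) J b
      fun x y => K.ve i x (θ * y) := fun i hi =>
    piece_euler (hK.smooth i hi).2.1 (m := m) hθ fun j k Y hY =>
      (hK.decay_euler i hi j k 0 h0L Y hY).2
  have upP : ∀ i ∈ Finset.Icc 1 4, Piece (fun _ => 1) (fun y => E y + J y)
      (fun y => E y + θ * J y) (fun y => E y + J y) b (K.up i) := fun i hi =>
    (piece_prandtl (hK.smooth i hi).2.2.1 (fun y hy => by
      rw [mul_one]
      exact (hK.bound_up i hi 0 h0L y hy.le).trans (le_bound₃ A (by norm_num)))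
      fun j k hjk y hy => hK.decay_up i hi j k hjk 0 h0L y hy).mono hb0 (fun _ _ => le_rfl)
      (fun y hy => by linarith [J0 y hy]) (fun y hy => by linarith [mul_nonneg hθ.le (J0 y hy)])
      (fun y hy => by linarith [J0 y hy])
  have vpP : ∀ i ∈ Finset.Icc 1 3, Piece (fun y => E y + J y) (fun y => E y + J y)
      (fun y => E y + θ * J y) (fun y => E y + J y) b (K.vp i) := fun i hi =>
    (piece_prandtl (hK.smooth i (Finset.Icc_subset_Icc_right (by norm_num) hi)).2.2.2
      (fun y hy => by
        have := hK.decay_vp i hi 0 0 0 h0L y hy.le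
        exact abs_le_mul_edecay ((by simpa [pd] using this : _ ≤ A 0).trans
          (le_bound₃ A (by norm_num))))
      fun j k _ y hy => hK.decay_vp i hi j k 0 h0L y hy).mono hb0
      (fun y hy => by linarith [J0 y hy])
      (fun y hy => by linarith [J0 y hy]) (fun y hy => by linarith [mul_nonneg hθ.le (J0 y hy)])
      (fun y hy => by linarith [J0 y hy])
  have m4 : 4 ∈ Finset.Icc 1 4 := by decide
  have hXθ : ∀ j ≤ 3, ∀ y : ℝ, 0 < y → |iteratedDeriv j χ (θ * y)| ≤ X * tail θ m y ∧
      |iteratedDeriv j χ (θ * y)| * (θ * y) ≤ X * tail θ m y :=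
    fun j hj y hy => hX j hj θ y hθ hy
  have bj : ∀ j k, 1 ≤ j + k → j + k ≤ 3 → ∀ y, 0 ≤ y → |pd j k (K.up 4) 0 y| ≤ b * E y :=
    fun j k h1 h2 y hy => abs_le_mul_edecay ((hK.decay_up 4 m4 j k h1 0 h0L y hy).trans
      (le_bound₃ A h2))
  have bxx : ∀ y, 0 ≤ y → |pd 2 0 (K.up 4) 0 y| ≤ b := fun y hy =>
    (bj 2 0 (by norm_num) (by norm_num) y hy).trans (mul_le_of_le_one_right hb0
      (Real.exp_le_one_iff.2 (by nlinarith)))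
  have bu : ∀ y, 0 ≤ y → |K.up 4 0 y| ≤ b := fun y hy =>
    (hK.bound_up 4 m4 0 h0L y hy).trans (le_bound₃ A (by norm_num))
  have b1 := fun y (hy : 0 < y) => bj 0 1 (by norm_num) (by norm_num) y hy.le
  have cuP := ((piece_cutV hχ hθ hθ1 hX0 hXθ hb0 (hK.smooth 4 m4).2.2.1 (fun y hy => bu y hy.le)
      b1 (fun y hy => bj 0 2 (by norm_num) (by norm_num) y hy.le) fun y hy => bxx y hy.le).add
      ((piece_cut_integral hχ hθ hθ1 hX0 hXθ hb0 (hK.smooth 4 m4).2.2.1 bu b1 bxx).mono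
        (γ₁ := fun y => E y + J y) (by positivity) (fun _ _ => le_rfl)
        (fun y _ => le_add_of_nonneg_left (E0 y)) (fun _ _ => le_rfl) fun _ _ => le_rfl)).mono
    (γ₀ := fun _ => 1) (γₓ := fun y => E y + J y) (by linarith) J1 (fun _ _ => le_rfl)
    (fun _ _ => le_rfl) fun y _ => le_add_of_nonneg_left (E0 y)
  obtain ⟨v0, v1, v2, vx⟩ := normal_bounds (hK.smooth 4 m4).2.2.1 (hK.smooth 4 m4).2.2.2 hκ hL
    (fun j k hjk y hy => hK.decay_up 4 m4 j k hjk 0 h0L y hy)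
    (fun x hx y hy => (hK.divFree 4 m4 x hx y hy).2) hK.wall_v_last
  have hbκ : 0 ≤ b / κ := by positivity
  have cvP := (piece_cutV (κ := κ) hχ hθ hθ1 hX0 hXθ hD0 (hK.smooth 4 m4).2.2.2
    (fun y hy => (v0 y hy).trans (by linarith))
    (fun y hy => (v1 y hy).trans (mul_le_right (by linarith) (E0 y)))
    (fun y hy => (v2 y hy).trans (mul_le_right (by linarith) (E0 y)))
    (fun y hy => (vx y hy).trans (by linarith))).mono (γ₀ := fun y => E y + J y)
    (γₓ := fun y => E y + J y) (by linarith) (fun y _ => le_add_of_nonneg_left (E0 y))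
    (fun _ _ => le_rfl) (fun _ _ => le_rfl) fun y _ => le_add_of_nonneg_left (E0 y)
  have scaleU : ∀ {G : ℝ → ℝ → ℝ} {i : ℕ}, 1 ≤ i → Piece (fun _ => 1) (fun y => E y + J y)
      (fun y => E y + θ * J y) (fun y => E y + J y) Z G →
      Piece (fun _ => θ) (fun y => θ * (E y + J y)) (fun y => θ * (E y + θ * J y))
        (fun y => E y + θ * J y) Z fun x y => θ ^ i * G x y := fun {G i} hi h =>
    h.smul hZ0 (pow_nonneg hθ.le i) (fun y hy => by rw [mul_one]; exact pow_le i hi)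
      (fun y hy => mul_le_right (pow_le i hi) (nEJ y hy))
      (fun y hy => mul_le_right (pow_le i hi) (nEtJ y hy))
      (fun y hy => (mul_le_right (pow_le i hi) (nEJ y hy)).trans
        (by linarith [tE y]))
  have scaleV : ∀ {G : ℝ → ℝ → ℝ} {i : ℕ}, 1 ≤ i → Piece (fun y => E y + J y)
      (fun y => E y + J y) (fun y => E y + θ * J y) (fun y => E y + J y) Z G →
      Piece (fun y => E y + J y) (fun y => θ * (E y + J y)) (fun y => θ * (E y + θ * J y))
        (fun y => E y + J y) Z fun x y => θ ^ i * G x y := fun {G i} hi h =>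
    h.smul hZ0 (pow_nonneg hθ.le i)
      (fun y hy => mul_le_of_le_one_left (nEJ y hy) ((pow_le i hi).trans hθ1))
      (fun y hy => mul_le_right (pow_le i hi) (nEJ y hy))
      (fun y hy => mul_le_right (pow_le i hi) (nEtJ y hy))
      (fun y hy => mul_le_of_le_one_left (nEJ y hy) ((pow_le i hi).trans hθ1))
  have n1 : ∀ y : ℝ, 0 < y → (0 : ℝ) ≤ (fun _ => 1) y := fun _ _ => zero_le_one
  have uStep : ∀ i ∈ Finset.Icc 1 3, Piece (fun _ => θ) (fun y => θ * (E y + J y))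
      (fun y => θ * (E y + θ * J y)) (fun y => E y + θ * J y) Z
      fun x y => θ ^ i * (K.ue i x (θ * y) + K.up i x y) := fun i hi => by
    have hi4 := Finset.Icc_subset_Icc_right (by norm_num : 3 ≤ 4) hi
    exact scaleU (Finset.mem_Icc.1 hi).1 (mon ((ueP i hi4).add (upP i hi4)) n1 nEJ nEtJ nEJ
      (by linarith))
  have vStep : ∀ i ∈ Finset.Icc 1 3, Piece (fun y => E y + J y) (fun y => θ * (E y + J y))
      (fun y => θ * (E y + θ * J y)) (fun y => E y + J y) Z
      fun x y => θ ^ i * (K.vp i x y + K.ve (i + 1) x (θ * y)) := fun i hi => by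
    have hi4 : i + 1 ∈ Finset.Icc 1 4 := by
      rw [Finset.mem_Icc] at hi ⊢; omega
    have hve := (veP (i + 1) hi4).mono (γ₀ := fun y => E y + J y) (γ₁ := fun y => E y + J y)
      (γ₂ := fun y => E y + θ * J y) (γₓ := fun y => E y + J y) hb0
      (fun y hy => by linarith [E0 y])
      (fun y hy => by linarith [tJ y hy, E0 y]) (fun y hy => by linarith [ttJ y hy, E0 y])
      (fun y hy => by linarith [E0 y])
    exact scaleV (Finset.mem_Icc.1 hi).1 (mon ((vpP i hi).add hve) nEJ nEJ nEtJ nEJ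
      (by linarith))
  have u4 := scaleU (i := 4) (by norm_num) (mon ((ueP 4 m4).add cuP) n1 nEJ nEtJ nEJ
    (by linarith))
  have v4 := scaleV (i := 4) (by norm_num) (mon cvP nEJ nEJ nEtJ nEJ (by linarith))
  have v1' : Piece (fun y => E y + J y) (fun y => θ * (E y + J y))
      (fun y => θ * (E y + θ * J y)) (fun y => E y + J y) Z fun x y => K.ve 1 x (θ * y) := by
    refine mon ((veP 1 (by decide)).mono hb0 (fun y hy => by linarith [E0 y])
      (fun y hy => ?_) (fun y hy => ?_) (fun y hy => by linarith [E0 y])) nEJ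
      (fun y hy => mul_nonneg hθ.le (nEJ y hy)) (fun y hy => mul_nonneg hθ.le (nEtJ y hy)) nEJ
      (by linarith)
    · linarith [mul_nonneg hθ.le (E0 y)]
    · nlinarith [mul_nonneg hθ.le (E0 y)]
  have i1 : 1 ∈ Finset.Icc 1 3 := by decide
  have i2 : 2 ∈ Finset.Icc 1 3 := by decide
  have i3 : 3 ∈ Finset.Icc 1 3 := by decide
  constructor
  · have h := (((uStep 1 i1).add (uStep 2 i2)).add (uStep 3 i3)).add u4
    have e : restU χ K ε = fun x y => θ ^ 1 * (K.ue 1 x (θ * y) + K.up 1 x y)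
        + θ ^ 2 * (K.ue 2 x (θ * y) + K.up 2 x y) + θ ^ 3 * (K.ue 3 x (θ * y) + K.up 3 x y)
        + θ ^ 4 * (K.ue 4 x (θ * y) + (χ (θ * y) * K.up 4 x y
          + θ * deriv χ (θ * y) * ∫ z in (0 : ℝ)..y, K.up 4 x z)) := by
      funext x y
      unfold restU Correctors.cutU
      rw [sum_Icc_one_three]
    rw [e]
    exact mon h (fun _ _ => hθ.le) (fun y hy => mul_nonneg hθ.le (nEJ y hy))
      (fun y hy => mul_nonneg hθ.le (nEtJ y hy)) nEtJ (by linarith)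
  · have h := (v1'.add (((vStep 1 i1).add (vStep 2 i2)).add (vStep 3 i3))).add v4
    have e : restV χ K ε = fun x y => K.ve 1 x (θ * y)
        + (θ ^ 1 * (K.vp 1 x y + K.ve (1 + 1) x (θ * y))
        + θ ^ 2 * (K.vp 2 x y + K.ve (2 + 1) x (θ * y))
        + θ ^ 3 * (K.vp 3 x y + K.ve (3 + 1) x (θ * y)))
        + θ ^ 4 * (χ (θ * y) * K.vp 4 x y) := by
      funext x y
      unfold restV Correctors.cutV
      rw [sum_Icc_one_three]
    rw [e]
    exact mon h nEJ (fun y hy => mul_nonneg hθ.le (nEJ y hy))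
      (fun y hy => mul_nonneg hθ.le (nEtJ y hy)) nEJ (by linarith)

/-- The coefficients of the operator, without a lower bound for the leading one. -/
structure Profile where
  a : ℝ → ℝ
  a1 : ℝ → ℝ
  a2 : ℝ → ℝ
  b : ℝ → ℝ
  b1 : ℝ → ℝ
  b2 : ℝ → ℝ
  e : ℝ → ℝ
  f : ℝ → ℝ
  da : ∀ y, HasDerivAt a (a1 y) y
  da1 : ∀ y, HasDerivAt a1 (a2 y) y
  ca2 : Continuous a2
  db : ∀ y, HasDerivAt b (b1 y) y
  db1 : ∀ y, HasDerivAt b1 (b2 y) y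
  cb2 : Continuous b2
  ce : Continuous e
  cf : Continuous f
  a_zero : a 0 = 0
  b_zero : b 0 = 0

/-- The coefficients with a lower bound. -/
def Profile.toCoefficients (Φ : Profile) (c : ℝ) (c_pos : 0 < c)
    (low : ∀ y, 0 ≤ y → c * y ≤ Φ.a y * (1 + y)) : Coefficients :=
  { a := Φ.a, a1 := Φ.a1, a2 := Φ.a2, b := Φ.b, b1 := Φ.b1, b2 := Φ.b2, e := Φ.e, f := Φ.f
    da := Φ.da, da1 := Φ.da1, ca2 := Φ.ca2, db := Φ.db, db1 := Φ.db1, cb2 := Φ.cb2, ce := Φ.ce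
    cf := Φ.cf, a_zero := Φ.a_zero, b_zero := Φ.b_zero, c := c, c_pos := c_pos, low := low }

/-- A boundary layer `[U, V]` with exponentially decaying derivatives. -/
structure Leading where
  U : ℝ → ℝ
  U1 : ℝ → ℝ
  U2 : ℝ → ℝ
  V : ℝ → ℝ
  V1 : ℝ → ℝ
  V2 : ℝ → ℝ
  c : ℝ
  B : ℝ
  κ : ℝ
  c_pos : 0 < c
  B_pos : 0 < B
  κ_pos : 0 < κ
  dU : ∀ z, HasDerivAt U (U1 z) z
  dV : ∀ z, HasDerivAt V (V1 z) z
  U_zero : U 0 = 0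
  V_zero : V 0 = 0
  low : ∀ z, 0 ≤ z → c * z ≤ U z * (1 + z)
  U_le : ∀ z, 0 ≤ z → |U z| ≤ B
  V_le : ∀ z, 0 ≤ z → |V z| ≤ B
  U1_le : ∀ z, 0 ≤ z → |U1 z| ≤ B * edecay κ z
  U2_le : ∀ z, 0 ≤ z → |U2 z| ≤ B * edecay κ z
  V1_le : ∀ z, 0 ≤ z → |V1 z| ≤ B * edecay κ z
  V2_le : ∀ z, 0 ≤ z → |V2 z| ≤ B * edecay κ z

/-- The profile is close to the rescaled leading layer for small `θ = √ε`. -/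
structure Profile.Approx (Φ : Profile) (W : Leading) (N lam k b₀ C θ : ℝ) (m : ℕ) : Prop where
  a_ge : ∀ y, 0 < y → b₀ - C * (edecay k y + θ) ≤ Φ.a y
  a_le : ∀ y, 0 < y → |Φ.a y| ≤ C
  a1 : ∀ y, 0 < y → |Φ.a1 y - N * lam * W.U1 (lam * y)| ≤
    C * (θ * (edecay k y + tail θ m y))
  a2 : ∀ y, 0 < y → |Φ.a2 y - N * lam ^ 2 * W.U2 (lam * y)| ≤
    C * (θ * (edecay k y + θ * tail θ m y))
  b_le : ∀ y, 0 < y → |Φ.b y| ≤ C * (edecay k y + tail θ m y)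
  b1 : ∀ y, 0 < y → |Φ.b1 y - lam ^ 2 * W.V1 (lam * y)| ≤
    C * (θ * (edecay k y + tail θ m y))
  b2 : ∀ y, 0 < y → |Φ.b2 y - lam ^ 3 * W.V2 (lam * y)| ≤
    C * (θ * (edecay k y + θ * tail θ m y))
  e : ∀ y, 0 < y → |Φ.e y| ≤ C * (θ ^ 2 * (edecay k y + θ * tail θ m y))
  f : ∀ y, 0 < y → |Φ.f y| ≤ C * (θ ^ 2 * (edecay k y + tail θ m y))

theorem exists_pow_mul_edecay_le {k : ℝ} (hk : 0 < k) (n : ℕ) :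
    ∃ Q : ℝ, 1 ≤ Q ∧ ∀ y, 0 ≤ y → (1 + y) ^ n * edecay k y ≤ Q := by
  have h1 : Tendsto (fun y : ℝ => (1 + y) ^ n * edecay k y) atTop (𝓝 0) := by
    have h2 := (Real.tendsto_pow_mul_exp_neg_atTop_nhds_zero n).comp
      ((tendsto_atTop_add_const_left atTop (1 : ℝ) tendsto_id).const_mul_atTop hk)
    have h3 := h2.const_mul (Real.exp k / k ^ n)
    rw [mul_zero] at h3
    refine h3.congr fun y => ?_
    simp only [Function.comp, edecay, id]
    rw [mul_pow, show -(k * (1 + y)) = -(k * y) - k by ring, Real.exp_sub]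
    field_simp
  have hc : Continuous fun y : ℝ => (1 + y) ^ n * edecay k y := by unfold edecay; fun_prop
  obtain ⟨Q, hQ⟩ := exists_bound_of_tendsto hc.continuousOn h1
  exact ⟨max Q 1, le_max_right _ _, fun y hy => (le_abs_self _).trans ((hQ y hy).trans
    (le_max_left _ _))⟩

theorem edecay_le_one {k y : ℝ} (hk : 0 < k) (hy : 0 ≤ y) : edecay k y ≤ 1 :=
  Real.exp_le_one_iff.2 (by nlinarith)

section decay

variable {θ y : ℝ} (hθ : 0 < θ) (hθ1 : θ ≤ 1) (m : ℕ) (hy : 0 < y)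
include hθ hy

theorem pow_mul_tail_le {n : ℕ} (hn : n ≤ m + 4) :
    (1 + θ * y) ^ n * tail θ m y ≤ 1 := by
  have h1 : 1 ≤ 1 + θ * y := by nlinarith [mul_pos hθ hy]
  unfold tail
  rw [← div_eq_mul_inv, div_le_one (by positivity)]
  exact pow_le_pow_right₀ h1 hn

theorem mul_tail_le : θ * y * tail θ m y ≤ 1 := by
  have h1 := pow_mul_tail_le hθ m hy (n := 1) (by omega)
  have := (tail_pos hθ m hy).le
  nlinarith

theorem sq_mul_tail_le : (θ * y) ^ 2 * tail θ m y ≤ 1 := by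
  have h1 := pow_mul_tail_le hθ m hy (n := 2) (by omega)
  have h2 := (tail_pos hθ m hy).le
  have h3 : (θ * y) ^ 2 ≤ (1 + θ * y) ^ 2 := by
    have := mul_pos hθ hy
    gcongr
    linarith
  nlinarith

include hθ1

theorem weight_mul_tail_le :
    θ * ((1 + y) * (1 + θ * y) ^ m) * tail θ m y ≤ 1 ∧
      θ ^ 2 * ((1 + y) * (1 + θ * y) ^ m * (1 + y)) * tail θ m y ≤ 1 := by
  have hJ := (tail_pos hθ m hy).le
  have hθy := mul_pos hθ hy
  have h0 : θ * (1 + y) ≤ 1 + θ * y := by nlinarith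
  have h1 := pow_mul_tail_le hθ m hy (n := m + 1) (by omega)
  have h2 := pow_mul_tail_le hθ m hy (n := m + 2) (by omega)
  have hp : 0 ≤ (1 + θ * y) ^ m := by positivity
  constructor
  · refine le_trans (mul_le_right ?_ hJ) h1
    calc θ * ((1 + y) * (1 + θ * y) ^ m) = (1 + θ * y) ^ m * (θ * (1 + y)) := by ring
      _ ≤ (1 + θ * y) ^ m * (1 + θ * y) := by gcongr
      _ = _ := by ring
  · refine le_trans (mul_le_right ?_ hJ) h2
    calc θ ^ 2 * ((1 + y) * (1 + θ * y) ^ m * (1 + y))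
        = (1 + θ * y) ^ m * (θ * (1 + y)) ^ 2 := by ring
      _ ≤ (1 + θ * y) ^ m * (1 + θ * y) ^ 2 := by gcongr
      _ = _ := by ring

theorem weight_mul_edecay_le {k Q : ℝ}
    (hQ : ∀ y, 0 ≤ y → (1 + y) ^ (m + 3) * edecay k y ≤ Q) :
    (1 + y) * (1 + θ * y) ^ m * (1 + y) * edecay k y ≤ Q / (1 + y) := by
  have hE := (edecay_pos k y).le
  rw [le_div_iff₀ (by positivity)]
  refine le_trans ?_ (hQ y hy.le)
  have h1 : 1 + θ * y ≤ 1 + y := by nlinarith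
  calc (1 + y) * (1 + θ * y) ^ m * (1 + y) * edecay k y * (1 + y)
      = (1 + θ * y) ^ m * (1 + y) ^ 3 * edecay k y := by ring
    _ ≤ (1 + y) ^ m * (1 + y) ^ 3 * edecay k y := by gcongr
    _ = _ := by ring

end decay

/-- Crude consequences of closeness to the leading layer. -/
structure Profile.Crude (Φ : Profile) (k C θ : ℝ) (m : ℕ) : Prop where
  a_le : ∀ y, 0 < y → |Φ.a y| ≤ C
  a_lin : ∀ y, 0 < y → |Φ.a y| ≤ C * y
  b_lin : ∀ y, 0 < y → |Φ.b y| ≤ C * y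
  b_le : ∀ y, 0 < y → |Φ.b y| ≤ C * (edecay k y + tail θ m y)
  a1 : ∀ y, 0 < y → |Φ.a1 y| ≤ C * (edecay k y + θ * tail θ m y)
  a2 : ∀ y, 0 < y → |Φ.a2 y| ≤ C * (edecay k y + θ ^ 2 * tail θ m y)
  b1 : ∀ y, 0 < y → |Φ.b1 y| ≤ C * (edecay k y + θ * tail θ m y)
  b2 : ∀ y, 0 < y → |Φ.b2 y| ≤ C * (edecay k y + θ ^ 2 * tail θ m y)
  e : ∀ y, 0 < y → |Φ.e y| ≤ C * (θ ^ 2 * (edecay k y + θ * tail θ m y))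
  f : ∀ y, 0 < y → |Φ.f y| ≤ C * (θ ^ 2 * (edecay k y + tail θ m y))

theorem abs_le_of_hasDerivAt_le {g g' : ℝ → ℝ} {X : ℝ} (hd : ∀ y, HasDerivAt g (g' y) y)
    (h0 : g 0 = 0) (h : ∀ y, 0 < y → |g' y| ≤ X) {y : ℝ} (hy : 0 < y) : |g y| ≤ X * y := by
  have hc : ContinuousOn g (Icc 0 y) := fun z _ => (hd z).continuousAt.continuousWithinAt
  obtain ⟨z, hz, hz'⟩ := exists_hasDerivAt_eq_slope g g' hy hc fun z _ => hd z
  rw [h0, sub_zero, sub_zero, eq_div_iff hy.ne'] at hz'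
  rw [← hz', abs_mul, abs_of_pos hy]
  exact mul_le_right (h z hz.1) hy.le

theorem Profile.Approx.crude {Φ : Profile} {W : Leading} {N lam k b₀ C θ : ℝ} {m : ℕ}
    (hN : 0 < N) (hl : 0 < lam) (hk : 0 < k) (hkl : k ≤ W.κ * lam) (hC : 0 ≤ C) (hθ : 0 < θ)
    (hθ1 : θ ≤ 1) (h : Φ.Approx W N lam k b₀ C θ m) :
    Φ.Crude k (2 * C + 2 * (N * lam * W.B + N * lam ^ 2 * W.B + lam ^ 2 * W.B + lam ^ 3 * W.B))
      θ m := by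
  have hB := W.B_pos
  have E0 := fun y => (edecay_pos k y).le
  have J0 := fun y (hy : 0 < y) => (tail_pos hθ m hy).le
  have E1 := fun y (hy : 0 < y) => edecay_le_one hk hy.le
  have J1 := fun y (hy : 0 < y) => tail_le_one hθ m hy
  have hE : ∀ y, 0 < y → edecay W.κ (lam * y) ≤ edecay k y := fun y hy =>
    Real.exp_le_exp.2 (neg_le_neg (by nlinarith))
  set Z := N * lam * W.B + N * lam ^ 2 * W.B + lam ^ 2 * W.B + lam ^ 3 * W.B with hZ
  have z1 : 0 < N * lam * W.B := by positivity
  have z2 : 0 < N * lam ^ 2 * W.B := by positivity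
  have z3 : 0 < lam ^ 2 * W.B := by positivity
  have z4 : 0 < lam ^ 3 * W.B := by positivity
  have main : ∀ {g s u T : ℝ} {y : ℝ}, 0 < y → 0 ≤ s → s * W.B ≤ Z →
      |g - s * u| ≤ C * T → |u| ≤ W.B * edecay W.κ (lam * y) →
      |g| ≤ C * T + Z * edecay k y := by
    intro g s u T y hy hs hsZ h1 h2
    have h3 : |s * u| ≤ Z * edecay k y := by
      rw [abs_mul, abs_of_nonneg hs]
      calc s * |u| ≤ s * (W.B * edecay k y) := by
            gcongr; exact h2.trans (by gcongr; exact hE y hy)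
        _ = s * W.B * edecay k y := by ring
        _ ≤ _ := by gcongr; exact E0 y
    have := abs_sub_abs_le_abs_sub g (s * u)
    linarith
  have hly : ∀ {y : ℝ}, 0 < y → 0 ≤ lam * y := fun hy => by positivity
  have hZ0 : 0 ≤ Z := by positivity
  have one : ∀ {g y : ℝ}, 0 < y → |g| ≤ C * (θ * (edecay k y + tail θ m y)) + Z * edecay k y →
      |g| ≤ (C + Z) * (edecay k y + θ * tail θ m y) := fun {_ y} hy h => by
    have n1 := mul_nonneg hC (E0 y)
    have n2 := mul_le_right hθ1 n1
    have n3 := mul_nonneg hZ0 (mul_nonneg hθ.le (J0 _ hy))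
    linarith
  have two : ∀ {g y : ℝ}, 0 < y →
      |g| ≤ C * (θ * (edecay k y + θ * tail θ m y)) + Z * edecay k y →
      |g| ≤ (2 * C + 2 * Z) * (edecay k y + θ ^ 2 * tail θ m y) := fun {_ y} hy h => by
    have n1 := mul_nonneg hC (E0 y)
    have n2 := mul_le_right hθ1 n1
    have n3 := mul_nonneg (sq_nonneg θ) (J0 _ hy)
    linarith [mul_nonneg hC n3, mul_nonneg hZ0 n3, mul_nonneg hZ0 (E0 y)]
  have ha1 := fun y hy =>
    one hy (main hy (by positivity) (by linarith) (h.a1 y hy) (W.U1_le _ (hly hy)))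
  have hb1 := fun y hy =>
    one hy (main hy (by positivity) (by linarith) (h.b1 y hy) (W.V1_le _ (hly hy)))
  have hEJ : ∀ y, 0 < y → edecay k y + θ * tail θ m y ≤ 2 := fun y hy => by
    have := mul_le_right hθ1 (J0 y hy)
    linarith [E1 y hy, J1 y hy]
  refine ⟨fun y hy => (h.a_le y hy).trans (by linarith), fun y hy => ?_, fun y hy => ?_,
    fun y hy => (h.b_le y hy).trans ?_, fun y hy => (ha1 y hy).trans ?_,
    fun y hy => two hy (main hy (by positivity) (by linarith) (h.a2 y hy) (W.U2_le _ (hly hy))),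
    fun y hy => (hb1 y hy).trans ?_,
    fun y hy => two hy (main hy (by positivity) (by linarith) (h.b2 y hy) (W.V2_le _ (hly hy))),
    fun y hy => (h.e y hy).trans ?_,
    fun y hy => (h.f y hy).trans ?_⟩
  · refine abs_le_of_hasDerivAt_le Φ.da Φ.a_zero (fun y hy => (ha1 y hy).trans ?_) hy
    nlinarith [hEJ y hy]
  · refine abs_le_of_hasDerivAt_le Φ.db Φ.b_zero (fun y hy => (hb1 y hy).trans ?_) hy
    nlinarith [hEJ y hy]
  · have := add_nonneg (E0 y) (J0 y hy)
    gcongr; linarith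
  · have := add_nonneg (E0 y) (mul_nonneg hθ.le (J0 y hy))
    gcongr <;> linarith
  · have := add_nonneg (E0 y) (mul_nonneg hθ.le (J0 y hy))
    gcongr <;> linarith
  · have := mul_nonneg (sq_nonneg θ) (add_nonneg (E0 y) (mul_nonneg hθ.le (J0 y hy)))
    gcongr; linarith
  · have := mul_nonneg (sq_nonneg θ) (add_nonneg (E0 y) (J0 y hy))
    gcongr; linarith

section crude

variable {Φ : Profile} {k C ε : ℝ} {m : ℕ} (hC : 0 ≤ C) (hε : 0 < ε) (hε1 : ε ≤ 1)
  (h : Φ.Crude k C (√ε) m) {Q : ℝ}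
  (hQ : ∀ y, 0 ≤ y → (1 + y) ^ (m + 3) * edecay k y ≤ Q)
include hC hε hε1 h hQ

theorem Profile.Crude.bounds (hk : 0 < k) {S : Coefficients} {c : ℝ} {hc : 0 < c}
    {low : ∀ y, 0 ≤ y → c * y ≤ Φ.a y * (1 + y)} (hS : S = Φ.toCoefficients c hc low) :
    S.Bounds (w0 m ε) (2 * C * (Q + 1)) := by
  subst hS
  have hθ : 0 < √ε := Real.sqrt_pos.2 hε
  have hθ1 : √ε ≤ 1 := Real.sqrt_le_one.2 hε1
  set θ := √ε with hθd
  have hw : ∀ y, w0 m ε y = (1 + y) * (1 + θ * y) ^ m := fun _ => rfl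
  have E0 := fun y => (edecay_pos k y).le
  have J0 := fun y (hy : 0 < y) => (tail_pos hθ m hy).le
  have hQ0 : 0 ≤ Q := le_trans (by have := E0 0; positivity) (hQ 0 le_rfl)
  have wE2 : ∀ y, 0 < y → edecay k y * (w0 m ε y * (1 + y)) ≤ Q := fun y hy => by
    have h1 := weight_mul_edecay_le hθ hθ1 m hy hQ
    have h2 : Q / (1 + y) ≤ Q := div_le_self hQ0 (by linarith)
    rw [hw]; linarith
  have w1 : ∀ y, 0 < y → 0 < w0 m ε y := fun y hy => by rw [hw]; positivity
  have wle : ∀ y, 0 < y → w0 m ε y ≤ w0 m ε y * (1 + y) := fun y hy =>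
    le_mul_of_one_le_right (w1 y hy).le (by linarith)
  have wE : ∀ y, 0 < y → edecay k y * w0 m ε y ≤ Q := fun y hy =>
    (mul_le_left (wle y hy) (E0 y)).trans (wE2 y hy)
  have wJ : ∀ y, 0 < y → θ * tail θ m y * w0 m ε y ≤ 1 := fun y hy => by
    have := (weight_mul_tail_le hθ hθ1 m hy).1
    rw [hw]; linarith
  have wJ2 : ∀ y, 0 < y → θ ^ 2 * tail θ m y * (w0 m ε y * (1 + y)) ≤ 1 := fun y hy => by
    have := (weight_mul_tail_le hθ hθ1 m hy).2
    rw [hw]; linarith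
  have fin : ∀ {g X p q W : ℝ}, |g| ≤ C * X → 0 ≤ W → X ≤ p + q → p * W ≤ Q → q * W ≤ 1 →
      |g| * W ≤ 2 * C * (Q + 1) := by
    intro g X p q W hg hW hX hp hq
    calc |g| * W ≤ C * X * W := by gcongr
      _ ≤ C * (p + q) * W := by gcongr
      _ = C * (p * W + q * W) := by ring
      _ ≤ C * (Q + 1) := by gcongr
      _ ≤ 2 * C * (Q + 1) := by nlinarith [mul_nonneg hC (by linarith : 0 ≤ Q + 1)]
  have sqle : ∀ y, 0 < y → θ ^ 2 * edecay k y ≤ edecay k y := fun y hy =>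
    mul_le_of_le_one_left (E0 y) (pow_le_one₀ hθ.le hθ1)
  have tJ : ∀ y, 0 < y → θ ^ 2 * tail θ m y ≤ θ * tail θ m y := fun y hy => by
    rw [pow_two, mul_assoc]
    exact mul_le_of_le_one_left (mul_nonneg hθ.le (J0 y hy)) hθ1
  have lin : ∀ {g : ℝ → ℝ}, (∀ y, 0 < y → |g y| ≤ 2 * C) → (∀ y, 0 < y → |g y| ≤ C * y) →
      ∀ y, 0 < y → |g y| * (1 + y) ≤ 2 * C * (Q + 1) * y := by
    intro g h1 h2 y hy
    have := h1 y hy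
    have := h2 y hy
    have hQ1 : 1 ≤ Q := le_trans (by simp [edecay]) (hQ 0 le_rfl)
    have : |g y| * y ≤ 2 * C * y := by gcongr
    nlinarith [mul_nonneg hC hy.le, mul_nonneg (mul_nonneg hC hy.le) (sub_nonneg.2 hQ1)]
  refine ⟨continuous_w0 m ε, fun y hy => (logWeight_w0 m hε).w_ge y hy.le, fun y hy => ?_,
    fun y hy => ?_, fun y hy => ?_, fun y hy => ?_, fun y hy => ?_, fun y hy => ?_,
    fun y hy => ?_, fun y hy => ?_⟩
  · exact (mul_le_right (le_abs_self _) (by positivity)).trans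
      (lin (fun y hy => (h.a_le y hy).trans (by linarith)) h.a_lin y hy)
  · exact fin (h.a1 y hy) (w1 y hy).le le_rfl (wE y hy) (wJ y hy)
  · exact fin (h.a2 y hy) (mul_pos (w1 y hy) (by linarith)).le le_rfl (wE2 y hy) (wJ2 y hy)
  · refine lin (fun y hy => (h.b_le y hy).trans ?_) h.b_lin y hy
    have := edecay_le_one hk hy.le
    have := tail_le_one hθ m hy
    nlinarith
  · exact fin (h.b1 y hy) (w1 y hy).le le_rfl (wE y hy) (wJ y hy)
  · exact fin (h.b2 y hy) (w1 y hy).le (add_le_add le_rfl (tJ y hy)) (wE y hy) (wJ y hy)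
  · refine fin (h.e y hy) (mul_pos (w1 y hy) (by linarith)).le ?_ (wE2 y hy) (wJ2 y hy)
    have := mul_le_left hθ1 (mul_nonneg (sq_nonneg θ) (J0 y hy))
    nlinarith [sqle y hy]
  · refine fin (h.f y hy) (w1 y hy).le ?_ (wE y hy) (wJ y hy)
    nlinarith [sqle y hy, tJ y hy]

theorem Profile.Crude.decay {S : Coefficients} {c : ℝ} {hc : 0 < c}
    {low : ∀ y, 0 ≤ y → c * y ≤ Φ.a y * (1 + y)} (hS : S = Φ.toCoefficients c hc low) :
    S.Decay (w0 m ε) := by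
  subst hS
  have hθ : 0 < √ε := Real.sqrt_pos.2 hε
  have hθ1 : √ε ≤ 1 := Real.sqrt_le_one.2 hε1
  set θ := √ε with hθd
  have hw : ∀ y, w0 m ε y = (1 + y) * (1 + θ * y) ^ m := fun _ => rfl
  have E0 := fun y => (edecay_pos k y).le
  have J0 := fun y (hy : 0 < y) => (tail_pos hθ m hy).le
  set H : ℝ → ℝ := fun y => Q * (1 + y)⁻¹ + (θ ^ 2)⁻¹ * (1 + θ * y)⁻¹ with hH
  have hHlim : Tendsto H atTop (𝓝 0) := by
    have l1 : Tendsto (fun y : ℝ => (1 + y)⁻¹) atTop (𝓝 0) :=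
      tendsto_inv_atTop_zero.comp (tendsto_atTop_add_const_left _ _ tendsto_id)
    have l2 : Tendsto (fun y : ℝ => (1 + θ * y)⁻¹) atTop (𝓝 0) :=
      tendsto_inv_atTop_zero.comp (tendsto_atTop_add_const_left _ _
        (tendsto_id.const_mul_atTop hθ))
    simpa using (l1.const_mul Q).add (l2.const_mul (θ ^ 2)⁻¹)
  have hmain : ∀ y, 0 < y →
      w0 m ε y * (1 + y) * (edecay k y + tail θ m y) ≤ H y := by
    intro y hy
    have h1 := weight_mul_edecay_le hθ hθ1 m hy hQ
    have h2 := pow_mul_tail_le hθ m hy (n := m + 3) (by omega)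
    have hp : 0 < 1 + θ * y := by positivity
    have h3 : w0 m ε y * (1 + y) * tail θ m y ≤ (θ ^ 2)⁻¹ * (1 + θ * y)⁻¹ := by
      rw [← mul_inv, ← one_div, le_div_iff₀ (by positivity)]
      refine le_trans ?_ h2
      have h0 : θ * (1 + y) ≤ 1 + θ * y := by nlinarith
      have hJ := J0 y hy
      calc w0 m ε y * (1 + y) * tail θ m y * (θ ^ 2 * (1 + θ * y))
          = (1 + θ * y) ^ (m + 1) * (θ * (1 + y)) ^ 2 * tail θ m y := by rw [hw]; ring
        _ ≤ (1 + θ * y) ^ (m + 1) * (1 + θ * y) ^ 2 * tail θ m y := by gcongr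
        _ = _ := by ring
    simp only [hH]
    rw [mul_add]
    refine add_le_add ?_ h3
    rw [hw, ← div_eq_mul_inv]
    exact h1
  have w1 : ∀ y, 0 < y → 1 ≤ w0 m ε y := fun y hy => by
    linarith [(logWeight_w0 m hε).w_ge y hy.le]
  have wle : ∀ y, 0 < y → w0 m ε y ≤ w0 m ε y * (1 + y) := fun y hy =>
    le_mul_of_one_le_right (by linarith [w1 y hy]) (by linarith)
  have sq : ∀ {g : ℝ → ℝ} {X : ℝ}, (∀ y, 0 < y →
      |g y| ≤ X * (w0 m ε y * (1 + y) * (edecay k y + tail θ m y))) → 0 ≤ X →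
      Tendsto g atTop (𝓝 0) := by
    intro g X hg hX
    refine squeeze_zero_norm' ?_ (by simpa using hHlim.const_mul X)
    filter_upwards [eventually_gt_atTop 0] with y hy
    exact (hg y hy).trans (mul_le_left (hmain y hy) hX)
  have EJ := fun y (hy : 0 < y) => add_nonneg (E0 y) (J0 y hy)
  have t2 : θ ^ 2 ≤ 1 := pow_le_one₀ hθ.le hθ1
  have a2b2 : ∀ {g : ℝ} {y : ℝ}, 0 < y →
      |g| ≤ C * (edecay k y + θ ^ 2 * tail θ m y) →
      |g| ≤ C * (edecay k y + tail θ m y) := fun {g y} hy hg => by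
    refine hg.trans (mul_le_left ?_ hC)
    linarith [mul_le_of_le_one_left (J0 y hy) t2]
  have hf : ∀ y, 0 < y → |Φ.f y| ≤ C * (edecay k y + tail θ m y) := fun y hy =>
    (h.f y hy).trans (mul_le_left (mul_le_of_le_one_left (EJ y hy) t2) hC)
  have he : ∀ y, 0 < y → |Φ.e y| ≤ C * (edecay k y + tail θ m y) := fun y hy => by
    refine (h.e y hy).trans (mul_le_left ?_ hC)
    have h1 := mul_le_of_le_one_left (J0 y hy) hθ1
    have h2 := mul_nonneg hθ.le (J0 y hy)
    exact (mul_le_of_le_one_left (add_nonneg (E0 y) h2) t2).trans (by linarith)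
  have add2 : ∀ {g₁ g₂ y W : ℝ}, 0 < y → 0 ≤ W → W ≤ w0 m ε y * (1 + y) →
      |g₁| ≤ C * (edecay k y + tail θ m y) →
      |g₂| ≤ C * (edecay k y + tail θ m y) →
      |W * (g₁ + g₂)| ≤ 2 * C * (w0 m ε y * (1 + y) * (edecay k y + tail θ m y)) := by
    intro g₁ g₂ y W hy hW hWle h1 h2
    have h3 : |g₁ + g₂| ≤ 2 * C * (edecay k y + tail θ m y) := by
      linarith [abs_add_le g₁ g₂]
    have h4 := EJ y hy
    rw [abs_mul, abs_of_nonneg hW]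
    calc W * |g₁ + g₂| ≤ w0 m ε y * (1 + y) * (2 * C * (edecay k y + tail θ m y)) := by
          gcongr
          exact hW.trans hWle
      _ = _ := by ring
  refine ⟨sq (X := C) (fun y hy => (h.b_le y hy).trans ?_) hC,
    sq (X := 2 * C) (fun y hy => add2 hy (by linarith [w1 y hy]) (wle y hy)
      (a2b2 hy (h.b2 y hy)) (hf y hy)) (by linarith),
    sq (X := 2 * C) (fun y hy => add2 hy (by nlinarith [w1 y hy]) le_rfl
      (a2b2 hy (h.a2 y hy)) (he y hy)) (by linarith)⟩
  have h1 : 1 ≤ w0 m ε y * (1 + y) := (w1 y hy).trans (wle y hy)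
  exact mul_le_left (le_mul_of_one_le_left (EJ y hy) h1) hC

end crude

/-- The terms which have to be absorbed in the energy estimate, up to errors of order `θ`. -/
structure Profile.Errors (Φ : Profile) (W : Leading) (N lam C θ : ℝ) : Prop where
  near : ∀ y, 0 < y → N * W.U (lam * y) - C * θ * y ≤ Φ.a y
  a2 : ∀ y, 0 < y → |Φ.a2 y| ≤ N * lam ^ 2 * |W.U2 (lam * y)| + C * θ
  ab : ∀ y, 0 < y → |Φ.a1 y * Φ.b y - Φ.a y * Φ.b1 y| ≤
    N * lam ^ 2 * |W.U1 (lam * y) * W.V (lam * y) - W.U (lam * y) * W.V1 (lam * y)| + C * θ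
  ab1 : ∀ y, 0 < y → y * |Φ.b y * Φ.a2 y - Φ.a1 y * Φ.b1 y| ≤ N * lam ^ 2 * (lam * y *
    |W.V (lam * y) * W.U2 (lam * y) - W.U1 (lam * y) * W.V1 (lam * y)|) + C * θ
  e : ∀ y, 0 < y → y ^ 2 * |Φ.e y * Φ.a y + Φ.f y * Φ.a1 y| ≤ C * θ
  f : ∀ y, 0 < y → y * |Φ.f y * Φ.a y| ≤ C * θ
  a2_sq : ∀ y, 0 < y → y ^ 2 * Φ.a2 y ^ 2 ≤
    2 * N ^ 2 * lam ^ 2 * ((lam * y) ^ 2 * W.U2 (lam * y) ^ 2) + C * θ * (y / (1 + y))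

theorem weighted_abs_mul_le {s p q x z X Z : ℝ} (hp : 0 ≤ p) (hq : 0 ≤ q) (hs : s = p * q)
    (hx : p * |x| ≤ X) (hz : q * |z| ≤ Z) : s * |x * z| ≤ X * Z := by
  have hx0 : 0 ≤ p * |x| := by positivity
  have hz0 : 0 ≤ q * |z| := by positivity
  rw [hs, abs_mul, mul_mul_mul_comm]
  exact mul_le_mul hx hz hz0 (hx0.trans hx)

theorem weighted_abs_cross_le {s x₁ x₂ x₃ x₄ z₁ z₂ z₃ z₄ P : ℝ} (hs : 0 ≤ s)
    (h1 : s * |z₁ * (x₂ - z₂)| ≤ P) (h2 : s * |(x₁ - z₁) * x₂| ≤ P)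
    (h3 : s * |(x₃ - z₃) * z₄| ≤ P) (h4 : s * |x₃ * (x₄ - z₄)| ≤ P) :
    s * |x₁ * x₂ - x₃ * x₄| ≤ s * |z₁ * z₂ - z₃ * z₄| + 4 * P := by
  have h : |x₁ * x₂ - x₃ * x₄| ≤ |z₁ * z₂ - z₃ * z₄| + ((|z₁ * (x₂ - z₂)| + |(x₁ - z₁) * x₂|)
      + (|(x₃ - z₃) * z₄| + |x₃ * (x₄ - z₄)|)) := by
    rw [show x₁ * x₂ - x₃ * x₄ = (z₁ * z₂ - z₃ * z₄) + ((z₁ * (x₂ - z₂) + (x₁ - z₁) * x₂)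
      - ((x₃ - z₃) * z₄ + x₃ * (x₄ - z₄))) by ring]
    exact (abs_add_le _ _).trans (add_le_add le_rfl ((abs_sub _ _).trans
      (add_le_add (abs_add_le _ _) (abs_add_le _ _))))
  have := mul_le_left h hs
  linarith

theorem Leading.exists_errors (W : Leading) {N lam k C : ℝ} (m : ℕ) (hN : 0 < N) (hl : 0 < lam)
    (hk : 0 < k) (hkl : k ≤ W.κ * lam) (hC : 0 ≤ C) :
    ∃ C' : ℝ, 0 ≤ C' ∧ ∀ (Φ : Profile) (b₀ θ : ℝ), 0 < θ → θ ≤ 1 →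
      Φ.Approx W N lam k b₀ C θ m → Φ.Errors W N lam C' θ := by
  obtain ⟨Q, hQ1, hQ⟩ := exists_pow_mul_edecay_le hk 2
  have hB := W.B_pos
  set D := 2 * C + 2 * (N * lam * W.B + N * lam ^ 2 * W.B + lam ^ 2 * W.B + lam ^ 3 * W.B) with hD
  have z1 : 0 < N * lam * W.B := by positivity
  have z2 : 0 < N * lam ^ 2 * W.B := by positivity
  have z3 : 0 < lam ^ 2 * W.B := by positivity
  have z4 : 0 < lam ^ 3 * W.B := by positivity
  have hD0 : 0 ≤ D := by positivity
  have hCD : 2 * C ≤ D := by linarith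
  set Z := 2 * D * (Q + 1) with hZ
  have hZ0 : 0 ≤ Z := by positivity
  have hDZ : 2 * D ≤ Z := le_mul_of_one_le_right (by linarith) (by linarith)
  have hDQ : D * (Q + 1) ≤ Z := by rw [hZ]; nlinarith
  refine ⟨4 * Z ^ 2 + Z, by positivity, fun Φ b₀ θ hθ hθ1 h => ?_⟩
  have hc := h.crude hN hl hk hkl hC hθ hθ1
  rw [← hD] at hc
  have E0 := fun y => (edecay_pos k y).le
  have J0 := fun y (hy : 0 < y) => (tail_pos hθ m hy).le
  have E1 := fun y (hy : 0 < y) => edecay_le_one hk hy.le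
  have J1 := fun y (hy : 0 < y) => tail_le_one hθ m hy
  have yyE : ∀ y, 0 < y → y ^ 2 * edecay k y ≤ Q := fun y hy =>
    (mul_le_right (pow_le_pow_left₀ hy.le (by linarith only) 2) (E0 y)).trans (hQ y hy.le)
  have yE : ∀ y, 0 < y → y * edecay k y ≤ Q := fun y hy =>
    (mul_le_right (by nlinarith only [hy]) (E0 y)).trans (hQ y hy.le)
  have scale : ∀ {s c : ℝ}, s ≤ c → s ≤ D → s * Q ≤ Z := fun _ h =>
    (mul_le_right h (by linarith)).trans (by linarith)
  have wmul : ∀ {g X F K T : ℝ} {p : ℝ}, 0 ≤ p → |g| ≤ X * F → 0 ≤ X → p * F ≤ K → X * K ≤ T →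
      p * |g| ≤ T := fun {g X F K T p} hp hg hX hF hT =>
    calc p * |g| ≤ p * (X * F) := mul_le_left hg hp
      _ = X * (p * F) := by ring
      _ ≤ X * K := mul_le_left hF hX
      _ ≤ T := hT
  have lead : ∀ {u s p y : ℝ}, 0 < y → 0 ≤ p → 0 ≤ s → s * W.B ≤ D → p * edecay k y ≤ Q →
      |u| ≤ W.B * edecay W.κ (lam * y) → p * |s * u| ≤ Z := fun {u s p y} hy hp hs hsD hpE hu => by
    refine wmul hp (X := s * W.B) (F := edecay k y) ?_ (by positivity) hpE (K := Q) ?_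
    · rw [abs_mul, abs_of_nonneg hs, mul_assoc]
      refine mul_le_left (hu.trans (mul_le_left (Real.exp_le_exp.2 (neg_le_neg ?_)) hB.le)) hs
      rw [← mul_assoc]; exact mul_le_right hkl hy.le
    · have := mul_le_right hsD (by linarith : 0 ≤ Q)
      linarith
  have hly : ∀ {y : ℝ}, 0 < y → 0 ≤ lam * y := fun hy => by positivity
  have dlin : ∀ y, HasDerivAt (fun y : ℝ => lam * y) lam y := fun y => by
    simpa using (hasDerivAt_id y).const_mul lam
  have r1 : ∀ {g y : ℝ}, 0 < y → |g| ≤ C * (θ * (edecay k y + tail θ m y)) → |g| ≤ Z * θ :=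
    fun {g y} hy hg => hg.trans (by
      have := mul_le_left (add_le_add (E1 y hy) (J1 y hy)) (mul_nonneg hC hθ.le)
      have := mul_le_right (hCD.trans (by linarith : D ≤ Z)) hθ.le
      linarith)
  have rA : ∀ y, 0 < y → y⁻¹ * |Φ.a y - N * W.U (lam * y)| ≤ Z * θ := fun y hy => by
    rw [inv_mul_le_iff₀ hy, mul_comm y]
    refine abs_le_of_hasDerivAt_le (g := fun y => Φ.a y - N * W.U (lam * y))
      (fun y => (Φ.da y).sub (((W.dU _).comp y (dlin y)).const_mul N))
      (by simp [Φ.a_zero, W.U_zero]) (fun y hy => ?_) hy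
    convert r1 hy (h.a1 y hy) using 2
    ring
  have rB : ∀ y, 0 < y → y⁻¹ * |Φ.b y - lam * W.V (lam * y)| ≤ Z * θ := fun y hy => by
    rw [inv_mul_le_iff₀ hy, mul_comm y]
    refine abs_le_of_hasDerivAt_le (g := fun y => Φ.b y - lam * W.V (lam * y))
      (fun y => (Φ.db y).sub (((W.dV _).comp y (dlin y)).const_mul lam))
      (by simp [Φ.b_zero, W.V_zero]) (fun y hy => ?_) hy
    convert r1 hy (h.b1 y hy) using 2
    ring
  have one : ∀ {x T : ℝ}, |x| ≤ T → 1 * |x| ≤ T := fun h => (one_mul _).trans_le h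
  have ra2 : ∀ y, 0 < y → |Φ.a2 y - N * lam ^ 2 * W.U2 (lam * y)| ≤ Z * θ := fun y hy => by
    refine r1 hy ((h.a2 y hy).trans ?_)
    have := mul_le_of_le_one_left (J0 y hy) hθ1
    gcongr
  have yra2 : ∀ y, 0 < y → y * |Φ.a2 y - N * lam ^ 2 * W.U2 (lam * y)| ≤ Z * θ := fun y hy => by
    refine wmul hy.le ((h.a2 y hy).trans_eq (mul_assoc _ _ _).symm) (by positivity) (K := Q + 1)
      (by linarith [yE y hy, mul_tail_le hθ m hy]) ?_
    have := mul_le_right (show C * (Q + 1) ≤ Z by nlinarith) hθ.le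
    linarith
  have b_le : ∀ y, 0 < y → |Φ.b y| ≤ Z := fun y hy => (hc.b_le y hy).trans (by
    have := mul_le_left (add_le_add (E1 y hy) (J1 y hy)) hD0
    linarith)
  have a_le : ∀ y, 0 < y → |Φ.a y| ≤ Z := fun y hy => (hc.a_le y hy).trans (by linarith)
  have ya1 : ∀ y, 0 < y → y * |Φ.a1 y| ≤ Z := fun y hy =>
    wmul hy.le (hc.a1 y hy) hD0 (by linarith [yE y hy, mul_tail_le hθ m hy]) hDQ
  have hθD : D * θ * (Q + 1) ≤ Z * θ := by
    have := mul_le_right hDQ hθ.le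
    linarith
  have tE : ∀ {x : ℝ}, x ≤ Q → 0 ≤ x → θ * x ≤ Q := fun hx h0 =>
    (mul_le_of_le_one_left h0 hθ1).trans hx
  have yye : ∀ y, 0 < y → y ^ 2 * |Φ.e y| ≤ Z * θ := fun y hy => by
    refine wmul (sq_nonneg y) (X := D * θ) (F := θ * (edecay k y + θ * tail θ m y))
      ((hc.e y hy).trans_eq (by ring)) (by positivity) (K := Q + 1) ?_ hθD
    linarith [tE (yyE y hy) (mul_nonneg (sq_nonneg y) (E0 y)), sq_mul_tail_le hθ m hy]
  have yf : ∀ y, 0 < y → y * |Φ.f y| ≤ Z * θ := fun y hy => by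
    refine wmul hy.le (X := D * θ) (F := θ * (edecay k y + tail θ m y))
      ((hc.f y hy).trans_eq (by ring)) (by positivity) (K := Q + 1) ?_ hθD
    linarith [tE (yE y hy) (mul_nonneg hy.le (E0 y)), mul_tail_le hθ m hy]
  have z0 : 0 ≤ Z * θ := by positivity
  have zz : 0 ≤ Z ^ 2 * θ := by positivity
  refine ⟨fun y hy => ?_, fun y hy => ?_, fun y hy => ?_, fun y hy => ?_, fun y hy => ?_,
    fun y hy => ?_, fun y hy => ?_⟩
  · have h1 := rA y hy
    rw [inv_mul_le_iff₀ hy] at h1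
    have := (abs_le.1 h1).1
    have := mul_nonneg hy.le zz
    linarith
  · have h1 := abs_sub_abs_le_abs_sub (Φ.a2 y) (N * lam ^ 2 * W.U2 (lam * y))
    have h2 := ra2 y hy
    rw [abs_mul, abs_of_pos (by positivity : 0 < N * lam ^ 2)] at h1
    linarith
  · have := weighted_abs_cross_le (P := Z * (Z * θ)) zero_le_one
      (weighted_abs_mul_le hy.le (inv_nonneg.2 hy.le) (mul_inv_cancel₀ hy.ne').symm
        (lead (s := N * lam) hy hy.le (by positivity) (by linarith) (yE y hy)
          (W.U1_le _ (hly hy))) (rB y hy))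
      ((weighted_abs_mul_le zero_le_one zero_le_one (one_mul 1).symm
        (one (r1 hy (h.a1 y hy))) (one (b_le y hy))).trans_eq (mul_comm _ _))
      ((weighted_abs_mul_le (inv_nonneg.2 hy.le) hy.le (inv_mul_cancel₀ hy.ne').symm (rA y hy)
        (lead (s := lam ^ 2) hy hy.le (by positivity) (by linarith) (yE y hy)
          (W.V1_le _ (hly hy)))).trans_eq (mul_comm _ _))
      (weighted_abs_mul_le zero_le_one zero_le_one (one_mul 1).symm (one (a_le y hy))
        (one (r1 hy (h.b1 y hy))))
    rw [one_mul, one_mul, show N * lam * W.U1 (lam * y) * (lam * W.V (lam * y))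
      - N * W.U (lam * y) * (lam ^ 2 * W.V1 (lam * y)) = N * lam ^ 2 * (W.U1 (lam * y)
      * W.V (lam * y) - W.U (lam * y) * W.V1 (lam * y)) by ring, abs_mul,
      abs_of_pos (by positivity : 0 < N * lam ^ 2)] at this
    linarith
  · have := weighted_abs_cross_le (P := Z * (Z * θ)) hy.le
      (weighted_abs_mul_le (sq_nonneg y) (inv_nonneg.2 hy.le) (by field_simp)
        (lead (s := N * lam ^ 2) hy (sq_nonneg y) (by positivity) (by linarith) (yyE y hy)
          (W.U2_le _ (hly hy))) (rB y hy))
      ((weighted_abs_mul_le hy.le zero_le_one (mul_one y).symm (yra2 y hy)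
        (one (b_le y hy))).trans_eq (mul_comm _ _))
      ((weighted_abs_mul_le zero_le_one hy.le (one_mul y).symm (one (r1 hy (h.a1 y hy)))
        (lead (s := lam ^ 2) hy hy.le (by positivity) (by linarith) (yE y hy)
          (W.V1_le _ (hly hy)))).trans_eq (mul_comm _ _))
      (weighted_abs_mul_le hy.le zero_le_one (mul_one y).symm (ya1 y hy)
        (one (r1 hy (h.b1 y hy))))
    rw [show N * lam ^ 2 * W.U2 (lam * y) * (lam * W.V (lam * y))
      - N * lam * W.U1 (lam * y) * (lam ^ 2 * W.V1 (lam * y)) = N * lam ^ 2 * lam *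
      (W.V (lam * y) * W.U2 (lam * y) - W.U1 (lam * y) * W.V1 (lam * y)) by ring, abs_mul,
      abs_of_pos (by positivity : 0 < N * lam ^ 2 * lam), mul_comm (Φ.a2 y)] at this
    linarith
  · have h1 := weighted_abs_mul_le (sq_nonneg y) zero_le_one (mul_one (y ^ 2)).symm (yye y hy)
      (one (a_le y hy))
    have h2 := weighted_abs_mul_le hy.le hy.le (pow_two y) (yf y hy) (ya1 y hy)
    have := mul_le_left (abs_add_le (Φ.e y * Φ.a y) (Φ.f y * Φ.a1 y)) (sq_nonneg y)
    linarith
  · have := weighted_abs_mul_le hy.le zero_le_one (mul_one y).symm (yf y hy) (one (a_le y hy))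
    linarith
  · set r := Φ.a2 y - N * lam ^ 2 * W.U2 (lam * y) with hr
    have hr1 := ra2 y hy
    have hr2 := yra2 y hy
    rw [← hr] at hr1 hr2
    have hr3 : y ^ 2 * r ^ 2 ≤ 2 * Z ^ 2 * θ * (y / (1 + y)) := by
      rw [mul_div_assoc', le_div_iff₀ (by positivity)]
      have e1 : y * |r| * ((1 + y) * |r|) ≤ Z * θ * (2 * (Z * θ)) :=
        mul_le_mul hr2 (by linarith) (by positivity) z0
      have e2 : Z * θ * (2 * (Z * θ)) ≤ 2 * Z ^ 2 * θ := by
        have := mul_le_left hθ1 zz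
        linarith
      have := mul_le_left (e1.trans e2) hy.le
      have : y ^ 2 * r ^ 2 * (1 + y) = y * (y * |r| * ((1 + y) * |r|)) := by
        rw [← sq_abs r]; ring
      linarith
    have e3 : Φ.a2 y ^ 2 ≤ 2 * (N * lam ^ 2 * W.U2 (lam * y)) ^ 2 + 2 * r ^ 2 := by
      nlinarith only [sq_nonneg (N * lam ^ 2 * W.U2 (lam * y) - r), hr]
    have := mul_le_left e3 (sq_nonneg y)
    have : 0 ≤ Z * θ * (y / (1 + y)) := by positivity
    linarith

/-- Bounds of the lower order terms generated by the leading layer. -/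
def Leading.IsBound (W : Leading) (M G : ℝ) : Prop := ∀ z, 0 < z →
    |W.U2 z| * (1 + z) ^ 2 ≤ M ∧ |W.U1 z * W.V z - W.U z * W.V1 z| * (1 + z) ^ 2 ≤ M ∧
    z * |W.V z * W.U2 z - W.U1 z * W.V1 z| * (1 + z) ^ 2 ≤ M ∧
    4 * (z ^ 2 * W.U2 z ^ 2) * (1 + z) ^ 3 ≤ M * W.c * z ∧
    z ^ 2 * W.U2 z ^ 2 * (1 + z) ^ 2 ≤ G

theorem Leading.exists_isBound (W : Leading) : ∃ M G : ℝ, 0 < M ∧ 0 < G ∧ W.IsBound M G := by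
  obtain ⟨G, hG1, hG⟩ := exists_pow_mul_edecay_le W.κ_pos 4
  have hB := W.B_pos
  have hc := W.c_pos
  have hG0 : 0 < G := by linarith
  have hMc : W.B * G + 2 * W.B ^ 2 * G ≤
      W.B * G + 2 * W.B ^ 2 * G + 4 * W.B ^ 2 * G / W.c := le_add_of_nonneg_right (by positivity)
  refine ⟨W.B * G + 2 * W.B ^ 2 * G + 4 * W.B ^ 2 * G / W.c, W.B ^ 2 * G, by positivity,
    by positivity, fun z hz => ?_⟩
  have hE := (edecay_pos W.κ z).le
  have hE1 := edecay_le_one W.κ_pos hz.le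
  have hn : ∀ n, n ≤ 4 → (1 + z) ^ n * edecay W.κ z ≤ G := fun n hn =>
    (mul_le_right (pow_le_pow_right₀ (by linarith) hn) hE).trans (hG z hz.le)
  have hP : 0 ≤ W.B * G := by positivity
  have hP2 : 0 ≤ 2 * W.B ^ 2 * G := by positivity
  have u1 := W.U1_le z hz.le
  have u2 := W.U2_le z hz.le
  have v1 := W.V1_le z hz.le
  have hsq : W.U2 z ^ 2 ≤ W.B ^ 2 * edecay W.κ z := by
    rw [← sq_abs]
    calc |W.U2 z| ^ 2 ≤ (W.B * edecay W.κ z) ^ 2 := by gcongr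
      _ = W.B ^ 2 * edecay W.κ z * edecay W.κ z := by ring
      _ ≤ _ := mul_le_of_le_one_right (by positivity) hE1
  refine ⟨?_, ?_, ?_, ?_, ?_⟩
  · calc _ ≤ W.B * edecay W.κ z * (1 + z) ^ 2 := by gcongr
      _ = W.B * ((1 + z) ^ 2 * edecay W.κ z) := by ring
      _ ≤ W.B * G := by gcongr; exact hn 2 (by norm_num)
      _ ≤ _ := by linarith
  · calc _ ≤ (W.B * edecay W.κ z * W.B + W.B * (W.B * edecay W.κ z)) * (1 + z) ^ 2 := by
          gcongr
          exact (abs_sub _ _).trans (add_le_add (abs_mul_le_mul u1 (W.V_le z hz.le))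
            (abs_mul_le_mul (W.U_le z hz.le) v1))
      _ = 2 * W.B ^ 2 * ((1 + z) ^ 2 * edecay W.κ z) := by ring
      _ ≤ 2 * W.B ^ 2 * G := by gcongr; exact hn 2 (by norm_num)
      _ ≤ _ := by linarith
  · calc _ ≤ (1 + z) * (W.B * (W.B * edecay W.κ z) + W.B * edecay W.κ z * (W.B * 1))
          * (1 + z) ^ 2 := by
          gcongr
          · linarith
          · exact (abs_sub _ _).trans (add_le_add (abs_mul_le_mul (W.V_le z hz.le) u2)
              (abs_mul_le_mul u1 (v1.trans (by gcongr))))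
      _ = 2 * W.B ^ 2 * ((1 + z) ^ 3 * edecay W.κ z) := by ring
      _ ≤ 2 * W.B ^ 2 * G := by gcongr; exact hn 3 (by norm_num)
      _ ≤ _ := by linarith
  · calc _ ≤ 4 * (z * (1 + z) * (W.B ^ 2 * edecay W.κ z)) * (1 + z) ^ 3 := by
          rw [pow_two z]
          gcongr
          linarith
      _ = 4 * W.B ^ 2 * ((1 + z) ^ 4 * edecay W.κ z) * z := by ring
      _ ≤ 4 * W.B ^ 2 * G * z := by gcongr; exact hn 4 le_rfl
      _ = 4 * W.B ^ 2 * G / W.c * W.c * z := by rw [div_mul_cancel₀ _ hc.ne']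
      _ ≤ _ := by gcongr; linarith
  · calc _ ≤ (1 + z) ^ 2 * (W.B ^ 2 * edecay W.κ z) * (1 + z) ^ 2 := by
          gcongr
          linarith
      _ = W.B ^ 2 * ((1 + z) ^ 4 * edecay W.κ z) := by ring
      _ ≤ _ := by gcongr; exact hn 4 le_rfl

theorem Profile.Errors.coercive {Φ : Profile} {W : Leading} {N lam C θ M G kap b₀ δ ρ c : ℝ}
    (h : Φ.Errors W N lam C θ) (hN : 0 < N) (hl : 0 < lam) (hM : 0 < M) (hG : 0 < G)
    (hW : W.IsBound M G)
    (hδ : 0 < δ) (hb₀ : 0 < b₀) (hk : 16 ≤ kap) (hkM : 6000 * M ≤ kap * W.c)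
    (hsig : 24000 * kap ^ 2 * M * lam ^ 2 ≤ N * W.c ^ 2)
    (hρ1 : 24000 * (M * N * lam ^ 2) * ρ ≤ b₀ ^ 2)
    (hρ2 : 12000 * (M * N * lam ^ 2) * ρ ≤ b₀ * (lam * kap) ^ 2)
    (hρ3 : 8 * (N ^ 2 * lam ^ 2 * G) * ρ ≤ δ * b₀)
    (hδ1 : 6000 * (1 + lam * kap) ^ 2 * δ ≤ c ^ 2)
    (hδ2 : 6000 * (1 + lam * kap) * δ ≤ c * (lam * kap) ^ 2)
    (he1 : C * θ ≤ δ) (he2 : 2 * (C * θ) ≤ δ * c)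
    (hnf : ∀ y, 0 < y → N * (W.c / 2) * (lam * y) ≤ Φ.a y * (1 + lam * y) ∨
      b₀ / 2 ≤ Φ.a y ∧ 1 ≤ ρ * (1 + lam * y) ^ 2) (hc : 0 < c)
    (low : ∀ y, 0 ≤ y → c * y ≤ Φ.a y * (1 + y)) :
    (Φ.toCoefficients c hc low).Coercive (fun y => M * N * lam ^ 2 * (1 + lam * y)⁻¹ ^ 2 + δ)
      (fun y => -(2 * (M * N * lam ^ 2) * lam * (1 + lam * y)⁻¹ ^ 3)) (lam * kap) δ
      (3 * (M * N * lam ^ 2) + δ) := by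
  obtain ⟨K, hK⟩ : ∃ K, K = M * N * lam ^ 2 := ⟨_, rfl⟩
  have hK0 : 0 < K := by rw [hK]; positivity
  rw [← hK] at hρ1 hρ2 ⊢
  have hkap : 0 < kap := by linarith
  have hk0 : 0 < lam * kap := mul_pos hl hkap
  have q0 : ∀ y : ℝ, 0 ≤ y → 0 < (1 + lam * y)⁻¹ := fun y hy => by positivity
  have q1 : ∀ y : ℝ, 0 ≤ y → (1 + lam * y)⁻¹ ≤ 1 := fun y hy =>
    inv_le_one_of_one_le₀ (le_add_of_nonneg_right (by positivity))
  have qm : ∀ y : ℝ, 0 ≤ y → (1 + lam * y)⁻¹ * (1 + lam * y) = 1 := fun y hy =>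
    inv_mul_cancel₀ (by positivity)
  have conv : ∀ {n : ℕ} {y x X : ℝ}, 0 < y → x * (1 + lam * y) ^ n ≤ X →
      x ≤ X * (1 + lam * y)⁻¹ ^ n := fun {n y x X} hy hx => by
    have := mul_le_right hx (pow_nonneg (q0 y hy.le).le n)
    rwa [mul_assoc, ← mul_pow, mul_comm (1 + lam * y), qm y hy.le, one_pow, mul_one] at this
  have lead : ∀ {y x g : ℝ}, 0 < y → x ≤ N * lam ^ 2 * g + C * θ → g * (1 + lam * y) ^ 2 ≤ M →
      x ≤ K * (1 + lam * y)⁻¹ ^ 2 + δ := fun {y x g} hy hx hg => by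
    have h1 := mul_le_left (conv hy hg) (by positivity : 0 ≤ N * lam ^ 2)
    rw [hK]
    linarith only [h1, hx, he1]
  have hRδ : ∀ y, 0 < y → δ ≤ K * (1 + lam * y)⁻¹ ^ 2 + δ := fun y hy =>
    le_add_of_nonneg_left (by have := q0 y hy.le; positivity)
  have hz : ∀ y : ℝ, 0 < y → 0 < lam * y := fun y hy => mul_pos hl hy
  have near : ∀ y, 0 < y → N * (W.c / 2) * (lam * y) ≤ Φ.a y * (1 + lam * y) →
      N * (W.c / 2) * (lam * y) * (1 + lam * y)⁻¹ ≤ Φ.a y := fun y hy h1 => by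
    have := mul_le_right h1 (q0 y hy.le).le
    rwa [mul_assoc (Φ.a y), mul_comm (1 + lam * y), qm y hy.le, mul_one] at this
  have far : ∀ y, 0 < y → 1 ≤ ρ * (1 + lam * y) ^ 2 → (1 + lam * y)⁻¹ ^ 2 ≤ ρ := fun y hy h1 => by
    have := mul_le_right h1 (pow_nonneg (q0 y hy.le).le 2)
    rwa [mul_assoc, ← mul_pow, mul_comm (1 + lam * y), qm y hy.le, one_pow, mul_one, one_mul]
      at this
  have hr : ∀ y, 0 < y → c * (y / (1 + y)) ≤ Φ.a y := fun y hy => by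
    rw [mul_div_assoc', div_le_iff₀ (by positivity)]
    exact low y hy.le
  have hw : ∀ y, 0 < y → 2 * kap * (lam * y) * (1 / (1 + lam * kap * y)) ^ 2 ≤ 1 := fun y hy => by
    rw [one_div, inv_pow, mul_inv_le_iff₀ (by positivity), one_mul]
    nlinarith only [sq_nonneg (lam * kap * y)]
  have hs1 : ∀ y, 0 < y → lam * kap * y * (1 / (1 + lam * kap * y)) ≤ 1 := fun y hy => by
    rw [mul_one_div, div_le_one (by positivity)]; linarith only
  have hs2 : ∀ y, 0 < y → lam * kap * y * (1 / (1 + lam * kap * y)) ≤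
      (1 + lam * kap) * (y / (1 + y)) := fun y hy => by
    rw [mul_one_div, mul_div_assoc', div_le_div_iff₀ (by positivity) (by positivity)]
    have : 0 ≤ lam * kap * y * (lam * kap * y) := by positivity
    nlinarith only [this, hy, mul_pos hk0 hy]
  refine ⟨hk0, hδ, fun y hy => ?_, ?_, hRδ, fun y hy => ?_, fun y hy => ?_, fun y hy => ?_,
    fun y hy => ?_, fun y hy => lead hy (h.a2 y hy) (hW _ (hz y hy)).1, fun y hy => ?_,
    fun y hy => lead hy (h.ab y hy) (hW _ (hz y hy)).2.1,
    fun y hy => lead hy (h.ab1 y hy) (hW _ (hz y hy)).2.2.1,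
    fun y hy => ((h.e y hy).trans he1).trans (hRδ y hy),
    fun y hy => ((h.f y hy).trans he1).trans (hRδ y hy), fun y hy => ?_, fun y hy => ?_⟩
  · have hne : (1 + lam * y) ≠ 0 := by positivity
    have h1 : HasDerivAt (fun y : ℝ => 1 + lam * y) lam y := by
      simpa using ((hasDerivAt_id y).const_mul lam).const_add 1
    refine ((((h1.inv hne).pow 2).const_mul K).add_const δ).congr_deriv ?_
    simp only [Pi.inv_apply]
    field_simp
    norm_num [mul_assoc, mul_inv_cancel₀ hne]
  · refine ContinuousOn.neg (continuousOn_const.mul (ContinuousOn.pow (ContinuousOn.inv₀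
      (by fun_prop) fun y hy => ?_) 3))
    have : 0 < y := hy
    positivity
  · have : (1 + lam * y)⁻¹ ^ 2 ≤ 1 := pow_le_one₀ (q0 y hy.le).le (q1 y hy.le)
    nlinarith only [this, hK0]
  · have := q0 y hy.le
    rw [Left.neg_nonpos_iff]
    positivity
  · have h1 : (1 + lam * y)⁻¹ ^ 2 ≤ 1 := pow_le_one₀ (q0 y hy.le).le (q1 y hy.le)
    have h2 : lam * y * (1 + lam * y)⁻¹ ≤ 1 := by
      linarith only [qm y hy.le, q0 y hy.le]
    have h3 := mul_le_mul h2 h1 (sq_nonneg _) zero_le_one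
    nlinarith only [mul_le_left h3 hK0.le, hK0, hδ]
  · set q := (1 + lam * y)⁻¹
    set w := (1 / (1 + lam * kap * y)) ^ 2
    have h1 : 32 * (lam * y * w) ≤ 1 := by
      have : 0 ≤ lam * y * w := mul_nonneg (hz y hy).le (sq_nonneg _)
      nlinarith only [hw y hy, hk, this]
    have h2 : 0 ≤ K * q ^ 3 := by have := q0 y hy.le; positivity
    have h3 : K * q ^ 3 ≤ K * q ^ 2 := mul_le_left
      (pow_le_pow_of_le_one (q0 y hy.le).le (q1 y hy.le) (by norm_num)) hK0.le
    linarith only [mul_le_left h1 h2, h3, hδ, h2]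
  · change y ^ 2 * Φ.a2 y ^ 2 ≤ (K * (1 + lam * y)⁻¹ ^ 2 + δ) * Φ.a y
    have h0 := h.a2_sq y hy
    have hr' := hr y hy
    have h1 : C * θ * (y / (1 + y)) ≤ δ / 2 * Φ.a y := by
      have h2 := mul_le_right he2 (by positivity : 0 ≤ y / (1 + y))
      linarith only [h2, mul_le_left hr' hδ.le]
    have ha : 0 ≤ Φ.a y := le_trans (by positivity) hr'
    obtain ⟨-, -, -, w4, w5⟩ := hW _ (hz y hy)
    set q := (1 + lam * y)⁻¹
    have hq : 0 ≤ K * q ^ 2 := by positivity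
    have hn : 0 ≤ N ^ 2 * lam ^ 2 := by positivity
    rcases hnf y hy with h3 | ⟨h3, h4⟩
    · have h5 := mul_le_left (conv hy w4) hn
      have h6 := mul_le_left (near y hy h3) hq
      have h7 : K * q ^ 2 * (N * (W.c / 2) * (lam * y) * q) =
        N ^ 2 * lam ^ 2 * (M * W.c * (lam * y) * q ^ 3) / 2 := by rw [hK]; ring
      linarith only [h0, h1, h5, h6, h7, mul_nonneg hδ.le ha]
    · have h5 := mul_le_left (conv hy w5) hn
      have h6 := mul_le_left (far y hy h4) (mul_nonneg hn hG.le)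
      have h7 := mul_le_left h3 hδ.le
      linarith only [h0, h1, h5, h6, h7, hρ3, mul_nonneg hq ha]
  · change 3000 * ((lam * kap * y * (1 / (1 + lam * kap * y))) ^ 2 *
      (K * (1 + lam * y)⁻¹ ^ 2 + δ)) ≤ Φ.a y ^ 2
    have hs0 : 0 ≤ lam * kap * y * (1 / (1 + lam * kap * y)) := by positivity
    have hsz : lam * kap * y * (1 / (1 + lam * kap * y)) ≤ kap * (lam * y) := by
      rw [mul_one_div, div_le_iff₀ (by positivity)]
      nlinarith only [mul_pos hk0 hy]
    have h1 := hs1 y hy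
    have h2 := hs2 y hy
    set s := lam * kap * y * (1 / (1 + lam * kap * y))
    have d : 3000 * (s ^ 2 * δ) ≤ Φ.a y ^ 2 / 2 := by
      have h3 := pow_le_pow_left₀ hs0 h2 2
      have h4 := pow_le_pow_left₀ (by positivity) (hr y hy) 2
      have h5 := mul_le_right h3 hδ.le
      have h6 := mul_le_right hδ1 (sq_nonneg (y / (1 + y)))
      linarith only [h4, h5, h6]
    have hq := q0 y hy.le
    have e : 3000 * (s ^ 2 * (K * (1 + lam * y)⁻¹ ^ 2)) ≤ Φ.a y ^ 2 / 2 := by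
      rcases hnf y hy with h3 | ⟨h3, h4⟩
      · have hc := W.c_pos
        have h4 := pow_le_pow_left₀ (by positivity) (near y hy h3) 2
        have h5 := pow_le_pow_left₀ hs0 hsz 2
        set q := (1 + lam * y)⁻¹
        have h6 := mul_le_right h5 (by positivity : 0 ≤ K * q ^ 2)
        have h7 := mul_le_right hsig (by positivity : 0 ≤ N * (lam * y * q) ^ 2)
        have h8 : (kap * (lam * y)) ^ 2 * (K * q ^ 2) =
          kap ^ 2 * M * lam ^ 2 * (N * (lam * y * q) ^ 2) := by rw [hK]; ring
        linarith only [h4, h6, h7, h8]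
      · have h4 := mul_le_left (far y hy h4) hK0.le
        have h5 := mul_le_mul (pow_le_one₀ hs0 h1 : s ^ 2 ≤ 1) h4 (by positivity) zero_le_one
        have h6 := pow_le_pow_left₀ (by positivity) h3 2
        linarith only [h5, h6, hρ1]
    linarith only [d, e]
  · change 3000 * ((y * (1 / (1 + lam * kap * y))) ^ 2 * (K * (1 + lam * y)⁻¹ ^ 2 + δ)) ≤ Φ.a y
    have hs0 : 0 ≤ lam * kap * y * (1 / (1 + lam * kap * y)) := by positivity
    have h1 := hs1 y hy
    have h2 := hs2 y hy
    have hw' := hw y hy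
    rw [mul_assoc] at hs0 h1 h2
    have ht : 2 * kap * lam ^ 2 * (y * (1 / (1 + lam * kap * y))) ^ 2 ≤ lam * y := by
      linarith only [mul_le_right hw' (hz y hy).le]
    set t := y * (1 / (1 + lam * kap * y))
    have hk2 : 0 < (lam * kap) ^ 2 := by positivity
    have hs2 : (lam * kap * t) ^ 2 ≤ lam * kap * t := pow_le_of_le_one hs0 h1 two_ne_zero
    have d : 3000 * (t ^ 2 * δ) ≤ Φ.a y / 2 := by
      refine le_of_mul_le_mul_left ?_ hk2
      have h5 := mul_le_right (hs2.trans h2) hδ.le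
      have h6 := mul_le_right hδ2 (by positivity : 0 ≤ y / (1 + y))
      have h7 := mul_le_left (hr y hy) hk2.le
      linarith only [h5, h6, h7]
    have hq := q0 y hy.le
    have e : 3000 * (t ^ 2 * (K * (1 + lam * y)⁻¹ ^ 2)) ≤ Φ.a y / 2 := by
      rcases hnf y hy with h3 | ⟨h3, h4⟩
      · have h4 := near y hy h3
        have h9 := q1 y hy.le
        set q := (1 + lam * y)⁻¹
        refine le_of_mul_le_mul_left ?_ hkap
        have h5 := mul_le_right ht (by positivity : 0 ≤ M * N * q ^ 2)
        have h6 := mul_le_right hkM (mul_nonneg (mul_nonneg hN.le (hz y hy).le)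
          (sq_nonneg q))
        have h7 := mul_le_left (mul_le_of_le_one_right hq.le h9)
          (by have := W.c_pos; positivity : 0 ≤ kap * (N * W.c * (lam * y)))
        have h8 := mul_le_left h4 hkap.le
        rw [hK]
        linarith only [h5, h6, h7, h8]
      · refine le_of_mul_le_mul_left ?_ hk2
        have h4 := mul_le_left (far y hy h4) hK0.le
        have h5 := mul_le_mul (pow_le_one₀ hs0 h1 : (lam * kap * t) ^ 2 ≤ 1) h4 (by positivity)
          zero_le_one
        have h6 := mul_le_left h3 hk2.le
        linarith only [h5, h6, hρ2]
    linarith only [d, e]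

theorem Leading.exists_coefficients (W : Leading) : ∃ σ₀ : ℝ, 0 < σ₀ ∧
    ∀ sig, 0 < sig → sig < σ₀ → ∀ lam, 0 < lam → ∀ (m : ℕ) (k : ℝ), 0 < k → k ≤ W.κ * lam →
    ∀ b₀ C, 0 < b₀ → 0 ≤ C → ∃ ε₀ c M δ : ℝ, 0 < ε₀ ∧ ε₀ ≤ 1 ∧ 0 < c ∧ 0 ≤ M ∧ 0 < δ ∧
    ∀ ε, 0 < ε → ε < ε₀ → ∀ Φ : Profile, Φ.Approx W (lam ^ 2 / sig) lam k b₀ C √ε m →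
      ∃ S : Coefficients, (∃ hc low, S = Φ.toCoefficients c hc low) ∧ S.Bounds (w0 m ε) M ∧
        (∃ R R1 k' B, S.Coercive R R1 k' δ B) ∧ S.Decay (w0 m ε) := by
  obtain ⟨M, G, hM, hG, hW⟩ := W.exists_isBound
  have hc := W.c_pos
  obtain ⟨kap, hkap⟩ : ∃ kap, kap = 16 + 6000 * M / W.c := ⟨_, rfl⟩
  have hMc : 0 < 6000 * M / W.c := by positivity
  have hk16 : 16 ≤ kap := by linarith
  have hkM : 6000 * M ≤ kap * W.c := by
    rw [hkap, add_mul, div_mul_cancel₀ _ hc.ne']; linarith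
  refine ⟨W.c ^ 2 / (24000 * kap ^ 2 * M), by positivity,
    fun sig hs hsσ lam hl m k hk hkl b₀ C hb hC => ?_⟩
  obtain ⟨N, hN⟩ : ∃ N, N = lam ^ 2 / sig := ⟨_, rfl⟩
  have hN0 : 0 < N := by rw [hN]; positivity
  have hsig : 24000 * kap ^ 2 * M * lam ^ 2 ≤ N * W.c ^ 2 := by
    rw [lt_div_iff₀ (by positivity)] at hsσ
    rw [hN, div_mul_eq_mul_div, le_div_iff₀ hs]
    linarith only [mul_le_left hsσ.le (sq_nonneg lam)]
  rw [← hN]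
  obtain ⟨C', hC', herr⟩ := W.exists_errors (C := C) m hN0 hl hk hkl hC
  obtain ⟨Q1, hQ1, hQ⟩ := exists_pow_mul_edecay_le hk 1
  obtain ⟨Q, hQp, hQm⟩ := exists_pow_mul_edecay_le hk (m + 3)
  have hmin : ∀ {x y : ℝ}, 0 < x → 0 < y → ∃ z, 0 < z ∧ z ≤ x ∧ z ≤ y := fun hx hy =>
    ⟨_, lt_min hx hy, min_le_left _ _, min_le_right _ _⟩
  have hk0 : 0 < lam * kap := by positivity
  obtain ⟨c, hc0, hc1, hc2⟩ := hmin (by positivity : 0 < N * (W.c / 2) * lam / (1 + lam))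
    (half_pos hb)
  obtain ⟨δ, hδ, hδ1, hδ2⟩ := hmin (by positivity : 0 < c ^ 2 / (6000 * (1 + lam * kap) ^ 2))
    (by positivity : 0 < c * (lam * kap) ^ 2 / (6000 * (1 + lam * kap)))
  obtain ⟨ρ', hρ', hρ1, hρ2⟩ := hmin (by positivity : 0 < b₀ ^ 2 / (24000 * (M * N * lam ^ 2)))
    (by positivity : 0 < b₀ * (lam * kap) ^ 2 / (12000 * (M * N * lam ^ 2)))
  obtain ⟨ρ, hρ, hρ12, hρ3⟩ := hmin hρ' (by positivity : 0 < δ * b₀ / (8 * (N ^ 2 * lam ^ 2 * G)))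
  obtain ⟨Y, hY⟩ : ∃ Y, Y = 4 * (C * Q1) / b₀ + 1 / (ρ * lam) := ⟨_, rfl⟩
  have hQ10 : 0 ≤ Q1 := zero_le_one.trans hQ1
  have y1 : 0 ≤ 4 * (C * Q1) / b₀ := by positivity
  have y2 : 0 < 1 / (ρ * lam) := by positivity
  have hY0 : 0 < Y := by linarith
  obtain ⟨r', hr', hr1, hr2⟩ := hmin (by positivity : 0 < N * (W.c / 2) * lam / (1 + lam * Y))
    (by positivity : 0 < b₀ / 4)
  obtain ⟨r, hr, hr3, hr4⟩ := hmin hr' (lt_min hδ (by positivity : 0 < δ * c / 2))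
  have hD : 0 < C' + C + 1 := by positivity
  obtain ⟨ε₀, hε₀, he1, he2⟩ := hmin zero_lt_one (by positivity : 0 < (r / (C' + C + 1)) ^ 2)
  set D := 2 * C + 2 * (N * lam * W.B + N * lam ^ 2 * W.B + lam ^ 2 * W.B + lam ^ 3 * W.B)
  have hD0 : 0 ≤ D := by have := W.B_pos; positivity
  have hQ0 : 0 ≤ Q := zero_le_one.trans hQp
  refine ⟨ε₀, c, 2 * D * (Q + 1), δ, hε₀, he1, hc0, by positivity, hδ, fun ε hε hεε Φ h => ?_⟩
  have hθ : 0 < √ε := Real.sqrt_pos.2 hε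
  have hθr : (C' + C + 1) * √ε ≤ r := by
    rw [mul_comm, ← le_div_iff₀ hD]
    exact Real.sqrt_le_iff.2 ⟨by positivity, hεε.le.trans he2⟩
  have hθ1 : √ε ≤ 1 := Real.sqrt_le_one.2 (hεε.le.trans he1)
  have hCθ : C * √ε ≤ r :=
    (mul_le_right (by linarith) hθ.le).trans hθr
  have hCθ' : C' * √ε ≤ r :=
    (mul_le_right (by linarith) hθ.le).trans hθr
  have hE := herr Φ b₀ _ hθ hθ1 h
  have hnf : ∀ y, 0 < y → N * (W.c / 2) * (lam * y) ≤ Φ.a y * (1 + lam * y) ∨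
      b₀ / 2 ≤ Φ.a y ∧ 1 ≤ ρ * (1 + lam * y) ^ 2 := fun y hy => by
    have hz : 0 < lam * y := mul_pos hl hy
    rcases le_total y Y with hyY | hyY
    · left
      have h1 := mul_le_right (hE.near y hy) (by positivity : 0 ≤ 1 + lam * y)
      have h2 := mul_le_left (W.low _ hz.le) hN0.le
      have h3 := (hCθ'.trans hr3).trans hr1
      rw [le_div_iff₀ (by positivity)] at h3
      have h4 : C' * √ε * (1 + lam * y) ≤ C' * √ε * (1 + lam * Y) := by gcongr
      linarith only [h1, h2, mul_le_right (h4.trans h3) hy.le]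
    · right
      constructor
      · have h1 := h.a_ge y hy
        have h2 := mul_le_left (hQ y hy.le) hC
        have h3 : 4 * (C * Q1) ≤ Y * b₀ := by
          rw [← div_le_iff₀ hb]; linarith only [hY, y2]
        have h4 : C * edecay k y ≤ b₀ / 4 := by
          refine le_of_mul_le_mul_right ?_ (by positivity : 0 < 1 + y)
          linarith only [h2, h3, mul_le_right hyY hb.le, hb]
        linarith only [h1, h4, (hCθ.trans hr3).trans hr2]
      · have h1 : 1 / (ρ * lam) ≤ y := by linarith only [hY, y1, hyY]
        rw [div_le_iff₀ (by positivity)] at h1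
        have h2 : 0 ≤ ρ * (1 + lam * y + (lam * y) ^ 2) := by positivity
        linarith only [h1, h2]
  have low : ∀ y, 0 ≤ y → c * y ≤ Φ.a y * (1 + y) := fun y hy => by
    rcases hy.eq_or_lt with rfl | hy
    · simp [Φ.a_zero]
    rcases hnf y hy with h1 | ⟨h1, -⟩
    · have hz : 0 < lam * y := mul_pos hl hy
      rw [le_div_iff₀ (by positivity)] at hc1
      refine le_of_mul_le_mul_right ?_ (by positivity : 0 < 1 + lam * y)
      have h2 := mul_le_right hc1 hy.le
      have h3 := mul_le_right h1 (by positivity : 0 ≤ 1 + y)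
      have h4 : 0 ≤ (c * lam + N * (W.c / 2) * lam * y + c) * y := by positivity
      have h5 : c * y * (1 + lam * y) ≤ c * (1 + lam) * y * (1 + y) := by
        have : 0 ≤ c * y * (y + lam) := by positivity
        linarith only [this]
      linarith only [h5, h3, mul_le_right h2 (by positivity : 0 ≤ 1 + y)]
    · have h2 := mul_le_right (hc2.trans h1) (by positivity : 0 ≤ 1 + y)
      linarith only [h2, hc0]
  have hcr := h.crude hN0 hl hk hkl hC hθ hθ1
  refine ⟨_, ⟨hc0, low, rfl⟩, hcr.bounds hD0 hε (hεε.le.trans he1) hQm hk rfl, ⟨_, _, _, _,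
    hE.coercive hN0 hl hM hG hW hδ hb hk16 hkM hsig ?_ ?_ ?_ ?_ ?_ ?_ ?_ hnf hc0 low⟩,
    hcr.decay hD0 hε (hεε.le.trans he1) hQm rfl⟩
  · have := hρ12.trans hρ1
    rwa [le_div_iff₀' (by positivity)] at this
  · have := hρ12.trans hρ2
    rwa [le_div_iff₀' (by positivity)] at this
  · rwa [le_div_iff₀' (by positivity)] at hρ3
  · rwa [le_div_iff₀' (by positivity)] at hδ1
  · rwa [le_div_iff₀' (by positivity)] at hδ2
  · exact (hCθ'.trans hr4).trans (min_le_left _ _)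
  · linarith only [(hCθ'.trans hr4).trans (min_le_right _ _)]

theorem exists_pos_mul_le {U : ℝ → ℝ} {s E : ℝ} (hU : Continuous U) (h0 : U 0 = 0)
    (hpos : ∀ y, 0 < y → 0 < U y) (hd : HasDerivAt U s 0) (hs : 0 < s) (hE : 0 < E)
    (hl : Tendsto U atTop (𝓝 E)) : ∃ c, 0 < c ∧ ∀ z, 0 ≤ z → c * z ≤ U z * (1 + z) := by
  obtain ⟨η, hη, h1⟩ := Metric.mem_nhdsWithin_iff.1
    ((hasDerivAt_iff_tendsto_slope.1 hd).eventually (lt_mem_nhds (half_lt_self hs)))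
  obtain ⟨Z, hZ⟩ := eventually_atTop.1 (hl.eventually (lt_mem_nhds (half_lt_self hE)))
  obtain ⟨x, hx, hmin⟩ := (isCompact_Icc (a := η) (b := max η Z)).exists_isMinOn
    ⟨η, le_rfl, le_max_left _ _⟩ hU.continuousOn
  have hc : 0 < min (s / 2) (min (E / 2) (U x)) :=
    lt_min (by linarith) (lt_min (by linarith) (hpos x (hη.trans_le hx.1)))
  refine ⟨_, hc, fun z hz => ?_⟩
  rcases hz.eq_or_lt with rfl | hz
  · simp [h0]
  rcases lt_or_ge z η with hzη | hzη
  · have h2 : s / 2 < slope U 0 z := h1 ⟨by simpa [abs_of_pos hz] using hzη, hz.ne'⟩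
    rw [slope_def_field, h0, sub_zero, sub_zero, lt_div_iff₀ hz] at h2
    have h3 := mul_le_right (min_le_left (s / 2) (min (E / 2) (U x))) hz.le
    nlinarith only [h2, h3, mul_pos (hpos z hz) hz]
  · have h2 : min (s / 2) (min (E / 2) (U x)) ≤ U z := by
      refine (min_le_right _ _).trans ?_
      rcases le_total z Z with h | h
      · exact (min_le_right _ _).trans (hmin ⟨hzη, h.trans (le_max_right _ _)⟩)
      · exact (min_le_left _ _).trans (hZ z h).le
    linarith only [mul_le_right h2 hz.le, hpos z hz]

theorem PrandtlLayer.exists_leading (P : PrandtlLayer) : ∃ W : Leading,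
    W.U1 = pd 0 1 P.u 0 ∧ W.U2 = pd 0 2 P.u 0 ∧ W.V1 = pd 0 1 P.v 0 ∧ W.V2 = pd 0 2 P.v 0 ∧
    ∀ z, 0 ≤ z → |P.u 0 z| ≤ W.B * edecay W.κ z ∧ |P.v 0 z| ≤ W.B * edecay W.κ z ∧
      |pd 2 0 P.u 0 z| ≤ W.B * edecay W.κ z ∧ |pd 2 0 P.v 0 z| ≤ W.B * edecay W.κ z := by
  obtain ⟨κ, hκ, hdec⟩ := P.decay
  choose b hb using hdec
  have hu : Smooth₂ P.u := P.smooth_u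
  have hv : Smooth₂ P.v := P.smooth_v
  have h00 : (0 : ℝ) ∈ Icc 0 P.len := ⟨le_rfl, P.len_pos.le⟩
  have hE := P.E_pos
  set B := P.E + 2 * |b 0 0| + |b 0 1| + |b 0 2| + |b 2 0| with hB
  have hB0 : 0 < B := by positivity
  have ex : ∀ z, Real.exp (-κ * z) = edecay κ z := fun z => by rw [edecay, neg_mul]
  have key : ∀ {j k : ℕ}, |b j k| ≤ B → ∀ z, 0 ≤ z →
      |pd j k P.u 0 z| ≤ B * edecay κ z ∧ |pd j k P.v 0 z| ≤ B * edecay κ z := by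
    intro j k hjk z hz
    have h := hb j k 0 h00 z hz
    rw [ex] at h
    have h2 := mul_le_right ((le_abs_self _).trans hjk) (edecay_pos κ z).le
    exact ⟨h.1.trans h2, h.2.trans h2⟩
  have a0 := abs_nonneg (b 0 0)
  have a1 := abs_nonneg (b 0 1)
  have a2 := abs_nonneg (b 0 2)
  have a3 := abs_nonneg (b 2 0)
  have k0 := key (j := 0) (k := 0) (by linarith)
  have k1 := key (j := 0) (k := 1) (by linarith)
  have k2 := key (j := 0) (k := 2) (by linarith)
  have kx := key (j := 2) (k := 0) (by linarith)
  have n0 : ∀ z, 0 ≤ z → |P.u 0 z| ≤ |b 0 0| ∧ |P.v 0 z| ≤ |b 0 0| := fun z hz => by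
    have h := hb 0 0 0 h00 z hz
    rw [ex] at h
    have h1 := mul_le_mul (le_abs_self (b 0 0)) (edecay_le_one hκ hz) (edecay_pos κ z).le
      (abs_nonneg _)
    rw [mul_one] at h1
    exact ⟨h.1.trans h1, h.2.trans h1⟩
  have dU : ∀ z, HasDerivAt (fun z => P.E + P.u 0 z) (pd 0 1 P.u 0 z) z := fun z =>
    (hu.regular.d1 z).const_add _
  have hlim : Tendsto (fun z => P.E + P.u 0 z) atTop (𝓝 P.E) := by
    have h1 : Tendsto (fun z => B * edecay κ z) atTop (𝓝 (B * 0)) :=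
      (Real.tendsto_exp_neg_atTop_nhds_zero.comp (tendsto_id.const_mul_atTop hκ)).const_mul B
    rw [mul_zero] at h1
    have h2 : Tendsto (P.u 0) atTop (𝓝 0) :=
      squeeze_zero_norm' ((eventually_ge_atTop 0).mono fun z hz => (k0 z hz).1) h1
    simpa using h2.const_add P.E
  obtain ⟨c, hc, hlow⟩ := exists_pos_mul_le (continuous_of_hasDerivAt dU) (by rw [P.noSlip 0 h00]; ring) P.initial_pos (dU 0) P.initial_slope
    P.E_pos hlim
  exact ⟨{
    U := fun z => P.E + P.u 0 z
    U1 := pd 0 1 P.u 0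
    U2 := pd 0 2 P.u 0
    V := fun z => P.v 0 z - P.v 0 0
    V1 := pd 0 1 P.v 0
    V2 := pd 0 2 P.v 0
    c := c
    B := B
    κ := κ
    c_pos := hc
    B_pos := hB0
    κ_pos := hκ
    dU := dU
    dV := fun z => (hv.regular.d1 z).sub_const _
    U_zero := by rw [P.noSlip 0 h00]; ring
    V_zero := sub_self _
    low := hlow
    U_le := fun z hz => (abs_add_le _ _).trans (by
      rw [abs_of_pos hE]; linarith [(n0 z hz).1])
    V_le := fun z hz => (abs_sub _ _).trans (by linarith [(n0 z hz).2, (n0 0 le_rfl).2])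
    U1_le := fun z hz => (k1 z hz).1
    U2_le := fun z hz => (k2 z hz).1
    V1_le := fun z hz => (k1 z hz).2
    V2_le := fun z hz => (k2 z hz).2 }, rfl, rfl, rfl, rfl,
    fun z hz => ⟨(k0 z hz).1, (k0 z hz).2, (kx z hz).1, (kx z hz).2⟩⟩

theorem IsOuterShear.exists_bound {r : ℝ} {g : ℝ → ℝ} (h : IsOuterShear r g) :
    ∃ B, ∀ y, 0 ≤ y → |g y| ≤ B := by
  obtain ⟨B, hB⟩ := h.decay 1 2 le_rfl
  have hB0 : 0 ≤ B := (by positivity : (0 : ℝ) ≤ _).trans (hB 0 le_rfl)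
  have hg : ContDiff ℝ 1 g := h.smooth.of_le (by exact_mod_cast le_top)
  refine ⟨|g 0| + B * (Real.pi / 2), fun y hy => ?_⟩
  refine (image_norm_le_of_norm_deriv_right_le_deriv_boundary (f' := deriv g)
    (B := fun x => |g 0| + B * Real.arctan x) (B' := fun x => B * (1 / (1 + x ^ 2)))
    hg.continuous.continuousOn
    (fun x _ => (hg.differentiable one_ne_zero x).hasDerivAt.hasDerivWithinAt) (by simp)
    (fun x => ((Real.hasDerivAt_arctan x).const_mul B).const_add _) (fun x hx => ?_)
    (right_mem_Icc.2 hy)).trans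
    (add_le_add le_rfl (mul_le_left (Real.arctan_lt_pi_div_two y).le hB0))
  have h1 := hB x hx.1
  rw [iteratedDeriv_one] at h1
  rw [mul_one_div, le_div_iff₀ (by positivity), Real.norm_eq_abs]
  refine le_trans (mul_le_left ?_ (abs_nonneg _)) h1
  linarith only [hx.1]

theorem Smooth₂.pd_scaled {f : ℝ → ℝ → ℝ} (hf : Smooth₂ f) (r s t : ℝ) :
    Regular (fun x y => r * f (s * x) (t * y)) ∧
    (pd 0 1 (fun x y => r * f (s * x) (t * y)) 0 = fun y => r * t * pd 0 1 f 0 (t * y)) ∧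
    (pd 0 2 (fun x y => r * f (s * x) (t * y)) 0 = fun y => r * t ^ 2 * pd 0 2 f 0 (t * y)) ∧
    (pd 2 0 (fun x y => r * f (s * x) (t * y)) 0 = fun y => r * s ^ 2 * pd 2 0 f 0 (t * y)) := by
  have h := (hf.comp_mul s t).regular
  obtain ⟨h1, h2, h3⟩ := h.smul_eq r
  refine ⟨h.smul r, h1.trans ?_, h2.trans ?_, h3.trans ?_⟩ <;> funext y <;>
    rw [hf.pd_comp_mul, mul_zero] <;> ring

/-- The coefficients given by a profile which vanishes at the wall. -/
def Regular.profile {us vs : ℝ → ℝ → ℝ} (hu : Regular us) (hv : Regular vs) (ε : ℝ)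
    (hu0 : us 0 0 = 0) (hv0 : vs 0 0 = 0) : Profile where
  a := us 0
  a1 := pd 0 1 us 0
  a2 := pd 0 2 us 0
  b := vs 0
  b1 := pd 0 1 vs 0
  b2 := pd 0 2 vs 0
  e y := ε * pd 2 0 us 0 y
  f y := ε * pd 2 0 vs 0 y
  da := hu.d1
  da1 := hu.d2
  ca2 := hu.c2
  db := hv.d1
  db1 := hv.d2
  cb2 := hv.c2
  ce := hu.cxx.const_mul ε
  cf := hv.cxx.const_mul ε
  a_zero := hu0
  b_zero := hv0

theorem wall_zero {P : PrandtlLayer} {lam sig κ L ε : ℝ} {ue0 χ : ℝ → ℝ} {m : ℕ} {A : ℕ → ℝ}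
    {K : Correctors} (hue : IsOuterShear (lam ^ 2 / sig * P.E) ue0) (hχ : IsCutoff χ) (hL : 0 < L)
    (hK : K.IsAdmissible P lam sig m κ A L) :
    uS P lam sig ue0 χ K ε 0 0 = 0 ∧ vS P lam sig χ K ε 0 0 = 0 := by
  have h0 : (0 : ℝ) ∈ Icc 0 L := ⟨le_rfl, hL.le⟩
  have hn := P.noSlip 0 ⟨le_rfl, P.len_pos.le⟩
  have hw := hue.wall
  have hc := hχ.one 0 ⟨le_rfl, zero_le_one⟩
  have u1 := hK.wall_u 1 (by decide) 0 h0
  have u2 := hK.wall_u 2 (by decide) 0 h0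
  have u3 := hK.wall_u 3 (by decide) 0 h0
  have u4 := hK.wall_u 4 (by decide) 0 h0
  have v1 := hK.wall_v 1 (by decide) 0 h0
  have v2 := hK.wall_v 2 (by decide) 0 h0
  have v3 := hK.wall_v 3 (by decide) 0 h0
  have v4 := hK.wall_v_last 0 h0
  have v0 := hK.wall_v_first 0 h0
  constructor
  · simp [uS, PrandtlLayer.su, Correctors.cutU, sum_Icc_one_three, hn, hw, hc, u1, u2, u3, u4]
  · simp only [vS, Correctors.cutV, sum_Icc_one_three, mul_zero, v0, v1, v2, v3, v4]
    ring

theorem PrandtlLayer.exists_approx {P : PrandtlLayer} {W : Leading} (hU1 : W.U1 = pd 0 1 P.u 0)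
    (hU2 : W.U2 = pd 0 2 P.u 0) (hV1 : W.V1 = pd 0 1 P.v 0) (hV2 : W.V2 = pd 0 2 P.v 0)
    (hW : ∀ z, 0 ≤ z → |P.u 0 z| ≤ W.B * edecay W.κ z ∧ |P.v 0 z| ≤ W.B * edecay W.κ z ∧
      |pd 2 0 P.u 0 z| ≤ W.B * edecay W.κ z ∧ |pd 2 0 P.v 0 z| ≤ W.B * edecay W.κ z)
    {lam sig κ k : ℝ} {ue0 χ : ℝ → ℝ} (hs : 0 < sig) (hl : 0 < lam)
    (hue : IsOuterShear (lam ^ 2 / sig * P.E) ue0) (hχ : IsCutoff χ) (m : ℕ) (hκ : 0 < κ)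
    (hk : 0 < k) (hkκ : k ≤ κ) (hkl : k ≤ W.κ * lam) (A : ℕ → ℝ) :
    ∃ b₀ C : ℝ, 0 < b₀ ∧ 0 ≤ C ∧ ∀ L ε : ℝ, 0 < L → 0 < ε → ε ≤ 1 → ∀ K : Correctors,
      K.IsAdmissible P lam sig m κ A L → ∀ us vs : ℝ → ℝ → ℝ, us = uS P lam sig ue0 χ K ε →
      vs = vS P lam sig χ K ε → ∃ (hu : Regular us) (hv : Regular vs) (hu0 : us 0 0 = 0)
        (hv0 : vs 0 0 = 0),
        (hu.profile hv ε hu0 hv0).Approx W (lam ^ 2 / sig) lam k b₀ C √ε m := by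
  obtain ⟨b₀, hb₀, hlow⟩ := hue.lower
  obtain ⟨B0, hB0⟩ := hue.exists_bound
  obtain ⟨B1, hB1⟩ := hue.decay 1 (m + 4) le_rfl
  obtain ⟨B2, hB2⟩ := hue.decay 2 (m + 4) one_le_two
  obtain ⟨Cr, hCr, hrest⟩ := exists_piece_rest hχ m hκ A
  have p0 : 0 ≤ B0 := (abs_nonneg _).trans (hB0 0 le_rfl)
  have p1 : 0 ≤ B1 := (by positivity : (0 : ℝ) ≤ _).trans (hB1 0 le_rfl)
  have p2 : 0 ≤ B2 := (by positivity : (0 : ℝ) ≤ _).trans (hB2 0 le_rfl)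
  have hWB := W.B_pos
  obtain ⟨N, hN⟩ : ∃ N, N = lam ^ 2 / sig := ⟨_, rfl⟩
  have hN0 : 0 < N := by rw [hN]; positivity
  rw [← hN]
  have p3 : 0 ≤ N * W.B := by positivity
  have p4 : 0 ≤ lam * W.B := by positivity
  have p5 : 0 ≤ N * sig ^ 2 * W.B := by positivity
  have p6 : 0 ≤ lam * sig ^ 2 * W.B := by positivity
  refine ⟨b₀, B0 + B1 + B2 + N * W.B + lam * W.B + N * sig ^ 2 * W.B + lam * sig ^ 2 * W.B + Cr,
    hb₀, by positivity, fun L ε hL hε hε1 K hK us vs hus hvs => ?_⟩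
  obtain ⟨C, hC⟩ : ∃ C, C = B0 + B1 + B2 + N * W.B + lam * W.B + N * sig ^ 2 * W.B
    + lam * sig ^ 2 * W.B + Cr := ⟨_, rfl⟩
  rw [← hC]
  obtain ⟨hu, hv⟩ := hrest P lam sig L ε hL hε hε1 K hK
  obtain ⟨hu0, hv0⟩ := wall_zero (ε := ε) hue hχ hL hK
  rw [← hus] at hu0
  rw [← hvs] at hv0
  have hθ : 0 < √ε := Real.sqrt_pos.2 hε
  have hθ1 : √ε ≤ 1 := Real.sqrt_le_one.2 hε1
  have hθε : ε = √ε ^ 2 := (Real.sq_sqrt hε.le).symm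
  set θ := √ε
  have hg : Smooth₂ fun _ Y => ue0 Y := hue.smooth.comp contDiff_snd
  obtain ⟨rg, g1, g2, gx⟩ := hg.pd_scaled 1 1 θ
  obtain ⟨ru, u1, u2, ux⟩ := Smooth₂.pd_scaled (f := P.u) P.smooth_u N sig lam
  obtain ⟨rv, v1, v2, vx⟩ := Smooth₂.pd_scaled (f := P.v) P.smooth_v lam sig lam
  have eu : us = fun x y => (1 * ue0 (θ * y) + N * P.u (sig * x) (lam * y)) + restU χ K ε x y := by
    funext x y
    rw [hus, uS, restU, PrandtlLayer.su, hN]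
    ring
  have ev : vs = fun x y => lam * P.v (sig * x) (lam * y) + restV χ K ε x y := by
    funext x y
    rw [hvs, vS, restV, PrandtlLayer.sv]
    ring
  obtain ⟨s1, s2, sx⟩ := (rg.add ru).add_eq hu.reg
  obtain ⟨t1, t2, tx⟩ := rg.add_eq ru
  obtain ⟨w1, w2, wx⟩ := rv.add_eq hv.reg
  rw [← eu, t1, g1, u1] at s1
  rw [← eu, t2, g2, u2] at s2
  rw [← eu, tx, gx, ux] at sx
  rw [← ev, v1] at w1
  rw [← ev, v2] at w2
  rw [← ev, vx] at wx
  beta_reduce at s1 s2 sx w1 w2 wx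
  have E0 := fun y => (edecay_pos k y).le
  have J0 := fun y (hy : 0 < y) => (tail_pos hθ m hy).le
  have Eκ : ∀ y, 0 < y → edecay κ y ≤ edecay k y := fun y hy =>
    Real.exp_le_exp.2 (neg_le_neg (mul_le_right hkκ hy.le))
  have El : ∀ y, 0 < y → edecay W.κ (lam * y) ≤ edecay k y := fun y hy =>
    Real.exp_le_exp.2 (neg_le_neg (by
      rw [← mul_assoc]; exact mul_le_right hkl hy.le))
  have lead : ∀ {g r y : ℝ}, 0 < y → 0 ≤ r → |g| ≤ W.B * edecay W.κ (lam * y) →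
      |r * g| ≤ r * W.B * edecay k y := fun {g r y} hy hr h => by
    rw [abs_mul, abs_of_nonneg hr, mul_assoc]
    exact mul_le_left (h.trans (mul_le_left (El y hy) hWB.le)) hr
  have fin : ∀ {x β γ D : ℝ}, x ≤ D * β → D ≤ C → 0 ≤ β → β ≤ γ → 0 ≤ C → x ≤ C * γ :=
    fun h1 h2 h3 h4 h5 => h1.trans (mul_le_mul h2 h4 h3 h5)
  have hC0 : 0 ≤ C := by rw [hC]; positivity
  have pg1 : ∀ Y, pd 0 1 (fun _ Y : ℝ => ue0 Y) 0 Y = iteratedDeriv 1 ue0 Y := fun Y => by simp [pd]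
  have pg2 : ∀ Y, pd 0 2 (fun _ Y : ℝ => ue0 Y) 0 Y = iteratedDeriv 2 ue0 Y := fun Y => by simp [pd]
  have pgx : ∀ Y, pd 2 0 (fun _ Y : ℝ => ue0 Y) 0 Y = 0 := fun Y => by simp [pd, iteratedDeriv_const]
  have outer : ∀ {g B y : ℝ}, 0 < y → |g| * (1 + θ * y) ^ (m + 4) ≤ B →
      |g| ≤ B * tail θ m y := fun hy h => abs_le_mul_tail hθ hy h
  have hly : ∀ {y : ℝ}, 0 < y → 0 ≤ lam * y := fun hy => by positivity
  have hty : ∀ {y : ℝ}, 0 < y → 0 ≤ θ * y := fun hy => by positivity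
  refine ⟨eu ▸ (rg.add ru).add hu.reg, ev ▸ rv.add hv.reg, hu0, hv0, fun y hy => ?_, fun y hy => ?_,
    fun y hy => ?_, fun y hy => ?_, fun y hy => ?_, fun y hy => ?_, fun y hy => ?_, fun y hy => ?_,
    fun y hy => ?_⟩ <;> dsimp only [Regular.profile] <;> have hE := E0 y <;> have hJ := J0 y hy <;>
    have hEκ := Eκ y hy <;> have hEκ0 := (edecay_pos κ y).le <;> have hθJ := mul_nonneg hθ.le hJ
  · have h1 := neg_le_of_abs_le (lead hy hN0.le (hW _ (hly hy)).1)
    have h2 := neg_le_of_abs_le (hu.b0 y hy)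
    have h3 := hlow _ (hty hy)
    have h4 : N * W.B * edecay k y ≤ C * edecay k y :=
      mul_le_right (by linarith) hE
    have h5 : Cr * θ ≤ C * θ := mul_le_right (by linarith) hθ.le
    rw [eu]
    simp only [mul_zero, one_mul]
    linarith only [h1, h2, h3, h4, h5]
  · have h1 := lead hy hN0.le (hW _ (hly hy)).1
    have h2 := hu.b0 y hy
    have h3 := hB0 _ (hty hy)
    have h4 := mul_le_of_le_one_right p3 (edecay_le_one hk hy.le)
    have h5 := mul_le_of_le_one_right hCr hθ1
    rw [eu]
    simp only [mul_zero, one_mul]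
    refine (abs_add_le _ _).trans ((add_le_add (abs_add_le _ _) le_rfl).trans ?_)
    linarith
  · have h1 := outer hy (hB1 _ (hty hy))
    have h2 := hu.b1 y hy
    rw [s1, hU1]
    beta_reduce
    rw [pg1, show 1 * θ * iteratedDeriv 1 ue0 (θ * y) + N * lam * pd 0 1 P.u 0 (lam * y)
      + pd 0 1 (restU χ K ε) 0 y - N * lam * pd 0 1 P.u 0 (lam * y) =
      θ * iteratedDeriv 1 ue0 (θ * y) + pd 0 1 (restU χ K ε) 0 y by ring]
    refine (abs_add_le _ _).trans ?_
    rw [abs_mul, abs_of_pos hθ]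
    refine fin (D := B1 + Cr) (β := θ * (edecay κ y + tail θ m y)) ?_ (by linarith)
      (by positivity) (by gcongr) hC0
    nlinarith only [mul_le_left h1 hθ.le, h2,
      mul_nonneg (mul_nonneg p1 hθ.le) hEκ0]
  · have h1 := outer hy (hB2 _ (hty hy))
    have h2 := hu.b2 y hy
    rw [s2, hU2]
    beta_reduce
    rw [pg2, show 1 * θ ^ 2 * iteratedDeriv 2 ue0 (θ * y) + N * lam ^ 2 * pd 0 2 P.u 0 (lam * y)
      + pd 0 2 (restU χ K ε) 0 y - N * lam ^ 2 * pd 0 2 P.u 0 (lam * y) =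
      θ ^ 2 * iteratedDeriv 2 ue0 (θ * y) + pd 0 2 (restU χ K ε) 0 y by ring]
    refine (abs_add_le _ _).trans ?_
    rw [abs_mul, abs_of_pos (by positivity : 0 < θ ^ 2)]
    refine fin (D := B2 + Cr) (β := θ * (edecay κ y + θ * tail θ m y)) ?_ (by linarith)
      (by positivity) (by gcongr) hC0
    nlinarith only [mul_le_left h1 (sq_nonneg θ), h2,
      mul_nonneg (mul_nonneg p2 hθ.le) hEκ0]
  · have h1 := lead hy hl.le (hW _ (hly hy)).2.1
    have h2 := hv.b0 y hy
    rw [ev]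
    simp only [mul_zero]
    refine (abs_add_le _ _).trans ?_
    refine fin (D := lam * W.B + Cr) (β := edecay k y + tail θ m y) ?_ (by linarith)
      (by positivity) le_rfl hC0
    nlinarith only [h1, h2, mul_le_left hEκ hCr, mul_nonneg p4 hJ]
  · rw [w1, hV1, ← pow_two, add_sub_cancel_left]
    exact fin (hv.b1 y hy) (by linarith) (by positivity) (by gcongr) hC0
  · rw [w2, hV2, ← pow_succ', add_sub_cancel_left]
    exact fin (hv.b2 y hy) (by linarith) (by positivity) (by gcongr) hC0
  · have h1 := lead hy (by positivity : 0 ≤ N * sig ^ 2) (hW _ (hly hy)).2.2.1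
    have h2 := hu.bx y hy
    rw [sx]
    beta_reduce
    rw [pgx, mul_zero, zero_add, abs_mul, abs_of_pos hε, ← hθε]
    rw [show C * (ε * (edecay k y + θ * tail θ m y)) =
      ε * (C * (edecay k y + θ * tail θ m y)) by ring]
    refine mul_le_left ((abs_add_le _ _).trans ?_) hε.le
    refine fin (D := N * sig ^ 2 * W.B + Cr) (β := edecay k y + θ * tail θ m y) ?_
      (by linarith) (by positivity) le_rfl hC0
    nlinarith only [h1, h2, mul_le_left hEκ hCr, mul_nonneg p5 hθJ]
  · have h1 := lead hy (by positivity : 0 ≤ lam * sig ^ 2) (hW _ (hly hy)).2.2.2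
    have h2 := hv.bx y hy
    rw [wx]
    beta_reduce
    rw [abs_mul, abs_of_pos hε, ← hθε]
    rw [show C * (ε * (edecay k y + tail θ m y)) =
      ε * (C * (edecay k y + tail θ m y)) by ring]
    refine mul_le_left ((abs_add_le _ _).trans ?_) hε.le
    refine fin (D := lam * sig ^ 2 * W.B + Cr) (β := edecay k y + tail θ m y) ?_
      (by linarith) (by positivity) le_rfl hC0
    nlinarith only [h1, h2, mul_le_left hEκ hCr, mul_nonneg p6 hJ]

end BoundaryLayer

end

open BoundaryLayer in
theorem proposition2p1 :
    ∃ m₀ : ℕ, ∀ P : PrandtlLayer, ∃ σ₀ : ℝ, 0 < σ₀ ∧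
      ∀ sig : ℝ, 0 < sig → sig < σ₀ → ∀ lam : ℝ, 0 < lam →
      ∀ ue0 : ℝ → ℝ, IsOuterShear (lam ^ 2 / sig * P.E) ue0 →
      ∀ χ : ℝ → ℝ, IsCutoff χ →
      ∀ m : ℕ, m₀ ≤ m → ∀ κ : ℝ, 0 < κ → ∀ A : ℕ → ℝ,
      ∃ ε₀ C c : ℝ, 0 < ε₀ ∧ 0 < C ∧ 0 < c ∧
      ∀ L : ℝ, 0 < L → ∀ ε : ℝ, 0 < ε → ε < ε₀ →
      ∀ K : Correctors, K.IsAdmissible P lam sig m κ A L →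
      ∀ us vs : ℝ → ℝ → ℝ, us = uS P lam sig ue0 χ K ε → vs = vS P lam sig χ K ε →
      ∀ F h : ℝ → ℝ, MemLp (fun y => F y * w0 m ε y) 2 (volume.restrict (Ioi 0)) → IsDatum h →
        (∃ v : ℝ → ℝ, IsSolution us vs m ε h F v) ∧
        (∀ v v' : ℝ → ℝ, IsSolution us vs m ε h F v → IsSolution us vs m ε h F v' →
          EqOn v v' (Ici 0)) ∧
        (∀ v : ℝ → ℝ, IsSolution us vs m ε h F v →
          IntegrableOn (fun y => F y * quot us v y) (Ioi 0) ∧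
          normB us m ε (uZero h v) v ^ 2 ≤
            ENNReal.ofReal C * (‖∫ y in Ioi 0, F y * quot us v y‖ₑ
              + L2 (fun y => F y * w0 m ε y) ^ 2 + normH m ε h ^ 2) ∧
          IntegrableOn (fun y =>
            (D 4 v y - D 1 (fun z => us 0 z ^ 2 * D 1 (quot us v) z) y) * quot us v y) (Ioi 0) ∧
          normQ us (quot us v) < ⊤ ∧
          c * (normQ us (quot us v)).toReal ^ 2 ≤
            ∫ y in Ioi 0,
              (D 4 v y - D 1 (fun z => us 0 z ^ 2 * D 1 (quot us v) z) y) * quot us v y) := by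
  refine ⟨1, fun P => ?_⟩
  obtain ⟨W, hU1, hU2, hV1, hV2, hW⟩ := P.exists_leading
  obtain ⟨σ₀, hσ₀, hcoef⟩ := W.exists_coefficients
  refine ⟨σ₀, hσ₀, fun sig hs hsσ lam hl ue0 hue χ hχ m hm κ hκ A => ?_⟩
  have hWκ := W.κ_pos
  have hk : 0 < min κ (W.κ * lam) := lt_min hκ (by positivity)
  obtain ⟨b₀, C₀, hb₀, hC₀, happ⟩ := P.exists_approx hU1 hU2 hV1 hV2 hW hs hl hue hχ m hκ hk
    (min_le_left _ _) (min_le_right _ _) A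
  obtain ⟨ε₀, c, M, δ, hε₀, hε₀1, hc, hM, hδ, hS⟩ :=
    hcoef sig hs hsσ lam hl m _ hk (min_le_right _ _) b₀ C₀ hb₀ hC₀
  obtain ⟨C, hC, hwell⟩ := Coefficients.exists_wellPosed m hc hM hδ
  refine ⟨ε₀, C, 1 / 6, hε₀, hC, by norm_num, fun L hL ε hε hεε K hK us vs hus hvs F h hF hh => ?_⟩
  have hε1 : ε ≤ 1 := hεε.le.trans hε₀1
  obtain ⟨hu, hv, hu0, hv0, hΦ⟩ := happ L ε hL hε hε1 K hK us vs hus hvs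
  obtain ⟨S, ⟨hc', low, rfl⟩, hB, ⟨R, R1, k', B, hco⟩, hD⟩ := hS ε hε hεε _ hΦ
  exact hwell ε hε hε1 _ rfl hB R R1 k' B hco
    (fun F hF => Coefficients.exists_of_decay hm hε hε1 hB hco hD hF) us vs
    ⟨rfl, rfl, rfl, rfl, rfl, rfl, rfl⟩ F h hF hh
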